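/- Let $d\ge 3$ be odd. Data qubits sit at the points $(i,j)$, $1\le i,j\le d$ (row $i$, column $j$). The face $(i,j)$ consists of those of the points $(i,j),(i,j+1),(i+1,j),(i+1,j+1)$ that lie in the lattice. Even faces: $0\le i\le d$, $1\le j\le d-1$, $i+j$ even; odd faces: $1\le i\le d-1$, $0\le j\le d$, $i+j$ odd. Faces with $1\le i,j\le d-1$ have weight four, the others (boundary faces) weight two. **Codes.** The heavy hexagon code has the $X$-type gauge generators on the even faces and the $Z$-type gauge generators $Z_{i,j}Z_{i+1,j}$; its $X$ errors are detected by the $Z$-type stabilizers on the odd faces (products of one or two of these $Z$-type gauge generators). The heavy square code has the $X$-type stabilizers on the odd faces and the $Z$-type stabilizers on the even faces. **Circuits.** There is a qubit $\mathrm{flag}(i,j)$ between the data qubits $(i,j)$ and $(i+1,j)$ ($1\le i\le d-1$, $1\le j\le d$) and, where needed, a syndrome qubit for a face. A weight-four $X$-type operator on the face $(i,j)$ is measured in time steps $0,\dots,6$ with a syndrome qubit $a$ and the flag qubits $l=\mathrm{flag}(i,j)$ and $r=\mathrm{flag}(i,j+1)$: prepare $a$ in $|+\rangle$ and $l,r$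 in $|0\rangle$ (step 0); CNOTs $a\to r$ (1); $a\to l$, $r\to(i+1,j+1)$ (2); $l\to(i,j)$, $r\to(i,j+1)$ (3); $l\to(i+1,j)$, $a\to r$ (4); $a\to l$ (5); measure $a$ in the $X$ basis and $l,r$ in the $Z$ basis (6). For $Z$-type operators the CNOTs are reversed and the bases exchanged. Weight-two operators are measured with one measurement qubit and two CNOTs, without flags. In a round of the heavy hexagon code (11 time steps) all $X$-type gauge generators are measured in steps $0$–$6$, and then every $Z_{i,j}Z_{i+1,j}$ with $\mathrm{flag}(i,j)$ as measurement qubit (preparation in step 7, CNOT from $(i,j)$ in step 8 and from $(i+1,j)$ in step 9, measurement in step 10). In a round of the heavy square code (14 time steps) all $X$-type stabilizers are measured in steps $0$–$6$ and then all $Z$-type stabilizers in steps $7$–$13$. In both codes the weight-two operators on top and bottom boundary faces have their own measurement qubit, coupled to the right data qubit in the third step of the seven and to the left one in the fifth; those on left and right boundary faces of the heavy square code use the flag qubit between their two data qubits, coupled to the upper one in the fourth step and to the lower one in the fifth. **Faults.** The locations are the CNOTs, preparations, measurements, and every qubit that is idle in a time step. A fault is any of the $15$ nontrivial two-qubit Paulis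 after a CNOT (probability $p/15$ each), any nontrivial Pauli on an idle qubit ($p/3$ each), preparation of the orthogonal state ($2p/3$), or a flipped measurement outcome ($2p/3$). $T\ge 1$ noisy rounds ($T=d$ in the protocol), starting without errors, are followed by a noiseless readout of the stabilizers. **Decoder.** Treat one type of errors: $X$ errors of the heavy hexagon code, or $X$ errors or $Z$ errors of the heavy square code. A vertex (layer $t\in\{0,\dots,T\}$, stabilizer that detects these errors) is highlighted if the outcome of the stabilizer in round $t$ differs from that in round $t-1$ (initially $+1$; round $T$ is the noiseless readout). All boundary vertices, being joined by edges of weight zero, count as one boundary vertex, which is highlighted if the number of highlighted vertices would otherwise be odd. The possible edges are: for each data qubit a space edge in a layer and diagonal edges between consecutive layers (error on this qubit); for each stabilizer a vertical edge between consecutive layers (no data error); for each weight-four face carrying a generator of the type of the errors, a cross edge in a layer (errors on its two left corners or, equivalently, on its two right corners). An edge belongs to the graph if some single fault results in exactly the change of syndrome and the data error of this edge; $P_E$ is the probability that exactly one location has a fault that results in the edge $E$. When a weight-four operator of the type of the errors is measured and exactly one of its two flag qubits (left or right) has a nontrivial outcome, this is a flag; if both do, they are ignored. The boomerang of a flag consists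 of the edges in which a single fault that causes this flag can result; cross edges are used only inside boomerangs of flags that have occurred. If $m$ flags have occurred, then edges inside their boomerangs have weight $-\log P_E$, and all other edges $-\log(p^mP_E)$. A minimum weight perfect matching of the highlighted vertices, with minimum weight paths between matched vertices, is chosen (ties in any way), and the errors of the edges on these paths, added modulo two, are applied as the correction. A set of faults is corrected if such a matching exists and, for every such choice, the remaining error of the type considered is a product of the stabilizer (for the heavy hexagon code: gauge) generators of this type. **Claim.** For each such $d$ and $T$ there is $p_0>0$ such that, for all $0<p<p_0$ and each of the three cases ($X$ errors of the heavy hexagon code, $X$ errors and $Z$ errors of the heavy square code), every set of at most $\lfloor (d-1)/2\rfloor$ faults is corrected. Moreover the effective distance, defined as $2k+1$ for the greatest $k$ such that all sets of at most $k$ faults are corrected, equals $d$. This holds even though a single fault can cause a weight-two error parallel to a logical operator: for $X$ errors of the heavy hexagon code and for $Z$ errors of the heavy square code, the least weight of a logical operator of this type is $d$, and some single fault leads to a data error on two qubits in the support of a logical operator of weight $d$, where no equivalent error has weight less than two. -/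

import Mathlib

namespace FlagCode

open Finset

/-! ## Pauli errors, circuits and faults -/

/-- The two Pauli types. -/
inductive Basis
  | X
  | Z
  deriving DecidableEq

instance : Fintype Basis where
  elems := {.X, .Z}
  complete b := by cases b <;> decide

/-- The Pauli type that anticommutes with the given one. -/
def Basis.other : Basis → Basis
  | .X => .Z
  | .Z => .X

/-- A single-qubit Pauli up to phase: `P .X` and `P .Z` are the exponents of `X` and `Z`. -/
abbrev Pauli := Basis → ZMod 2

/-- The physical qubits. `data i j` is the data qubit in row `i` and column `j` (counted from `1`),
`flag i j` sits on the vertical edge between the data qubits `(i, j)` and `(i + 1, j)`, and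
`anc i j` is the syndrome measurement qubit of the face with corners
`(i, j), (i, j + 1), (i + 1, j), (i + 1, j + 1)`. -/
inductive Qubit
  | data (i j : ℕ)
  | flag (i j : ℕ)
  | anc (i j : ℕ)
  deriving DecidableEq

/-- The circuit operations. `prep .Z q` prepares `|0⟩`, `prep .X q` prepares `|+⟩`, and `meas b q`
measures the Pauli operator of type `b`. -/
inductive Op
  | cnot (c t : Qubit)
  | prep (b : Basis) (q : Qubit)
  | meas (b : Basis) (q : Qubit)
  | idle (q : Qubit)
  deriving DecidableEq

/-- The qubits on which an operation acts. -/
def Op.acts : Op → Finset Qubit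
  | .cnot c t => {c, t}
  | .prep _ q => {q}
  | .meas _ q => {q}
  | .idle q => {q}

/-- The faults of an operation: any nontrivial two-qubit Pauli (control, target) after a CNOT, any
nontrivial Pauli on an idle qubit, preparation of the orthogonal state, a flipped measurement
outcome (the last two as the Pauli that has this effect). For one-qubit operations the second
entry is not used and is `0`. -/
def Op.errors : Op → Finset (Pauli × Pauli)
  | .cnot _ _ => univ.erase 0
  | .prep b _ => {(Pi.single b.other 1, 0)}
  | .meas b _ => {(Pi.single b.other 1, 0)}
  | .idle _ => univ.filter fun a => a.1 ≠ 0 ∧ a.2 = 0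

/-- The probability of each single fault of an operation in the depolarizing circuit noise model
of strength `p`. -/
noncomputable def Op.prob (p : ℝ) : Op → ℝ
  | .cnot _ _ => p / 15
  | .prep _ _ => 2 * p / 3
  | .meas _ _ => 2 * p / 3
  | .idle _ => p / 3

/-- The Pauli that the fault `a` of an operation puts on the qubit `q`. -/
def Op.spread : Op → Pauli × Pauli → Qubit → Pauli
  | .cnot c t, a, q => (if q = c then a.1 else 0) + (if q = t then a.2 else 0)
  | .prep _ q₀, a, q => if q = q₀ then a.1 else 0
  | .meas _ q₀, a, q => if q = q₀ then a.1 else 0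
  | .idle q₀, a, q => if q = q₀ then a.1 else 0

/-- One round of syndrome measurement: `(s, o) ∈ gates` means that the operation `o` is applied in
time step `s < steps`. Qubits on which nothing acts in a time step are idle in it. -/
structure Circuit where
  steps : ℕ
  qubits : Finset Qubit
  gates : Finset (ℕ × Op)

namespace Circuit

variable (C : Circuit)

/-- The non-idle operations of time step `s`. -/
def gatesAt (s : ℕ) : Finset Op := (C.gates.filter fun x => x.1 = s).image Prod.snd

/-- All operations of time step `s`, with the idle ones. -/
def ops (s : ℕ) : Finset Op :=
  C.gatesAt s ∪ (C.qubits \ (C.gatesAt s).biUnion Op.acts).image Op.idle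

end Circuit

/-- A fault location: round, time step, operation. -/
abbrev Location := ℕ × ℕ × Op

/-- What goes wrong at every location; `0` means no fault. -/
abbrev FaultPattern := Location → Pauli × Pauli

namespace Circuit

variable (C : Circuit)

/-- The fault locations of `T` rounds. -/
def locations (T : ℕ) : Finset Location :=
  (range T ×ˢ range C.steps).biUnion fun x => (C.ops x.2).image fun o => (x.1, x.2, o)

/-- `e` assigns to some locations of the `T` rounds one of their faults. -/
def IsFaultPattern (T : ℕ) (e : FaultPattern) : Prop :=
  ∀ l, e l = 0 ∨ (l ∈ C.locations T ∧ e l ∈ l.2.2.errors)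

/-- The number of faults. -/
def faultCount (T : ℕ) (e : FaultPattern) : ℕ := #{l ∈ C.locations T | e l ≠ 0}

/-- Propagation of a Pauli error through time step `s`: preparations erase it, a CNOT copies `X`
from control to target and `Z` from target to control. -/
def propagate (s : ℕ) (f : Qubit → Pauli) (q : Qubit) : Pauli := fun b =>
  if (s, Op.prep .X q) ∈ C.gates ∨ (s, Op.prep .Z q) ∈ C.gates then 0
  else f q b + match b with
    | .X => ∑ c ∈ C.qubits with (s, Op.cnot c q) ∈ C.gates, f c .X
    | .Z => ∑ t ∈ C.qubits with (s, Op.cnot q t) ∈ C.gates, f t .Z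

/-- The Pauli error on the qubits after the first `k` time steps (over all rounds). -/
def frame (e : FaultPattern) : ℕ → Qubit → Pauli
  | 0 => 0
  | k + 1 => fun q =>
      C.propagate (k % C.steps) (frame e k) q +
        ∑ o ∈ C.ops (k % C.steps), o.spread (e (k / C.steps, k % C.steps, o)) q

/-- Whether (`1`) or not (`0`) the outcome of a measurement of the qubit `q` in round `t` and time
step `s` is flipped by the faults; `b` is the type of error that flips this measurement. -/
def flip (e : FaultPattern) (b : Basis) (t s : ℕ) (q : Qubit) : ZMod 2 :=
  C.frame e (t * C.steps + s + 1) q b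

end Circuit

/-! ## The codes and their syndrome measurement circuits -/

/-- The data qubits among the four corners of the face `(i, j)`. -/
def plaquette (d : ℕ) (f : ℕ × ℕ) : Finset (ℕ × ℕ) :=
  (({f.1, f.1 + 1} : Finset ℕ) ×ˢ ({f.2, f.2 + 1} : Finset ℕ)) ∩ (Icc 1 d ×ˢ Icc 1 d)

/-- The bulk faces with `i + j` even, with weight-two faces on the top and bottom boundaries
(`i = 0` and `i = d`). -/
def evenFaces (d : ℕ) : Finset (ℕ × ℕ) :=
  {f ∈ range (d + 1) ×ˢ Icc 1 (d - 1) | Even (f.1 + f.2)}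

/-- The bulk faces with `i + j` odd, with weight-two faces on the left and right boundaries
(`j = 0` and `j = d`). -/
def oddFaces (d : ℕ) : Finset (ℕ × ℕ) :=
  {f ∈ Icc 1 (d - 1) ×ˢ range (d + 1) | Odd (f.1 + f.2)}

/-- The weight-four faces. -/
def bulk (d : ℕ) (F : Finset (ℕ × ℕ)) : Finset (ℕ × ℕ) :=
  {f ∈ F | f ∈ Icc 1 (d - 1) ×ˢ Icc 1 (d - 1)}

/-- The CNOT which a measurement of a type `b` operator applies between `a` (nearer to the syndrome
measurement qubit) and `q` (nearer to the data). -/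
def couple (b : Basis) (a q : Qubit) : Op :=
  match b with
  | .X => .cnot a q
  | .Z => .cnot q a

/-- Measurement of the weight-four operator of type `b` on the face `(i, j)`, in the time steps
`s, …, s + 6`, with the flag qubits `flag i j` (left) and `flag i (j + 1)` (right). -/
def flaggedMeasurement (b : Basis) (s : ℕ) (f : ℕ × ℕ) : Finset (ℕ × Op) :=
  let (i, j) := f
  let a := Qubit.anc i j
  let l := Qubit.flag i j
  let r := Qubit.flag i (j + 1)
  { (s, .prep b a), (s, .prep b.other l), (s, .prep b.other r),
    (s + 1, couple b a r),
    (s + 2, couple b a l), (s + 2, couple b r (.data (i + 1) (j + 1))),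
    (s + 3, couple b l (.data i j)), (s + 3, couple b r (.data i (j + 1))),
    (s + 4, couple b l (.data (i + 1) j)), (s + 4, couple b a r),
    (s + 5, couple b a l),
    (s + 6, .meas b a), (s + 6, .meas b.other l), (s + 6, .meas b.other r) }

/-- Measurement of a weight-two operator of type `b` on `q₁, q₂` with the measurement qubit `a`:
preparation, the two CNOTs and the measurement in the time steps `s₀`, `s₁`, `s₂`, `s₃`. -/
def pairMeasurement (b : Basis) (a q₁ q₂ : Qubit) (s₀ s₁ s₂ s₃ : ℕ) : Finset (ℕ × Op) :=
  { (s₀, .prep b a), (s₁, couple b a q₁), (s₂, couple b a q₂), (s₃, .meas b a) }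

/-- Measurement of the type `b` operators on all even faces, in the time steps `s, …, s + 6`. -/
def measureEven (d : ℕ) (b : Basis) (s : ℕ) : Finset (ℕ × Op) :=
  (bulk d (evenFaces d)).biUnion (flaggedMeasurement b s) ∪
  (evenFaces d \ bulk d (evenFaces d)).biUnion fun f =>
    let i := if f.1 = 0 then 1 else d
    pairMeasurement b (.anc f.1 f.2) (.data i f.2) (.data i (f.2 + 1)) s (s + 4) (s + 2) (s + 6)

/-- Measurement of the type `b` operators on all odd faces, in the time steps `s, …, s + 6`. On the
left and right boundaries the flag qubit between the two data qubits is the measurement qubit. -/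
def measureOdd (d : ℕ) (b : Basis) (s : ℕ) : Finset (ℕ × Op) :=
  (bulk d (oddFaces d)).biUnion (flaggedMeasurement b s) ∪
  (oddFaces d \ bulk d (oddFaces d)).biUnion fun f =>
    let j := if f.2 = 0 then 1 else d
    pairMeasurement b (.flag f.1 j) (.data f.1 j) (.data (f.1 + 1) j) s (s + 3) (s + 4) (s + 6)

def dataQubits (d : ℕ) : Finset Qubit :=
  (Icc 1 d ×ˢ Icc 1 d).image fun x => Qubit.data x.1 x.2

def flagQubits (d : ℕ) : Finset Qubit :=
  (Icc 1 (d - 1) ×ˢ Icc 1 d).image fun x => Qubit.flag x.1 x.2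

def ancQubits (F : Finset (ℕ × ℕ)) : Finset Qubit := F.image fun x => Qubit.anc x.1 x.2

/-- One round for the heavy hexagon code: the `X`-type gauge generators (even faces), then the
`Z`-type gauge generators `Z_{i,j} Z_{i+1,j}`, the latter with the flag qubits as measurement
qubits. -/
def heavyHexCircuit (d : ℕ) : Circuit where
  steps := 11
  qubits := dataQubits d ∪ flagQubits d ∪ ancQubits (evenFaces d)
  gates := measureEven d .X 0 ∪
    (Icc 1 (d - 1) ×ˢ Icc 1 d).biUnion fun x =>
      pairMeasurement .Z (.flag x.1 x.2) (.data x.1 x.2) (.data (x.1 + 1) x.2) 7 8 9 10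

/-- One round for the heavy square code: the `X`-type stabilizers (odd faces), then the `Z`-type
stabilizers (even faces). -/
def heavySquareCircuit (d : ℕ) : Circuit where
  steps := 14
  qubits := dataQubits d ∪ flagQubits d ∪ ancQubits (evenFaces d ∪ bulk d (oddFaces d))
  gates := measureOdd d .X 0 ∪ measureEven d .Z 7

/-- The data of the correction of one type of errors on a distance-`d` code. -/
structure Problem where
  d : ℕ
  circuit : Circuit
  /-- The type of the errors to be corrected. -/
  err : Basis
  /-- The faces that carry the stabilizer generators of the other type, which detect them. -/
  checks : Finset (ℕ × ℕ)
  /-- The measurements (time step, qubit) whose total parity is the outcome of a stabilizer. -/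
  readout : ℕ × ℕ → Finset (ℕ × Qubit)
  /-- The faces that carry the stabilizer (or gauge) generators of type `err`. -/
  gens : Finset (ℕ × ℕ)
  /-- The time step in which the flag qubits for the generators of type `err` are measured. -/
  flagStep : ℕ

/-- `X` errors of the heavy hexagon code (its surface-code part). -/
def heavyHexX (d : ℕ) : Problem where
  d := d
  circuit := heavyHexCircuit d
  err := .X
  checks := oddFaces d
  readout v := (({v.2, v.2 + 1} : Finset ℕ) ∩ Icc 1 d).image fun j => (10, Qubit.flag v.1 j)
  gens := evenFaces d
  flagStep := 6

/-- `X` errors of the heavy square code. -/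
def heavySquareX (d : ℕ) : Problem where
  d := d
  circuit := heavySquareCircuit d
  err := .X
  checks := evenFaces d
  readout v := {(13, Qubit.anc v.1 v.2)}
  gens := oddFaces d
  flagStep := 6

/-- `Z` errors of the heavy square code. -/
def heavySquareZ (d : ℕ) : Problem where
  d := d
  circuit := heavySquareCircuit d
  err := .Z
  checks := oddFaces d
  readout v := {(6, if v.2 = 0 then Qubit.flag v.1 1
    else if v.2 = d then Qubit.flag v.1 d else Qubit.anc v.1 v.2)}
  gens := evenFaces d
  flagStep := 13

/-! ## Errors, syndromes and flags -/

/-- The type `err` part of a Pauli error on the data qubits. -/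
abbrev DataError := ℕ × ℕ → ZMod 2

/-- A vertex of the matching graph: layer and stabilizer. -/
abbrev Vertex := ℕ × ℕ × ℕ

/-- The product of Pauli operators of the type in question over the qubits in `s`. -/
def errorOn (s : Finset (ℕ × ℕ)) : DataError := fun q => if q ∈ s then 1 else 0

inductive Side
  | left
  | right
  deriving DecidableEq

instance : Fintype Side where
  elems := {.left, .right}
  complete b := by cases b <;> decide

def Side.opposite : Side → Side
  | .left => .right
  | .right => .left

/-- A flag: round, weight-four face, left or right. -/
abbrev Flag := ℕ × (ℕ × ℕ) × Side

namespace Problem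

variable (D : Problem)

def lattice : Finset (ℕ × ℕ) := Icc 1 D.d ×ˢ Icc 1 D.d

/-- The weight-four generators of type `err`, which are measured with two flag qubits. -/
def flaggedFaces : Finset (ℕ × ℕ) := bulk D.d D.gens

/-- The errors that act trivially on the logical qubit: products of generators. -/
def trivialErrors : Submodule (ZMod 2) DataError :=
  Submodule.span (ZMod 2) {x | ∃ f ∈ D.gens, x = errorOn (plaquette D.d f)}

/-- Whether the data error `x` commutes (`0`) or anticommutes (`1`) with the stabilizer `v`. -/
def checkValue (x : DataError) (v : ℕ × ℕ) : ZMod 2 := ∑ q ∈ plaquette D.d v, x q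

def weight (x : DataError) : ℕ := #{q ∈ D.lattice | x q ≠ 0}

/-- The logical operators of type `err`: they commute with all stabilizers and act nontrivially on
the logical qubit. -/
def IsLogical (x : DataError) : Prop :=
  (∀ q, q ∉ D.lattice → x q = 0) ∧ (∀ v ∈ D.checks, D.checkValue x v = 0) ∧ x ∉ D.trivialErrors

/-- The error on the data qubits after `T` rounds with the faults `e`. -/
def dataError (T : ℕ) (e : FaultPattern) : DataError := fun q =>
  if q ∈ D.lattice then D.circuit.frame e (T * D.circuit.steps) (.data q.1 q.2) D.err else 0

/-- The (flip of the) outcome of the stabilizer `v` in round `t`. The `T` noisy rounds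
`0, …, T - 1` are followed by a noiseless readout of the stabilizers, round `T`. -/
def outcome (T : ℕ) (e : FaultPattern) (t : ℕ) (v : ℕ × ℕ) : ZMod 2 :=
  if t < T then ∑ x ∈ D.readout v, D.circuit.flip e D.err t x.1 x.2
  else D.checkValue (D.dataError T e) v

/-- The vertices of stabilizers whose outcome has changed since the round before. -/
def changed (T : ℕ) (e : FaultPattern) : Finset Vertex :=
  {x ∈ range (T + 1) ×ˢ D.checks |
    D.outcome T e x.1 x.2 ≠ if x.1 = 0 then 0 else D.outcome T e (x.1 - 1) x.2}

/-- The flag `φ` has a nontrivial measurement outcome. -/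
def Flagged (e : FaultPattern) (φ : Flag) : Prop :=
  D.circuit.flip e D.err φ.1 D.flagStep
    (.flag φ.2.1.1 (match φ.2.2 with | .left => φ.2.1.2 | .right => φ.2.1.2 + 1)) ≠ 0

open Classical in
/-- The left or right flags of the `T` rounds. If both flags of one measurement have a nontrivial
outcome, then they are ignored. -/
noncomputable def flags (T : ℕ) (e : FaultPattern) : Finset Flag :=
  {φ ∈ range T ×ˢ (D.flaggedFaces ×ˢ (univ : Finset Side)) |
    D.Flagged e φ ∧ ¬ D.Flagged e (φ.1, φ.2.1, φ.2.2.opposite)}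

end Problem

/-! ## The matching graph -/

/-- The edges of the matching graph: for the data qubit `q` a space edge in layer `t`, or a diagonal
edge from the vertex `v` of layer `t` to `w` of layer `t + 1`; the vertical edge of `v` from layer
`t` to `t + 1`; the cross edge of a weight-four face `f` in layer `t`. -/
inductive Edge
  | space (t : ℕ) (q : ℕ × ℕ)
  | diag (t : ℕ) (q v w : ℕ × ℕ)
  | vert (t : ℕ) (v : ℕ × ℕ)
  | cross (t : ℕ) (f : ℕ × ℕ)

/-- The data error to which an edge corresponds. A cross edge is an error on the two left (up to the
operator of the face: the two right) corners of the face. -/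
def Edge.error : Edge → DataError
  | .space _ q => errorOn {q}
  | .diag _ q _ _ => errorOn {q}
  | .vert _ _ => 0
  | .cross _ f => errorOn {f, (f.1 + 1, f.2)}

namespace Problem

variable (D : Problem)

/-- The vertices in layer `t` of the stabilizers that anticommute with `x`. -/
def violated (t : ℕ) (x : DataError) : Finset Vertex :=
  ({v ∈ D.checks | D.checkValue x v ≠ 0}).image fun v => (t, v)

/-- The ends of an edge, apart from the boundary. -/
def ends : Edge → Finset Vertex
  | .space t q => D.violated t (Edge.error (.space t q))
  | .diag t _ v w => {(t, v), (t + 1, w)}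
  | .vert t v => {(t, v), (t + 1, v)}
  | .cross t f => D.violated t (Edge.error (.cross t f))

/-- The faults `e` have the effect of an error on the given edge. -/
def ResultsIn (T : ℕ) (e : FaultPattern) (E : Edge) : Prop :=
  D.changed T e = D.ends E ∧
    match E with
    | .cross _ f => f ∈ D.flaggedFaces ∧
        (D.dataError T e = E.error ∨ D.dataError T e = E.error + errorOn (plaquette D.d f))
    | _ => D.dataError T e = E.error

/-- Some single fault, with the fault `a` at the location `l`, satisfies `P`. -/
def SingleFault (T : ℕ) (P : FaultPattern → Prop) : Prop :=
  ∃ l ∈ D.circuit.locations T, ∃ a ∈ l.2.2.errors, P (Pi.single l a)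

open Classical in
/-- The probability that a fault at the location `l` results in an error on `E`. -/
noncomputable def locationProb (p : ℝ) (T : ℕ) (E : Edge) (l : Location) : ℝ :=
  ∑ _a ∈ l.2.2.errors with D.ResultsIn T (Pi.single l _a) E, l.2.2.prob p

/-- The probability `P_E` (to leading order) of an error on the edge `E`: exactly one location has a
fault that results in it. -/
noncomputable def edgeProb (p : ℝ) (T : ℕ) (E : Edge) : ℝ :=
  ∑ l ∈ D.circuit.locations T, D.locationProb p T E l *
    ∏ l' ∈ (D.circuit.locations T).erase l, (1 - D.locationProb p T E l')

/-- The boomerang of the flag `φ`: the edges that can be afflicted by an error from a single fault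
that results in this flag. -/
def InBoomerang (T : ℕ) (φ : Flag) (E : Edge) : Prop :=
  D.SingleFault T fun e => φ ∈ D.flags T e ∧ D.ResultsIn T e E

/-- `E` lies inside a boomerang that is highlighted by the flag outcomes. -/
def Highlighted (T : ℕ) (e : FaultPattern) (E : Edge) : Prop :=
  ∃ φ ∈ D.flags T e, D.InBoomerang T φ E

/-- The edges of the matching graph are those that are the result of some single fault; cross edges
are present only in highlighted boomerangs. -/
def IsEdge (T : ℕ) (e : FaultPattern) (E : Edge) : Prop :=
  D.SingleFault T (fun e' => D.ResultsIn T e' E) ∧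
    ((∃ t f, E = .cross t f) → D.Highlighted T e E)

open Classical in
/-- The weights: `- log P_E` inside the highlighted boomerangs and `- log (p ^ m * P_E)` outside,
where `m` is the number of left or right flags. -/
noncomputable def edgeWeight (p : ℝ) (T : ℕ) (e : FaultPattern) (E : Edge) : ℝ :=
  if D.Highlighted T e E then - Real.log (D.edgeProb p T E)
  else - Real.log (p ^ #(D.flags T e) * D.edgeProb p T E)

/-! ## The decoder -/

/-- `E` joins `x` and `y`. All boundary vertices, which are connected by edges of weight zero, are
identified with the vertex `none`. -/
def Joins (E : Edge) (x y : Option Vertex) : Prop :=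
  x ≠ y ∧ (D.ends E).image some = ({x, y} : Finset (Option Vertex)).erase none

/-- `l` is the list of the edges of a path from `x` to `y` in the graph. -/
def IsPath (T : ℕ) (e : FaultPattern) : Option Vertex → List Edge → Option Vertex → Prop
  | x, [], y => x = y
  | x, E :: l, y => D.IsEdge T e E ∧ E ∉ l ∧ ∃ z, D.Joins E x z ∧ IsPath T e z l y

/-- The highlighted vertices, with a boundary vertex if their number would be odd otherwise. -/
def highlightedVertices (T : ℕ) (e : FaultPattern) : Finset (Option Vertex) :=
  (D.changed T e).image some ∪ if Odd #(D.changed T e) then {none} else ∅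

/-- Pairs of vertices, each with a path between them. -/
abbrev Matching := List (Option Vertex × List Edge × Option Vertex)

/-- `M` is a perfect matching of the highlighted vertices, with a path for every matched pair. -/
def IsMatching (T : ℕ) (e : FaultPattern) (M : Matching) : Prop :=
  (∀ x ∈ M, D.IsPath T e x.1 x.2.1 x.2.2) ∧
  (M.flatMap fun x => [x.1, x.2.2]).Nodup ∧
  (M.flatMap fun x => [x.1, x.2.2]).toFinset = D.highlightedVertices T e

/-- The total weight of the paths. -/
noncomputable def matchingWeight (p : ℝ) (T : ℕ) (e : FaultPattern) (M : Matching) : ℝ :=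
  (M.map fun x => (x.2.1.map (D.edgeWeight p T e)).sum).sum

/-- `M` is a possible result of minimum weight perfect matching: a matching of the highlighted
vertices and minimum weight paths between the matched ones, of least total weight. -/
def IsMWPM (p : ℝ) (T : ℕ) (e : FaultPattern) (M : Matching) : Prop :=
  D.IsMatching T e M ∧
    ∀ M', D.IsMatching T e M' → D.matchingWeight p T e M ≤ D.matchingWeight p T e M'

/-- The correction: the errors of all edges on the paths, added modulo two over all layers. -/
def correction (M : Matching) : DataError :=
  (M.map fun x => (x.2.1.map Edge.error).sum).sum

/-- The decoder corrects the faults `e`: it has a result, and for each of its possible results (ties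
may be broken in any way) the error that is left acts trivially on the logical qubit. -/
def Corrects (p : ℝ) (T : ℕ) (e : FaultPattern) : Prop :=
  (∃ M, D.IsMWPM p T e M) ∧
    ∀ M, D.IsMWPM p T e M → D.dataError T e + correction M ∈ D.trivialErrors

/-- All errors that arise from at most `k` faults are corrected. -/
def CorrectsFaults (p : ℝ) (T k : ℕ) : Prop :=
  ∀ e, D.circuit.IsFaultPattern T e → D.circuit.faultCount T e ≤ k → D.Corrects p T e

/-- The effective distance is `2 k + 1` for the greatest `k` such that all errors that arise from at
most `k` faults are corrected. -/
def HasEffectiveDistance (p : ℝ) (T n : ℕ) : Prop :=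
  ∃ k, n = 2 * k + 1 ∧ IsGreatest {k' | D.CorrectsFaults p T k'} k

/-- A single fault can cause an error of weight two (which no equivalent error reduces) along a
logical operator of minimum weight `d`. -/
def HasParallelWeightTwoFault (T : ℕ) : Prop :=
  ∃ L : DataError, D.IsLogical L ∧ D.weight L = D.d ∧ (∀ L', D.IsLogical L' → D.d ≤ D.weight L') ∧
    D.SingleFault T fun e =>
      D.weight (D.dataError T e) = 2 ∧
      (∀ x ∈ D.trivialErrors, 2 ≤ D.weight (D.dataError T e + x)) ∧
      ∀ q, D.dataError T e q ≠ 0 → L q ≠ 0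

end Problem

end FlagCode

/-! Errors of one type propagate linearly over `ZMod 2`. Hence the data error, the changes of the
stabilizer outcomes and the flips of the flags caused by a set of faults are the sums of those
caused by its members (`effect_eq_sum`). A single fault has one of a few effects (`Elementary`): a
trivial data error without any change, one ordinary edge of the graph, both flags of a measurement
and nothing else, or exactly one flag, with no data error or an error on a corner or a pair of
corners of the face. In the last case the data error is an edge of the boomerang.

For small `p` the weight of an edge is dominated by an integer multiple of `-log p`. With `m` flags
this cost is `1` in a highlighted boomerang and `m + 1` elsewhere; the remaining terms are bounded
independently of `p`. A set of edges with the right boundary contains a matching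
(`exists_isMatching`), so a minimum weight matching costs at most as much as any such set of bounded
cost (`IsMWPM.cost_le`).

The argument counts lines: rows for errors detected on odd faces, columns for errors detected on
even faces. Every generator meets every line in an even number of points, and an error that commutes
with all checks is trivial as soon as its weight on a single line is even (`mem_span_evenFaces`,
`mem_span_oddFaces`). Let `k` faults cause `m` flags, and let `R` be the set of the at most `2 m`
lines through the faces with a flag. Grouping the faults by measurement (`exists_piece`) shows that
the changes bound a set of edges of cost at most `k (m + 1) - m ^ 2`, and that the data error has
odd weight on at most `k - m` lines outside `R`. The correction uses edges which either stay on the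
lines of `R` or cost `m + 1` and meet at most one line. If it has odd weight on `c` lines outside
`R`, then `c (m + 1) ≤ k (m + 1) - m ^ 2`, and therefore `c ≤ k - m`. The remaining error thus has
odd weight on at most `2 m + 2 (k - m) = 2 k < d` lines (`corrects_of_faultCount_le`), so it has
even weight on some line and is trivial.

For `d = 2 K + 1`, put `K + 1` faults on a straight logical operator of weight `d`. They cause no
flag, and the `K` other points of the operator explain the changes at lower cost. So the decoder
leaves a logical error (`not_correctsFaults`).

What is needed of a code and its circuit is collected in `Tractable`. The part about the circuit,
`Simulates`, is obtained by following an error on one qubit backwards in time: the effect of an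
error after one time step is what is observed at once plus the effect of its copies after the next
step. An error on both qubits after a CNOT equals an error on one of them before it, so single
qubits suffice (`elementary_effect`). The flagged measurement is evaluated once for errors that it
spreads (`SpreadWindow`) and once for errors that it detects (`DetectWindow`).

The weight-two error parallel to a logical operator is the error on the two left corners of the face
`(1, 1)`. It has odd weight on two rows, and adding generators does not change this. -/

namespace FlagCode

open Finset

/-! ## Propagation of the errors of one type -/

namespace Circuit

variable (C : Circuit)

/-- Errors of type `b` on `x` are copied to `y` in time step `s`. -/
abbrev Arrow (b : Basis) (s : ℕ) (x y : Qubit) : Prop := (s, couple b x y) ∈ C.gates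

/-- The qubit `q` is prepared in time step `s`. -/
abbrev Prepared (s : ℕ) (q : Qubit) : Prop :=
  (s, Op.prep .X q) ∈ C.gates ∨ (s, Op.prep .Z q) ∈ C.gates

/-- The type `b` part of the propagation through time step `s`. -/
def step (b : Basis) (s : ℕ) (f : Qubit → ZMod 2) (q : Qubit) : ZMod 2 :=
  if C.Prepared s q then 0 else f q + ∑ c ∈ C.qubits with C.Arrow b s c q, f c

theorem propagate_apply (b : Basis) (s : ℕ) (f : Qubit → Pauli) (q : Qubit) :
    C.propagate s f q b = C.step b s (fun x => f x b) q := by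
  cases b <;> rfl

theorem step_add (b : Basis) (s : ℕ) (f g : Qubit → ZMod 2) :
    C.step b s (f + g) = C.step b s f + C.step b s g := by
  funext q
  simp only [step, Pi.add_apply, Finset.sum_add_distrib]
  split_ifs
  · simp
  · ring

@[simp] theorem step_zero (b : Basis) (s : ℕ) : C.step b s 0 = 0 := by
  funext q
  simp [step]

/-- The trajectory of the type `b` error `f`, inserted after `k` time steps. -/
def pulse (b : Basis) (k : ℕ) (f : Qubit → ZMod 2) : ℕ → Qubit → ZMod 2
  | 0 => if k = 0 then f else 0
  | j + 1 => if k = j + 1 then f else C.step b (j % C.steps) (pulse b k f j)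

theorem pulse_succ (b : Basis) (k j : ℕ) (f : Qubit → ZMod 2) : C.pulse b k f (j + 1) =
    if k = j + 1 then f else C.step b (j % C.steps) (C.pulse b k f j) := rfl

theorem pulse_of_lt (b : Basis) {k j : ℕ} (h : j < k) (f : Qubit → ZMod 2) :
    C.pulse b k f j = 0 := by
  induction j with
  | zero => simp [pulse, h.ne']
  | succ j ih => simp [pulse, h.ne', ih (by omega)]

theorem pulse_self (b : Basis) (k : ℕ) (f : Qubit → ZMod 2) : C.pulse b k f k = f := by
  cases k <;> simp [pulse]

/-- The state at time `k` is split off from everything later. Repeated, this computes the effect of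
an error backwards in time: what is observed at time `k` plus the effect of the propagated error. -/
theorem pulse_eq (b : Basis) (k : ℕ) (f : Qubit → ZMod 2) :
    C.pulse b k f = Pi.single k f + C.pulse b (k + 1) (C.step b (k % C.steps) f) := by
  funext j
  rcases lt_trichotomy j k with h | rfl | h
  · simp [C.pulse_of_lt b h, C.pulse_of_lt b (Nat.lt_succ_of_lt h), h.ne]
  · simp [C.pulse_self, C.pulse_of_lt b (Nat.lt_succ_self j)]
  · obtain ⟨n, rfl⟩ := Nat.exists_eq_add_of_lt h
    induction n with
    | zero =>
      have : k ≠ k + 0 + 1 := by omega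
      rw [Pi.add_apply, Pi.single_eq_of_ne (by omega), zero_add, pulse, if_neg this]
      simp [C.pulse_self]
    | succ n ih =>
      have := ih (by omega)
      rw [Pi.add_apply, Pi.single_eq_of_ne (by omega), zero_add] at this ⊢
      change C.pulse b k f ((k + n + 1) + 1) = C.pulse b (k + 1) _ ((k + n + 1) + 1)
      rw [C.pulse_succ b k, if_neg (by omega), C.pulse_succ b (k + 1), if_neg (by omega), this]

theorem pulse_add (b : Basis) (k : ℕ) (f g : Qubit → ZMod 2) :
    C.pulse b k (f + g) = C.pulse b k f + C.pulse b k g := by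
  funext j
  induction j with
  | zero => simp only [pulse, Pi.add_apply]; split_ifs <;> simp
  | succ j ih =>
    rw [Pi.add_apply, pulse, pulse, pulse, ih, Pi.add_apply, C.step_add]
    split_ifs <;> rfl

theorem pulse_zero (b : Basis) (k : ℕ) : C.pulse b k 0 = 0 := by
  simpa using C.pulse_add b k 0 0

end Circuit

theorem Op.spread_add (o : Op) (a a' : Pauli × Pauli) (q : Qubit) :
    o.spread (a + a') q = o.spread a q + o.spread a' q := by
  cases o <;> simp only [Op.spread, Prod.fst_add, Prod.snd_add] <;> split_ifs <;>
    first | simp | abel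

@[simp] theorem Op.spread_zero (o : Op) (q : Qubit) : o.spread 0 q = 0 := by
  cases o <;> simp [Op.spread]

namespace Circuit

variable (C : Circuit)

/-- The trajectory of the type `b` errors that come from the faults `e`. -/
def trajectory (b : Basis) (e : FaultPattern) : ℕ → Qubit → ZMod 2 := fun k q => C.frame e k q b

/-- The type `b` error caused by the faults in the time step `k` (over all rounds). -/
def insertion (b : Basis) (e : FaultPattern) (k : ℕ) : Qubit → ZMod 2 := fun q =>
  ∑ o ∈ C.ops (k % C.steps), o.spread (e (k / C.steps, k % C.steps, o)) q b

theorem trajectory_succ (b : Basis) (e : FaultPattern) (k : ℕ) :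
    C.trajectory b e (k + 1) =
      C.step b (k % C.steps) (C.trajectory b e k) + C.insertion b e k := by
  funext q
  simp only [trajectory, frame, Pi.add_apply, propagate_apply, insertion, Finset.sum_apply]
  rfl

theorem trajectory_add (b : Basis) (e e' : FaultPattern) :
    C.trajectory b (e + e') = C.trajectory b e + C.trajectory b e' := by
  funext k
  induction k with
  | zero => funext q; simp [trajectory, frame]
  | succ k ih =>
    have hi : C.insertion b (e + e') k = C.insertion b e k + C.insertion b e' k := by
      funext q
      simp [insertion, Op.spread_add, Finset.sum_add_distrib]
    rw [trajectory_succ, ih, Pi.add_apply, Pi.add_apply, C.step_add, hi, trajectory_succ,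
      trajectory_succ]
    abel

theorem insertion_single (b : Basis) {t s : ℕ} {o : Op} (hs : s < C.steps) (ho : o ∈ C.ops s)
    (a : Pauli × Pauli) (k : ℕ) :
    C.insertion b (Pi.single (t, s, o) a) k =
      if k = t * C.steps + s then (fun q => o.spread a q b) else 0 := by
  funext q
  have key : ∀ o', (Pi.single (t, s, o) a : FaultPattern) (k / C.steps, k % C.steps, o') =
      if k = t * C.steps + s ∧ o' = o then a else 0 := by
    intro o'
    rw [Pi.single_apply]
    -- Since `s < steps`, division with remainder recovers round and time step from the time counted
    -- over all rounds.
    have : (k / C.steps, k % C.steps, o') = (t, s, o) ↔ k = t * C.steps + s ∧ o' = o := by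
      simp only [Prod.mk.injEq]
      constructor
      · rintro ⟨rfl, rfl, rfl⟩
        exact ⟨(Nat.div_add_mod' k C.steps).symm, rfl⟩
      · rintro ⟨rfl, rfl⟩
        refine ⟨?_, ?_, rfl⟩
        · rw [mul_comm, Nat.mul_add_div (by omega), Nat.div_eq_of_lt hs, add_zero]
        · rw [mul_comm, Nat.mul_add_mod, Nat.mod_eq_of_lt hs]
    simp only [this]
  simp only [insertion, key]
  split_ifs with h
  · have hk : k % C.steps = s := by
      rw [h, mul_comm, Nat.mul_add_mod, Nat.mod_eq_of_lt hs]
    rw [hk, Finset.sum_eq_single o]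
    · simp [h]
    · intro o' _ hne
      simp [hne]
    · exact fun h' => absurd ho h'
  · simp [h]

/-- The trajectory of a single fault. -/
theorem trajectory_single (b : Basis) {t s : ℕ} {o : Op} (hs : s < C.steps) (ho : o ∈ C.ops s)
    (a : Pauli × Pauli) :
    C.trajectory b (Pi.single (t, s, o) a) =
      C.pulse b (t * C.steps + s + 1) (fun q => o.spread a q b) := by
  funext k
  induction k with
  | zero => funext q; simp [trajectory, frame, pulse]
  | succ k ih =>
    rw [trajectory_succ, C.insertion_single b hs ho, pulse, ih]
    by_cases h : k = t * C.steps + s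
    · rw [if_pos h, if_pos (by omega), C.pulse_of_lt b (by omega)]
      simp
    · rw [if_neg h, if_neg (by omega), add_zero]

end Circuit

/-! ## The effect of an error -/

/-- The qubit on which a flag is measured. -/
def Flag.qubit (φ : Flag) : Qubit :=
  .flag φ.2.1.1 (match φ.2.2 with | .left => φ.2.1.2 | .right => φ.2.1.2 + 1)

/-- The data error, the changes of the stabilizer outcomes and the flips of the flags. -/
abbrev Effect := DataError × (Vertex → ZMod 2) × (Flag → ZMod 2)

namespace Problem

variable (D : Problem)

theorem checkValue_add (x y : DataError) (v : ℕ × ℕ) :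
    D.checkValue (x + y) v = D.checkValue x v + D.checkValue y v := by
  simp [checkValue, Finset.sum_add_distrib]

@[simp] theorem checkValue_zero (v : ℕ × ℕ) : D.checkValue 0 v = 0 := by simp [checkValue]

/-- The type `err` error on the data at the end of a trajectory. -/
def finalData (T : ℕ) (τ : ℕ → Qubit → ZMod 2) : DataError := fun q =>
  if q ∈ D.lattice then τ (T * D.circuit.steps) (.data q.1 q.2) else 0

/-- The outcomes along a trajectory. -/
def outcomes (T : ℕ) (τ : ℕ → Qubit → ZMod 2) (t : ℕ) (v : ℕ × ℕ) : ZMod 2 :=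
  if t < T then ∑ x ∈ D.readout v, τ (t * D.circuit.steps + x.1 + 1) x.2
  else D.checkValue (D.finalData T τ) v

/-- The changes of the outcomes along a trajectory. -/
def changes (T : ℕ) (τ : ℕ → Qubit → ZMod 2) (x : Vertex) : ZMod 2 :=
  if x ∈ range (T + 1) ×ˢ D.checks then
    D.outcomes T τ x.1 x.2 - if x.1 = 0 then 0 else D.outcomes T τ (x.1 - 1) x.2
  else 0

/-- The flips of the flags along a trajectory. -/
def flagFlips (T : ℕ) (τ : ℕ → Qubit → ZMod 2) (φ : Flag) : ZMod 2 :=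
  if φ.1 < T ∧ φ.2.1 ∈ D.flaggedFaces then
    τ (φ.1 * D.circuit.steps + D.flagStep + 1) φ.qubit
  else 0

theorem finalData_add (T : ℕ) (τ σ : ℕ → Qubit → ZMod 2) :
    D.finalData T (τ + σ) = D.finalData T τ + D.finalData T σ := by
  funext q
  simp only [finalData, Pi.add_apply]
  split_ifs <;> simp

theorem outcomes_add (T : ℕ) (τ σ : ℕ → Qubit → ZMod 2) (t : ℕ) (v : ℕ × ℕ) :
    D.outcomes T (τ + σ) t v = D.outcomes T τ t v + D.outcomes T σ t v := by
  simp only [outcomes, finalData_add, checkValue_add, Pi.add_apply, Finset.sum_add_distrib]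
  split_ifs <;> rfl

/-- The effect of a trajectory. -/
def effectOf (T : ℕ) : (ℕ → Qubit → ZMod 2) →+ Effect :=
  AddMonoidHom.mk' (fun τ => (D.finalData T τ, D.changes T τ, D.flagFlips T τ)) fun τ σ => by
    refine Prod.ext (D.finalData_add T τ σ) (Prod.ext ?_ ?_)
    · funext x
      simp only [changes, outcomes_add, Prod.snd_add, Prod.fst_add, Pi.add_apply]
      split_ifs <;> ring
    · funext φ
      simp only [flagFlips, Prod.snd_add, Pi.add_apply]
      split_ifs <;> simp

/-- The effect of the faults `e`. -/
def effect (T : ℕ) (e : FaultPattern) : Effect :=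
  D.effectOf T (D.circuit.trajectory D.err e)

/-- To keep this linear, an `Effect` records every flip of a flag. The rule that two flags of one
measurement are ignored is not linear; it enters only through `mem_flags`. -/
theorem effect_add (T : ℕ) (e e' : FaultPattern) :
    D.effect T (e + e') = D.effect T e + D.effect T e' := by
  rw [effect, D.circuit.trajectory_add, map_add]; rfl

theorem effect_data (T : ℕ) (e : FaultPattern) : (D.effect T e).1 = D.dataError T e := rfl

theorem mem_changed (T : ℕ) (e : FaultPattern) (x : Vertex) :
    x ∈ D.changed T e ↔ (D.effect T e).2.1 x ≠ 0 := by
  have h : ∀ t v, D.outcomes T (D.circuit.trajectory D.err e) t v = D.outcome T e t v :=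
    fun t v => rfl
  change _ ↔ D.changes T (D.circuit.trajectory D.err e) x ≠ 0
  simp only [changes, h]
  simp only [changed, Finset.mem_filter]
  by_cases h1 : x ∈ range (T + 1) ×ˢ D.checks
  · simp only [h1, true_and, if_true, sub_ne_zero]
  · simp only [h1, false_and, if_false, ne_eq, not_true]

theorem mem_flags (T : ℕ) (e : FaultPattern) (φ : Flag) :
    φ ∈ D.flags T e ↔ (D.effect T e).2.2 φ ≠ 0 ∧
      (D.effect T e).2.2 (φ.1, φ.2.1, φ.2.2.opposite) = 0 := by
  have h : ∀ φ : Flag, D.Flagged e φ ↔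
      D.circuit.trajectory D.err e (φ.1 * D.circuit.steps + D.flagStep + 1) φ.qubit ≠ 0 :=
    fun φ => Iff.rfl
  have h2 : ∀ φ, (D.effect T e).2.2 φ = D.flagFlips T (D.circuit.trajectory D.err e) φ :=
    fun φ => rfl
  simp only [flags, Finset.mem_filter, h, h2, flagFlips, Finset.mem_product, Finset.mem_range,
    Finset.mem_univ, and_true, not_not]
  split_ifs with h1 <;> simp [h1]

/-- The effect of an error of type `err` on `q`, inserted after `k` time steps. -/
def pulseEffect (T k : ℕ) (f : Qubit → ZMod 2) : Effect :=
  D.effectOf T (D.circuit.pulse D.err k f)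

theorem pulseEffect_add (T k : ℕ) (f g : Qubit → ZMod 2) :
    D.pulseEffect T k (f + g) = D.pulseEffect T k f + D.pulseEffect T k g := by
  rw [pulseEffect, D.circuit.pulse_add, map_add]; rfl

@[simp] theorem pulseEffect_zero (T k : ℕ) : D.pulseEffect T k 0 = 0 := by
  rw [pulseEffect, D.circuit.pulse_zero, map_zero]

theorem pulseEffect_eq (T k : ℕ) (f : Qubit → ZMod 2) :
    D.pulseEffect T k f = D.effectOf T (Pi.single k f) +
      D.pulseEffect T (k + 1) (D.circuit.step D.err (k % D.circuit.steps) f) := by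
  rw [pulseEffect, D.circuit.pulse_eq, map_add]; rfl

theorem mem_locations {C : Circuit} {T : ℕ} {l : Location} :
    l ∈ C.locations T ↔ l.1 < T ∧ l.2.1 < C.steps ∧ l.2.2 ∈ C.ops l.2.1 := by
  obtain ⟨t, s, o⟩ := l
  simp only [Circuit.locations, mem_biUnion, mem_product, Finset.mem_range, mem_image,
    Prod.mk.injEq, Prod.exists]
  constructor
  · rintro ⟨t', s', ⟨h1, h2⟩, o', h3, rfl, rfl, rfl⟩
    exact ⟨h1, h2, h3⟩
  · rintro ⟨h1, h2, h3⟩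
    exact ⟨t, s, ⟨h1, h2⟩, o, h3, rfl, rfl, rfl⟩

theorem effect_single {T : ℕ} {l : Location} (hl : l ∈ D.circuit.locations T)
    (a : Pauli × Pauli) :
    D.effect T (Pi.single l a) = D.pulseEffect T (l.1 * D.circuit.steps + l.2.1 + 1)
      (fun q => l.2.2.spread a q D.err) := by
  obtain ⟨t, s, o⟩ := l
  rw [mem_locations] at hl
  rw [effect, D.circuit.trajectory_single D.err hl.2.1 hl.2.2]; rfl

/-- The faults with at least one entry different from `0`. -/
def faultLocations (T : ℕ) (e : FaultPattern) : Finset Location :=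
  {l ∈ D.circuit.locations T | e l ≠ 0}

/-- A fault pattern is the sum of its restrictions to single locations, and `effect` is additive. -/
theorem effect_eq_sum {T : ℕ} {e : FaultPattern} (he : D.circuit.IsFaultPattern T e) :
    D.effect T e = ∑ l ∈ D.faultLocations T e, D.effect T (Pi.single l (e l)) := by
  have h0 : e = ∑ l ∈ D.faultLocations T e, Pi.single l (e l) := by
    funext l
    rw [Finset.sum_apply]
    by_cases h : e l = 0
    · rw [h, eq_comm]
      refine Finset.sum_eq_zero fun l' _ => ?_
      rw [Pi.single_apply]
      split_ifs with h'
      · rw [← h', h]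
      · rfl
    · rw [Finset.sum_eq_single l]
      · simp
      · intro l' _ hne
        simp [hne.symm]
      · intro h'
        exact absurd (Finset.mem_filter.2 ⟨((he l).resolve_left h).1, h⟩) h'
  have h1 : ∀ (s : Finset Location) (g : Location → FaultPattern),
      D.effect T (∑ l ∈ s, g l) = ∑ l ∈ s, D.effect T (g l) := by
    intro s g
    exact map_sum (AddMonoidHom.mk' (D.effect T) (D.effect_add T)) g s
  conv_lhs => rw [h0]
  exact h1 _ _

end Problem

namespace Problem

variable (D : Problem)

/-! ## Paths and matchings -/

section Paths

variable {D} {T : ℕ} {e : FaultPattern}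

theorem Joins.symm {E : Edge} {x y : Option Vertex} (h : D.Joins E x y) : D.Joins E y x :=
  ⟨h.1.symm, by rw [h.2, Finset.pair_comm]⟩

theorem IsPath.singleton {E : Edge} {x y : Option Vertex} (hE : D.IsEdge T e E)
    (h : D.Joins E x y) : D.IsPath T e x [E] y :=
  ⟨hE, by simp, y, h, rfl⟩

theorem IsPath.append {l l' : List Edge} {x y z : Option Vertex} (h : D.IsPath T e x l y)
    (h' : D.IsPath T e y l' z) (hd : l.Disjoint l') : D.IsPath T e x (l ++ l') z := by
  induction l generalizing x with
  | nil => obtain rfl : x = y := h; exact h'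
  | cons E l ih =>
    obtain ⟨hE, hl, w, hj, hp⟩ := h
    rw [List.disjoint_cons_left] at hd
    exact ⟨hE, by simp [hl, hd.1], w, hj, ih hp hd.2⟩

theorem IsPath.nodup {l : List Edge} {x y : Option Vertex} (h : D.IsPath T e x l y) :
    l.Nodup := by
  induction l generalizing x with
  | nil => exact List.nodup_nil
  | cons E l ih =>
    obtain ⟨-, hl, w, -, hp⟩ := h
    exact List.nodup_cons.2 ⟨hl, ih hp⟩

theorem IsPath.isEdge {l : List Edge} {x y : Option Vertex} (h : D.IsPath T e x l y) :
    ∀ E ∈ l, D.IsEdge T e E := by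
  induction l generalizing x with
  | nil => simp
  | cons E l ih =>
    obtain ⟨hE, -, w, -, hp⟩ := h
    simpa [hE] using ih hp

theorem IsPath.reverse {l : List Edge} {x y : Option Vertex} (h : D.IsPath T e x l y) :
    D.IsPath T e y l.reverse x := by
  induction l generalizing x with
  | nil => exact Eq.symm h
  | cons E l ih =>
    obtain ⟨hE, hl, w, hj, hp⟩ := h
    rw [List.reverse_cons]
    exact (ih hp).append (.singleton hE hj.symm) (by simpa using hl)

/-- The indicator function of the ends of an edge. -/
def boundary (D : Problem) (E : Edge) (v : Vertex) : ZMod 2 := if v ∈ D.ends E then 1 else 0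

theorem Joins.boundary_eq {E : Edge} {x y : Option Vertex} (h : D.Joins E x y) (v : Vertex) :
    D.boundary E v = (if x = some v then 1 else 0) + (if y = some v then 1 else 0) := by
  have : v ∈ D.ends E ↔ some v = x ∨ some v = y := by
    have h2 := congrArg (some v ∈ ·) h.2
    simpa using h2
  have hne := h.1
  rw [boundary]
  by_cases hx : x = some v
  · have hy : y ≠ some v := fun h' => hne (hx.trans h'.symm)
    simp [this, hx, hy]
  · by_cases hy : y = some v
    · simp [this, hx, hy]
    · simp [this, hx, hy, Ne.symm hx, Ne.symm hy]

/-- Inner vertices of a path belong to two consecutive edges and cancel modulo two. The boundary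
vertex `none` is never counted. -/
theorem IsPath.sum_boundary {l : List Edge} {x y : Option Vertex} (h : D.IsPath T e x l y)
    (v : Vertex) : (l.map fun E => D.boundary E v).sum =
      (if x = some v then 1 else 0) + (if y = some v then 1 else 0) := by
  induction l generalizing x with
  | nil =>
    obtain rfl : x = y := h
    rw [CharTwo.add_self_eq_zero]; rfl
  | cons E l ih =>
    obtain ⟨-, -, w, hj, hp⟩ := h
    rw [List.map_cons, List.sum_cons, ih hp, hj.boundary_eq]
    calc _ = (if x = some v then (1 : ZMod 2) else 0) + (if y = some v then 1 else 0) +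
        ((if w = some v then 1 else 0) + (if w = some v then 1 else 0)) := by ring
      _ = _ := by rw [CharTwo.add_self_eq_zero, add_zero]

/-- The sum of the boundaries of the edges of a matching. -/
theorem IsMatching.sum_boundary {M : Matching} (h : D.IsMatching T e M) (v : Vertex) :
    (M.map fun x => (x.2.1.map fun E => D.boundary E v).sum).sum =
      if v ∈ D.changed T e then 1 else 0 := by
  obtain ⟨hp, hn, hs⟩ := h
  have hv : v ∈ D.changed T e ↔ some v ∈ M.flatMap fun x => [x.1, x.2.2] := by
    rw [← List.mem_toFinset, hs, highlightedVertices]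
    split_ifs <;> simp
  simp only [hv]
  clear hs hv
  induction M with
  | nil => simp
  | cons x M ih =>
    simp only [List.flatMap_cons, List.cons_append, List.nil_append, List.nodup_cons,
      List.mem_cons, not_or] at hn ⊢
    rw [List.map_cons, List.sum_cons, ih (fun y hy => hp y (by simp [hy])) hn.2.2,
      (hp x (by simp)).sum_boundary]
    by_cases hx : x.1 = some v
    · have h1 : x.2.2 ≠ some v := fun h' => hn.1.1 (hx.trans h'.symm)
      have h2 : some v ∉ M.flatMap fun x => [x.1, x.2.2] := hx ▸ hn.1.2
      simp only [hx, h1, h2, if_true, if_false, add_zero, true_or]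
    · by_cases hy : x.2.2 = some v
      · have h2 : some v ∉ M.flatMap fun x => [x.1, x.2.2] := hy ▸ hn.2.1
        simp only [hx, hy, h2, if_true, if_false, add_zero, zero_add, true_or, or_true]
      · simp only [hx, hy, Ne.symm hx, Ne.symm hy, if_false, false_or, zero_add]

open Classical in
/-- `H` is perfectly matched by edge-disjoint paths which consist of the edges in `C`. -/
inductive Matched (D : Problem) (T : ℕ) (e : FaultPattern) :
    Finset (Option Vertex) → Finset Edge → Prop
  | nil : Matched D T e ∅ ∅
  | cons {x y : Option Vertex} {l : List Edge} {H : Finset (Option Vertex)} {C : Finset Edge}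
      (hp : D.IsPath T e x l y) (hxy : x ≠ y) (hx : x ∉ H) (hy : y ∉ H)
      (hd : Disjoint l.toFinset C) (hM : Matched D T e H C) :
      Matched D T e (insert x (insert y H)) (l.toFinset ∪ C)

open Classical in
-- Reversing a path exchanges its ends, so the path that matches `x` may be assumed to start at `x`.
theorem Matched.exists_path {H : Finset (Option Vertex)} {C : Finset Edge}
    (h : D.Matched T e H C) {x : Option Vertex} (hx : x ∈ H) :
    ∃ y l H' C', D.IsPath T e x l y ∧ x ≠ y ∧ x ∉ H' ∧ y ∉ H' ∧ Disjoint l.toFinset C' ∧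
      D.Matched T e H' C' ∧ H = insert x (insert y H') ∧ C = l.toFinset ∪ C' := by
  induction h with
  | nil => simp at hx
  | @cons u w l H C hp huw hu hw hd hM ih =>
    by_cases hxu : x = u
    · subst hxu
      exact ⟨w, l, H, C, hp, huw, hu, hw, hd, hM, rfl, rfl⟩
    · by_cases hxw : x = w
      · subst hxw
        exact ⟨u, l.reverse, H, C, hp.reverse, huw.symm, hw, hu, by simpa using hd, hM,
          Finset.insert_comm _ _ _, by simp⟩
      · obtain ⟨y, l', H', C', h1, h2, h3, h4, h5, h6, h7, h8⟩ :=
          ih (by simpa [hxu, hxw] using hx)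
        subst h7 h8
        simp only [Finset.mem_insert, not_or] at hu hw
        rw [Finset.disjoint_union_right] at hd
        refine ⟨y, l', insert u (insert w H'), l.toFinset ∪ C', h1, h2, ?_, ?_, ?_, ?_, ?_, ?_⟩
        · simp [hxu, hxw, h3]
        · simp [Ne.symm hu.2.1, Ne.symm hw.2.1, h4]
        · rw [Finset.disjoint_union_right]; exact ⟨hd.1.symm, h5⟩
        · exact .cons hp huw hu.2.2 hw.2.2 hd.2 h6
        · ext; simp only [Finset.mem_insert]; tauto
        · ext; simp only [Finset.mem_union]; tauto

open Classical in
-- The new edge toggles its two ends. If neither is matched, it is a path of its own. If one is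
-- matched, it prolongs the path of that end. If both are matched, it either closes their common
-- path to a cycle, which is dropped, or merges two paths into one between their other ends.
theorem Matched.insert_edge {H : Finset (Option Vertex)} {C : Finset Edge}
    (h : D.Matched T e H C) {E : Edge} (hE : D.IsEdge T e E) (hEC : E ∉ C)
    {x y : Option Vertex} (hj : D.Joins E x y) :
    ∃ C' ⊆ insert E C, D.Matched T e (symmDiff H {x, y}) C' := by
  have hxy := hj.1
  wlog hw : y ∈ H → x ∈ H generalizing x y
  · rw [Finset.pair_comm]
    exact this hj.symm hxy.symm (by tauto)
  by_cases hx : x ∈ H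
  · obtain ⟨z, l, H', C', h1, h2, h3, h4, h5, h6, rfl, rfl⟩ := h.exists_path hx
    rw [Finset.mem_union, List.mem_toFinset, not_or] at hEC
    by_cases hy : y ∈ insert x (insert z H')
    · by_cases hyz : y = z
      · subst hyz
        refine ⟨C', by intro; simp; tauto, ?_⟩
        convert h6 using 1
        ext w
        by_cases hwx : w = x
        · simp [Finset.mem_symmDiff, hwx, h3]
        · by_cases hwy : w = y
          · simp [Finset.mem_symmDiff, hwy, h4]
          · simp [Finset.mem_symmDiff, hwx, hwy]
      · have hy' : y ∈ H' := by simpa [hxy.symm, hyz] using hy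
        obtain ⟨w, l', H'', C'', g1, g2, g3, g4, g5, g6, rfl, rfl⟩ := h6.exists_path hy'
        simp only [Finset.mem_insert, not_or] at h3 h4
        rw [Finset.disjoint_union_right] at h5
        have hE' : E ∉ l' := fun h' => hEC.2 (by simp [h'])
        refine ⟨(l.reverse ++ E :: l').toFinset ∪ C'', ?_, ?_⟩
        · intro; simp
        have hp : D.IsPath T e z (l.reverse ++ E :: l') w := by
          refine h1.reverse.append ⟨hE, hE', y, hj, g1⟩ ?_
          intro F hF hF'
          rw [List.mem_reverse] at hF
          rcases List.mem_cons.1 hF' with rfl | hF'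
          · exact hEC.1 hF
          · exact Finset.disjoint_left.1 h5.1 (List.mem_toFinset.2 hF) (List.mem_toFinset.2 hF')
        have hd : Disjoint (l.reverse ++ E :: l').toFinset C'' := by
          rw [Finset.disjoint_left] at h5 g5 ⊢
          intro F hF hF'
          simp only [List.toFinset_append, List.mem_toFinset, Finset.mem_union, List.mem_reverse,
            List.mem_cons] at hF
          rcases hF with hF | rfl | hF
          · exact Finset.disjoint_left.1 h5.2 (List.mem_toFinset.2 hF) hF'
          · exact hEC.2 (by simp [hF'])
          · exact g5 (List.mem_toFinset.2 hF) hF'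
        convert Matched.cons hp h4.2.1 h4.2.2 g4 hd g6 using 1
        ext u
        have hzw := h4.2.1
        have hzx := h2.symm
        have hwx := Ne.symm h3.2.1
        have hwy := g2.symm
        by_cases hux : u = x
        · subst hux; simp [Finset.mem_symmDiff, hzx.symm, hwx.symm, h3]
        · by_cases huy : u = y
          · subst huy; simp [Finset.mem_symmDiff, hyz, hwy.symm, g3]
          · simp [Finset.mem_symmDiff, hux, huy]
    · have hyz : y ≠ z := by rintro rfl; simp at hy
      refine ⟨(E :: l).toFinset ∪ C', by intro; simp, ?_⟩
      have hp : D.IsPath T e y (E :: l) z := ⟨hE, hEC.1, x, hj.symm, h1⟩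
      have hd : Disjoint (E :: l).toFinset C' := by
        simp only [List.toFinset_cons, Finset.disjoint_insert_left]
        exact ⟨hEC.2, h5⟩
      have hyH : y ∉ H' := fun h' => hy (by simp [h'])
      convert Matched.cons hp hyz hyH h4 hd h6 using 1
      ext u
      by_cases hux : u = x
      · subst hux; simp [Finset.mem_symmDiff, h2, hxy, h3]
      · by_cases huy : u = y
        · subst huy; simp [Finset.mem_symmDiff, hxy.symm, hyz, hyH]
        · simp [Finset.mem_symmDiff, hux, huy]
  · have hy : y ∉ H := fun h' => hx (hw h')
    refine ⟨[E].toFinset ∪ C, by intro; simp, ?_⟩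
    convert Matched.cons (.singleton hE hj) hxy hx hy (by simpa using hEC) h using 1
    ext u
    by_cases hux : u = x
    · subst hux; simp [Finset.mem_symmDiff, hx]
    · by_cases huy : u = y
      · subst huy; simp [Finset.mem_symmDiff, hy]
      · simp [Finset.mem_symmDiff, hux, huy]

open Classical in
/-- A set of edges contains paths which match the vertices at which an odd number of its edges
end. -/
theorem exists_matched {C : Finset Edge} (hC : ∀ E ∈ C, D.IsEdge T e E)
    (hj : ∀ E ∈ C, ∃ x y, D.Joins E x y) {H : Finset (Option Vertex)} (hH : Even #H)
    (hb : ∀ v, ∑ E ∈ C, D.boundary E v = if some v ∈ H then 1 else 0) :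
    ∃ C' ⊆ C, D.Matched T e H C' := by
  induction C using Finset.induction_on generalizing H with
  | empty =>
    -- Without edges no proper vertex belongs to `H`, and `H = {none}` is excluded by parity.
    have hsub : H ⊆ {none} := by
      intro x hx
      cases x with
      | none => simp
      | some v => have := hb v; simp [hx] at this
    have : H = ∅ := by
      rcases Finset.subset_singleton_iff.1 hsub with h | h
      · exact h
      · simp [h] at hH
    exact ⟨∅, subset_rfl, this ▸ .nil⟩
  | insert E C hE ih =>
    obtain ⟨x, y, hxy⟩ := hj E (by simp)
    -- The hypothesis on boundaries says nothing about `none`; the parity of `H` replaces it and has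
    -- to be carried through the induction.
    have hpar : Even #(symmDiff H {x, y}) := by
      have h2 : #({x, y} : Finset (Option Vertex)) = 2 := Finset.card_pair hxy.1
      have h3 : #(symmDiff H {x, y}) = #(H \ {x, y}) + #({x, y} \ H) := by
        rw [symmDiff_def, Finset.sup_eq_union, Finset.card_union_of_disjoint]
        rw [Finset.disjoint_left]
        intro a ha hb
        simp only [Finset.mem_sdiff] at ha hb
        exact ha.2 hb.1
      have h4 := Finset.card_sdiff_add_card_inter H {x, y}
      have h5 := Finset.card_sdiff_add_card_inter {x, y} H
      rw [Finset.inter_comm] at h5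
      rw [h3]
      obtain ⟨r, hr⟩ := hH
      exact ⟨r + 1 - #(H ∩ {x, y}), by omega⟩
    obtain ⟨C', hC', hM⟩ := ih (fun F hF => hC F (by simp [hF])) (fun F hF => hj F (by simp [hF]))
      hpar (by
        intro v
        have h1 := hb v
        rw [Finset.sum_insert hE, hxy.boundary_eq] at h1
        have h2 : ∀ a b c : ZMod 2, a + b = c → b = c + a := by decide
        rw [h2 _ _ _ h1]
        have hne := hxy.1
        by_cases hx : x = some v
        · have hy : y ≠ some v := fun h' => hne (hx.trans h'.symm)
          by_cases hv : some v ∈ H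
          · simp [Finset.mem_symmDiff, hx, hy, hv, CharTwo.add_self_eq_zero]
          · simp [Finset.mem_symmDiff, hx, hy, hv]
        · by_cases hy : y = some v
          · by_cases hv : some v ∈ H
            · simp [Finset.mem_symmDiff, hx, hy, hv, CharTwo.add_self_eq_zero]
            · simp [Finset.mem_symmDiff, hx, hy, hv]
          · simp [Finset.mem_symmDiff, hx, hy, Ne.symm hx, Ne.symm hy])
    obtain ⟨C'', hC'', hM'⟩ := hM.insert_edge (hC E (by simp)) (fun h => hE (hC' h)) hxy
    refine ⟨C'', hC''.trans (Finset.insert_subset_insert _ hC'), ?_⟩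
    rwa [symmDiff_symmDiff_cancel_right] at hM'

open Classical in
theorem Matched.exists_matching {H : Finset (Option Vertex)} {C : Finset Edge}
    (h : D.Matched T e H C) (w : Edge → ℝ) :
    ∃ M : Matching, (∀ x ∈ M, D.IsPath T e x.1 x.2.1 x.2.2) ∧
      (M.flatMap fun x => [x.1, x.2.2]).Nodup ∧
      (M.flatMap fun x => [x.1, x.2.2]).toFinset = H ∧
      (M.map fun x => (x.2.1.map w).sum).sum = ∑ E ∈ C, w E := by
  induction h with
  | nil => exact ⟨[], by simp⟩
  | @cons x y l H C hp hxy hx hy hd hM ih =>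
    obtain ⟨M, h1, h2, h3, h4⟩ := ih
    have hm : ∀ z, z ∈ (M.flatMap fun x => [x.1, x.2.2]) ↔ z ∈ H := by
      intro z; rw [← List.mem_toFinset, h3]
    refine ⟨(x, l, y) :: M, ?_, ?_, ?_, ?_⟩
    · rintro z (_ | ⟨_, hz⟩)
      exacts [hp, h1 z hz]
    · rw [List.flatMap_cons, List.cons_append, List.cons_append, List.nil_append,
        List.nodup_cons, List.nodup_cons, List.mem_cons, hm, hm]
      exact ⟨fun h => h.elim hxy hx, hy, h2⟩
    · ext z
      simp only [List.flatMap_cons, List.cons_append, List.nil_append, List.mem_toFinset,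
        List.mem_cons, hm, Finset.mem_insert]
    · rw [List.map_cons, List.sum_cons, h4, Finset.sum_union hd,
        List.sum_toFinset w hp.nodup]

theorem even_card_highlightedVertices : Even #(D.highlightedVertices T e) := by
  rw [highlightedVertices]
  have h : #((D.changed T e).image some) = #(D.changed T e) :=
    Finset.card_image_of_injective _ (Option.some_injective _)
  split_ifs with ho
  · rw [Finset.card_union_of_disjoint (by simp), h, Finset.card_singleton]
    exact ho.add_one
  · rw [Finset.union_empty, h]
    exact Nat.not_odd_iff_even.1 ho

open Classical in
/-- A set of edges whose boundary consists of the changed vertices contains a matching. -/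
theorem exists_isMatching {C : Finset Edge} (hC : ∀ E ∈ C, D.IsEdge T e E)
    (hj : ∀ E ∈ C, ∃ x y, D.Joins E x y)
    (hb : ∀ v, ∑ E ∈ C, D.boundary E v = if v ∈ D.changed T e then 1 else 0) (w : Edge → ℝ) :
    ∃ M, D.IsMatching T e M ∧ ∃ C' ⊆ C,
      (M.map fun x => (x.2.1.map w).sum).sum = ∑ E ∈ C', w E := by
  obtain ⟨C', hC', hM⟩ := exists_matched hC hj (H := D.highlightedVertices T e)
    even_card_highlightedVertices (by
      intro v
      rw [hb v, highlightedVertices]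
      congr 1
      split_ifs <;> simp)
  obtain ⟨M, h1, h2, h3, h4⟩ := hM.exists_matching w
  exact ⟨M, ⟨h1, h2, h3⟩, C', hC', h4⟩

theorem finite_nodup_lists {α : Type*} {s : Set α} (hs : s.Finite) :
    {l : List α | l.Nodup ∧ ∀ x ∈ l, x ∈ s}.Finite := by
  classical
  have : Fintype s := hs.fintype
  refine (Set.finite_range fun l : {l : List s // l.Nodup} => l.1.map Subtype.val).subset ?_
  rintro l ⟨h1, h2⟩
  lift l to List s using h2
  exact ⟨⟨l, h1.of_map _⟩, rfl⟩

/-- Paths repeat no edge and matched vertices are distinct, so a matching is a list without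
repetitions over a finite set. -/
theorem finite_matchings (hE : {E | D.IsEdge T e E}.Finite) :
    {M | D.IsMatching T e M}.Finite := by
  have h1 := finite_nodup_lists hE
  have h2 : (↑(D.highlightedVertices T e) : Set (Option Vertex)).Finite := Finset.finite_toSet _
  refine (finite_nodup_lists (h2.prod (h1.prod h2))).subset ?_
  rintro M ⟨hp, hn, hs⟩
  have hm : ∀ z, z ∈ (M.flatMap fun x => [x.1, x.2.2]) → z ∈ D.highlightedVertices T e := by
    intro z hz; rwa [← hs, List.mem_toFinset]
  refine ⟨?_, fun x hx => ⟨?_, ⟨(hp x hx).nodup, (hp x hx).isEdge⟩, ?_⟩⟩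
  · rw [List.nodup_flatMap] at hn
    refine hn.2.imp ?_
    rintro a b hab rfl
    exact hab (a := a.1) (by simp) (by simp)
  · exact hm _ (List.mem_flatMap.2 ⟨x, hx, by simp⟩)
  · exact hm _ (List.mem_flatMap.2 ⟨x, hx, by simp⟩)

/-- If there is a matching, then there is one of least weight. -/
theorem exists_isMWPM (hE : {E | D.IsEdge T e E}.Finite) {M₀ : Matching}
    (h₀ : D.IsMatching T e M₀) (p : ℝ) : ∃ M, D.IsMWPM p T e M := by
  obtain ⟨M, hM, hmin⟩ := Set.exists_min_image _ (D.matchingWeight p T e) (finite_matchings hE)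
    ⟨M₀, h₀⟩
  exact ⟨M, hM, hmin⟩

end Paths

end Problem

/-! ## Probabilities and weights of the edges -/

theorem Op.le_prob {p : ℝ} (hp : 0 ≤ p) (o : Op) : p / 15 ≤ o.prob p := by
  cases o <;> simp only [Op.prob] <;> linarith

theorem Op.card_errors_mul_prob_le {p : ℝ} (hp : 0 ≤ p) (o : Op) :
    #o.errors * o.prob p ≤ p := by
  cases o with
  | cnot c t =>
    have : #(Op.cnot c t).errors = 15 := by
      rw [Op.errors, Finset.card_erase_of_mem (Finset.mem_univ _)]
      rfl
    rw [this, Op.prob]; push_cast; linarith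
  | prep b q => simp only [Op.errors, Op.prob, Finset.card_singleton]; push_cast; linarith
  | meas b q => simp only [Op.errors, Op.prob, Finset.card_singleton]; push_cast; linarith
  | idle q =>
    have : #(Op.idle q).errors = 3 := by
      rw [Op.errors]; decide
    rw [this, Op.prob]; push_cast; linarith

namespace Problem

variable {D : Problem} {T : ℕ}

theorem locationProb_nonneg {p : ℝ} (hp : 0 ≤ p) (E : Edge) (l : Location) :
    0 ≤ D.locationProb p T E l :=
  Finset.sum_nonneg fun _ _ => le_trans (by linarith) (l.2.2.le_prob hp)

theorem locationProb_le {p : ℝ} (hp : 0 ≤ p) (E : Edge) (l : Location) :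
    D.locationProb p T E l ≤ p := by
  classical
  have h0 : 0 ≤ l.2.2.prob p := le_trans (by linarith) (l.2.2.le_prob hp)
  refine le_trans ?_ (l.2.2.card_errors_mul_prob_le hp)
  rw [locationProb, Finset.sum_const, nsmul_eq_mul]
  exact mul_le_mul_of_nonneg_right (by exact_mod_cast Finset.card_filter_le _ _) h0

theorem le_locationProb {p : ℝ} (hp : 0 ≤ p) {E : Edge} {l : Location} {a : Pauli × Pauli}
    (ha : a ∈ l.2.2.errors) (h : D.ResultsIn T (Pi.single l a) E) :
    p / 15 ≤ D.locationProb p T E l := by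
  classical
  refine (l.2.2.le_prob hp).trans ?_
  rw [locationProb]
  exact Finset.single_le_sum (f := fun _ => l.2.2.prob p)
    (fun _ _ => le_trans (by linarith) (l.2.2.le_prob hp)) (Finset.mem_filter.2 ⟨ha, h⟩)

theorem edgeProb_le {p : ℝ} (hp : 0 ≤ p) (hp1 : p ≤ 1) (E : Edge) :
    D.edgeProb p T E ≤ #(D.circuit.locations T) * p := by
  rw [edgeProb, ← nsmul_eq_mul]
  refine Finset.sum_le_card_nsmul _ _ _ fun l _ => ?_
  refine le_trans ?_ (locationProb_le (D := D) (T := T) hp E l)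
  refine mul_le_of_le_one_right (locationProb_nonneg hp E l) ?_
  refine Finset.prod_le_one (fun l' _ => ?_) fun l' _ => ?_
  · have := locationProb_le (D := D) (T := T) hp E l'; linarith
  · have := locationProb_nonneg (D := D) (T := T) hp E l'; linarith

/-- The location of the given fault contributes at least `p / 15`. By Bernoulli's inequality the
product over the other locations is at least `1 - N p ≥ 1 / 2`, where `N` is the number of
locations. -/
theorem le_edgeProb {p : ℝ} (hp : 0 ≤ p) (hp1 : p ≤ 1)
    (hN : #(D.circuit.locations T) * p ≤ 1 / 2) {E : Edge}
    (hE : D.SingleFault T fun e => D.ResultsIn T e E) : p / 30 ≤ D.edgeProb p T E := by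
  obtain ⟨l, hl, a, ha, h⟩ := hE
  have hprod : ∀ l, 1 / 2 ≤ ∏ l' ∈ (D.circuit.locations T).erase l,
      (1 - D.locationProb p T E l') := by
    intro l
    have h1 : (1 - p) ^ #((D.circuit.locations T).erase l) ≤
        ∏ l' ∈ (D.circuit.locations T).erase l, (1 - D.locationProb p T E l') := by
      rw [← Finset.prod_const]
      refine Finset.prod_le_prod (fun _ _ => by linarith) fun l' _ => ?_
      have := locationProb_le (D := D) (T := T) hp E l'; linarith
    refine le_trans ?_ h1
    have h2 := one_add_mul_le_pow (a := -p) (by linarith) #((D.circuit.locations T).erase l)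
    have h3 : (#((D.circuit.locations T).erase l) : ℝ) * p ≤ #(D.circuit.locations T) * p :=
      mul_le_mul_of_nonneg_right (by exact_mod_cast Finset.card_erase_le) hp
    rw [← sub_eq_add_neg] at h2
    linarith
  rw [edgeProb]
  have h0 : ∀ l ∈ D.circuit.locations T, 0 ≤ D.locationProb p T E l *
      ∏ l' ∈ (D.circuit.locations T).erase l, (1 - D.locationProb p T E l') := fun l _ =>
    mul_nonneg (locationProb_nonneg hp E l) (by linarith [hprod l])
  refine le_trans ?_ (Finset.single_le_sum h0 hl)
  have h4 := le_locationProb hp ha h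
  nlinarith [hprod l]

open Classical in
/-- The weight of an edge in units of `- log p`, to leading order. -/
noncomputable def edgeCost (D : Problem) (T : ℕ) (e : FaultPattern) (E : Edge) : ℕ :=
  if D.Highlighted T e E then 1 else #(D.flags T e) + 1

theorem one_le_edgeCost (e : FaultPattern) (E : Edge) : 1 ≤ D.edgeCost T e E := by
  rw [edgeCost]; split_ifs <;> omega

section

variable {p : ℝ} (hp : 0 < p) (hp1 : p < 1) (hN : #(D.circuit.locations T) * p ≤ 1 / 2)
  {e : FaultPattern} {E : Edge} (hE : D.SingleFault T fun e => D.ResultsIn T e E)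

include hp hp1 hN hE in
-- The cost is the exponent of `p` in the weight. The rest, `P_E / p`, lies between `1 / 30` and the
-- number of locations, which gives the two estimates that follow.
theorem edgeWeight_eq : D.edgeWeight p T e E =
    D.edgeCost T e E * (- Real.log p) - Real.log (D.edgeProb p T E / p) := by
  have h0 : 0 < D.edgeProb p T E :=
    lt_of_lt_of_le (by linarith) (le_edgeProb hp.le hp1.le hN hE)
  rw [edgeWeight, edgeCost, Real.log_div h0.ne' hp.ne']
  split_ifs
  · push_cast; ring
  · rw [Real.log_mul (pow_pos hp _).ne' h0.ne', Real.log_pow]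
    push_cast; ring

include hp hp1 hN hE in
theorem edgeWeight_le : D.edgeWeight p T e E ≤
    D.edgeCost T e E * (- Real.log p) + Real.log 30 := by
  rw [edgeWeight_eq hp hp1 hN hE, sub_eq_add_neg]
  have h := le_edgeProb hp.le hp1.le hN hE
  have h0 : 0 < D.edgeProb p T E := lt_of_lt_of_le (by linarith) h
  refine add_le_add le_rfl ?_
  rw [← Real.log_inv]
  refine Real.log_le_log (inv_pos.2 (div_pos h0 hp)) ?_
  rw [inv_div, div_le_iff₀ h0]
  linarith

include hp hp1 hN hE in
theorem le_edgeWeight : D.edgeCost T e E * (- Real.log p) -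
    Real.log #(D.circuit.locations T) ≤ D.edgeWeight p T e E := by
  rw [edgeWeight_eq hp hp1 hN hE]
  have h := le_edgeProb hp.le hp1.le hN hE
  have h0 : 0 < D.edgeProb p T E := lt_of_lt_of_le (by linarith) h
  refine sub_le_sub le_rfl (Real.log_le_log (div_pos h0 hp) ?_)
  rw [div_le_iff₀ hp]
  exact edgeProb_le hp.le hp1.le E

end

/-- The cost of a matching to leading order. -/
noncomputable def matchingCost (D : Problem) (T : ℕ) (e : FaultPattern) (M : Matching) : ℕ :=
  (M.map fun x => (x.2.1.map (D.edgeCost T e)).sum).sum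

/-- Different paths of a matching may share edges, so the estimate is summed over lists instead of a
set of edges. -/
theorem matchingCost_mul_le {e : FaultPattern} {M : Matching} (hM : D.IsMatching T e M)
    {c : ℝ} {w : Edge → ℝ} (hw : ∀ E, D.IsEdge T e E → D.edgeCost T e E * c ≤ w E) :
    D.matchingCost T e M * c ≤ (M.map fun x => (x.2.1.map w).sum).sum := by
  have hp := hM.1
  clear hM
  rw [matchingCost]
  induction M with
  | nil => simp
  | cons x M ih =>
    have hl : ∀ l : List Edge, (∀ E ∈ l, D.IsEdge T e E) →
        ((l.map (D.edgeCost T e)).sum : ℕ) * c ≤ (l.map w).sum := by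
      intro l
      induction l with
      | nil => simp
      | cons E l ih =>
        intro h
        simp only [List.map_cons, List.sum_cons, Nat.cast_add, add_mul]
        exact add_le_add (hw E (h E (by simp))) (ih fun F hF => h F (by simp [hF]))
    simp only [List.map_cons, List.sum_cons, Nat.cast_add, add_mul]
    exact add_le_add (hl _ (hp x (by simp)).isEdge) (ih fun y hy => hp y (by simp [hy]))

/-- For small `p` a minimum weight matching has least cost. -/
theorem IsMWPM.cost_le {p : ℝ} (hp : 0 < p) (hp1 : p < 1)
    (hN : #(D.circuit.locations T) * p ≤ 1 / 2) {W : ℕ}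
    (hW : (W + 1) * (Real.log #(D.circuit.locations T) + Real.log 30) < - Real.log p)
    {e : FaultPattern} {M : Matching} (hM : D.IsMWPM p T e M) {C : Finset Edge}
    (hC : ∀ E ∈ C, D.IsEdge T e E) (hj : ∀ E ∈ C, ∃ x y, D.Joins E x y)
    (hb : ∀ v, ∑ E ∈ C, D.boundary E v = if v ∈ D.changed T e then 1 else 0) {n : ℕ}
    (hn : ∑ E ∈ C, D.edgeCost T e E ≤ n) (hnW : n ≤ W) : D.matchingCost T e M ≤ n := by
  set L := - Real.log p
  set A := Real.log #(D.circuit.locations T)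
  have hA : 0 ≤ A := Real.log_natCast_nonneg _
  have hB : 0 ≤ Real.log 30 := Real.log_nonneg (by norm_num)
  have hAL : A + Real.log 30 < L := by
    have : (0 : ℝ) ≤ W * (A + Real.log 30) := by positivity
    linarith
  obtain ⟨M', hM', C', hC', hw⟩ := exists_isMatching hC hj hb (D.edgeWeight p T e)
  -- Every edge costs at least `1`, so the error `log 30` per edge can be absorbed in the factor of
  -- the cost. The same holds for `A` in the lower bound.
  have h1 : D.matchingWeight p T e M ≤ n * (L + Real.log 30) := by
    refine (hM.2 M' hM').trans ?_
    rw [matchingWeight, hw]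
    calc ∑ E ∈ C', D.edgeWeight p T e E
        ≤ ∑ E ∈ C', (D.edgeCost T e E : ℝ) * (L + Real.log 30) := by
          refine Finset.sum_le_sum fun E hE => ?_
          refine (edgeWeight_le hp hp1 hN (hC E (hC' hE)).1).trans ?_
          have : (1 : ℝ) ≤ D.edgeCost T e E := by exact_mod_cast one_le_edgeCost e E
          nlinarith
      _ = ((∑ E ∈ C', D.edgeCost T e E : ℕ) : ℝ) * (L + Real.log 30) := by
          rw [Nat.cast_sum, Finset.sum_mul]
      _ ≤ n * (L + Real.log 30) := by
          refine mul_le_mul_of_nonneg_right ?_ (by linarith)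
          exact_mod_cast (Finset.sum_le_sum_of_subset hC').trans hn
  have h2 : D.matchingCost T e M * (L - A) ≤ D.matchingWeight p T e M := by
    refine matchingCost_mul_le hM.1 fun E hE => ?_
    refine le_trans ?_ (le_edgeWeight hp hp1 hN hE.1)
    have : (1 : ℝ) ≤ D.edgeCost T e E := by exact_mod_cast one_le_edgeCost e E
    nlinarith
  -- A cost of at least `n + 1` would give `(n + 1) (L - A) ≤ n (L + log 30)`, hence `L ≤ (n + 1) A
  -- + n log 30`, which contradicts `hW` because `n ≤ W`.
  by_contra! hlt
  have h3 : ((n : ℝ) + 1) * (L - A) ≤ D.matchingCost T e M * (L - A) :=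
    mul_le_mul_of_nonneg_right (by exact_mod_cast hlt) (by linarith)
  have h4 : ((n : ℝ) + 1) * (A + Real.log 30) ≤ (W + 1) * (A + Real.log 30) :=
    mul_le_mul_of_nonneg_right (by exact_mod_cast Nat.succ_le_succ hnW) (by linarith)
  nlinarith

/-- The conditions of `IsMWPM.cost_le` are satisfied for all small `p`. -/
theorem exists_threshold (N W : ℕ) : ∃ p₀ : ℝ, 0 < p₀ ∧ ∀ p : ℝ, 0 < p → p < p₀ →
    p < 1 ∧ N * p ≤ 1 / 2 ∧ (W + 1) * (Real.log N + Real.log 30) < - Real.log p := by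
  -- The first bound yields `p < 1` and `N p ≤ 1 / 2`, with `N + 1` in place of `N` since `N` may be
  -- `0`. The second one is the condition on the logarithm, solved for `p`.
  refine ⟨min (1 / (2 * (N + 1))) (Real.exp (-((W + 1) * (Real.log N + Real.log 30)))),
    lt_min (by positivity) (Real.exp_pos _), fun p hp h => ?_⟩
  rw [lt_min_iff] at h
  have hN : (0 : ℝ) ≤ N := Nat.cast_nonneg N
  have h1 : p * (2 * (N + 1)) < 1 := by rw [← lt_div_iff₀ (by positivity)]; exact h.1
  refine ⟨by nlinarith, by nlinarith, ?_⟩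
  have := (Real.log_lt_iff_lt_exp hp).2 h.2
  linarith

end Problem

/-! ### Plaquettes, syndromes and the effects of single faults -/

theorem plaquette_of_bulk {d : ℕ} {F : Finset (ℕ × ℕ)} {f : ℕ × ℕ} (hf : f ∈ bulk d F) :
    plaquette d f = {f, (f.1, f.2 + 1), (f.1 + 1, f.2), (f.1 + 1, f.2 + 1)} := by
  obtain ⟨i, j⟩ := f
  simp only [bulk, mem_filter, mem_product, mem_Icc] at hf
  ext ⟨a, b⟩
  simp only [plaquette, mem_inter, mem_product, mem_insert, mem_singleton, mem_Icc, Prod.mk.injEq]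
  omega

theorem errorOn_insert {q : ℕ × ℕ} {s : Finset (ℕ × ℕ)} (h : q ∉ s) :
    errorOn (insert q s) = errorOn {q} + errorOn s := by
  funext x
  by_cases hx : x = q
  · subst hx; simp [errorOn, h]
  · simp [errorOn, hx]

theorem errorOn_plaquette {d : ℕ} {F : Finset (ℕ × ℕ)} {f : ℕ × ℕ} (hf : f ∈ bulk d F) :
    errorOn (plaquette d f) = errorOn {f} + (errorOn {(f.1, f.2 + 1)} +
      (errorOn {(f.1 + 1, f.2)} + errorOn {(f.1 + 1, f.2 + 1)})) := by
  obtain ⟨i, j⟩ := f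
  rw [plaquette_of_bulk hf, errorOn_insert (by simp), errorOn_insert (by simp),
    errorOn_insert (by simp)]

namespace Problem

variable (D : Problem)

/-- The changes caused by the data error `x` when it is first detected in layer `t`. -/
def syndrome (t : ℕ) (x : DataError) (v : Vertex) : ZMod 2 :=
  if v.1 = t ∧ v.2 ∈ D.checks then D.checkValue x v.2 else 0

theorem syndrome_add (t : ℕ) (x y : DataError) :
    D.syndrome t (x + y) = D.syndrome t x + D.syndrome t y := by
  funext v
  simp only [syndrome, Pi.add_apply, checkValue_add]
  split_ifs <;> simp

@[simp] theorem syndrome_zero (t : ℕ) : D.syndrome t 0 = 0 := by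
  funext v; simp [syndrome]

theorem boundary_of_ends {E : Edge} {t : ℕ} {x : DataError} (h : D.ends E = D.violated t x) :
    D.boundary E = D.syndrome t x := by
  funext v
  have hv : v ∈ D.violated t x ↔ (v.1 = t ∧ v.2 ∈ D.checks) ∧ D.checkValue x v.2 ≠ 0 := by
    obtain ⟨t', v⟩ := v
    simp only [violated, mem_image, mem_filter, Prod.mk.injEq]
    constructor
    · rintro ⟨w, ⟨h1, h2⟩, rfl, rfl⟩
      exact ⟨⟨rfl, h1⟩, h2⟩
    · rintro ⟨⟨rfl, h1⟩, h2⟩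
      exact ⟨v, ⟨h1, h2⟩, rfl, rfl⟩
  rw [boundary, syndrome, h]
  by_cases h1 : v.1 = t ∧ v.2 ∈ D.checks
  · rw [if_pos h1]
    have h2 : ∀ a : ZMod 2, (if a ≠ 0 then 1 else 0) = a := by decide
    simpa only [hv, h1, true_and] using h2 _
  · simp only [hv, h1, false_and, if_false]

/-- The corner of the face `f` which alone is affected by some fault with the given flag. -/
def corner (f : ℕ × ℕ) : Side → ℕ × ℕ
  | .left => (f.1 + 1, f.2)
  | .right => (f.1, f.2 + 1)

/-- The error on the two left corners of a face. -/
def leftPair (f : ℕ × ℕ) : DataError := errorOn {f, (f.1 + 1, f.2)}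

/-- The error on the two right corners of a face. -/
def rightPair (f : ℕ × ℕ) : DataError := errorOn {(f.1, f.2 + 1), (f.1 + 1, f.2 + 1)}

theorem leftPair_eq (f : ℕ × ℕ) : leftPair f = errorOn {f} + errorOn {(f.1 + 1, f.2)} := by
  obtain ⟨i, j⟩ := f
  exact errorOn_insert (by simp)

theorem rightPair_eq (f : ℕ × ℕ) :
    rightPair f = errorOn {(f.1, f.2 + 1)} + errorOn {(f.1 + 1, f.2 + 1)} :=
  errorOn_insert (by simp)

/-- The possible effects of single faults. The data errors that come with a flag in round `t` are
detected in the layer `layer t`. -/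
inductive Elementary (T : ℕ) (layer : ℕ → ℕ) : Effect → Prop
  | neutral {x : DataError} (hx : x ∈ D.trivialErrors) : Elementary T layer (x, 0, 0)
  | space {t : ℕ} {q : ℕ × ℕ} (ht : t ≤ T) (hq : q ∈ D.lattice) :
      Elementary T layer (errorOn {q}, D.syndrome t (errorOn {q}), 0)
  | diag {t : ℕ} {q v w : ℕ × ℕ} (hq : q ∈ D.lattice) :
      Elementary T layer (errorOn {q}, D.boundary (.diag t q v w), 0)
  | vert {t : ℕ} {v : ℕ × ℕ} : Elementary T layer (0, D.boundary (.vert t v), 0)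
  | both {t : ℕ} {f : ℕ × ℕ} (ht : t < T) (hf : f ∈ D.flaggedFaces) :
      Elementary T layer (0, 0, Pi.single (t, f, .left) 1 + Pi.single (t, f, .right) 1)
  | one {t : ℕ} {f : ℕ × ℕ} {σ : Side} {x : DataError} (ht : t < T) (hf : f ∈ D.flaggedFaces)
      (hx : x = 0 ∨ x = errorOn {corner f σ} ∨ x = leftPair f ∨ x = rightPair f) :
      Elementary T layer (x, D.syndrome (layer t) x, Pi.single (t, f, σ) 1)

/-- The sum of an error over the line (row or column) `i`. -/
def lineSum (line : ℕ × ℕ → ℕ) (i : ℕ) (x : DataError) : ZMod 2 :=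
  ∑ q ∈ D.lattice with line q = i, x q

/-- The effect `w` is that of a single fault. -/
def SingleEffect (T : ℕ) (w : Effect) : Prop := D.SingleFault T fun e => D.effect T e = w

/-- What is used of the codes and the circuits: logical operators cross all lines, all single faults
have elementary effects, and some effects do occur. -/
structure Tractable (T : ℕ) (line : ℕ × ℕ → ℕ) (point : ℕ → ℕ × ℕ) (layer : ℕ → ℕ) : Prop where
  line_eq : line = Prod.fst ∨ line = Prod.snd
  point_mem : ∀ i ∈ Icc 1 D.d, point i ∈ D.lattice
  line_point : ∀ i, line (point i) = i
  layer_le : ∀ t < T, layer t ≤ T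
  checkValue_gen : ∀ f ∈ D.gens, ∀ v ∈ D.checks, D.checkValue (errorOn (plaquette D.d f)) v = 0
  lineSum_gen : ∀ f ∈ D.gens, ∀ i, D.lineSum line i (errorOn (plaquette D.d f)) = 0
  checkValue_line : ∀ v ∈ D.checks, D.checkValue (∑ i ∈ Icc 1 D.d, errorOn {point i}) v = 0
  mem_trivialErrors : ∀ x : DataError, (∀ q, q ∉ D.lattice → x q = 0) →
    (∀ v ∈ D.checks, D.checkValue x v = 0) → ∀ i ∈ Icc 1 D.d, D.lineSum line i x = 0 →
    x ∈ D.trivialErrors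
  card_space : ∀ q ∈ D.lattice, #{v ∈ D.checks | D.checkValue (errorOn {q}) v ≠ 0} = 1 ∨
    #{v ∈ D.checks | D.checkValue (errorOn {q}) v ≠ 0} = 2
  card_cross : ∀ f ∈ D.flaggedFaces, #{v ∈ D.checks | D.checkValue (leftPair f) v ≠ 0} = 1 ∨
    #{v ∈ D.checks | D.checkValue (leftPair f) v ≠ 0} = 2
  elementary : ∀ l ∈ D.circuit.locations T, ∀ a ∈ l.2.2.errors,
    D.Elementary T layer (D.effect T (Pi.single l a))
  space : ∀ t ≤ T, ∀ q ∈ D.lattice,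
    D.SingleEffect T (errorOn {q}, D.syndrome t (errorOn {q}), 0)
  pair : ∀ t < T, ∀ f ∈ D.flaggedFaces, ∀ σ, ∃ x, (x = leftPair f ∨ x = rightPair f) ∧
    D.SingleEffect T (x, D.syndrome (layer t) x, Pi.single (t, f, σ) 1)
  corner : ∀ t < T, ∀ f ∈ D.flaggedFaces, ∀ σ, D.SingleEffect T
    (errorOn {corner f σ}, D.syndrome (layer t) (errorOn {corner f σ}), Pi.single (t, f, σ) 1)
  idle : ∀ q ∈ D.lattice, ((0, 0, .idle (.data q.1 q.2)) : Location) ∈ D.circuit.locations T ∧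
    D.effect T (Pi.single (0, 0, .idle (.data q.1 q.2)) (Pi.single D.err 1, 0)) =
      (errorOn {q}, D.syndrome 0 (errorOn {q}), 0)

variable {D}

theorem lineSum_add (line : ℕ × ℕ → ℕ) (i : ℕ) (x y : DataError) :
    D.lineSum line i (x + y) = D.lineSum line i x + D.lineSum line i y := by
  simp [lineSum, Finset.sum_add_distrib]

@[simp] theorem lineSum_zero (line : ℕ × ℕ → ℕ) (i : ℕ) : D.lineSum line i 0 = 0 := by
  simp [lineSum]

theorem lineSum_errorOn {line : ℕ × ℕ → ℕ} {q : ℕ × ℕ} (hq : q ∈ D.lattice) (i : ℕ) :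
    D.lineSum line i (errorOn {q}) = if line q = i then 1 else 0 := by
  simp [lineSum, errorOn, Finset.sum_ite_eq', hq]

theorem lineSum_eq_zero_of_trivial {T : ℕ} {line point layer}
    (h : D.Tractable T line point layer) {x : DataError} (hx : x ∈ D.trivialErrors) (i : ℕ) :
    D.lineSum line i x = 0 := by
  induction hx using Submodule.span_induction with
  | mem x hx => obtain ⟨f, hf, rfl⟩ := hx; exact h.lineSum_gen f hf i
  | zero => simp
  | add x y _ _ hx hy => rw [lineSum_add, hx, hy, add_zero]
  | smul a x _ hx =>
    have : D.lineSum line i (a • x) = a * D.lineSum line i x := by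
      simp [lineSum, Finset.mul_sum]
    rw [this, hx, mul_zero]

/-! ## Single faults and edges -/

theorem resultsIn_iff (T : ℕ) (e : FaultPattern) (E : Edge) :
    D.ResultsIn T e E ↔ (D.effect T e).2.1 = D.boundary E ∧ match E with
      | .cross _ f => f ∈ D.flaggedFaces ∧
        ((D.effect T e).1 = E.error ∨ (D.effect T e).1 = E.error + errorOn (plaquette D.d f))
      | _ => (D.effect T e).1 = E.error := by
  have h : D.changed T e = D.ends E ↔ (D.effect T e).2.1 = D.boundary E := by
    have h2 : ∀ a : ZMod 2, ∀ P : Prop, [Decidable P] →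
        ((a ≠ 0 ↔ P) ↔ a = if P then 1 else 0) := by
      intro a P _
      by_cases hP : P
      · simp only [hP, iff_true, if_true]; revert a; decide
      · simp only [hP, iff_false, if_false, not_not]
    rw [Finset.ext_iff, funext_iff]
    exact forall_congr' fun v => by rw [mem_changed, h2, boundary]
  cases E <;> exact and_congr h Iff.rfl

theorem dataError_eq_zero {T : ℕ} {e : FaultPattern} {q : ℕ × ℕ} (hq : q ∉ D.lattice) :
    (D.effect T e).1 q = 0 := by
  rw [effect_data, dataError, if_neg hq]

/-- The changes telescope over the layers, and the last outcome, being noiseless, is the check value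
of the final data error. -/
theorem sum_changes (T : ℕ) (e : FaultPattern) {v : ℕ × ℕ} (hv : v ∈ D.checks) :
    ∑ t ∈ range (T + 1), (D.effect T e).2.1 (t, v) = D.checkValue (D.effect T e).1 v := by
  have h1 : ∀ n ≤ T, ∑ t ∈ range (n + 1), (D.effect T e).2.1 (t, v) =
      D.outcomes T (D.circuit.trajectory D.err e) n v := by
    intro n hn
    have h2 : ∀ t ≤ T, (D.effect T e).2.1 (t, v) =
        D.outcomes T (D.circuit.trajectory D.err e) t v -
          if t = 0 then 0 else D.outcomes T (D.circuit.trajectory D.err e) (t - 1) v := by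
      intro t ht
      have : (t, v) ∈ range (T + 1) ×ˢ D.checks := by simp [hv]; omega
      change D.changes T _ (t, v) = _
      rw [changes, if_pos this]
    induction n with
    | zero => simp [h2 0 hn]
    | succ n ih => rw [Finset.sum_range_succ, ih (by omega), h2 _ hn]; simp
  rw [h1 T le_rfl, outcomes, if_neg (lt_irrefl _)]
  rfl

section

variable {T : ℕ} {line : ℕ × ℕ → ℕ} {point : ℕ → ℕ × ℕ} {layer : ℕ → ℕ}
  (h : D.Tractable T line point layer)

theorem exists_joins_of_card {E : Edge} (hE : #(D.ends E) = 1 ∨ #(D.ends E) = 2) :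
    ∃ x y, D.Joins E x y := by
  rcases hE with hE | hE
  · obtain ⟨v, hv⟩ := Finset.card_eq_one.1 hE
    refine ⟨some v, none, by simp, ?_⟩
    rw [hv]
    ext a
    cases a <;> simp
  · obtain ⟨v, w, hvw, hv⟩ := Finset.card_eq_two.1 hE
    refine ⟨some v, some w, by simpa using hvw, ?_⟩
    rw [hv]
    ext a
    cases a <;> simp

theorem card_violated (t : ℕ) (x : DataError) :
    #(D.violated t x) = #{v ∈ D.checks | D.checkValue x v ≠ 0} :=
  Finset.card_image_of_injective _ fun a b hab => by simpa using hab

theorem ends_subset {E : Edge} (hE : D.SingleFault T fun e => D.ResultsIn T e E) :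
    D.ends E ⊆ range (T + 1) ×ˢ D.checks := by
  obtain ⟨l, -, a, -, hE⟩ := hE
  rw [← hE.1]
  exact Finset.filter_subset _ _

include h in
-- Space and cross edges have one or two ends by the geometry of the checks; diagonal and vertical
-- edges have two ends in different layers. An edge with a single end joins it to the boundary.
theorem exists_joins {E : Edge} (hE : D.SingleFault T fun e => D.ResultsIn T e E) :
    ∃ x y, D.Joins E x y := by
  obtain ⟨l, -, a, -, hE⟩ := hE
  apply exists_joins_of_card
  cases E with
  | space t q =>
    refine (card_violated t _).symm ▸ h.card_space q ?_
    -- An error on a point outside the lattice is not the data error of any fault.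
    by_contra hq
    have h1 : D.dataError T (Pi.single l a) = errorOn {q} := hE.2
    have h2 := congrFun h1 q
    simp [dataError, hq, errorOn] at h2
  | diag t q v w => right; exact Finset.card_pair (by simp)
  | vert t v => right; exact Finset.card_pair (by simp)
  | cross t f => exact (card_violated t _).symm ▸ h.card_cross f hE.2.1

include h in
theorem finite_isEdge (e : FaultPattern) : {E | D.IsEdge T e E}.Finite := by
  have hfin : ((fun x : ℕ × ℕ × ℕ => Edge.space x.1 x.2) '' ↑(range (T + 1) ×ˢ D.lattice) ∪
      (fun x : ℕ × (ℕ × ℕ) × (ℕ × ℕ) × ℕ × ℕ => Edge.diag x.1 x.2.1 x.2.2.1 x.2.2.2) ''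
        ↑(range (T + 1) ×ˢ D.lattice ×ˢ D.checks ×ˢ D.checks) ∪
      (fun x : ℕ × ℕ × ℕ => Edge.vert x.1 x.2) '' ↑(range (T + 1) ×ˢ D.checks) ∪
      (fun x : ℕ × ℕ × ℕ => Edge.cross x.1 x.2) '' ↑(range (T + 1) ×ˢ D.flaggedFaces)).Finite :=
    (((Set.toFinite _).union (Set.toFinite _)).union (Set.toFinite _)).union (Set.toFinite _)
  refine hfin.subset ?_
  rintro E ⟨hE, -⟩
  have hsub := ends_subset hE
  obtain ⟨x, y, hj⟩ := exists_joins h hE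
  obtain ⟨l, -, a, -, hE⟩ := hE
  -- A space or cross edge has at least one end, and this end bounds its layer.
  have hne : (D.ends E).Nonempty := by
    rw [Finset.nonempty_iff_ne_empty]
    intro h0
    have h1 := hj.2
    rw [h0, Finset.image_empty] at h1
    have h2 : ∀ z ∈ ({x, y} : Finset (Option Vertex)), z = none := by
      intro z hz
      by_contra hz'
      have := Finset.mem_erase.2 ⟨hz', hz⟩
      rw [← h1] at this
      simp at this
    exact hj.1 ((h2 x (by simp)).trans (h2 y (by simp)).symm)
  have hlat : ∀ q, D.dataError T (Pi.single l a) = errorOn {q} → q ∈ D.lattice := by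
    intro q hq
    by_contra hq'
    have h2 := congrFun hq q
    simp [dataError, hq', errorOn] at h2
  have hlay : ∀ t x, D.ends E = D.violated t x → t < T + 1 := by
    intro t x hx
    obtain ⟨u, hu⟩ := hne
    have h1 := hsub hu
    rw [hx, violated, Finset.mem_image] at hu
    obtain ⟨v, -, rfl⟩ := hu
    simpa using (Finset.mem_product.1 h1).1
  cases E with
  | space t q =>
    left; left; left
    exact ⟨(t, q), by simpa using ⟨Nat.le_of_lt_succ (hlay t _ rfl), hlat q hE.2⟩, rfl⟩
  | diag t q v w =>
    left; left; right
    have h1 : (t, v) ∈ range (T + 1) ×ˢ D.checks := hsub (by simp [ends])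
    have h2 : (t + 1, w) ∈ range (T + 1) ×ˢ D.checks := hsub (by simp [ends])
    simp only [mem_product, Finset.mem_range] at h1 h2
    exact ⟨(t, q, v, w), by simpa using ⟨Nat.le_of_lt_succ h1.1, hlat q hE.2, h1.2, h2.2⟩, rfl⟩
  | vert t v =>
    left; right
    have h1 : (t, v) ∈ range (T + 1) ×ˢ D.checks := hsub (by simp [ends])
    exact ⟨(t, v), by simpa using h1, rfl⟩
  | cross t f =>
    right
    exact ⟨(t, f), by simpa using ⟨Nat.le_of_lt_succ (hlay t _ rfl), hE.2.1⟩, rfl⟩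

theorem SingleEffect.singleFault {w : Effect} (hw : D.SingleEffect T w) {P : FaultPattern → Prop}
    (hP : ∀ e, D.effect T e = w → P e) : D.SingleFault T P := by
  obtain ⟨l, hl, a, ha, hw⟩ := hw
  exact ⟨l, hl, a, ha, hP _ hw⟩

theorem boundary_space (t : ℕ) (q : ℕ × ℕ) :
    D.boundary (.space t q) = D.syndrome t (errorOn {q}) := D.boundary_of_ends rfl

theorem boundary_cross (t : ℕ) (f : ℕ × ℕ) :
    D.boundary (.cross t f) = D.syndrome t (leftPair f) := D.boundary_of_ends rfl

theorem resultsIn_space {t : ℕ} {q : ℕ × ℕ} {e : FaultPattern}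
    (h1 : (D.effect T e).1 = errorOn {q})
    (h2 : (D.effect T e).2.1 = D.syndrome t (errorOn {q})) : D.ResultsIn T e (.space t q) := by
  rw [resultsIn_iff, boundary_space]
  exact ⟨h2, h1⟩

include h in
theorem singleFault_space {t : ℕ} (ht : t ≤ T) {q : ℕ × ℕ} (hq : q ∈ D.lattice) :
    D.SingleFault T fun e => D.ResultsIn T e (.space t q) :=
  (h.space t ht q hq).singleFault fun e he => resultsIn_space (by rw [he]) (by rw [he])

theorem mem_flags_of_single {φ : Flag} {e : FaultPattern}
    (he : (D.effect T e).2.2 = Pi.single φ 1) : φ ∈ D.flags T e := by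
  obtain ⟨t, f, σ⟩ := φ
  rw [mem_flags, he]
  cases σ <;> simp [Side.opposite]

include h in
theorem syndrome_eq_of_plaquette {f : ℕ × ℕ} (hf : f ∈ D.gens) (t : ℕ) :
    D.syndrome t (errorOn (plaquette D.d f)) = 0 := by
  funext v
  rw [syndrome]
  split_ifs with hv
  · exact h.checkValue_gen f hf _ hv.2
  · rfl

include h in
theorem inBoomerang_corner {t : ℕ} (ht : t < T) {f : ℕ × ℕ} (hf : f ∈ D.flaggedFaces)
    (σ : Side) : D.InBoomerang T (t, f, σ) (.space (layer t) (Problem.corner f σ)) :=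
  (h.corner t ht f hf σ).singleFault fun e he =>
    ⟨mem_flags_of_single (by rw [he]), resultsIn_space (by rw [he]) (by rw [he])⟩

theorem add_self (x : DataError) : x + x = 0 := by
  funext q; exact CharTwo.add_self_eq_zero _

theorem leftPair_add_plaquette {f : ℕ × ℕ} (hf : f ∈ D.flaggedFaces) :
    leftPair f + errorOn (plaquette D.d f) = rightPair f := by
  rw [errorOn_plaquette hf, leftPair_eq, rightPair_eq]
  calc _ = (errorOn {f} + errorOn {f}) +
        (errorOn {(f.1 + 1, f.2)} + errorOn {(f.1 + 1, f.2)}) +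
        (errorOn {(f.1, f.2 + 1)} + errorOn {(f.1 + 1, f.2 + 1)}) := by abel
    _ = _ := by rw [add_self, add_self, add_zero, zero_add]

theorem gens_of_flagged {f : ℕ × ℕ} (hf : f ∈ D.flaggedFaces) : f ∈ D.gens :=
  (Finset.mem_filter.1 hf).1

include h in
-- The two pairs differ by the generator on the face, which no check sees. This is why one cross
-- edge can stand for both.
theorem syndrome_rightPair {f : ℕ × ℕ} (hf : f ∈ D.flaggedFaces) (t : ℕ) :
    D.syndrome t (rightPair f) = D.syndrome t (leftPair f) := by
  rw [← leftPair_add_plaquette hf, syndrome_add,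
    syndrome_eq_of_plaquette h (gens_of_flagged hf), add_zero]

include h in
theorem inBoomerang_cross {t : ℕ} (ht : t < T) {f : ℕ × ℕ} (hf : f ∈ D.flaggedFaces)
    (σ : Side) : D.InBoomerang T (t, f, σ) (.cross (layer t) f) := by
  obtain ⟨x, hx, hs⟩ := h.pair t ht f hf σ
  refine hs.singleFault fun e he => ⟨mem_flags_of_single (by rw [he]), ?_⟩
  rw [resultsIn_iff, boundary_cross, he]
  rcases hx with rfl | rfl
  · exact ⟨rfl, hf, .inl rfl⟩
  · exact ⟨syndrome_rightPair h hf _, hf, .inr (leftPair_add_plaquette hf).symm⟩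

/-- The lines which meet the face `f`. -/
def faceLines (line : ℕ × ℕ → ℕ) (f : ℕ × ℕ) : Finset ℕ := {line f, line (f.1 + 1, f.2 + 1)}

theorem corner_mem_lattice {f : ℕ × ℕ} (hf : f ∈ D.flaggedFaces) :
    f ∈ D.lattice ∧ (f.1, f.2 + 1) ∈ D.lattice ∧ (f.1 + 1, f.2) ∈ D.lattice ∧
      (f.1 + 1, f.2 + 1) ∈ D.lattice := by
  obtain ⟨i, j⟩ := f
  simp only [flaggedFaces, bulk, mem_filter, mem_product, mem_Icc] at hf
  simp only [lattice, mem_product, mem_Icc]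
  omega

include h in
theorem lineSum_corners {f : ℕ × ℕ} (hf : f ∈ D.flaggedFaces) {i : ℕ}
    (hi : i ∉ faceLines line f) : D.lineSum line i (errorOn {f}) = 0 ∧
      D.lineSum line i (errorOn {(f.1, f.2 + 1)}) = 0 ∧
      D.lineSum line i (errorOn {(f.1 + 1, f.2)}) = 0 ∧
      D.lineSum line i (errorOn {(f.1 + 1, f.2 + 1)}) = 0 := by
  obtain ⟨h1, h2, h3, h4⟩ := corner_mem_lattice hf
  rw [lineSum_errorOn h1, lineSum_errorOn h2, lineSum_errorOn h3, lineSum_errorOn h4]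
  rcases h.line_eq with rfl | rfl <;>
  · simp only [faceLines, Finset.mem_insert, Finset.mem_singleton, not_or] at hi
    obtain ⟨h1, h2⟩ := hi
    simp [Ne.symm h1, Ne.symm h2]

include h in
-- A single fault that flips the flag has its data error on corners of the face, and these lie on
-- two lines.
theorem InBoomerang.lineSum_eq_zero {φ : Flag} {E : Edge} (hE : D.InBoomerang T φ E) {i : ℕ}
    (hi : i ∉ faceLines line φ.2.1) : D.lineSum line i E.error = 0 := by
  obtain ⟨l, hl, a, ha, hφ, hE⟩ := hE
  have key : D.lineSum line i (D.effect T (Pi.single l a)).1 = 0 := by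
    rw [mem_flags] at hφ
    have hel := h.elementary l hl a ha
    obtain ⟨hφ, -⟩ := hφ
    generalize D.effect T (Pi.single l a) = w at hel hφ
    cases hel with
    | neutral => simp at hφ
    | space => simp at hφ
    | diag => simp at hφ
    | vert => simp at hφ
    | both => simp
    | @one t f σ x ht hf hx =>
      change (Pi.single (t, f, σ) 1 : Flag → ZMod 2) φ ≠ 0 at hφ
      rw [Pi.single_apply] at hφ
      have hφ' : φ = (t, f, σ) := by by_contra hc; simp [hc] at hφ
      subst hφ'
      obtain ⟨h1, h2, h3, h4⟩ := lineSum_corners h hf hi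
      rcases hx with rfl | rfl | rfl | rfl
      · simp
      · cases σ
        exacts [h3, h2]
      · rw [leftPair_eq, lineSum_add, h1, h3, add_zero]
      · rw [rightPair_eq, lineSum_add, h2, h4, add_zero]
  rw [resultsIn_iff] at hE
  cases E with
  | space t q => rw [← hE.2, key]
  | diag t q v w => rw [← hE.2, key]
  | vert t v => rw [← hE.2, key]
  | cross t f =>
    obtain ⟨-, hf, hE | hE⟩ := hE
    · rw [← hE, key]
    -- The fault may have led to the right pair; the plaquette by which it differs from the left one
    -- has even weight on every line.
    · rw [hE, lineSum_add, h.lineSum_gen f (gens_of_flagged hf), add_zero] at key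
      exact key

end

end Problem

namespace Problem

variable {D : Problem} {T : ℕ} {e : FaultPattern}

/-! ## Chains of edges -/

/-- The vector `z` is the boundary of a set of edges of cost at most `n`. -/
def Chain (D : Problem) (T : ℕ) (e : FaultPattern) (z : Vertex → ZMod 2) (n : ℕ) : Prop :=
  ∃ C : Finset Edge, (∀ E ∈ C, D.IsEdge T e E) ∧ (∀ v, ∑ E ∈ C, D.boundary E v = z v) ∧
    ∑ E ∈ C, D.edgeCost T e E ≤ n

theorem Chain.zero (n : ℕ) : D.Chain T e 0 n := ⟨∅, by simp⟩

theorem Chain.mono {z : Vertex → ZMod 2} {n n' : ℕ} (h : D.Chain T e z n) (hn : n ≤ n') :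
    D.Chain T e z n' := by
  obtain ⟨C, h1, h2, h3⟩ := h
  exact ⟨C, h1, h2, h3.trans hn⟩

theorem Chain.of_edge {E : Edge} (hE : D.IsEdge T e E) :
    D.Chain T e (D.boundary E) (D.edgeCost T e E) :=
  ⟨{E}, by simpa using hE, by simp, by simp⟩

/-- Edges common to both sets cancel modulo two. So the symmetric difference has the sum as its
boundary, and it costs no more than the two sets together. -/
theorem Chain.add {z z' : Vertex → ZMod 2} {n n' : ℕ} (h : D.Chain T e z n)
    (h' : D.Chain T e z' n') : D.Chain T e (z + z') (n + n') := by
  classical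
  obtain ⟨C, h1, h2, h3⟩ := h
  obtain ⟨C', h1', h2', h3'⟩ := h'
  have hd : Disjoint (C \ C') (C' \ C) := by
    rw [Finset.disjoint_left]
    intro a ha hb
    simp only [Finset.mem_sdiff] at ha hb
    exact ha.2 hb.1
  refine ⟨C \ C' ∪ C' \ C, ?_, ?_, ?_⟩
  · intro E hE
    simp only [Finset.mem_union, Finset.mem_sdiff] at hE
    exact hE.elim (fun h => h1 E h.1) fun h => h1' E h.1
  · intro v
    rw [Finset.sum_union hd, Pi.add_apply, ← h2, ← h2',
      ← Finset.sum_inter_add_sum_sdiff C C', ← Finset.sum_inter_add_sum_sdiff C' C,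
      Finset.inter_comm C' C]
    generalize ∑ E ∈ C ∩ C', D.boundary E v = a
    generalize ∑ E ∈ C \ C', D.boundary E v = b
    generalize ∑ E ∈ C' \ C, D.boundary E v = c
    revert a b c
    decide
  · rw [Finset.sum_union hd]
    exact add_le_add ((Finset.sum_le_sum_of_subset Finset.sdiff_subset).trans h3)
      ((Finset.sum_le_sum_of_subset Finset.sdiff_subset).trans h3')

/-- Here `z₁`, `z₂`, `z₃` are the syndromes of the upper left, upper right and lower left corners of
a face; the fourth corner has their sum, as the plaquette has syndrome zero. So any error on the
corners is equivalent to one on at most two of them, of cost `2 (m + 1)`. If the cross edge (`z₁ +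
z₃`) and the distinguished corner of the flag (`z₃` or `z₂`) have cost `1`, then every case is
covered by an edge of cost `1`, an ordinary edge, or one of each. -/
theorem Chain.corners {z₁ z₂ z₃ : Vertex → ZMod 2} {m : ℕ}
    (h₁ : D.Chain T e z₁ (m + 1)) (h₂ : D.Chain T e z₂ (m + 1)) (h₃ : D.Chain T e z₃ (m + 1))
    (h₄ : D.Chain T e (z₁ + z₂ + z₃) (m + 1)) (a b c d : ZMod 2) :
    D.Chain T e (a • z₁ + b • z₂ + c • z₃ + d • (z₁ + z₂ + z₃)) (2 * (m + 1)) ∧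
    (D.Chain T e (z₁ + z₃) 1 → D.Chain T e z₃ 1 ∨ D.Chain T e z₂ 1 →
      D.Chain T e (a • z₁ + b • z₂ + c • z₃ + d • (z₁ + z₂ + z₃)) (m + 2)) := by
  have hred : a • z₁ + b • z₂ + c • z₃ + d • (z₁ + z₂ + z₃) =
      (a + d) • z₁ + (b + d) • z₂ + (c + d) • z₃ := by module
  rw [hred]
  have h01 : ∀ a : ZMod 2, a = 0 ∨ a = 1 := by decide
  -- The error on the two upper corners is equivalent to that on the two lower ones, which contain
  -- the distinguished corner of a left flag.
  have e12 : z₁ + z₂ = z₃ + (z₁ + z₂ + z₃) := by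
    funext v
    simp only [Pi.add_apply]
    generalize z₁ v = a
    generalize z₂ v = b
    generalize z₃ v = c
    revert a b c
    decide
  rcases h01 (a + d) with ha | ha <;> rcases h01 (b + d) with hb | hb <;>
    rcases h01 (c + d) with hc | hc <;> rw [ha, hb, hc] <;>
    simp only [one_smul, zero_smul, add_zero, zero_add]
  · exact ⟨.zero _, fun _ _ => .zero _⟩
  · exact ⟨h₃.mono (by omega), fun _ _ => h₃.mono (by omega)⟩
  · exact ⟨h₂.mono (by omega), fun _ _ => h₂.mono (by omega)⟩
  · refine ⟨(h₂.add h₃).mono (by omega), fun _ h => ?_⟩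
    rcases h with h | h
    · exact (h₂.add h).mono (by omega)
    · exact (h.add h₃).mono (by omega)
  · exact ⟨h₁.mono (by omega), fun _ _ => h₁.mono (by omega)⟩
  · exact ⟨(h₁.add h₃).mono (by omega), fun h _ => h.mono (by omega)⟩
  · refine ⟨(h₁.add h₂).mono (by omega), fun _ h => ?_⟩
    rcases h with h | h
    · rw [e12]
      exact (h.add h₄).mono (by omega)
    · exact (h₁.add h).mono (by omega)
  · exact ⟨h₄.mono (by omega), fun _ _ => h₄.mono (by omega)⟩

/-- The lines outside `R` on which an error has odd weight. -/
def outerLines (D : Problem) (line : ℕ × ℕ → ℕ) (R : Finset ℕ) (x : DataError) : Finset ℕ :=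
  {i ∈ Icc 1 D.d | D.lineSum line i x ≠ 0 ∧ i ∉ R}

theorem card_outerLines_add (line : ℕ × ℕ → ℕ) (R : Finset ℕ) (x y : DataError) :
    #(D.outerLines line R (x + y)) ≤ #(D.outerLines line R x) + #(D.outerLines line R y) := by
  refine le_trans (Finset.card_le_card ?_) (Finset.card_union_le _ _)
  intro i hi
  simp only [outerLines, mem_filter, mem_union, lineSum_add] at hi ⊢
  obtain ⟨h1, h2, h3⟩ := hi
  by_cases hx : D.lineSum line i x = 0
  · exact .inr ⟨h1, by simpa [hx] using h2, h3⟩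
  · exact .inl ⟨h1, hx, h3⟩

theorem outerLines_eq_empty {line : ℕ × ℕ → ℕ} {R : Finset ℕ} {x : DataError}
    (h : ∀ i ∉ R, D.lineSum line i x = 0) : D.outerLines line R x = ∅ := by
  refine Finset.filter_eq_empty_iff.2 fun i _ hi => hi.1 (h i hi.2)

theorem card_outerLines_errorOn (line : ℕ × ℕ → ℕ) (R : Finset ℕ) (q : ℕ × ℕ) :
    #(D.outerLines line R (errorOn {q})) ≤ 1 := by
  rw [← Finset.card_singleton (line q)]
  refine Finset.card_le_card fun i hi => ?_
  simp only [outerLines, mem_filter] at hi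
  by_contra hne
  refine hi.2.1 (Finset.sum_eq_zero fun q' hq' => ?_)
  have : q' ≠ q := by
    rintro rfl
    simp only [mem_filter] at hq'
    exact hne (by simp [hq'.2])
  simp [errorOn, this]

/-- Part of the effect of a set of faults: the changes are the boundary of a chain of cost at most
`n`, and the data error crosses at most `k` lines outside `R`. -/
def Piece (D : Problem) (T : ℕ) (e : FaultPattern) (line : ℕ × ℕ → ℕ) (R : Finset ℕ)
    (w : Effect) (n k : ℕ) : Prop :=
  D.Chain T e w.2.1 n ∧ #(D.outerLines line R w.1) ≤ k

theorem Piece.sum {ι : Type*} {line : ℕ × ℕ → ℕ} {R : Finset ℕ} (s : Finset ι) (w : ι → Effect)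
    (n k : ι → ℕ) (h : ∀ i ∈ s, D.Piece T e line R (w i) (n i) (k i)) :
    D.Piece T e line R (∑ i ∈ s, w i) (∑ i ∈ s, n i) (∑ i ∈ s, k i) := by
  classical
  induction s using Finset.induction_on with
  | empty => exact ⟨.zero _, by rw [outerLines_eq_empty] <;> simp⟩
  | insert i s hi ih =>
    rw [Finset.sum_insert hi, Finset.sum_insert hi, Finset.sum_insert hi]
    have h1 := h i (by simp)
    have h2 := ih fun j hj => h j (by simp [hj])
    exact ⟨h1.1.add h2.1, (card_outerLines_add _ _ _ _).trans (add_le_add h1.2 h2.2)⟩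

/-! ## The faults of one measurement -/

/-- The effect of a single fault that flips one or two flags of the face `f` in round `t`. -/
def FaceElementary (D : Problem) (layer : ℕ → ℕ) (t : ℕ) (f : ℕ × ℕ) (w : Effect) : Prop :=
  w = (0, 0, Pi.single (t, f, .left) 1 + Pi.single (t, f, .right) 1) ∨
  ∃ σ x, (x = 0 ∨ x = errorOn {corner f σ} ∨ x = leftPair f ∨ x = rightPair f) ∧
    w = (x, D.syndrome (layer t) x, Pi.single (t, f, σ) 1)

/-- An effect with the data error on the corners of the face `f`. -/
def FaceSpan (D : Problem) (layer : ℕ → ℕ) (t : ℕ) (f : ℕ × ℕ) (w : Effect) : Prop :=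
  (∃ a b c d : ZMod 2, w.1 = a • errorOn {f} + b • errorOn {(f.1, f.2 + 1)} +
    c • errorOn {(f.1 + 1, f.2)} + d • errorOn {(f.1 + 1, f.2 + 1)}) ∧
  w.2.1 = D.syndrome (layer t) w.1

section

variable {layer : ℕ → ℕ} {t : ℕ} {f : ℕ × ℕ} {w w' : Effect}

theorem FaceSpan.add (h : D.FaceSpan layer t f w) (h' : D.FaceSpan layer t f w') :
    D.FaceSpan layer t f (w + w') := by
  obtain ⟨⟨a, b, c, d, h1⟩, h2⟩ := h
  obtain ⟨⟨a', b', c', d', h1'⟩, h2'⟩ := h'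
  refine ⟨⟨a + a', b + b', c + c', d + d', ?_⟩, ?_⟩
  · rw [Prod.fst_add, h1, h1']; module
  · rw [Prod.snd_add, Prod.fst_add, Prod.fst_add, h2, h2', syndrome_add]

theorem FaceSpan.sum {ι : Type*} {s : Finset ι} {w : ι → Effect}
    (h : ∀ i ∈ s, D.FaceSpan layer t f (w i)) : D.FaceSpan layer t f (∑ i ∈ s, w i) :=
  Finset.sum_induction w _ (fun _ _ => FaceSpan.add)
    ⟨⟨0, 0, 0, 0, by simp⟩, by simp⟩ h

theorem FaceElementary.span (h : D.FaceElementary layer t f w) : D.FaceSpan layer t f w := by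
  rcases h with rfl | ⟨σ, x, hx, rfl⟩
  · exact ⟨⟨0, 0, 0, 0, by simp⟩, by simp⟩
  · refine ⟨?_, rfl⟩
    rcases hx with rfl | rfl | rfl | rfl
    · exact ⟨0, 0, 0, 0, by simp⟩
    · cases σ
      · exact ⟨0, 0, 1, 0, by simp [corner]⟩
      · exact ⟨0, 1, 0, 0, by simp [corner]⟩
    · exact ⟨1, 0, 1, 0, by simp [leftPair_eq]⟩
    · exact ⟨0, 1, 0, 1, by simp [rightPair_eq]⟩

theorem FaceElementary.flag_eq_zero (h : D.FaceElementary layer t f w) {φ : Flag}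
    (hφ : (φ.1, φ.2.1) ≠ (t, f)) : w.2.2 φ = 0 := by
  have h1 : ∀ σ, φ ≠ (t, f, σ) := by rintro σ rfl; exact hφ rfl
  rcases h with rfl | ⟨σ, x, hx, rfl⟩
  · simp [h1]
  · change (Pi.single (t, f, σ) 1 : Flag → ZMod 2) φ = 0
    simp [h1]

end

section

variable {line : ℕ × ℕ → ℕ} {point : ℕ → ℕ × ℕ} {layer : ℕ → ℕ}
  (h : D.Tractable T line point layer)

theorem isEdge_of_inBoomerang {φ : Flag} (hφ : φ ∈ D.flags T e) {E : Edge}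
    (hE : D.InBoomerang T φ E) : D.Highlighted T e E ∧ D.IsEdge T e E := by
  have hH : D.Highlighted T e E := ⟨φ, hφ, hE⟩
  obtain ⟨l, hl, a, ha, -, hE⟩ := hE
  exact ⟨hH, ⟨l, hl, a, ha, hE⟩, fun _ => hH⟩

theorem chain_of_inBoomerang {φ : Flag} (hφ : φ ∈ D.flags T e) {E : Edge}
    (hE : D.InBoomerang T φ E) : D.Chain T e (D.boundary E) 1 := by
  obtain ⟨h1, h2⟩ := isEdge_of_inBoomerang hφ hE
  refine (Chain.of_edge h2).mono ?_
  rw [edgeCost, if_pos h1]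

theorem chain_of_singleFault {E : Edge} (hE : D.SingleFault T fun e' => D.ResultsIn T e' E)
    (hc : ∀ t f, E ≠ .cross t f) : D.Chain T e (D.boundary E) (#(D.flags T e) + 1) := by
  have : D.IsEdge T e E := ⟨hE, fun ⟨t, f, hE⟩ => absurd hE (hc t f)⟩
  refine (Chain.of_edge this).mono ?_
  rw [edgeCost]
  split_ifs <;> omega

include h in
theorem chain_space {t : ℕ} (ht : t ≤ T) {q : ℕ × ℕ} (hq : q ∈ D.lattice) :
    D.Chain T e (D.syndrome t (errorOn {q})) (#(D.flags T e) + 1) := by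
  rw [← boundary_space]
  exact chain_of_singleFault (singleFault_space h ht hq) (by simp)

/-- The lines through the faces with a flag. -/
noncomputable def flagLines (D : Problem) (T : ℕ) (e : FaultPattern) (line : ℕ × ℕ → ℕ) : Finset ℕ :=
  (D.flags T e).biUnion fun φ => faceLines line φ.2.1

theorem card_flagLines_le : #(D.flagLines T e line) ≤ 2 * #(D.flags T e) := by
  rw [mul_comm]
  exact Finset.card_biUnion_le_card_mul _ _ _ fun φ _ => Finset.card_le_two

theorem syndrome_smul (t : ℕ) (a : ZMod 2) (x : DataError) :
    D.syndrome t (a • x) = a • D.syndrome t x := by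
  funext v
  simp only [syndrome, checkValue, Pi.smul_apply, smul_eq_mul]
  split_ifs
  · rw [Finset.mul_sum]
  · rw [mul_zero]

theorem lineSum_smul (line : ℕ × ℕ → ℕ) (i : ℕ) (a : ZMod 2) (x : DataError) :
    D.lineSum line i (a • x) = a * D.lineSum line i x := by
  simp [lineSum, Finset.mul_sum]

include h in
theorem FaceSpan.lineSum_eq_zero {t : ℕ} {f : ℕ × ℕ} (hf : f ∈ D.flaggedFaces) {w : Effect}
    (hw : D.FaceSpan layer t f w) {i : ℕ} (hi : i ∉ faceLines line f) :
    D.lineSum line i w.1 = 0 := by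
  obtain ⟨⟨a, b, c, d, h1⟩, -⟩ := hw
  obtain ⟨g1, g2, g3, g4⟩ := lineSum_corners h hf hi
  simp [h1, lineSum_add, lineSum_smul, g1, g2, g3, g4]

include h in
-- However many faults occur in one measurement, their sum is an error on the corners of the face.
-- The costs come from `Chain.corners`; a flag at this face makes its cross edge and one corner
-- cheap and puts its two lines into `flagLines`.
theorem FaceSpan.piece {t : ℕ} (ht : t < T) {f : ℕ × ℕ} (hf : f ∈ D.flaggedFaces) {w : Effect}
    (hw : D.FaceSpan layer t f w) (R : Finset ℕ) :
    D.Piece T e line R w (2 * (#(D.flags T e) + 1)) 2 ∧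
    ∀ σ, (t, f, σ) ∈ D.flags T e →
      D.Piece T e line (D.flagLines T e line) w (#(D.flags T e) + 2) 0 := by
  have hchain : D.Chain T e w.2.1 (2 * (#(D.flags T e) + 1)) ∧
      ∀ σ, (t, f, σ) ∈ D.flags T e → D.Chain T e w.2.1 (#(D.flags T e) + 2) := by
    obtain ⟨⟨a, b, c, d, h1⟩, h2⟩ := hw
    obtain ⟨l1, l2, l3, l4⟩ := corner_mem_lattice hf
    have hl := h.layer_le t ht
    set y := D.syndrome (layer t)
    have hp : y (errorOn {(f.1 + 1, f.2 + 1)}) =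
        y (errorOn {f}) + y (errorOn {(f.1, f.2 + 1)}) + y (errorOn {(f.1 + 1, f.2)}) := by
      have := syndrome_eq_of_plaquette h (gens_of_flagged hf) (layer t)
      rw [errorOn_plaquette hf, syndrome_add, syndrome_add, syndrome_add] at this
      have h2 : ∀ a b c d : ZMod 2, a + (b + (c + d)) = 0 → d = a + b + c := by decide
      funext v
      exact h2 _ _ _ _ (congrFun this v)
    have hw2 : w.2.1 = a • y (errorOn {f}) + b • y (errorOn {(f.1, f.2 + 1)}) +
        c • y (errorOn {(f.1 + 1, f.2)}) + d • (y (errorOn {f}) +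
          y (errorOn {(f.1, f.2 + 1)}) + y (errorOn {(f.1 + 1, f.2)})) := by
      rw [← hp, h2, h1]
      simp only [syndrome_add, syndrome_smul, y]
    have key := Chain.corners (D := D) (T := T) (e := e) (chain_space h hl l1)
      (chain_space h hl l2) (chain_space h hl l3) (hp ▸ chain_space h hl l4) a b c d
    rw [hw2]
    refine ⟨key.1, fun σ hσ => key.2 ?_ ?_⟩
    · have := chain_of_inBoomerang hσ (inBoomerang_cross h ht hf σ)
      rwa [boundary_cross, leftPair_eq, syndrome_add] at this
    · have := chain_of_inBoomerang hσ (inBoomerang_corner h ht hf σ)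
      rw [boundary_space] at this
      cases σ
      · exact .inl this
      · exact .inr this
  refine ⟨⟨hchain.1, ?_⟩, fun σ hσ => ⟨hchain.2 σ hσ, ?_⟩⟩
  · refine le_trans (Finset.card_le_card ?_) (Finset.card_le_two (a := line f)
      (b := line (f.1 + 1, f.2 + 1)))
    intro i hi
    simp only [outerLines, mem_filter] at hi
    by_contra hi'
    exact hi.2.1 (hw.lineSum_eq_zero h hf hi')
  · rw [outerLines_eq_empty, Finset.card_empty]
    intro i hi
    refine hw.lineSum_eq_zero h hf fun hi' => hi ?_
    exact Finset.mem_biUnion.2 ⟨_, hσ, hi'⟩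

include h in
/-- A single fault that causes exactly one flag results in an edge in the boomerang. -/
theorem FaceElementary.piece_of_flag {t : ℕ} (ht : t < T) {f : ℕ × ℕ} (hf : f ∈ D.flaggedFaces)
    {w : Effect} (hw : D.FaceElementary layer t f w) {σ : Side} (hσ : (t, f, σ) ∈ D.flags T e)
    (h1 : w.2.2 (t, f, σ) ≠ 0) (h2 : w.2.2 (t, f, σ.opposite) = 0) :
    D.Piece T e line (D.flagLines T e line) w 1 0 := by
  refine ⟨?_, ((hw.span.piece h ht hf ∅).2 σ hσ).2⟩
  rcases hw with rfl | ⟨σ', x, hx, rfl⟩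
  · cases σ <;> simp [Side.opposite] at h2
  · have : σ = σ' := by
      by_contra hne
      change (Pi.single (t, f, σ') 1 : Flag → ZMod 2) (t, f, σ) ≠ 0 at h1
      simp [hne] at h1
    subst this
    rcases hx with rfl | rfl | rfl | rfl
    · simpa using Chain.zero 1
    · have := chain_of_inBoomerang hσ (inBoomerang_corner h ht hf σ)
      rwa [boundary_space] at this
    · have := chain_of_inBoomerang hσ (inBoomerang_cross h ht hf σ)
      rwa [boundary_cross] at this
    · have := chain_of_inBoomerang hσ (inBoomerang_cross h ht hf σ)
      rw [boundary_cross] at this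
      rwa [syndrome_rightPair h hf]

/-- A fault of this kind without an isolated flag flips both flags, and then it leaves no error on
the data. -/
theorem FaceElementary.piece_of_no_flag {t : ℕ} {f : ℕ × ℕ} {w : Effect}
    (hw : D.FaceElementary layer t f w)
    (h1 : ∀ σ, w.2.2 (t, f, σ) ≠ 0 → w.2.2 (t, f, σ.opposite) ≠ 0) (R : Finset ℕ) :
    D.Piece T e line R w 0 0 := by
  rcases hw with rfl | ⟨σ, x, hx, rfl⟩
  · exact ⟨.zero 0, by rw [outerLines_eq_empty] <;> simp⟩
  · have := h1 σ
    change (Pi.single (t, f, σ) 1 : Flag → ZMod 2) (t, f, σ) ≠ 0 →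
      (Pi.single (t, f, σ) 1 : Flag → ZMod 2) (t, f, σ.opposite) ≠ 0 at this
    cases σ <;> simp [Side.opposite] at this

include h in
/-- A single fault without flag results in an edge, or does nothing. -/
theorem Elementary.cases_flag {w : Effect} (hw : D.Elementary T layer w)
    (hs : D.SingleEffect T w) (R : Finset ℕ) :
    (w.2.2 = 0 ∧ D.Piece T e line R w (#(D.flags T e) + 1) 1) ∨
    ∃ t < T, ∃ f ∈ D.flaggedFaces, D.FaceElementary layer t f w := by
  cases hw with
  | neutral hx =>
    refine .inl ⟨rfl, .zero _, ?_⟩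
    rw [outerLines_eq_empty fun i _ => lineSum_eq_zero_of_trivial h hx i]
    simp
  | space ht hq => exact .inl ⟨rfl, chain_space h ht hq, card_outerLines_errorOn _ _ _⟩
  | @diag t q v w hq =>
    refine .inl ⟨rfl, chain_of_singleFault (hs.singleFault fun e he => ?_) (by simp),
      card_outerLines_errorOn _ _ _⟩
    rw [resultsIn_iff, he]
    exact ⟨rfl, rfl⟩
  | @vert t v =>
    refine .inl ⟨rfl, chain_of_singleFault (hs.singleFault fun e he => ?_) (by simp),
      by rw [outerLines_eq_empty] <;> simp⟩
    rw [resultsIn_iff, he]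
    exact ⟨rfl, rfl⟩
  | both ht hf => exact .inr ⟨_, ht, _, hf, .inl rfl⟩
  | one ht hf hx => exact .inr ⟨_, ht, _, hf, .inr ⟨_, _, hx, rfl⟩⟩

/-! ### The cost of a fault pattern with a given number of flags -/

open Classical in
include h in
/-- The changes caused by `k` faults with `m` flags are the boundary of a chain of cost at most
`k (m + 1) - m ^ 2`, and outside the flagged faces the data error crosses at most `k - m` lines. -/
theorem exists_piece (he : D.circuit.IsFaultPattern T e) :
    ∃ n k, D.Piece T e line (D.flagLines T e line) (D.effect T e) n k ∧
      n + #(D.flags T e) * #(D.flags T e) ≤ D.circuit.faultCount T e * (#(D.flags T e) + 1) ∧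
      k + #(D.flags T e) ≤ D.circuit.faultCount T e := by
  set m := #(D.flags T e) with hm
  set R := D.flagLines T e line
  set F := D.faultLocations T e with hF
  set w : Location → Effect := fun l => D.effect T (Pi.single l (e l)) with hw
  have hcount : D.circuit.faultCount T e = #F := rfl
  have hsum : D.effect T e = ∑ l ∈ F, w l := D.effect_eq_sum he
  -- The label `κ` of a fault is the round and the face whose flags it flips, or `none` if it flips
  -- no flag.
  have hspec : ∀ l, ∃ κ : Option (ℕ × ℕ × ℕ), l ∈ F →
      (κ = none ∧ (w l).2.2 = 0 ∧ D.Piece T e line R (w l) (m + 1) 1) ∨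
      ∃ t f, κ = some (t, f) ∧ t < T ∧ f ∈ D.flaggedFaces ∧ D.FaceElementary layer t f (w l) := by
    intro l
    by_cases hl : l ∈ F
    · have hl' := Finset.mem_filter.1 hl
      have ha := ((he l).resolve_left hl'.2).2
      rcases (h.elementary l hl'.1 _ ha).cases_flag (e := e) h ⟨l, hl'.1, _, ha, rfl⟩ R with
        h1 | ⟨t, ht, f, hf, h1⟩
      · exact ⟨none, fun _ => .inl ⟨rfl, h1⟩⟩
      · exact ⟨some (t, f), fun _ => .inr ⟨t, f, rfl, ht, hf, h1⟩⟩
    · exact ⟨none, fun h' => absurd h' hl⟩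
  choose κ hκ using hspec
  have hface : ∀ l ∈ F, ∀ t f, κ l = some (t, f) →
      t < T ∧ f ∈ D.flaggedFaces ∧ D.FaceElementary layer t f (w l) := by
    intro l hl t f hk
    rcases hκ l hl with ⟨h1, -⟩ | ⟨t', f', h1, h2⟩
    · rw [hk] at h1; cases h1
    · rw [hk, Option.some_inj, Prod.mk.injEq] at h1
      obtain ⟨rfl, rfl⟩ := h1
      exact h2
  -- The flags of one measurement depend only on the faults with its label.
  have hflag : ∀ t f σ, (D.effect T e).2.2 (t, f, σ) =
      (∑ l ∈ F with κ l = some (t, f), w l).2.2 (t, f, σ) := by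
    intro t f σ
    have hs : ∀ s : Finset Location,
        (∑ l ∈ s, w l).2.2 (t, f, σ) = ∑ l ∈ s, (w l).2.2 (t, f, σ) := by
      intro s
      rw [Prod.snd_sum, Prod.snd_sum, Finset.sum_apply]
    rw [hsum, hs, hs, Finset.sum_filter]
    refine Finset.sum_congr rfl fun l hl => ?_
    split_ifs with hk
    · rfl
    · rcases hκ l hl with ⟨-, h1, -⟩ | ⟨t', f', h1, -, -, h2⟩
      · rw [h1]; rfl
      · refine h2.flag_eq_zero fun h3 => hk ?_
        rw [h1, ← h3]
  set Γ : Finset (Option (ℕ × ℕ × ℕ)) := (D.flags T e).image fun φ => some (φ.1, φ.2.1) with hΓ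
  -- If both flags of a measurement are flipped, neither counts; so distinct flags belong to
  -- distinct measurements.
  have hΓm : #Γ = m := by
    refine Finset.card_image_of_injOn ?_
    rintro ⟨t, f, σ⟩ hφ ⟨t', f', σ'⟩ hφ' heq
    simp only [Option.some_inj, Prod.mk.injEq] at heq
    obtain ⟨rfl, rfl⟩ := heq
    rw [Finset.mem_coe, mem_flags] at hφ hφ'
    cases σ <;> cases σ' <;> simp_all [Side.opposite]
  have hΓF : Γ ⊆ F.image κ := by
    intro γ hγ
    obtain ⟨⟨t, f, σ⟩, hφ, rfl⟩ := Finset.mem_image.1 hγ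
    rw [mem_flags] at hφ
    by_contra hne
    refine hφ.1 ?_
    rw [hflag, Finset.filter_eq_empty_iff.2, Finset.sum_empty]
    · rfl
    · intro l hl hk
      exact hne (Finset.mem_image.2 ⟨l, hl, hk⟩)
  -- The account of one group of `c` faults: its cost is at most `c (m + 1)` and it crosses at most
  -- `c` outer lines; if the group causes a flag, the cost is smaller by `m` and the number of lines
  -- by `1`. Summed over the groups this gives the claim, since exactly `m` of them cause a flag.
  have hgroup : ∀ γ, ∃ n k, γ ∈ F.image κ →
      D.Piece T e line R (∑ l ∈ F with κ l = γ, w l) n k ∧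
      n + m * (if γ ∈ Γ then 1 else 0) ≤ #{l ∈ F | κ l = γ} * (m + 1) ∧
      k + (if γ ∈ Γ then 1 else 0) ≤ #{l ∈ F | κ l = γ} := by
    intro γ
    by_cases hγ : γ ∈ F.image κ
    swap
    · exact ⟨0, 0, fun h' => absurd h' hγ⟩
    have hpos : 0 < #{l ∈ F | κ l = γ} := by
      obtain ⟨l, hl, hk⟩ := Finset.mem_image.1 hγ
      exact Finset.card_pos.2 ⟨l, Finset.mem_filter.2 ⟨hl, hk⟩⟩
    rcases γ with _ | ⟨t, f⟩
    · have hn : (none : Option (ℕ × ℕ × ℕ)) ∉ Γ := by simp [hΓ]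
      refine ⟨∑ l ∈ F with κ l = none, (m + 1), ∑ l ∈ F with κ l = none, 1, fun _ => ⟨?_, ?_, ?_⟩⟩
      · refine Piece.sum _ _ _ _ fun l hl => ?_
        rw [Finset.mem_filter] at hl
        rcases hκ l hl.1 with ⟨-, -, h1⟩ | ⟨t', f', h1, -⟩
        · exact h1
        · rw [hl.2] at h1; cases h1
      · simp [hn]
      · simp [hn]
    · obtain ⟨l₀, hl₀, hk₀⟩ := Finset.mem_image.1 hγ
      obtain ⟨ht, hf, -⟩ := hface l₀ hl₀ t f hk₀
      have hspan : D.FaceSpan layer t f (∑ l ∈ F with κ l = some (t, f), w l) :=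
        FaceSpan.sum fun l hl => by
          rw [Finset.mem_filter] at hl
          exact (hface l hl.1 t f hl.2).2.2.span
      have hpiece := hspan.piece (e := e) h ht hf R
      by_cases hin : some (t, f) ∈ Γ
      · obtain ⟨⟨t', f', σ⟩, hφ, heq⟩ := Finset.mem_image.1 hin
        simp only [Option.some_inj, Prod.mk.injEq] at heq
        obtain ⟨rfl, rfl⟩ := heq
        -- A group with a flag: one fault is an edge of cost `1`, and `1 + m = m + 1`; two or more
        -- faults have cost at most `m + 2`, and `(m + 2) + m = 2 (m + 1)`.
        by_cases hone : #{l ∈ F | κ l = some (t', f')} = 1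
        · obtain ⟨l, hl⟩ := Finset.card_eq_one.1 hone
          have hl' : l ∈ F ∧ κ l = some (t', f') :=
            Finset.mem_filter.1 (by rw [hl]; exact Finset.mem_singleton_self l)
          refine ⟨1, 0, fun _ => ⟨?_, ?_, ?_⟩⟩
          · have hφ2 := hφ
            rw [mem_flags, hflag, hflag, hl, Finset.sum_singleton] at hφ2
            rw [hl, Finset.sum_singleton]
            exact (hface l hl'.1 t' f' hl'.2).2.2.piece_of_flag h ht hf hφ hφ2.1 hφ2.2
          · rw [if_pos hin, hone]; omega
          · rw [if_pos hin, hone]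
        · refine ⟨m + 2, 0, fun _ => ⟨hpiece.2 σ hφ, ?_, ?_⟩⟩
          · rw [if_pos hin]
            have : 2 * (m + 1) ≤ #{l ∈ F | κ l = some (t', f')} * (m + 1) :=
              Nat.mul_le_mul_right _ (by omega)
            omega
          · rw [if_pos hin]; omega
      -- A group without a counted flag: a single fault has flipped both flags and is harmless; two
      -- or more faults pay for the two ordinary edges that suffice.
      · by_cases hone : #{l ∈ F | κ l = some (t, f)} = 1
        · obtain ⟨l, hl⟩ := Finset.card_eq_one.1 hone
          have hl' : l ∈ F ∧ κ l = some (t, f) :=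
            Finset.mem_filter.1 (by rw [hl]; exact Finset.mem_singleton_self l)
          refine ⟨0, 0, fun _ => ⟨?_, by simp [hin], by simp [hin]⟩⟩
          rw [hl, Finset.sum_singleton]
          refine (hface l hl'.1 t f hl'.2).2.2.piece_of_no_flag (fun σ h1 h2 => hin ?_) R
          refine Finset.mem_image.2 ⟨(t, f, σ), ?_, rfl⟩
          rw [mem_flags, hflag, hflag, hl, Finset.sum_singleton]
          exact ⟨h1, h2⟩
        · refine ⟨2 * (m + 1), 2, fun _ => ⟨hpiece.1, ?_, ?_⟩⟩
          · rw [if_neg hin]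
            exact Nat.mul_le_mul_right _ (by omega)
          · rw [if_neg hin]; omega
  choose n k hnk using hgroup
  refine ⟨∑ γ ∈ F.image κ, n γ, ∑ γ ∈ F.image κ, k γ, ?_, ?_, ?_⟩
  · rw [hsum, ← Finset.sum_fiberwise_of_maps_to (g := κ)
      (fun l hl => Finset.mem_image_of_mem κ hl) w]
    exact Piece.sum _ _ _ _ fun γ hγ => (hnk γ hγ).1
  all_goals
    have hε : ∑ γ ∈ F.image κ, (if γ ∈ Γ then 1 else 0) = m := by
      rw [← Finset.sum_filter, Finset.sum_const, smul_eq_mul, mul_one,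
        Finset.filter_mem_eq_inter, Finset.inter_eq_right.2 hΓF, hΓm]
    have hcard : #F = ∑ γ ∈ F.image κ, #{l ∈ F | κ l = γ} :=
      Finset.card_eq_sum_card_image κ F
  · have := Finset.sum_le_sum fun γ hγ => (hnk γ hγ).2.1
    rw [Finset.sum_add_distrib, ← Finset.mul_sum, hε, ← Finset.sum_mul, ← hcard] at this
    rwa [hcount]
  · have := Finset.sum_le_sum fun γ hγ => (hnk γ hγ).2.2
    rw [Finset.sum_add_distrib, hε, ← hcard] at this
    rwa [hcount]

end

end Problem

namespace Problem

variable {D : Problem} {T : ℕ} {e : FaultPattern} {line : ℕ × ℕ → ℕ} {point : ℕ → ℕ × ℕ}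
  {layer : ℕ → ℕ} (h : D.Tractable T line point layer)

/-! ## The correction -/

/-- Additive quantities of the correction are sums over the edges of the matching. -/
theorem map_correction {A : Type*} [AddCommMonoid A] (g : DataError →+ A) (M : Matching) :
    g (correction M) = (M.map fun x => (x.2.1.map fun E => g E.error).sum).sum := by
  simp only [correction, map_list_sum, List.map_map, Function.comp_def]

include h in
-- An edge is realized by a single fault, so `sum_changes` relates its ends to its data error.
theorem IsEdge.checkValue {E : Edge} (hE : D.IsEdge T e E) {v : ℕ × ℕ} (hv : v ∈ D.checks) :
    D.checkValue E.error v = ∑ t ∈ range (T + 1), D.boundary E (t, v) := by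
  obtain ⟨⟨l, -, a, -, hE⟩, -⟩ := hE
  rw [resultsIn_iff] at hE
  rw [← hE.1, sum_changes T _ hv]
  cases E with
  | space => rw [hE.2]
  | diag => rw [hE.2]
  | vert => rw [hE.2]
  | cross t f =>
    obtain ⟨-, hf, hE | hE⟩ := hE <;> rw [hE]
    rw [checkValue_add, h.checkValue_gen f (gens_of_flagged hf) v hv, add_zero]

theorem IsEdge.error_eq_zero {E : Edge} (hE : D.IsEdge T e E) {q : ℕ × ℕ} (hq : q ∉ D.lattice) :
    E.error q = 0 := by
  obtain ⟨⟨l, -, a, -, hE⟩, -⟩ := hE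
  rw [resultsIn_iff] at hE
  have h0 := dataError_eq_zero (D := D) (T := T) (e := Pi.single l a) hq
  cases E with
  | space => rw [← hE.2, h0]
  | diag => rw [← hE.2, h0]
  | vert => rw [← hE.2, h0]
  | cross t f =>
    obtain ⟨-, hf, hE | hE⟩ := hE
    · rw [← hE, h0]
    · rw [hE, Pi.add_apply] at h0
      have : q ∉ plaquette D.d f := fun h' => hq (Finset.mem_inter.1 h').2
      simpa [errorOn, this] using h0

include h in
-- The matching has the changed vertices as its boundary. Summed over the layers, the boundary gives
-- the check values of the correction, and the changes give those of the data error.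
theorem checkValue_correction {M : Matching} (hM : D.IsMatching T e M) {v : ℕ × ℕ}
    (hv : v ∈ D.checks) : D.checkValue (correction M) v = D.checkValue (D.dataError T e) v := by
  have h1 := map_correction (AddMonoidHom.mk' (fun x => D.checkValue x v)
    fun x y => D.checkValue_add x y v) M
  simp only [AddMonoidHom.mk'_apply] at h1
  rw [h1, ← effect_data, ← sum_changes T e hv]
  have h2 : ∀ t, (D.effect T e).2.1 (t, v) =
      (M.map fun x => (x.2.1.map fun E => D.boundary E (t, v)).sum).sum := by
    intro t
    rw [hM.sum_boundary]
    have h3 : ∀ a : ZMod 2, a = if a ≠ 0 then 1 else 0 := by decide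
    rw [h3 ((D.effect T e).2.1 (t, v))]
    simp only [mem_changed]
  simp only [h2]
  have hp := hM.1
  clear h1 h2 hM
  induction M with
  | nil => simp
  | cons x M ih =>
    simp only [List.map_cons, List.sum_cons, Finset.sum_add_distrib]
    rw [ih fun y hy => hp y (by simp [hy])]
    congr 1
    have hx := (hp x (by simp)).isEdge
    generalize x.2.1 = l at hx
    induction l with
    | nil => simp
    | cons E l ih' =>
      simp only [List.map_cons, List.sum_cons, Finset.sum_add_distrib]
      rw [ih' fun F hF => hx F (by simp [hF]), (hx E (by simp)).checkValue h hv]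

theorem correction_eq_zero {M : Matching} (hM : D.IsMatching T e M) {q : ℕ × ℕ}
    (hq : q ∉ D.lattice) : correction M q = 0 := by
  have h1 := map_correction (Pi.evalAddMonoidHom _ q) M
  simp only [Pi.evalAddMonoidHom_apply] at h1
  rw [h1]
  refine List.sum_eq_zero fun a ha => ?_
  obtain ⟨x, hx, rfl⟩ := List.mem_map.1 ha
  refine List.sum_eq_zero fun a ha => ?_
  obtain ⟨E, hE, rfl⟩ := List.mem_map.1 ha
  exact ((hM.1 x hx).isEdge E hE).error_eq_zero hq

include h in
-- Edges in highlighted boomerangs do not leave the lines of their faces. All other edges cost `m +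
-- 1` and affect at most one qubit, because cross edges are present only in highlighted boomerangs.
theorem IsEdge.card_outerLines {E : Edge} (hE : D.IsEdge T e E) :
    #(D.outerLines line (D.flagLines T e line) E.error) * (#(D.flags T e) + 1) ≤
      D.edgeCost T e E := by
  by_cases hH : D.Highlighted T e E
  · obtain ⟨φ, hφ, hE⟩ := hH
    rw [outerLines_eq_empty, Finset.card_empty, zero_mul]
    · exact Nat.zero_le _
    · intro i hi
      exact hE.lineSum_eq_zero h fun h' => hi (Finset.mem_biUnion.2 ⟨φ, hφ, h'⟩)
  · rw [edgeCost, if_neg hH]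
    refine Nat.mul_le_of_le_div _ _ _ ?_
    rw [Nat.div_self (Nat.succ_pos _)]
    cases E with
    | space t q => exact card_outerLines_errorOn _ _ _
    | diag t q v w => exact card_outerLines_errorOn _ _ _
    | vert t v =>
      rw [outerLines_eq_empty fun i _ => ?_]
      · simp
      · simp [Edge.error]
    | cross t f => exact absurd (hE.2 ⟨t, f, rfl⟩) hH

include h in
theorem card_outerLines_correction {M : Matching} (hM : D.IsMatching T e M) :
    #(D.outerLines line (D.flagLines T e line) (correction M)) * (#(D.flags T e) + 1) ≤
      D.matchingCost T e M := by
  have hp := hM.1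
  clear hM
  set R := D.flagLines T e line
  have h0 : #(D.outerLines line R 0) = 0 := by
    rw [outerLines_eq_empty] <;> simp
  rw [matchingCost, correction]
  induction M with
  | nil => simp [h0]
  | cons x M ih =>
    simp only [List.map_cons, List.sum_cons]
    refine (Nat.mul_le_mul_right _ (card_outerLines_add _ _ _ _)).trans ?_
    rw [add_mul]
    refine add_le_add ?_ (ih fun y hy => hp y (by simp [hy]))
    have hx := (hp x (by simp)).isEdge
    generalize x.2.1 = l at hx
    induction l with
    | nil => simp [h0]
    | cons E l ih' =>
      simp only [List.map_cons, List.sum_cons]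
      refine (Nat.mul_le_mul_right _ (card_outerLines_add _ _ _ _)).trans ?_
      rw [add_mul]
      exact add_le_add ((hx E (by simp)).card_outerLines h) (ih' fun F hF => hx F (by simp [hF]))

/-! ### Correction of fewer than half as many faults as there are lines -/

include h in
/-- Few faults are corrected. -/
theorem corrects_of_faultCount_le {p : ℝ} (hp : 0 < p) (hp1 : p < 1)
    (hN : #(D.circuit.locations T) * p ≤ 1 / 2) {K : ℕ}
    (hW : (((K * (K + 1) : ℕ) : ℝ) + 1) * (Real.log #(D.circuit.locations T) + Real.log 30) <
      - Real.log p) (hK : 2 * K < D.d)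
    (he : D.circuit.IsFaultPattern T e) (hk : D.circuit.faultCount T e ≤ K) :
    D.Corrects p T e := by
  obtain ⟨n, k, ⟨⟨C, hC, hb, hn⟩, hpk⟩, h1, h2⟩ := exists_piece h he
  set m := #(D.flags T e) with hm
  have hj : ∀ E ∈ C, ∃ x y, D.Joins E x y := fun E hE => exists_joins h (hC E hE).1
  have hb' : ∀ v, ∑ E ∈ C, D.boundary E v = if v ∈ D.changed T e then 1 else 0 := by
    intro v
    have h3 : ∀ a : ZMod 2, a = if a ≠ 0 then 1 else 0 := by decide
    rw [hb v, h3 ((D.effect T e).2.1 v)]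
    simp only [mem_changed]
  refine ⟨?_, fun M hM => ?_⟩
  · obtain ⟨M, hM, -⟩ := exists_isMatching hC hj hb' (fun _ => 0)
    exact exists_isMWPM (finite_isEdge h e) hM p
  have hcost : D.matchingCost T e M ≤ n := by
    refine hM.cost_le hp hp1 hN hW hC hj hb' hn ?_
    -- As `m ≤ k ≤ K` for `k` faults, the cost has a bound that does not depend on the faults, and
    -- one threshold serves for all of them.
    calc n ≤ D.circuit.faultCount T e * (m + 1) := by omega
      _ ≤ K * (K + 1) := Nat.mul_le_mul hk (by omega)
  have hcorr := card_outerLines_correction h hM.1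
  set R := D.flagLines T e line
  -- Let `k = m + r`. If the correction crossed at least `r + 1` outer lines, then `(r + 1) (m + 1)
  -- ≤ n ≤ (m + r) (m + 1) - m ^ 2 = r (m + 1) + m`, which is false.
  have hc : #(D.outerLines line R (correction M)) + m ≤ D.circuit.faultCount T e := by
    rw [← hm] at hcorr
    by_contra! hlt
    have h4 : (D.circuit.faultCount T e + 1 - m) * (m + 1) ≤
        #(D.outerLines line R (correction M)) * (m + 1) := Nat.mul_le_mul_right _ (by omega)
    obtain ⟨r, hr⟩ := Nat.exists_eq_add_of_le (show m ≤ D.circuit.faultCount T e by omega)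
    rw [hr, show m + r + 1 - m = r + 1 by omega] at h4
    rw [hr] at h1
    nlinarith
  have hR : #R ≤ 2 * m := card_flagLines_le
  -- At most `2 m` lines lie in `R`, and the data error and the correction have odd weight on at
  -- most `k - m` further lines each: `2 k < d` lines in all.
  have htot : #(R ∪ D.outerLines line R (D.dataError T e + correction M)) < #(Icc 1 D.d) := by
    rw [Nat.card_Icc, Nat.add_sub_cancel]
    have h5 := card_outerLines_add (D := D) line R (D.dataError T e) (correction M)
    have h6 := Finset.card_union_le R (D.outerLines line R (D.dataError T e + correction M))
    rw [effect_data] at hpk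
    omega
  obtain ⟨i, hi, hi'⟩ := Finset.exists_mem_notMem_of_card_lt_card htot
  rw [Finset.mem_union, not_or] at hi'
  refine h.mem_trivialErrors _ (fun q hq => ?_) (fun v hv => ?_) i hi ?_
  · rw [Pi.add_apply, ← effect_data, dataError_eq_zero hq, correction_eq_zero hM.1 hq, add_zero]
  · rw [checkValue_add, checkValue_correction h hM.1 hv, CharTwo.add_self_eq_zero]
  · by_contra hne
    exact hi'.2 (Finset.mem_filter.2 ⟨hi, hne, hi'.1⟩)

/-! ### Failure for one fault more -/

/-- Faults in the first time step on the data qubits on the lines `1, …, n`. -/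
def lineFaults (D : Problem) (point : ℕ → ℕ × ℕ) (n : ℕ) : FaultPattern :=
  ∑ i ∈ Icc 1 n, Pi.single (0, 0, .idle (.data (point i).1 (point i).2)) (Pi.single D.err 1, 0)

include h in
theorem point_injective : Function.Injective point := fun i j hij => by
  rw [← h.line_point i, hij, h.line_point j]

open Classical in
include h in
theorem lineFaults_apply (n : ℕ) (l : Location) : lineFaults D point n l =
    if l ∈ (Icc 1 n).image fun i => ((0, 0, .idle (.data (point i).1 (point i).2)) : Location)
    then (Pi.single D.err 1, 0) else 0 := by
  rw [lineFaults, Finset.sum_apply]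
  split_ifs with hl
  · obtain ⟨i, hi, rfl⟩ := Finset.mem_image.1 hl
    rw [Finset.sum_eq_single i]
    · simp
    · intro j _ hji
      rw [Pi.single_apply, if_neg]
      intro heq
      simp only [Prod.mk.injEq, Op.idle.injEq, Qubit.data.injEq, true_and] at heq
      exact hji (point_injective h (Prod.ext heq.1.symm heq.2.symm))
    · exact fun h' => absurd hi h'
  · refine Finset.sum_eq_zero fun i hi => ?_
    rw [Pi.single_apply, if_neg]
    rintro rfl
    exact hl (Finset.mem_image_of_mem _ hi)

include h in
theorem isFaultPattern_lineFaults {n : ℕ} (hn : n ≤ D.d) :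
    D.circuit.IsFaultPattern T (lineFaults D point n) ∧
      D.circuit.faultCount T (lineFaults D point n) ≤ n := by
  classical
  constructor
  · intro l
    rw [lineFaults_apply h]
    split_ifs with hl
    · obtain ⟨i, hi, rfl⟩ := Finset.mem_image.1 hl
      refine .inr ⟨(h.idle _ (h.point_mem i ?_)).1, ?_⟩
      · rw [Finset.mem_Icc] at hi ⊢; omega
      · simp [Op.errors]
    · exact .inl rfl
  · have : #((Icc 1 n).image fun i =>
        ((0, 0, .idle (.data (point i).1 (point i).2)) : Location)) ≤ n := by
      simpa using Finset.card_image_le (s := Icc 1 n) (f := fun i =>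
        ((0, 0, .idle (.data (point i).1 (point i).2)) : Location))
    refine le_trans (Finset.card_le_card fun l hl => ?_) this
    rw [Finset.mem_filter, lineFaults_apply h] at hl
    by_contra hl'
    exact hl.2 (if_neg hl')

include h in
theorem effect_lineFaults {n : ℕ} (hn : n ≤ D.d) : D.effect T (lineFaults D point n) =
    (∑ i ∈ Icc 1 n, errorOn {point i}, D.syndrome 0 (∑ i ∈ Icc 1 n, errorOn {point i}), 0) := by
  induction n with
  | zero =>
    have : D.effect T 0 = 0 := (AddMonoidHom.mk' (D.effect T) (D.effect_add T)).map_zero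
    have h0 : lineFaults D point 0 = 0 := by simp [lineFaults]
    rw [h0, this]
    refine Prod.ext ?_ (Prod.ext ?_ rfl) <;> simp
  | succ n ih =>
    have hs : lineFaults D point (n + 1) = lineFaults D point n +
        Pi.single (0, 0, .idle (.data (point (n + 1)).1 (point (n + 1)).2))
          (Pi.single D.err 1, 0) := by
      rw [lineFaults, Finset.sum_Icc_succ_top (by omega)]; rfl
    rw [hs, effect_add, ih (by omega), (h.idle _ (h.point_mem (n + 1) (by simpa using hn))).2,
      Finset.sum_Icc_succ_top (by omega), syndrome_add]
    simp

theorem lineSum_sum_point (hp : ∀ i ∈ Icc 1 D.d, point i ∈ D.lattice)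
    (hl : ∀ i, line (point i) = i) {n : ℕ} (hn : n ≤ D.d) (i : ℕ) :
    D.lineSum line i (∑ j ∈ Icc 1 n, errorOn {point j}) = if i ∈ Icc 1 n then 1 else 0 := by
  have h1 : D.lineSum line i (∑ j ∈ Icc 1 n, errorOn {point j}) =
      ∑ j ∈ Icc 1 n, D.lineSum line i (errorOn {point j}) :=
    map_sum (AddMonoidHom.mk' (D.lineSum line i) (lineSum_add line i)) _ _
  rw [h1, ← Finset.sum_ite_eq' (Icc 1 n) i fun _ => (1 : ZMod 2)]
  refine Finset.sum_congr rfl fun j hj => ?_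
  rw [lineSum_errorOn (hp j ?_), hl]
  rw [Finset.mem_Icc] at hj ⊢
  omega

include h in
/-- One fault more than half of the distance need not be corrected. -/
theorem not_correctsFaults {p : ℝ} (hp : 0 < p) (hp1 : p < 1)
    (hN : #(D.circuit.locations T) * p ≤ 1 / 2) {K : ℕ}
    (hW : (((K * (K + 1) : ℕ) : ℝ) + 1) * (Real.log #(D.circuit.locations T) + Real.log 30) <
      - Real.log p) (hK : D.d = 2 * K + 1) : ¬ D.CorrectsFaults p T (K + 1) := by
  classical
  intro hcor
  have hle : K + 1 ≤ D.d := by omega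
  set e := lineFaults D point (K + 1)
  have heff : D.effect T e = _ := effect_lineFaults h hle
  obtain ⟨⟨M, hM⟩, hall⟩ := hcor e (isFaultPattern_lineFaults h hle).1
    (isFaultPattern_lineFaults h hle).2
  have hres := hall M hM
  -- Without flags every edge costs `1`.
  have hflags : D.flags T e = ∅ := by
    refine Finset.eq_empty_of_forall_notMem fun φ hφ => ?_
    rw [mem_flags, heff] at hφ
    exact hφ.1 rfl
  -- The rest of the straight logical operator has the same syndrome as the faults, and it consists
  -- of only `K` space edges.
  set C := (Ioc (K + 1) D.d).image fun i => Edge.space 0 (point i) with hCdef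
  have hinj : Set.InjOn (fun i => Edge.space 0 (point i)) (Ioc (K + 1) D.d : Finset ℕ) := by
    intro i _ j _ hij
    simp only [Edge.space.injEq, true_and] at hij
    exact point_injective h hij
  have hmem : ∀ i ∈ Ioc (K + 1) D.d, point i ∈ D.lattice := fun i hi =>
    h.point_mem i (by rw [Finset.mem_Ioc] at hi; rw [Finset.mem_Icc]; omega)
  have hC : ∀ E ∈ C, D.IsEdge T e E := by
    intro E hE
    obtain ⟨i, hi, rfl⟩ := Finset.mem_image.1 hE
    exact ⟨singleFault_space h (Nat.zero_le T) (hmem i hi), by simp⟩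
  have hb : ∀ v, ∑ E ∈ C, D.boundary E v = if v ∈ D.changed T e then 1 else 0 := by
    intro v
    have h3 : ∀ a : ZMod 2, a = if a ≠ 0 then 1 else 0 := by decide
    have h4 : ∑ E ∈ C, D.boundary E v = (D.effect T e).2.1 v := by
      rw [hCdef, Finset.sum_image hinj, heff]
      have h5 : D.syndrome 0 (∑ i ∈ Icc 1 D.d, errorOn {point i}) v = 0 := by
        rw [syndrome]
        split_ifs with hv
        · exact h.checkValue_line _ hv.2
        · rfl
      have h6 : ∑ i ∈ Icc 1 D.d, errorOn {point i} = ∑ i ∈ Icc 1 (K + 1), errorOn {point i} +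
          ∑ i ∈ Ioc (K + 1) D.d, errorOn {point i} := by
        rw [← Finset.sum_union]
        · congr 1
          ext i
          simp only [mem_Icc, mem_union, mem_Ioc]
          omega
        · rw [Finset.disjoint_left]
          intro i hi
          simp only [mem_Icc, mem_Ioc] at hi ⊢
          omega
      rw [h6, syndrome_add, Pi.add_apply] at h5
      have h7 : D.syndrome 0 (∑ i ∈ Ioc (K + 1) D.d, errorOn {point i}) v =
          ∑ i ∈ Ioc (K + 1) D.d, D.boundary (.space 0 (point i)) v := by
        have := map_sum (AddMonoidHom.mk' (fun x => D.syndrome 0 x v) fun x y => by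
          rw [syndrome_add]; rfl) (fun i => errorOn {point i}) (Ioc (K + 1) D.d)
        simp only [AddMonoidHom.mk'_apply] at this
        rw [this]
        simp only [boundary_space]
      rw [← h7]
      have h8 : ∀ a b : ZMod 2, a + b = 0 → b = a := by decide
      exact h8 _ _ h5
    rw [h4, h3 ((D.effect T e).2.1 v)]
    simp only [mem_changed]
  have hcost : D.matchingCost T e M ≤ K := by
    refine hM.cost_le hp hp1 hN hW hC (fun E hE => exists_joins h (hC E hE).1) hb ?_ ?_
    · calc ∑ E ∈ C, D.edgeCost T e E ≤ ∑ E ∈ C, 1 := by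
            refine Finset.sum_le_sum fun E _ => ?_
            rw [edgeCost, hflags]
            split_ifs <;> simp
        _ ≤ K := by
            rw [Finset.sum_const, smul_eq_mul, mul_one]
            refine Finset.card_image_le.trans ?_
            rw [Nat.card_Ioc]
            omega
    -- The threshold was chosen for costs up to `K (K + 1)`, which includes `K`.
    · exact Nat.le_mul_of_pos_right K (Nat.succ_pos K)
  have hcorr := card_outerLines_correction h hM.1
  rw [hflags, Finset.card_empty, zero_add, mul_one] at hcorr
  -- Trivial errors have even weight on all lines. So a successful correction would be odd on the
  -- same `K + 1` lines as the faults, although its cost is at most `K`.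
  have hsub : Icc 1 (K + 1) ⊆ D.outerLines line (D.flagLines T e line) (correction M) := by
    intro i hi
    have hi' : i ∈ Icc 1 D.d := by rw [Finset.mem_Icc] at hi ⊢; omega
    refine Finset.mem_filter.2 ⟨hi', ?_, by simp [flagLines, hflags]⟩
    have h9 := lineSum_eq_zero_of_trivial h hres i
    rw [lineSum_add, ← effect_data, heff, lineSum_sum_point h.point_mem h.line_point hle,
      if_pos hi] at h9
    intro h10
    rw [h10] at h9
    simp at h9
  have := Finset.card_le_card hsub
  rw [Nat.card_Icc] at this
  omega

theorem CorrectsFaults.mono {p : ℝ} {k k' : ℕ} (hc : D.CorrectsFaults p T k') (hk : k ≤ k') :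
    D.CorrectsFaults p T k := fun e he hek => hc e he (hek.trans hk)

/-! ### The effective distance -/

include h in
theorem Tractable.main (hodd : Odd D.d) : ∃ p₀ : ℝ, 0 < p₀ ∧ ∀ p : ℝ, 0 < p → p < p₀ →
    D.CorrectsFaults p T ((D.d - 1) / 2) ∧ D.HasEffectiveDistance p T D.d := by
  obtain ⟨K, hK⟩ := hodd
  obtain ⟨p₀, hp₀, hsmall⟩ := exists_threshold #(D.circuit.locations T) (K * (K + 1))
  have hdiv : (D.d - 1) / 2 = K := by omega
  refine ⟨p₀, hp₀, fun p hp hpp => ?_⟩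
  obtain ⟨hp1, hN, hW⟩ := hsmall p hp hpp
  have hc : D.CorrectsFaults p T K := fun e he hk =>
    corrects_of_faultCount_le h hp hp1 hN hW (by omega) he hk
  refine ⟨hdiv ▸ hc, K, hK, hc, fun k hk => ?_⟩
  by_contra! hlt
  exact not_correctsFaults h hp hp1 hN hW hK (CorrectsFaults.mono hk hlt)

end Problem

/-! ## The lattice -/

theorem mem_plaquette {d i j a b : ℕ} : (a, b) ∈ plaquette d (i, j) ↔
    (a = i ∨ a = i + 1) ∧ (b = j ∨ b = j + 1) ∧ 1 ≤ a ∧ a ≤ d ∧ 1 ≤ b ∧ b ≤ d := by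
  simp only [plaquette, mem_inter, mem_product, mem_insert, mem_singleton, mem_Icc]
  tauto

theorem mem_evenFaces {d i j : ℕ} :
    (i, j) ∈ evenFaces d ↔ i ≤ d ∧ 1 ≤ j ∧ j ≤ d - 1 ∧ (i + j) % 2 = 0 := by
  simp only [evenFaces, mem_filter, mem_product, Finset.mem_range, mem_Icc, Nat.even_iff]
  omega

theorem mem_oddFaces {d i j : ℕ} :
    (i, j) ∈ oddFaces d ↔ 1 ≤ i ∧ i ≤ d - 1 ∧ j ≤ d ∧ (i + j) % 2 = 1 := by
  simp only [oddFaces, mem_filter, mem_product, Finset.mem_range, mem_Icc, Nat.odd_iff]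
  omega

theorem mem_bulk_evenFaces {d i j : ℕ} : (i, j) ∈ bulk d (evenFaces d) ↔
    1 ≤ i ∧ i ≤ d - 1 ∧ 1 ≤ j ∧ j ≤ d - 1 ∧ (i + j) % 2 = 0 := by
  simp only [bulk, mem_filter, mem_evenFaces, mem_product, mem_Icc]
  omega

theorem mem_bulk_oddFaces {d i j : ℕ} : (i, j) ∈ bulk d (oddFaces d) ↔
    1 ≤ i ∧ i ≤ d - 1 ∧ 1 ≤ j ∧ j ≤ d - 1 ∧ (i + j) % 2 = 1 := by
  simp only [bulk, mem_filter, mem_oddFaces, mem_product, mem_Icc]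
  omega

/-- A sum over a plaquette as a sum over its four corners. -/
theorem sum_plaquette (d i j : ℕ) (x : DataError) : ∑ q ∈ plaquette d (i, j), x q =
    (if (i, j) ∈ Icc 1 d ×ˢ Icc 1 d then x (i, j) else 0) +
    (if (i, j + 1) ∈ Icc 1 d ×ˢ Icc 1 d then x (i, j + 1) else 0) +
    ((if (i + 1, j) ∈ Icc 1 d ×ˢ Icc 1 d then x (i + 1, j) else 0) +
    (if (i + 1, j + 1) ∈ Icc 1 d ×ˢ Icc 1 d then x (i + 1, j + 1) else 0)) := by
  rw [plaquette, ← Finset.filter_mem_eq_inter, Finset.sum_filter, Finset.sum_product]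
  rw [Finset.sum_pair (by simp), Finset.sum_pair (by simp), Finset.sum_pair (by simp)]

/-- The overlap of an even and an odd face has even size. -/
theorem sum_plaquette_plaquette {d i j k l : ℕ} (hf : (i, j) ∈ evenFaces d)
    (hv : (k, l) ∈ oddFaces d) :
    ∑ q ∈ plaquette d (k, l), errorOn (plaquette d (i, j)) q = 0 := by
  rw [mem_evenFaces] at hf
  rw [mem_oddFaces] at hv
  obtain ⟨h1, h2, h3, h4⟩ := hf
  obtain ⟨g1, g2, g3, g4⟩ := hv
  rw [sum_plaquette]
  simp only [errorOn, mem_plaquette, mem_product, mem_Icc]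
  split_ifs <;> first | rfl | (exfalso; omega)

theorem sum_plaquette_plaquette' {d i j k l : ℕ} (hf : (i, j) ∈ evenFaces d)
    (hv : (k, l) ∈ oddFaces d) :
    ∑ q ∈ plaquette d (i, j), errorOn (plaquette d (k, l)) q = 0 := by
  rw [← sum_plaquette_plaquette hf hv]
  simp only [errorOn, Finset.sum_ite_mem, Finset.inter_comm]

/-! ### Errors that commute with all checks, by partial sums of rows -/

section Sweep

variable {d π : ℕ} {x : ℕ → ℕ → ZMod 2}

/-- The error `x` commutes with the checks between the rows `i` and `i + 1`. -/
def Commutes (d π : ℕ) (x : ℕ → ℕ → ZMod 2) : Prop :=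
  ∀ i l, 1 ≤ i → i ≤ d - 1 → l ≤ d → (i + l) % 2 ≠ π →
    ((if 1 ≤ l then x i l + x (i + 1) l else 0) +
      (if l + 1 ≤ d then x i (l + 1) + x (i + 1) (l + 1) else 0)) = 0

/-- The sum of the first `j` entries of the row `i`. -/
def rowSum (x : ℕ → ℕ → ZMod 2) (i j : ℕ) : ZMod 2 := ∑ c ∈ range j, x i (c + 1)

theorem rowSum_succ (i j : ℕ) : rowSum x i (j + 1) = rowSum x i j + x i (j + 1) :=
  Finset.sum_range_succ _ _

/-- The checks between the two rows that lie in the first `j` columns cover these in disjoint pairs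
of neighbours, with the first column covered alone by a boundary check if `j` is odd. Their sum is
the equality. -/
theorem rowSum_eq (hx : Commutes d π x) (hπ : π < 2) {i : ℕ} (h1 : 1 ≤ i) (hi : i ≤ d - 1) (j : ℕ)
    (hj : j ≤ d) (hij : (i + j) % 2 = π) : rowSum x i j = rowSum x (i + 1) j := by
  induction j using Nat.strong_induction_on with
  | _ j ih =>
    rcases j with _ | _ | j
    · simp [rowSum]
    · have h := hx i 0 h1 hi (by omega) (by omega)
      have h2 : ∀ a b : ZMod 2, a + b = 0 → a = b := by decide
      have hd : 1 ≤ d := by omega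
      rw [if_neg (by omega), zero_add, if_pos hd] at h
      simpa [rowSum] using h2 _ _ h
    · have h := hx i (j + 1) h1 hi (by omega) (by omega)
      rw [if_pos (by omega), if_pos hj] at h
      have h2 : ∀ r a b c d : ZMod 2, (a + b) + (c + d) = 0 → r + a + c = r + b + d := by decide
      rw [rowSum_succ, rowSum_succ, rowSum_succ, rowSum_succ,
        ih j (by omega) (by omega) (by omega)]
      exact h2 _ _ _ _ _ h

/-- For one parity of `i` the checks cover the whole rows as in `rowSum_eq`; for the other one they
cover all columns but the last, which has a boundary check of its own. -/
theorem rowSum_last (hx : Commutes d π x) (hπ : π < 2) {i : ℕ} (h1 : 1 ≤ i) (hi : i ≤ d - 1) :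
    rowSum x i d = rowSum x (i + 1) d := by
  by_cases hp : (i + d) % 2 = π
  · exact rowSum_eq hx hπ h1 hi d le_rfl hp
  · obtain ⟨n, rfl⟩ := Nat.exists_eq_add_of_le' (show 1 ≤ d by omega)
    have h := hx i (n + 1) h1 hi le_rfl hp
    rw [if_pos (by omega), if_neg (by omega), add_zero] at h
    have h2 : ∀ a b : ZMod 2, a + b = 0 → a = b := by decide
    rw [rowSum_succ, rowSum_succ, rowSum_eq hx hπ h1 hi n (by omega) (by omega), h2 _ _ h]

/-- By `rowSum_last` all rows have the same parity, so one even row suffices. -/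
theorem rowSum_last_eq_zero (hx : Commutes d π x) (hπ : π < 2) {i₀ : ℕ} (h₁ : 1 ≤ i₀) (h₂ : i₀ ≤ d)
    (h₀ : rowSum x i₀ d = 0) {i : ℕ} (h1 : 1 ≤ i) (hi : i ≤ d) : rowSum x i d = 0 := by
  have h3 : ∀ n, 1 + n ≤ d → rowSum x (1 + n) d = rowSum x 1 d := by
    intro n
    induction n with
    | zero => intro; rfl
    | succ n ih =>
      intro hn
      rw [← ih (by omega), ← add_assoc, ← rowSum_last hx hπ (by omega) (by omega)]
  obtain ⟨n, rfl⟩ := Nat.exists_eq_add_of_le h1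
  obtain ⟨n', rfl⟩ := Nat.exists_eq_add_of_le h₁
  rw [h3 n hi, ← h3 n' h₂, h₀]

/-- The error at `(a, b)` is the sum of the coefficients of the two faces which contain it. -/
theorem eq_add_coeff (hx : Commutes d π x) (hπ : π < 2) (h0 : ∀ i, 1 ≤ i → i ≤ d → rowSum x i d = 0)
    {a b : ℕ} (ha : 1 ≤ a) (ha' : a ≤ d) (hb : 1 ≤ b) (hb' : b ≤ d) :
    x a b = if (a + b) % 2 = π then
        (if b ≤ d - 1 then rowSum x (max a 1) b else 0) +
          (if 2 ≤ b then rowSum x (max (a - 1) 1) (b - 1) else 0)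
      else (if b ≤ d - 1 then rowSum x (max (a - 1) 1) b else 0) +
        (if 2 ≤ b then rowSum x (max a 1) (b - 1) else 0) := by
  obtain ⟨n, rfl⟩ := Nat.exists_eq_add_of_le' hb
  -- In the last column there is no face to the right; its coefficient would be the sum of an entire
  -- row, which vanishes.
  have hlast : ∀ i, 1 ≤ i → i ≤ d →
      (if n + 1 ≤ d - 1 then rowSum x i (n + 1) else 0) = rowSum x i (n + 1) := by
    intro i h1 hi
    split_ifs with h
    · rfl
    · rw [show n + 1 = d by omega, h0 i h1 hi]
  have hfirst : ∀ i, (if 2 ≤ n + 1 then rowSum x i n else 0) = rowSum x i n := by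
    intro i
    split_ifs with h
    · rfl
    · rw [show n = 0 by omega]; simp [rowSum]
  -- The coefficient of a face may be read off in its upper or its lower row. Moving both
  -- coefficients to the row `a`, their sum is the difference of two consecutive partial sums.
  have hmove : ∀ j, j ≤ d → (a - 1 + j) % 2 = π ∨ a = 1 →
      rowSum x (max (a - 1) 1) j = rowSum x a j := by
    intro j hj hp
    by_cases h1 : a = 1
    · subst h1; rfl
    · rw [max_eq_left (by omega), rowSum_eq hx hπ (by omega) (by omega) j hj (by omega),
        Nat.sub_add_cancel ha]
  have h2 : ∀ r a : ZMod 2, a = r + a + r := by decide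
  rw [Nat.add_sub_cancel, hlast _ (by omega) (by omega), hlast _ (by omega) (by omega), hfirst,
    hfirst, max_eq_left ha]
  split_ifs with hp
  · rw [hmove n (by omega) (by omega), rowSum_succ]
    exact h2 _ _
  · rw [hmove (n + 1) hb' (by omega), rowSum_succ]
    exact h2 _ _

end Sweep

/-! ### Expansion in plaquettes -/

theorem sum_eq_of_support {α : Type*} [DecidableEq α] (s : Finset α) (g : α → ZMod 2) {f₁ f₂ : α}
    (h12 : f₁ ≠ f₂) (h : ∀ f ∈ s, g f ≠ 0 → f = f₁ ∨ f = f₂) :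
    ∑ f ∈ s, g f = (if f₁ ∈ s then g f₁ else 0) + (if f₂ ∈ s then g f₂ else 0) := by
  rw [← Finset.sum_pair (f := fun f => if f ∈ s then g f else 0) h12, Finset.sum_ite_mem,
    eq_comm]
  refine Finset.sum_subset Finset.inter_subset_right fun f hf hf' => ?_
  by_contra hg
  exact hf' (by simpa [hf] using h f hf hg)

/-- Of the four faces around `(a, b)` two diagonally opposite ones have the parity of the
generators. The conditions on `b` remove those beyond the first and the last column. -/
theorem sum_coeff {d π : ℕ} {gens : Finset (ℕ × ℕ)}
    (hgen : ∀ i j, (i, j) ∈ gens ↔ i ≤ d ∧ 1 ≤ j ∧ j ≤ d - 1 ∧ (i + j) % 2 = π)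
    (hπ : π < 2) (C : ℕ → ℕ → ZMod 2) {a b : ℕ} (ha : 1 ≤ a) (ha' : a ≤ d) (hb : 1 ≤ b)
    (hb' : b ≤ d) : ∑ f ∈ gens, C f.1 f.2 * errorOn (plaquette d f) (a, b) =
      if (a + b) % 2 = π then
        (if b ≤ d - 1 then C a b else 0) + (if 2 ≤ b then C (a - 1) (b - 1) else 0)
      else (if b ≤ d - 1 then C (a - 1) b else 0) + (if 2 ≤ b then C a (b - 1) else 0) := by
  have hsupp : ∀ f ∈ gens, C f.1 f.2 * errorOn (plaquette d f) (a, b) ≠ 0 →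
      (a, b) ∈ plaquette d f := by
    intro f _ hg
    by_contra hne
    simp [errorOn, hne] at hg
  have hone : ∀ i j, (a = i ∨ a = i + 1) → (b = j ∨ b = j + 1) →
      C i j * errorOn (plaquette d (i, j)) (a, b) = C i j := by
    intro i j hi hj
    rw [errorOn, if_pos (mem_plaquette.2 ⟨hi, hj, ha, ha', hb, hb'⟩), mul_one]
  by_cases hp : (a + b) % 2 = π
  · rw [if_pos hp, sum_eq_of_support _ _ (f₁ := (a, b)) (f₂ := (a - 1, b - 1))]
    · refine congrArg₂ _ (if_congr ?_ (hone _ _ ?_ ?_) rfl) (if_congr ?_ (hone _ _ ?_ ?_) rfl)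
      · rw [hgen]; omega
      all_goals first | omega | (rw [hgen]; omega)
    · simp only [ne_eq, Prod.mk.injEq]; omega
    · rintro ⟨i, j⟩ hf hg
      have := hsupp _ hf hg
      rw [mem_plaquette] at this
      rw [hgen] at hf
      simp only [Prod.mk.injEq]
      omega
  · rw [if_neg hp, sum_eq_of_support _ _ (f₁ := (a - 1, b)) (f₂ := (a, b - 1))]
    · refine congrArg₂ _ (if_congr ?_ (hone _ _ ?_ ?_) rfl) (if_congr ?_ (hone _ _ ?_ ?_) rfl)
      · rw [hgen]; omega
      all_goals first | omega | (rw [hgen]; omega)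
    · simp only [ne_eq, Prod.mk.injEq]; omega
    · rintro ⟨i, j⟩ hf hg
      have := hsupp _ hf hg
      rw [mem_plaquette] at this
      rw [hgen] at hf
      simp only [Prod.mk.injEq]
      omega

/-- An error that commutes with all checks and has even weight on some row is a sum of
plaquettes. -/
theorem eq_sum_coeff {d π : ℕ} {gens : Finset (ℕ × ℕ)}
    (hgen : ∀ i j, (i, j) ∈ gens ↔ i ≤ d ∧ 1 ≤ j ∧ j ≤ d - 1 ∧ (i + j) % 2 = π)
    (hπ : π < 2) {X : ℕ → ℕ → ZMod 2} (hX : Commutes d π X) {i₀ : ℕ} (h₁ : 1 ≤ i₀) (h₂ : i₀ ≤ d)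
    (h₀ : ∑ c ∈ Icc 1 d, X i₀ c = 0) {a b : ℕ} (ha : 1 ≤ a) (ha' : a ≤ d) (hb : 1 ≤ b)
    (hb' : b ≤ d) :
    X a b = ∑ f ∈ gens, rowSum X (max f.1 1) f.2 * errorOn (plaquette d f) (a, b) := by
  have hrow : ∀ i, rowSum X i d = ∑ c ∈ Icc 1 d, X i c := by
    intro i
    rw [rowSum, Finset.range_eq_Ico, Finset.sum_Ico_add' (fun c => X i c) 0 d 1]
    rfl
  -- The coefficient of the face `(i, j)` is the sum of the first `j` entries of row `i`. The faces
  -- on the top boundary have `i = 0`, where row `1` is used instead; hence the maximum.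
  rw [sum_coeff hgen hπ (fun i j => rowSum X (max i 1) j) ha ha' hb hb']
  exact eq_add_coeff hX hπ
    (fun i h1 hi => rowSum_last_eq_zero hX hπ h₁ h₂ ((hrow i₀).trans h₀) h1 hi) ha ha' hb hb'

/-- The plaquettes of the even faces generate all errors that commute with the odd faces and have
even weight on some row. -/
theorem mem_span_evenFaces {d : ℕ} (x : DataError)
    (hx0 : ∀ q, q ∉ Icc 1 d ×ˢ Icc 1 d → x q = 0)
    (hx : ∀ v ∈ oddFaces d, ∑ q ∈ plaquette d v, x q = 0) {i₀ : ℕ} (h₁ : 1 ≤ i₀) (h₂ : i₀ ≤ d)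
    (h₀ : ∑ c ∈ Icc 1 d, x (i₀, c) = 0) :
    x ∈ Submodule.span (ZMod 2) {y | ∃ f ∈ evenFaces d, y = errorOn (plaquette d f)} := by
  have hX : Commutes d 0 fun i j => x (i, j) := by
    intro i l h1 h2 h3 h4
    refine Eq.trans ?_ (hx (i, l) (mem_oddFaces.2 ⟨h1, h2, h3, by omega⟩))
    rw [sum_plaquette]
    simp only [mem_product, mem_Icc]
    split_ifs <;> first | (exfalso; omega) | ring
  have hsum : x = ∑ f ∈ evenFaces d,
      rowSum (fun i j => x (i, j)) (max f.1 1) f.2 • errorOn (plaquette d f) := by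
    funext ⟨a, b⟩
    rw [Finset.sum_apply]
    simp only [Pi.smul_apply, smul_eq_mul]
    by_cases hq : (a, b) ∈ Icc 1 d ×ˢ Icc 1 d
    · simp only [mem_product, mem_Icc] at hq
      exact eq_sum_coeff (fun i j => mem_evenFaces) (by norm_num) hX h₁ h₂ h₀ hq.1.1 hq.1.2
        hq.2.1 hq.2.2
    · rw [hx0 _ hq, eq_comm]
      refine Finset.sum_eq_zero fun f _ => ?_
      have : (a, b) ∉ plaquette d f := fun h' => hq (Finset.mem_inter.1 h').2
      simp [errorOn, this]
  rw [hsum]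
  exact Submodule.sum_mem _ fun f hf =>
    Submodule.smul_mem _ _ (Submodule.subset_span ⟨f, hf, rfl⟩)

/-- The plaquettes of the odd faces generate all errors that commute with the even faces and have
even weight on some column. -/
theorem mem_span_oddFaces {d : ℕ} (x : DataError)
    (hx0 : ∀ q, q ∉ Icc 1 d ×ˢ Icc 1 d → x q = 0)
    (hx : ∀ v ∈ evenFaces d, ∑ q ∈ plaquette d v, x q = 0) {i₀ : ℕ} (h₁ : 1 ≤ i₀) (h₂ : i₀ ≤ d)
    (h₀ : ∑ c ∈ Icc 1 d, x (c, i₀) = 0) :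
    x ∈ Submodule.span (ZMod 2) {y | ∃ f ∈ oddFaces d, y = errorOn (plaquette d f)} := by
  -- Transposition turns columns into rows and reduces this case to the same sweep, with the parity
  -- of the generators now odd.
  have hX : Commutes d 1 fun i j => x (j, i) := by
    intro i l h1 h2 h3 h4
    refine Eq.trans ?_ (hx (l, i) (mem_evenFaces.2 ⟨h3, h1, h2, by omega⟩))
    rw [sum_plaquette]
    simp only [mem_product, mem_Icc]
    split_ifs <;> first | (exfalso; omega) | ring
  have hsum : x = ∑ f ∈ oddFaces d,
      rowSum (fun i j => x (j, i)) (max f.2 1) f.1 • errorOn (plaquette d f) := by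
    funext ⟨b, a⟩
    rw [Finset.sum_apply]
    simp only [Pi.smul_apply, smul_eq_mul]
    by_cases hq : (b, a) ∈ Icc 1 d ×ˢ Icc 1 d
    · simp only [mem_product, mem_Icc] at hq
      have hgen : ∀ i j, (i, j) ∈ (oddFaces d).map (Equiv.prodComm ℕ ℕ).toEmbedding ↔
          i ≤ d ∧ 1 ≤ j ∧ j ≤ d - 1 ∧ (i + j) % 2 = 1 := by
        intro i j
        rw [Finset.mem_map_equiv]
        change (j, i) ∈ oddFaces d ↔ _
        rw [mem_oddFaces]
        omega
      refine (eq_sum_coeff hgen (by norm_num) hX h₁ h₂ h₀ hq.2.1 hq.2.2 hq.1.1 hq.1.2).trans ?_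
      rw [Finset.sum_map]
      refine Finset.sum_congr rfl fun f _ => ?_
      obtain ⟨i, j⟩ := f
      change _ * errorOn (plaquette d (j, i)) (a, b) = _ * errorOn (plaquette d (i, j)) (b, a)
      congr 1
      simp only [errorOn, mem_plaquette]
      exact if_congr (by tauto) rfl rfl
    · rw [hx0 _ hq, eq_comm]
      refine Finset.sum_eq_zero fun f _ => ?_
      have : (b, a) ∉ plaquette d f := fun h' => hq (Finset.mem_inter.1 h').2
      simp [errorOn, this]
  rw [hsum]
  exact Submodule.sum_mem _ fun f hf =>
    Submodule.smul_mem _ _ (Submodule.subset_span ⟨f, hf, rfl⟩)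

/-! ## The effect of an error on one qubit -/

namespace Circuit

variable (C : Circuit) (b : Basis)

/-- Errors on `q` stay in place in time step `s`. -/
def Stays (s : ℕ) (q : Qubit) : Prop := ¬ C.Prepared s q ∧ ∀ y, ¬ C.Arrow b s q y

/-- Errors on `q` are erased in time step `s`. -/
def Resets (s : ℕ) (q : Qubit) : Prop := C.Prepared s q ∧ ∀ y, ¬ C.Arrow b s q y

/-- Errors on `q` are copied to `y`, and to no other qubit, in time step `s`. -/
def Moves (s : ℕ) (q y : Qubit) : Prop :=
  q ∈ C.qubits ∧ q ≠ y ∧ ¬ C.Prepared s q ∧ ¬ C.Prepared s y ∧ ∀ y', C.Arrow b s q y' ↔ y' = y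

variable {C b} {s : ℕ} {q y : Qubit}

theorem step_single (q' : Qubit) : C.step b s (Pi.single q 1) q' =
    if C.Prepared s q' then 0
    else (if q' = q then 1 else 0) + if q ∈ C.qubits ∧ C.Arrow b s q q' then 1 else 0 := by
  rw [step]
  split_ifs with h1 h2 h3 h3
  · rfl
  all_goals simp only [Pi.single_apply, h2, if_true, if_false, Finset.sum_ite_eq',
    Finset.mem_filter]
  · subst h2
    rw [if_pos h3]
  · subst h2
    rw [if_neg h3]
  · rw [if_pos h3]
  · rw [if_neg h3]

theorem Stays.step_eq (h : C.Stays b s q) : C.step b s (Pi.single q 1) = Pi.single q 1 := by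
  funext q'
  rw [step_single, Pi.single_apply]
  by_cases hq : q' = q
  · subst hq; simp [h.1, h.2]
  · simp [hq, h.2]

theorem Resets.step_eq (h : C.Resets b s q) : C.step b s (Pi.single q 1) = 0 := by
  funext q'
  rw [step_single]
  by_cases hq : q' = q
  · subst hq; simp [h.1]
  · simp [hq, h.2]

theorem Moves.step_eq (h : C.Moves b s q y) :
    C.step b s (Pi.single q 1) = Pi.single q 1 + Pi.single y 1 := by
  obtain ⟨h1, h2, h3, h4, h5⟩ := h
  funext q'
  rw [step_single, Pi.add_apply, Pi.single_apply, Pi.single_apply]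
  simp only [h1, h5, true_and]
  by_cases hq : q' = q
  · subst hq; simp [h3]
  · by_cases hy : q' = y
    · subst hy; simp [h4]
    · simp [hq, hy]

end Circuit

/-! ### What measurements see of an error on one qubit -/

namespace Problem

variable (D : Problem)

/-- The measurements take place within a round. -/
structure Regular : Prop where
  readout_lt : ∀ v ∈ D.checks, ∀ x ∈ D.readout v, x.1 < D.circuit.steps
  flagStep_lt : D.flagStep < D.circuit.steps

/-- The measurement of `q` in time step `s` is neither part of a stabilizer outcome nor a flag. -/
def Silent (s : ℕ) (q : Qubit) : Prop :=
  (∀ v ∈ D.checks, (s, q) ∉ D.readout v) ∧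
  (s = D.flagStep → ∀ φ : Flag, φ.2.1 ∈ D.flaggedFaces → q ≠ φ.qubit)

/-- The effect of a type `err` error on `q` directly after time step `s` of round `t`. -/
def after (T t s : ℕ) (q : Qubit) : Effect :=
  D.pulseEffect T (t * D.circuit.steps + s + 1) (Pi.single q 1)

/-- The effect of a flipped outcome of the stabilizer `v` in round `t`. -/
def vertEffect (t : ℕ) (v : ℕ × ℕ) : Effect := (0, D.boundary (.vert t v), 0)

/-- The effect of a flag. -/
def flagEffect (φ : Flag) : Effect := (0, 0, Pi.single φ 1)

/-- The effect of an error on the data qubit `q` before round `t`. -/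
def spaceEffect (t : ℕ) (q : ℕ × ℕ) : Effect := (errorOn {q}, D.syndrome t (errorOn {q}), 0)

variable {D} {T : ℕ}

theorem index_inj {S t s t' s' : ℕ} (hs : s < S) (hs' : s' < S)
    (h : t * S + s + 1 = t' * S + s' + 1) : t = t' ∧ s = s' := by
  have h1 : t * S + s = t' * S + s' := by omega
  have h2 : (t * S + s) % S = (t' * S + s') % S := by rw [h1]
  rw [mul_comm t, mul_comm t', Nat.mul_add_mod, Nat.mul_add_mod, Nat.mod_eq_of_lt hs,
    Nat.mod_eq_of_lt hs'] at h2
  subst h2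
  exact ⟨Nat.eq_of_mul_eq_mul_right (by omega) (Nat.add_right_cancel h1), rfl⟩

/-- An error at a single instant is seen only by a measurement of this qubit in this time step. A
flipped outcome in round `t` changes the comparison with round `t - 1` and that with round `t + 1`.
The hypothesis `hq` excludes data qubits at the end of a round, as an error there could be part of
the final data error. -/
theorem effectOf_single (hD : D.Regular) {t s : ℕ} (ht : t < T) (hs : s < D.circuit.steps)
    {q : Qubit} (hq : s + 1 < D.circuit.steps ∨ ∀ i j, q ≠ .data i j) :
    D.effectOf T (Pi.single (t * D.circuit.steps + s + 1) (Pi.single q 1)) =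
      (0, fun x => if x.2 ∈ D.checks ∧ (x.1 = t ∨ x.1 = t + 1) ∧ (s, q) ∈ D.readout x.2
        then 1 else 0,
      fun φ => if φ.1 = t ∧ s = D.flagStep ∧ φ.2.1 ∈ D.flaggedFaces ∧ q = φ.qubit
        then 1 else 0) := by
  classical
  set S := D.circuit.steps
  set τ : ℕ → Qubit → ZMod 2 := Pi.single (t * S + s + 1) (Pi.single q 1) with hτ
  have hval : ∀ t' s' q', s' < S → τ (t' * S + s' + 1) q' =
      if t' = t ∧ s' = s ∧ q' = q then 1 else 0 := by
    intro t' s' q' hs'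
    rw [hτ, Pi.single_apply]
    split_ifs with h1 h2 h2
    · obtain ⟨-, -, rfl⟩ := h2; simp
    · obtain ⟨rfl, rfl⟩ := index_inj hs' hs h1
      rw [Pi.single_apply, if_neg fun h => h2 ⟨rfl, rfl, h⟩]
    · obtain ⟨rfl, rfl, -⟩ := h2; exact absurd rfl h1
    · rfl
  have hdata : D.finalData T τ = 0 := by
    funext x
    rw [finalData]
    split_ifs
    · rw [hτ, Pi.single_apply]
      split_ifs with h1
      · rcases hq with hq | hq
        · have : (t + 1) * S ≤ T * S := Nat.mul_le_mul_right _ ht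
          rw [add_mul] at this
          change T * S = _ at h1
          omega
        · rw [Pi.single_apply, if_neg (hq _ _).symm]; rfl
      · rfl
    · rfl
  have hout : ∀ t' v, v ∈ D.checks → D.outcomes T τ t' v =
      if t' = t ∧ (s, q) ∈ D.readout v then 1 else 0 := by
    intro t' v hv
    rw [outcomes, hdata]
    by_cases ht' : t' < T
    · rw [if_pos ht']
      have : ∀ x ∈ D.readout v, τ (t' * D.circuit.steps + x.1 + 1) x.2 =
          if x = (s, q) then (if t' = t then 1 else 0) else 0 := by
        intro x hx
        rw [hval t' x.1 x.2 (hD.readout_lt v hv x hx)]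
        by_cases hx' : x = (s, q)
        · subst hx'; simp
        · rw [if_neg hx', if_neg]
          exact fun h => hx' (Prod.ext h.2.1 h.2.2)
      rw [Finset.sum_congr rfl this, Finset.sum_ite_eq']
      split_ifs <;> simp_all
    · rw [if_neg ht', checkValue_zero]
      refine (if_neg ?_).symm
      rintro ⟨rfl, -⟩
      exact ht' ht
  refine Prod.ext hdata (Prod.ext ?_ ?_)
  · funext x
    change D.changes T τ x = _
    rw [changes]
    by_cases hx : x ∈ range (T + 1) ×ˢ D.checks
    · rw [if_pos hx]
      rw [Finset.mem_product, Finset.mem_range] at hx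
      rw [hout _ _ hx.2, hout _ _ hx.2]
      by_cases hr : (s, q) ∈ D.readout x.2
      · simp only [hr, hx.2, and_true, true_and]
        split_ifs <;> first | rfl | (exfalso; omega)
      · simp [hr]
    · rw [if_neg hx]
      rw [Finset.mem_product, Finset.mem_range] at hx
      exact (if_neg fun h => hx ⟨by omega, h.1⟩).symm
  · funext φ
    change D.flagFlips T τ φ = _
    rw [flagFlips, hval _ _ _ hD.flagStep_lt]
    by_cases h1 : φ.1 = t
    · subst h1
      by_cases h2 : φ.2.1 ∈ D.flaggedFaces
      · simp only [h2, ht, true_and, and_true, if_true]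
        exact if_congr (by rw [eq_comm, @eq_comm _ q]) rfl rfl
      · simp [h2]
    · simp [h1]

theorem effectOf_silent (hD : D.Regular) {t s : ℕ} (ht : t < T) (hs : s < D.circuit.steps)
    {q : Qubit} (hq : s + 1 < D.circuit.steps ∨ ∀ i j, q ≠ .data i j) (h : D.Silent s q) :
    D.effectOf T (Pi.single (t * D.circuit.steps + s + 1) (Pi.single q 1)) = 0 := by
  rw [effectOf_single hD ht hs hq]
  refine Prod.ext rfl (Prod.ext ?_ ?_)
  · funext x
    exact if_neg fun h' => h.1 _ h'.1 h'.2.2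
  · funext φ
    exact if_neg fun h' => h.2 h'.2.1 φ h'.2.2.1 h'.2.2.2

/-- The measurement of `q` in time step `s` contributes to the outcome of the check `v` only. -/
def ReadsCheck (D : Problem) (s : ℕ) (q : Qubit) (v : ℕ × ℕ) : Prop :=
  (∀ v', v' ∈ D.checks ∧ (s, q) ∈ D.readout v' ↔ v' = v) ∧
  (s = D.flagStep → ∀ φ : Flag, φ.2.1 ∈ D.flaggedFaces → q ≠ φ.qubit)

theorem effectOf_readsCheck (hD : D.Regular) {t s : ℕ} (ht : t < T) (hs : s < D.circuit.steps)
    {q : Qubit} (hq : s + 1 < D.circuit.steps ∨ ∀ i j, q ≠ .data i j) {v : ℕ × ℕ}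
    (h : D.ReadsCheck s q v) :
    D.effectOf T (Pi.single (t * D.circuit.steps + s + 1) (Pi.single q 1)) =
      D.vertEffect t v := by
  rw [effectOf_single hD ht hs hq]
  refine Prod.ext rfl (Prod.ext ?_ ?_)
  · funext ⟨t', v'⟩
    change _ = D.boundary (.vert t v) (t', v')
    rw [boundary]
    refine if_congr ?_ rfl rfl
    have h' := h.1 v'
    simp only [ends, mem_insert, mem_singleton, Prod.mk.injEq]
    tauto
  · funext φ
    exact if_neg fun h' => h.2 h'.2.1 φ h'.2.2.1 h'.2.2.2

/-- Two flagged faces could share a flag qubit; `h2` excludes this, so that only one flag is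
flipped. -/
theorem effectOf_flag (hD : D.Regular) {φ : Flag} (ht : φ.1 < T)
    (hf : φ.2.1 ∈ D.flaggedFaces)
    (h1 : ∀ v ∈ D.checks, (D.flagStep, φ.qubit) ∉ D.readout v)
    (h2 : ∀ ψ : Flag, ψ.2.1 ∈ D.flaggedFaces → φ.qubit = ψ.qubit → ψ.2 = φ.2) :
    D.effectOf T (Pi.single (φ.1 * D.circuit.steps + D.flagStep + 1) (Pi.single φ.qubit 1)) =
      flagEffect φ := by
  rw [effectOf_single hD ht hD.flagStep_lt (.inr fun i j => by simp [Flag.qubit])]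
  refine Prod.ext rfl (Prod.ext ?_ ?_)
  · funext x
    exact if_neg fun h' => h1 _ h'.1 h'.2.2
  · funext ψ
    change _ = (Pi.single φ 1 : Flag → ZMod 2) ψ
    rw [Pi.single_apply]
    refine if_congr ⟨?_, ?_⟩ rfl rfl
    · rintro ⟨h3, -, h4, h5⟩
      exact Prod.ext h3 (h2 ψ h4 h5)
    · rintro rfl
      exact ⟨rfl, rfl, hf, rfl⟩

theorem after_eq {t s : ℕ} (hs : s + 1 < D.circuit.steps) (q : Qubit) :
    D.after T t s q =
      D.effectOf T (Pi.single (t * D.circuit.steps + s + 1) (Pi.single q 1)) +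
      D.pulseEffect T (t * D.circuit.steps + (s + 1) + 1)
        (D.circuit.step D.err (s + 1) (Pi.single q 1)) := by
  rw [after, pulseEffect_eq]
  have : (t * D.circuit.steps + s + 1) % D.circuit.steps = s + 1 := by
    rw [add_assoc, mul_comm, Nat.mul_add_mod, Nat.mod_eq_of_lt hs]
  rw [this]
  rfl

theorem after_of_resets {t s : ℕ} (hs : s + 1 < D.circuit.steps) {q : Qubit}
    (h : D.circuit.Resets D.err (s + 1) q) :
    D.after T t s q =
      D.effectOf T (Pi.single (t * D.circuit.steps + s + 1) (Pi.single q 1)) := by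
  rw [after_eq hs, h.step_eq, pulseEffect_zero, add_zero]

section Rules

variable (hD : D.Regular) {t s : ℕ} (ht : t < T) (hs : s + 1 < D.circuit.steps) {q y : Qubit}

include hD ht hs

theorem after_of_stays (h : D.circuit.Stays D.err (s + 1) q) (hq : D.Silent s q) :
    D.after T t s q = D.after T t (s + 1) q := by
  rw [after_eq hs, effectOf_silent hD ht (by omega) (.inl hs) hq, h.step_eq, zero_add]
  rfl

theorem after_of_moves (h : D.circuit.Moves D.err (s + 1) q y) (hq : D.Silent s q) :
    D.after T t s q = D.after T t (s + 1) q + D.after T t (s + 1) y := by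
  rw [after_eq hs, effectOf_silent hD ht (by omega) (.inl hs) hq, h.step_eq, zero_add,
    pulseEffect_add]
  rfl

end Rules

theorem after_eq_of_stays (hD : D.Regular) {t : ℕ} (ht : t < T) {s s' : ℕ} (hss : s ≤ s')
    (hs' : s' < D.circuit.steps) {q : Qubit}
    (h : ∀ u, s ≤ u → u < s' → D.circuit.Stays D.err (u + 1) q ∧ D.Silent u q) :
    D.after T t s q = D.after T t s' q := by
  induction s', hss using Nat.le_induction with
  | base => rfl
  | succ n hn ih =>
    obtain ⟨h1, h2⟩ := h n hn (Nat.lt_succ_self n)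
    rw [ih (by omega) fun u hu hu' => h u hu (by omega), after_of_stays hD ht hs' h1 h2]

/-- After the last round nothing has an effect. -/
theorem pulseEffect_eq_zero (hD : D.Regular) {k : ℕ} (hk : T * D.circuit.steps < k)
    (f : Qubit → ZMod 2) : D.pulseEffect T k f = 0 := by
  have h0 : ∀ j ≤ T * D.circuit.steps, D.circuit.pulse D.err k f j = 0 := fun j hj =>
    D.circuit.pulse_of_lt D.err (by omega) f
  have hle : ∀ t s, t < T → s < D.circuit.steps →
      t * D.circuit.steps + s + 1 ≤ T * D.circuit.steps := by
    intro t s ht hs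
    have : (t + 1) * D.circuit.steps ≤ T * D.circuit.steps := Nat.mul_le_mul_right _ ht
    rw [add_mul] at this
    omega
  have hdata : D.finalData T (D.circuit.pulse D.err k f) = 0 := by
    funext q
    rw [finalData, h0 _ le_rfl]
    simp
  have hout : ∀ t v, v ∈ D.checks → D.outcomes T (D.circuit.pulse D.err k f) t v = 0 := by
    intro t v hv
    rw [outcomes, hdata]
    split_ifs with ht
    · refine Finset.sum_eq_zero fun x hx => ?_
      rw [h0 _ (hle t x.1 ht (hD.readout_lt v hv x hx))]; rfl
    · simp
  refine Prod.ext hdata (Prod.ext ?_ ?_)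
  · funext x
    change D.changes T _ x = 0
    rw [changes]
    split_ifs with h1 h2
    · rw [hout _ _ (Finset.mem_product.1 h1).2, sub_zero]
    · rw [hout _ _ (Finset.mem_product.1 h1).2, hout _ _ (Finset.mem_product.1 h1).2, sub_zero]
    · rfl
  · funext φ
    change D.flagFlips T _ φ = 0
    rw [flagFlips]
    split_ifs with h1
    · rw [h0 _ (hle _ _ h1.1 hD.flagStep_lt)]; rfl
    · rfl

theorem succ_mul_eq (S t : ℕ) (hS : 0 < S) : t * S + (S - 1) + 1 = (t + 1) * S := by
  rw [add_mul]; omega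

/-- In time step `s`, errors on `q` stay in place and are not seen by a measurement. -/
def Quiet (D : Problem) (s : ℕ) (q : Qubit) : Prop := D.circuit.Stays D.err s q ∧ D.Silent s q

/-- After time step `s`, errors on `q` have no effect. -/
def Forgotten (D : Problem) (T s : ℕ) (q : Qubit) : Prop := ∀ t < T, D.after T t s q =
  D.effectOf T (Pi.single (t * D.circuit.steps + s + 1) (Pi.single q 1))

theorem Forgotten.after_eq_zero (hD : D.Regular) {s : ℕ} (hs : s < D.circuit.steps) {q : Qubit}
    (hq : ∀ i j, q ≠ .data i j) (h : D.Forgotten T s q) (h' : D.Silent s q) {t : ℕ} (ht : t < T) :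
    D.after T t s q = 0 := by
  rw [h t ht, effectOf_silent hD ht hs (.inr hq) h']

/-- Until the qubit is prepared again in the same round, it neither interacts nor is read. -/
theorem forgotten_of_resets (hD : D.Regular) {s u : ℕ} (hsu : s < u) (hu : u < D.circuit.steps)
    {q : Qubit} (hr : D.circuit.Resets D.err u q) (h : ∀ v, s < v → v < u → D.Quiet v q) :
    D.Forgotten T s q := by
  intro t ht
  rcases Nat.lt_or_ge (s + 1) u with h1 | h1
  · obtain ⟨n, rfl⟩ := Nat.exists_eq_add_of_lt h1
    rw [after_eq (by omega), (h (s + 1) (by omega) h1).1.step_eq]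
    change _ + D.after T t (s + 1) q = _
    rw [after_eq_of_stays hD ht (show s + 1 ≤ s + 1 + n by omega) (by omega) fun v hv hv' =>
      ⟨(h (v + 1) (by omega) (by omega)).1, (h v (by omega) (by omega)).2⟩,
      after_of_resets hu hr, effectOf_silent hD ht (by omega) (.inl (by omega))
        (h (s + 1 + n) (by omega) (by omega)).2, add_zero]
  · obtain rfl : u = s + 1 := by omega
    exact after_of_resets hu hr

/-- The error survives until the next round and is erased there by the preparation in step `u`,
before the qubit interacts or is read. After the last round nothing is left that could see it. -/
theorem forgotten_of_wrap (hD : D.Regular) {s u : ℕ} (hs : s < D.circuit.steps)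
    (hu : u < D.circuit.steps) {q : Qubit} (hq : ∀ i j, q ≠ .data i j)
    (hr : D.circuit.Resets D.err u q)
    (h : ∀ v < D.circuit.steps, v < u ∨ s < v → D.Quiet v q) : D.Forgotten T s q := by
  have hlast : D.Forgotten T (D.circuit.steps - 1) q := by
    intro t ht
    rw [after, pulseEffect_eq, succ_mul_eq _ _ (by omega)]
    suffices h : D.pulseEffect T ((t + 1) * D.circuit.steps + 1)
        (D.circuit.step D.err ((t + 1) * D.circuit.steps % D.circuit.steps) (Pi.single q 1)) = 0 by
      rw [h, add_zero]
    rw [Nat.mul_mod_left]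
    rcases Nat.lt_or_ge (t + 1) T with h1 | h1
    · rcases Nat.eq_zero_or_pos u with rfl | hpos
      · rw [hr.step_eq, pulseEffect_zero]
      · rw [(h 0 (by omega) (.inl hpos)).1.step_eq]
        change D.after T (t + 1) 0 q = 0
        exact (forgotten_of_resets hD hpos hu hr fun v _ hv =>
          h v (by omega) (.inl hv)).after_eq_zero hD (by omega) hq (h 0 (by omega) (.inl hpos)).2 h1
    -- This is the end of the last noisy round.
    · refine pulseEffect_eq_zero hD ?_ _
      have := Nat.mul_le_mul_right D.circuit.steps h1
      omega
  intro t ht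
  rcases Nat.lt_or_ge (s + 1) D.circuit.steps with h1 | h1
  · rw [after_eq h1, (h (s + 1) h1 (.inr (by omega))).1.step_eq]
    change _ + D.after T t (s + 1) q = _
    rw [after_eq_of_stays hD ht (show s + 1 ≤ D.circuit.steps - 1 by omega) (by omega)
      fun v hv hv' => ⟨(h (v + 1) (by omega) (by omega)).1, (h v (by omega) (by omega)).2⟩,
      hlast.after_eq_zero hD (by omega) hq (h _ (by omega) (.inr (by omega))).2 ht, add_zero]
  · obtain rfl : s = D.circuit.steps - 1 := by omega
    exact hlast t ht

/-! ## Errors on data qubits -/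

/-- Since no measurement reads a data qubit, an instantaneous error on it matters only at the very
end, where it is seen by the noiseless readout as a space edge in layer `T`. -/
theorem effectOf_data (hr : ∀ v ∈ D.checks, ∀ x ∈ D.readout v,
    ∀ i j, x.2 ≠ .data i j) {q : ℕ × ℕ} (hq : q ∈ D.lattice) (k : ℕ) :
    D.effectOf T (Pi.single k (Pi.single (.data q.1 q.2) 1)) =
      if k = T * D.circuit.steps then D.spaceEffect T q else 0 := by
  classical
  set τ : ℕ → Qubit → ZMod 2 := Pi.single k (Pi.single (.data q.1 q.2) 1) with hτ
  have hdata : D.finalData T τ = if k = T * D.circuit.steps then errorOn {q} else 0 := by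
    funext x
    rw [finalData, hτ]
    by_cases h1 : k = T * D.circuit.steps
    · rw [if_pos h1, h1, Pi.single_eq_same, Pi.single_apply, errorOn]
      by_cases hx : x = q
      · subst hx; simp [hq]
      · have : Qubit.data x.1 x.2 ≠ Qubit.data q.1 q.2 := fun h => hx (by
          rw [Qubit.data.injEq] at h; exact Prod.ext h.1 h.2)
        simp [hx, this]
    · rw [if_neg h1, Pi.single_apply, if_neg (Ne.symm h1)]
      simp
  have hout : ∀ t v, v ∈ D.checks → D.outcomes T τ t v =
      if t < T then 0 else D.checkValue (D.finalData T τ) v := by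
    intro t v hv
    rw [outcomes]
    split_ifs with ht
    · refine Finset.sum_eq_zero fun x hx => ?_
      rw [hτ, Pi.single_apply]
      split_ifs
      · rw [Pi.single_apply, if_neg (hr v hv x hx _ _)]
      · rfl
    · rfl
  have hflag : D.flagFlips T τ = 0 := by
    funext φ
    rw [flagFlips, hτ, Pi.single_apply]
    split_ifs
    · simp [Flag.qubit]
    · rfl
    · rfl
  have hch : D.changes T τ = D.syndrome T (D.finalData T τ) := by
    funext x
    rw [changes, syndrome]
    by_cases hx : x ∈ range (T + 1) ×ˢ D.checks
    · rw [if_pos hx]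
      rw [Finset.mem_product, Finset.mem_range] at hx
      rw [hout _ _ hx.2, hout _ _ hx.2]
      by_cases h1 : x.1 = T
      · have h3 : T ≠ 0 → T - 1 < T := by omega
        simp +contextual [h1, hx.2, h3]
      · have h2 : x.1 < T := by omega
        have h3 : x.1 - 1 < T := by omega
        simp [h1, h2, h3]
    · rw [if_neg hx, if_neg]
      rintro ⟨h1, h2⟩
      exact hx (by simp [h1, h2])
  have : D.effectOf T τ = (D.finalData T τ, D.syndrome T (D.finalData T τ), 0) :=
    Prod.ext rfl (Prod.ext hch hflag)
  rw [this, hdata]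
  split_ifs
  · rfl
  · refine Prod.ext rfl (Prod.ext ?_ rfl)
    simp

/-- The measurements read no data qubits. -/
theorem silent_data (hr : ∀ v ∈ D.checks, ∀ x ∈ D.readout v, ∀ i j, x.2 ≠ .data i j) (s i j : ℕ) :
    D.Silent s (.data i j) :=
  ⟨fun v hv h => hr v hv _ h i j rfl, fun _ φ _ => by simp [Flag.qubit]⟩

/-- An error on the data qubit `q` at some time of a round: before the time step `lo` it is as good
as before the round, and from the time step `hi` on it is as good as after the round. -/
def DataRule (D : Problem) (T : ℕ) (layer : ℕ → ℕ) (lo hi : ℕ) (q : ℕ × ℕ) : Prop :=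
  ∀ t < T, ∀ s < D.circuit.steps, D.Elementary T layer (D.after T t s (.data q.1 q.2)) ∧
    (s < lo → D.after T t s (.data q.1 q.2) = D.spaceEffect t q) ∧
    (hi ≤ s → D.after T t s (.data q.1 q.2) = D.spaceEffect (t + 1) q)

section Data

variable (hD : D.Regular) (hr : ∀ v ∈ D.checks, ∀ x ∈ D.readout v, ∀ i j, x.2 ≠ .data i j)
  {q : ℕ × ℕ} (hq : q ∈ D.lattice)

include hD hr hq in
/-- Downward induction over the rounds. -/
theorem pulseEffect_data (hS : 0 < D.circuit.steps)
    (h0 : D.circuit.Stays D.err 0 (.data q.1 q.2))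
    (hround : ∀ t < T, D.after T t (D.circuit.steps - 1) (.data q.1 q.2) = D.spaceEffect (t + 1) q →
      D.after T t 0 (.data q.1 q.2) = D.spaceEffect t q) (t : ℕ) (ht : t ≤ T) :
    D.pulseEffect T (t * D.circuit.steps) (Pi.single (.data q.1 q.2) 1) = D.spaceEffect t q := by
  induction ht using Nat.decreasingInduction with
  | self =>
    rw [pulseEffect_eq, effectOf_data hr hq, if_pos rfl,
      pulseEffect_eq_zero hD (Nat.lt_succ_self _), add_zero]
  | of_succ t ht ih =>
    rw [pulseEffect_eq, effectOf_data hr hq, if_neg, zero_add, Nat.mul_mod_left, h0.step_eq]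
    · refine hround t ht ?_
      rw [after, succ_mul_eq _ _ hS, ih]
    · intro h
      have := Nat.eq_of_mul_eq_mul_right hS h
      omega

include hD hr hq in
/-- A data qubit with two checks, which are affected by its errors in time steps `s₁ < s₂`. -/
theorem dataRule_two {layer : ℕ → ℕ} {lo hi s₁ s₂ : ℕ} {v₁ v₂ : ℕ × ℕ} {y₁ y₂ : Qubit}
    (h1 : 1 ≤ s₁) (h12 : s₁ < s₂) (h2 : s₂ < D.circuit.steps)
    (hlo : lo ≤ s₁) (hhi : s₂ ≤ hi)
    (hv : v₁ ≠ v₂) (hc : ∀ v, v ∈ D.checks ∧ q ∈ plaquette D.d v ↔ v = v₁ ∨ v = v₂)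
    (hst : ∀ s, s ≠ s₁ → s ≠ s₂ → D.circuit.Stays D.err s (.data q.1 q.2))
    (hm₁ : D.circuit.Moves D.err s₁ (.data q.1 q.2) y₁)
    (hm₂ : D.circuit.Moves D.err s₂ (.data q.1 q.2) y₂)
    (ha₁ : ∀ t < T, D.after T t s₁ y₁ = D.vertEffect t v₁)
    (ha₂ : ∀ t < T, D.after T t s₂ y₂ = D.vertEffect t v₂) : D.DataRule T layer lo hi q := by
  have hsil := silent_data hr
  have hsyn : ∀ t' t v, D.syndrome t (errorOn {q}) (t', v) =
      if t' = t ∧ (v = v₁ ∨ v = v₂) then 1 else 0 := by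
    intro t' t v
    rw [syndrome]
    have : D.checkValue (errorOn {q}) v = if q ∈ plaquette D.d v then 1 else 0 := by
      simp [checkValue, errorOn, Finset.sum_ite_eq']
    rw [this, ← ite_and]
    exact if_congr (by rw [← hc]; tauto) rfl rfl
  -- An error between the two couplings is missed by `v₁` in this round and seen by `v₂`: this is
  -- the diagonal edge from `v₂` in layer `t` to `v₁` in layer `t + 1`.
  have e1 : ∀ t, D.spaceEffect (t + 1) q + D.vertEffect t v₂ =
      (errorOn {q}, D.boundary (.diag t q v₂ v₁), 0) := by
    intro t
    refine Prod.ext (add_zero _) (Prod.ext ?_ (add_zero _))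
    funext ⟨t', v⟩
    change D.syndrome (t + 1) (errorOn {q}) (t', v) + D.boundary (.vert t v₂) (t', v) =
      D.boundary (.diag t q v₂ v₁) (t', v)
    rw [hsyn, boundary, boundary]
    simp only [ends, mem_insert, mem_singleton, Prod.mk.injEq]
    by_cases g1 : v = v₁
    · subst g1
      simp only [hv, and_false, or_false, if_false, add_zero, and_true, false_or]
    · by_cases g2 : v = v₂
      · subst g2
        simp only [g1, and_true, or_true, and_false, or_false]
        split_ifs <;> first | rfl | (exfalso; omega)
      · simp [g1, g2]
  -- Before the first coupling `v₁` sees the error too, which moves this end of the edge to layer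
  -- `t`.
  have e2 : ∀ t, ((errorOn {q}, D.boundary (.diag t q v₂ v₁), 0) : Effect) + D.vertEffect t v₁ =
      D.spaceEffect t q := by
    intro t
    refine Prod.ext (add_zero _) (Prod.ext ?_ (add_zero _))
    funext ⟨t', v⟩
    change D.boundary (.diag t q v₂ v₁) (t', v) + D.boundary (.vert t v₁) (t', v) =
      D.syndrome t (errorOn {q}) (t', v)
    rw [hsyn, boundary, boundary]
    simp only [ends, mem_insert, mem_singleton, Prod.mk.injEq]
    by_cases g1 : v = v₁
    · subst g1
      simp only [hv, and_true, true_or, and_false, false_or]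
      split_ifs <;> first | rfl | (exfalso; omega)
    · by_cases g2 : v = v₂
      · subst g2
        simp [g1]
      · simp [g1, g2]
  have r3 : ∀ t < T, ∀ s, s₂ ≤ s → s < D.circuit.steps → D.after T t s (.data q.1 q.2) =
      D.after T t (D.circuit.steps - 1) (.data q.1 q.2) := fun t ht s hs hs' =>
    after_eq_of_stays hD ht (by omega) (by omega) fun u hu hu' =>
      ⟨hst _ (by omega) (by omega), hsil _ _ _⟩
  have r2 : ∀ t < T, D.after T t (D.circuit.steps - 1) (.data q.1 q.2) = D.spaceEffect (t + 1) q →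
      ∀ s, s₁ ≤ s → s < s₂ → D.after T t s (.data q.1 q.2) =
        (errorOn {q}, D.boundary (.diag t q v₂ v₁), 0) := by
    intro t ht hE s hs hs'
    obtain ⟨n, rfl⟩ := Nat.exists_eq_add_of_le' (show 1 ≤ s₂ by omega)
    rw [after_eq_of_stays hD ht (show s ≤ n by omega) (by omega) fun u hu hu' =>
      ⟨hst _ (by omega) (by omega), hsil _ _ _⟩, after_of_moves hD ht h2 hm₂ (hsil _ _ _),
      r3 t ht _ le_rfl h2, hE, ha₂ t ht, e1]
  have r1 : ∀ t < T, D.after T t (D.circuit.steps - 1) (.data q.1 q.2) = D.spaceEffect (t + 1) q →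
      ∀ s, s < s₁ → D.after T t s (.data q.1 q.2) = D.spaceEffect t q := by
    intro t ht hE s hs
    obtain ⟨n, rfl⟩ := Nat.exists_eq_add_of_le' h1
    rw [after_eq_of_stays hD ht (show s ≤ n by omega) (by omega) fun u hu hu' =>
      ⟨hst _ (by omega) (by omega), hsil _ _ _⟩, after_of_moves hD ht (by omega) hm₁ (hsil _ _ _),
      r2 t ht hE _ le_rfl h12, ha₁ t ht, e2]
  -- `r1` at `s = 0` is the induction step over the rounds; its result discharges the assumption in
  -- `r1` and `r2` about the end of the round.
  have hall := pulseEffect_data (T := T) hD hr hq (by omega) (hst 0 (by omega) (by omega))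
    fun t ht hE => r1 t ht hE 0 (by omega)
  have hE : ∀ t < T, D.after T t (D.circuit.steps - 1) (.data q.1 q.2) =
      D.spaceEffect (t + 1) q := by
    intro t ht
    rw [after, succ_mul_eq _ _ (by omega), hall _ ht]
  intro t ht s hs
  rcases Nat.lt_or_ge s s₁ with g1 | g1
  · rw [r1 t ht (hE t ht) s g1]
    exact ⟨.space ht.le hq, fun _ => rfl, fun h => absurd h (by omega)⟩
  · rcases Nat.lt_or_ge s s₂ with g2 | g2
    · rw [r2 t ht (hE t ht) s g1 g2]
      exact ⟨.diag hq, fun h => absurd h (by omega), fun h => absurd h (by omega)⟩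
    · rw [r3 t ht s g2 hs, hE t ht]
      exact ⟨.space ht hq, fun h => absurd h (by omega), fun _ => rfl⟩

include hD hr hq in
/-- A data qubit with one check, which is affected by its errors in time step `s₁`. -/
theorem dataRule_one {layer : ℕ → ℕ} {lo hi s₁ : ℕ} {v₁ : ℕ × ℕ} {y₁ : Qubit}
    (h1 : 1 ≤ s₁) (h2 : s₁ < D.circuit.steps) (hlo : lo ≤ s₁) (hhi : s₁ ≤ hi)
    (hc : ∀ v, v ∈ D.checks ∧ q ∈ plaquette D.d v ↔ v = v₁)
    (hst : ∀ s, s ≠ s₁ → D.circuit.Stays D.err s (.data q.1 q.2))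
    (hm₁ : D.circuit.Moves D.err s₁ (.data q.1 q.2) y₁)
    (ha₁ : ∀ t < T, D.after T t s₁ y₁ = D.vertEffect t v₁) : D.DataRule T layer lo hi q := by
  have hsil := silent_data hr
  have hsyn : ∀ t' t v, D.syndrome t (errorOn {q}) (t', v) =
      if t' = t ∧ v = v₁ then 1 else 0 := by
    intro t' t v
    rw [syndrome]
    have : D.checkValue (errorOn {q}) v = if q ∈ plaquette D.d v then 1 else 0 := by
      simp [checkValue, errorOn, Finset.sum_ite_eq']
    rw [this, ← ite_and]
    exact if_congr (by rw [← hc]; tauto) rfl rfl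
  have e1 : ∀ t, D.spaceEffect (t + 1) q + D.vertEffect t v₁ = D.spaceEffect t q := by
    intro t
    refine Prod.ext (add_zero _) (Prod.ext ?_ (add_zero _))
    funext ⟨t', v⟩
    change D.syndrome (t + 1) (errorOn {q}) (t', v) + D.boundary (.vert t v₁) (t', v) =
      D.syndrome t (errorOn {q}) (t', v)
    rw [hsyn, hsyn, boundary]
    simp only [ends, mem_insert, mem_singleton, Prod.mk.injEq]
    by_cases g1 : v = v₁
    · simp only [g1, and_true]
      split_ifs <;> first | rfl | (exfalso; omega)
    · simp [g1]
  have r3 : ∀ t < T, ∀ s, s₁ ≤ s → s < D.circuit.steps → D.after T t s (.data q.1 q.2) =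
      D.after T t (D.circuit.steps - 1) (.data q.1 q.2) := fun t ht s hs hs' =>
    after_eq_of_stays hD ht (by omega) (by omega) fun u hu hu' =>
      ⟨hst _ (by omega), hsil _ _ _⟩
  have r1 : ∀ t < T, D.after T t (D.circuit.steps - 1) (.data q.1 q.2) = D.spaceEffect (t + 1) q →
      ∀ s, s < s₁ → D.after T t s (.data q.1 q.2) = D.spaceEffect t q := by
    intro t ht hE s hs
    obtain ⟨n, rfl⟩ := Nat.exists_eq_add_of_le' h1
    rw [after_eq_of_stays hD ht (show s ≤ n by omega) (by omega) fun u hu hu' =>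
      ⟨hst _ (by omega), hsil _ _ _⟩, after_of_moves hD ht h2 hm₁ (hsil _ _ _),
      r3 t ht _ le_rfl h2, hE, ha₁ t ht, e1]
  have hall := pulseEffect_data (T := T) hD hr hq (by omega) (hst 0 (by omega))
    fun t ht hE => r1 t ht hE 0 (by omega)
  have hE : ∀ t < T, D.after T t (D.circuit.steps - 1) (.data q.1 q.2) =
      D.spaceEffect (t + 1) q := by
    intro t ht
    rw [after, succ_mul_eq _ _ (by omega), hall _ ht]
  intro t ht s hs
  rcases Nat.lt_or_ge s s₁ with g1 | g1
  · rw [r1 t ht (hE t ht) s g1]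
    exact ⟨.space ht.le hq, fun _ => rfl, fun h => absurd h (by omega)⟩
  · rw [r3 t ht s g1 hs, hE t ht]
    exact ⟨.space ht hq, fun h => absurd h (by omega), fun _ => rfl⟩

end Data

end Problem

namespace Problem

variable {D : Problem} {T : ℕ}

/-! ## The effects of the faults of an operation -/

theorem mem_gates_of_mem_ops {C : Circuit} {s : ℕ} {o : Op} (h : o ∈ C.ops s) :
    (s, o) ∈ C.gates ∨ ∃ q ∈ C.qubits, o = .idle q := by
  simp only [Circuit.ops, Circuit.gatesAt, mem_union, mem_image, mem_filter, mem_sdiff] at h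
  rcases h with ⟨⟨s', o'⟩, ⟨h1, rfl⟩, rfl⟩ | ⟨q, h1, rfl⟩
  · exact .inl h1
  · exact .inr ⟨q, h1.1, rfl⟩

theorem mem_ops_of_mem_gates {C : Circuit} {s : ℕ} {o : Op} (h : (s, o) ∈ C.gates) :
    o ∈ C.ops s :=
  mem_union_left _ (mem_image.2 ⟨(s, o), mem_filter.2 ⟨h, rfl⟩, rfl⟩)

theorem idle_mem_ops {C : Circuit} {s : ℕ} {q : Qubit} (hq : q ∈ C.qubits)
    (h : ∀ o, (s, o) ∈ C.gates → q ∉ o.acts) : Op.idle q ∈ C.ops s := by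
  refine mem_union_right _ (mem_image_of_mem _ (mem_sdiff.2 ⟨hq, fun h' => ?_⟩))
  simp only [Circuit.gatesAt, mem_biUnion, mem_image, mem_filter] at h'
  obtain ⟨o, ⟨⟨s', o'⟩, ⟨h1, rfl⟩, rfl⟩, h2⟩ := h'
  exact h _ h1 h2

theorem effect_idle {t s : ℕ} {q : Qubit}
    (h : ((t, s, .idle q) : Location) ∈ D.circuit.locations T) :
    D.effect T (Pi.single (t, s, .idle q) (Pi.single D.err 1, 0)) = D.after T t s q := by
  rw [effect_single D h, after]
  congr 1
  funext q'
  simp only [Op.spread, Pi.single_apply]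
  split_ifs <;> simp

theorem singleEffect_idle {t s : ℕ} {q : Qubit} (ht : t < T) (hs : s < D.circuit.steps)
    (h : Op.idle q ∈ D.circuit.ops s) : D.SingleEffect T (D.after T t s q) := by
  have hl : ((t, s, .idle q) : Location) ∈ D.circuit.locations T := mem_locations.2 ⟨ht, hs, h⟩
  refine ⟨_, hl, (Pi.single D.err 1, 0), ?_, effect_idle hl⟩
  simp [Op.errors]

theorem effect_cnot {t s : ℕ} {c q : Qubit}
    (h : ((t, s, .cnot c q) : Location) ∈ D.circuit.locations T) (a : Pauli × Pauli) :
    D.effect T (Pi.single (t, s, .cnot c q) a) =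
      D.pulseEffect T (t * D.circuit.steps + s + 1)
        (Pi.single c (a.1 D.err) + Pi.single q (a.2 D.err)) := by
  rw [effect_single D h]
  congr 1
  funext q'
  simp only [Op.spread, Pi.add_apply, Pi.single_apply]
  split_ifs <;> rfl

/-- The faults after a CNOT include an error on either qubit alone. For `Z` errors control and
target exchange roles. -/
theorem singleEffect_arrow {t s : ℕ} {x y : Qubit} (ht : t < T) (hs : s < D.circuit.steps)
    (h : D.circuit.Arrow D.err s x y) :
    D.SingleEffect T (D.after T t s x) ∧ D.SingleEffect T (D.after T t s y) := by
  have key : ∀ c q, (s, Op.cnot c q) ∈ D.circuit.gates →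
      D.SingleEffect T (D.after T t s c) ∧ D.SingleEffect T (D.after T t s q) := by
    intro c q h
    have hl : ((t, s, .cnot c q) : Location) ∈ D.circuit.locations T :=
      mem_locations.2 ⟨ht, hs, mem_ops_of_mem_gates h⟩
    refine ⟨⟨_, hl, (Pi.single D.err 1, 0), by simp [Op.errors], ?_⟩,
      ⟨_, hl, (0, Pi.single D.err 1), by simp [Op.errors], ?_⟩⟩
    · exact (effect_cnot hl _).trans (by simp [after])
    · exact (effect_cnot hl _).trans (by simp [after])
  revert h
  cases D.err
  · exact key x y
  · exact fun h => (key y x h).symm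

theorem elementary_zero (D : Problem) (T : ℕ) (layer : ℕ → ℕ) : D.Elementary T layer 0 :=
  .neutral (zero_mem _)

/-- A fault on both qubits of a CNOT has the effect of an error on the source alone directly before
it: this is `after_of_moves` read backwards. Hence it suffices to know the effects of errors on
single qubits. The hypothesis `hc` says that every CNOT has an earlier step in the round, in which
its source is not read. -/
theorem elementary_effect {layer : ℕ → ℕ}
    (hq : ∀ t < T, ∀ s < D.circuit.steps, ∀ q ∈ D.circuit.qubits,
      D.Elementary T layer (D.after T t s q))
    (ha : ∀ s o, (s, o) ∈ D.circuit.gates → o.acts ⊆ D.circuit.qubits)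
    (hD : D.Regular)
    (hc : ∀ s < D.circuit.steps, ∀ x y, D.circuit.Arrow D.err s x y →
      1 ≤ s ∧ D.circuit.Moves D.err s x y ∧ D.Silent (s - 1) x)
    {l : Location} (hl : l ∈ D.circuit.locations T) (a : Pauli × Pauli) :
    D.Elementary T layer (D.effect T (Pi.single l a)) := by
  obtain ⟨t, s, o⟩ := l
  obtain ⟨ht, hs, ho⟩ := mem_locations.1 hl
  dsimp only at ht hs ho
  have zero_or_one : ∀ z : ZMod 2, z = 0 ∨ z = 1 := by decide
  have one : ∀ q ∈ D.circuit.qubits, (∀ q', o.spread a q' = if q' = q then a.1 else 0) →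
      D.Elementary T layer (D.effect T (Pi.single (t, s, o) a)) := by
    intro q hq' h
    have h1 : (fun q' => o.spread a q' D.err) = Pi.single q (a.1 D.err) := by
      funext q'
      rw [h, Pi.single_apply]
      split_ifs <;> rfl
    rw [effect_single D hl]
    change D.Elementary T layer (D.pulseEffect T _ fun q' => o.spread a q' D.err)
    rw [h1]
    rcases zero_or_one (a.1 D.err) with h2 | h2
    · rw [h2, Pi.single_zero, pulseEffect_zero]
      exact elementary_zero D T layer
    · rw [h2]
      exact hq t ht s hs q hq'
  rcases mem_gates_of_mem_ops ho with h | ⟨q, hq', rfl⟩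
  swap
  · exact one q hq' fun _ => rfl
  have hacts := ha s o h
  cases o with
  | idle q => exact one q (hacts (by simp [Op.acts])) fun _ => rfl
  | prep b q => exact one q (hacts (by simp [Op.acts])) fun _ => rfl
  | meas b q => exact one q (hacts (by simp [Op.acts])) fun _ => rfl
  | cnot c q =>
    rw [effect_cnot hl]
    have h2 : D.Elementary T layer (D.after T t s c + D.after T t s q) := by
      have key : ∀ x y, D.circuit.Arrow D.err s x y → x ∈ D.circuit.qubits →
          D.Elementary T layer (D.after T t s x + D.after T t s y) := by
        intro x y hxy hx
        obtain ⟨h1, h2, h3⟩ := hc s hs x y hxy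
        obtain ⟨n, rfl⟩ := Nat.exists_eq_add_of_le' h1
        rw [← after_of_moves hD ht hs h2 h3]
        exact hq t ht n (by omega) x hx
      cases hb : D.err
      · exact key c q (by rw [hb]; exact h) (hacts (by simp [Op.acts]))
      · rw [add_comm]
        exact key q c (by rw [hb]; exact h) (hacts (by simp [Op.acts]))
    have hc1 := hq t ht s hs c (hacts (by simp [Op.acts]))
    have hc2 := hq t ht s hs q (hacts (by simp [Op.acts]))
    rcases zero_or_one (a.1 D.err) with h3 | h3 <;> rcases zero_or_one (a.2 D.err) with h4 | h4
    · simpa [h3, h4] using elementary_zero D T layer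
    · simpa [h3, h4, after] using hc2
    · simpa [h3, h4, after] using hc1
    · rw [h3, h4, pulseEffect_add]
      exact h2

/-! ## Measurement qubits -/

/-- An error that stays in place until the measurement in step `m` and is erased afterwards has
exactly the effect of flipping this measurement. -/
theorem after_read (hD : D.Regular) {t : ℕ} (ht : t < T) {s m : ℕ} (hsm : s ≤ m)
    (hm : m < D.circuit.steps) {q : Qubit}
    (hst : ∀ v, s < v → v ≤ m → D.circuit.Stays D.err v q)
    (hsil : ∀ v, s ≤ v → v < m → D.Silent v q) (hf : D.Forgotten T m q) : D.after T t s q =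
      D.effectOf T (Pi.single (t * D.circuit.steps + m + 1) (Pi.single q 1)) := by
  rw [after_eq_of_stays hD ht hsm hm fun u hu hu' =>
    ⟨hst _ (by omega) (by omega), hsil _ hu hu'⟩, hf t ht]

theorem effect_add_self (w : Effect) : w + w = 0 :=
  Prod.ext (add_self _) (Prod.ext (funext fun _ => CharTwo.add_self_eq_zero _)
    (funext fun _ => CharTwo.add_self_eq_zero _))

/-- The effect of the data error `x` in layer `t`. -/
def dataEffect (D : Problem) (t : ℕ) (x : DataError) : Effect := (x, D.syndrome t x, 0)

theorem dataEffect_add (t : ℕ) (x y : DataError) :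
    D.dataEffect t (x + y) = D.dataEffect t x + D.dataEffect t y :=
  Prod.ext rfl (Prod.ext (D.syndrome_add t x y) (add_zero 0).symm)

theorem flagEffect_add (φ : Flag) (t : ℕ) (x : DataError) :
    flagEffect φ + D.dataEffect t x = (x, D.syndrome t x, Pi.single φ 1) :=
  Prod.ext (zero_add _) (Prod.ext (zero_add _) (add_zero _))

/-! ### The flagged measurement of a weight-four operator -/

/-- The measurement of a generator on a weight-four face, in the time steps `s₀, …, s₀ + 6`, as seen
by the errors of the same type. -/
structure SpreadWindow (D : Problem) (T : ℕ) (layer : ℕ → ℕ) (s₀ i j : ℕ) : Prop where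
  lt : s₀ + 6 < D.circuit.steps
  mem : (i, j) ∈ D.flaggedFaces
  anc_mem : .anc i j ∈ D.circuit.qubits
  left_mem : .flag i j ∈ D.circuit.qubits
  right_mem : .flag i (j + 1) ∈ D.circuit.qubits
  prepared : ∀ k, 1 ≤ k → k ≤ 6 → ¬ D.circuit.Prepared (s₀ + k) (.anc i j) ∧
    ¬ D.circuit.Prepared (s₀ + k) (.flag i j) ∧ ¬ D.circuit.Prepared (s₀ + k) (.flag i (j + 1)) ∧
    ∀ i' j', ¬ D.circuit.Prepared (s₀ + k) (.data i' j')
  anc : ∀ k, 1 ≤ k → k ≤ 6 → ∀ y, D.circuit.Arrow D.err (s₀ + k) (.anc i j) y ↔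
    (k = 1 ∨ k = 4) ∧ y = .flag i (j + 1) ∨ (k = 2 ∨ k = 5) ∧ y = .flag i j
  left : ∀ k, 1 ≤ k → k ≤ 6 → ∀ y, D.circuit.Arrow D.err (s₀ + k) (.flag i j) y ↔
    k = 3 ∧ y = .data i j ∨ k = 4 ∧ y = .data (i + 1) j
  right : ∀ k, 1 ≤ k → k ≤ 6 → ∀ y, D.circuit.Arrow D.err (s₀ + k) (.flag i (j + 1)) y ↔
    k = 2 ∧ y = .data (i + 1) (j + 1) ∨ k = 3 ∧ y = .data i (j + 1)
  anc_silent : ∀ k ≤ 6, D.Silent (s₀ + k) (.anc i j)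
  left_silent : ∀ k < 6, D.Silent (s₀ + k) (.flag i j)
  right_silent : ∀ k < 6, D.Silent (s₀ + k) (.flag i (j + 1))
  anc_forgotten : D.Forgotten T (s₀ + 6) (.anc i j)
  left_forgotten : D.Forgotten T (s₀ + 6) (.flag i j)
  right_forgotten : D.Forgotten T (s₀ + 6) (.flag i (j + 1))
  read : ∀ t < T, ∀ σ, D.effectOf T (Pi.single (t * D.circuit.steps + (s₀ + 6) + 1)
    (Pi.single (Flag.qubit (t, (i, j), σ)) 1)) = flagEffect (t, (i, j), σ)
  data : ∀ t < T, ∀ k ≤ 6, ∀ q ∈ D.lattice,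
    D.after T t (s₀ + k) (.data q.1 q.2) = D.spaceEffect (layer t) q

namespace SpreadWindow

variable {layer : ℕ → ℕ} {s₀ i j : ℕ} (hD : D.Regular) (h : D.SpreadWindow T layer s₀ i j)
  {t : ℕ} (ht : t < T)

include hD h ht

/-- The left flag qubit acts on the upper left corner in step `3` and on the lower left one in step
`4`. The later the error occurs, the fewer corners it reaches; the flag is flipped in any case. -/
theorem after_left : (∀ k, 4 ≤ k → k ≤ 6 →
      D.after T t (s₀ + k) (.flag i j) = flagEffect (t, (i, j), .left)) ∧
    D.after T t (s₀ + 3) (.flag i j) =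
      flagEffect (t, (i, j), .left) + D.dataEffect (layer t) (errorOn {(i + 1, j)}) ∧
    ∀ k ≤ 2, D.after T t (s₀ + k) (.flag i j) =
      flagEffect (t, (i, j), .left) + D.dataEffect (layer t) (leftPair (i, j)) := by
  obtain ⟨c1, c2, c3, c4⟩ := corner_mem_lattice h.mem
  have hlt := h.lt
  have st : ∀ k, 1 ≤ k → k ≤ 6 → k ≠ 3 → k ≠ 4 → D.circuit.Stays D.err (s₀ + k) (.flag i j) :=
    fun k h1 h2 h3 h4 => ⟨(h.prepared k h1 h2).2.1, fun y hy => by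
      rcases (h.left k h1 h2 y).1 hy with hy | hy <;> omega⟩
  have e1 : ∀ k, 4 ≤ k → k ≤ 6 →
      D.after T t (s₀ + k) (.flag i j) = flagEffect (t, (i, j), .left) := by
    intro k h1 h2
    rw [after_read hD ht (show s₀ + k ≤ s₀ + 6 by omega) h.lt (fun v hv hv' => ?_)
      (fun v hv hv' => ?_) h.left_forgotten]
    · exact h.read t ht .left
    · obtain ⟨n, rfl⟩ := Nat.exists_eq_add_of_le (show s₀ ≤ v by omega)
      exact st n (by omega) (by omega) (by omega) (by omega)
    · obtain ⟨n, rfl⟩ := Nat.exists_eq_add_of_le (show s₀ ≤ v by omega)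
      exact h.left_silent n (by omega)
  have e2 : D.after T t (s₀ + 3) (.flag i j) =
      flagEffect (t, (i, j), .left) + D.dataEffect (layer t) (errorOn {(i + 1, j)}) := by
    have hm : D.circuit.Moves D.err (s₀ + 3 + 1) (.flag i j) (.data (i + 1) j) :=
      ⟨h.left_mem, by simp, (h.prepared 4 (by omega) (by omega)).2.1,
        (h.prepared 4 (by omega) (by omega)).2.2.2 _ _, fun y => by
          have := h.left 4 (by omega) (by omega) y
          simpa using this⟩
    rw [after_of_moves hD ht (by omega) hm (h.left_silent 3 (by omega)),
      show s₀ + 3 + 1 = s₀ + 4 from rfl, e1 4 (by omega) (by omega),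
      h.data t ht 4 (by omega) _ c3]
    rfl
  refine ⟨e1, e2, fun k hk => ?_⟩
  have hm : D.circuit.Moves D.err (s₀ + 2 + 1) (.flag i j) (.data i j) :=
    ⟨h.left_mem, by simp, (h.prepared 3 (by omega) (by omega)).2.1,
      (h.prepared 3 (by omega) (by omega)).2.2.2 _ _, fun y => by
        have := h.left 3 (by omega) (by omega) y
        simpa using this⟩
  rw [after_eq_of_stays hD ht (show s₀ + k ≤ s₀ + 2 by omega) (by omega) fun u hu hu' => ?_,
    after_of_moves hD ht (by omega) hm (h.left_silent 2 (by omega)),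
    show s₀ + 2 + 1 = s₀ + 3 from rfl, e2, h.data t ht 3 (by omega) _ c1, leftPair_eq,
    dataEffect_add, add_assoc, add_comm (D.dataEffect _ (errorOn {(i, j)}))]
  · rfl
  · obtain ⟨n, rfl⟩ := Nat.exists_eq_add_of_le (show s₀ ≤ u by omega)
    exact ⟨st (n + 1) (by omega) (by omega) (by omega) (by omega), h.left_silent n (by omega)⟩

/-- As for the left flag qubit, but one step earlier and from bottom to top: the lower right corner
in step `2`, the upper right one in step `3`. The corner reached alone is therefore the upper one.
-/
theorem after_right : (∀ k, 3 ≤ k → k ≤ 6 →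
      D.after T t (s₀ + k) (.flag i (j + 1)) = flagEffect (t, (i, j), .right)) ∧
    D.after T t (s₀ + 2) (.flag i (j + 1)) =
      flagEffect (t, (i, j), .right) + D.dataEffect (layer t) (errorOn {(i, j + 1)}) ∧
    ∀ k ≤ 1, D.after T t (s₀ + k) (.flag i (j + 1)) =
      flagEffect (t, (i, j), .right) + D.dataEffect (layer t) (rightPair (i, j)) := by
  obtain ⟨c1, c2, c3, c4⟩ := corner_mem_lattice h.mem
  have hlt := h.lt
  have st : ∀ k, 1 ≤ k → k ≤ 6 → k ≠ 2 → k ≠ 3 →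
      D.circuit.Stays D.err (s₀ + k) (.flag i (j + 1)) :=
    fun k h1 h2 h3 h4 => ⟨(h.prepared k h1 h2).2.2.1, fun y hy => by
      rcases (h.right k h1 h2 y).1 hy with hy | hy <;> omega⟩
  have e1 : ∀ k, 3 ≤ k → k ≤ 6 →
      D.after T t (s₀ + k) (.flag i (j + 1)) = flagEffect (t, (i, j), .right) := by
    intro k h1 h2
    rw [after_read hD ht (show s₀ + k ≤ s₀ + 6 by omega) h.lt (fun v hv hv' => ?_)
      (fun v hv hv' => ?_) h.right_forgotten]
    · exact h.read t ht .right
    · obtain ⟨n, rfl⟩ := Nat.exists_eq_add_of_le (show s₀ ≤ v by omega)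
      exact st n (by omega) (by omega) (by omega) (by omega)
    · obtain ⟨n, rfl⟩ := Nat.exists_eq_add_of_le (show s₀ ≤ v by omega)
      exact h.right_silent n (by omega)
  have e2 : D.after T t (s₀ + 2) (.flag i (j + 1)) =
      flagEffect (t, (i, j), .right) + D.dataEffect (layer t) (errorOn {(i, j + 1)}) := by
    have hm : D.circuit.Moves D.err (s₀ + 2 + 1) (.flag i (j + 1)) (.data i (j + 1)) :=
      ⟨h.right_mem, by simp, (h.prepared 3 (by omega) (by omega)).2.2.1,
        (h.prepared 3 (by omega) (by omega)).2.2.2 _ _, fun y => by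
          have := h.right 3 (by omega) (by omega) y
          simpa using this⟩
    rw [after_of_moves hD ht (by omega) hm (h.right_silent 2 (by omega)),
      show s₀ + 2 + 1 = s₀ + 3 from rfl, e1 3 (by omega) (by omega),
      h.data t ht 3 (by omega) _ c2]
    rfl
  refine ⟨e1, e2, fun k hk => ?_⟩
  have hm : D.circuit.Moves D.err (s₀ + 1 + 1) (.flag i (j + 1)) (.data (i + 1) (j + 1)) :=
    ⟨h.right_mem, by simp, (h.prepared 2 (by omega) (by omega)).2.2.1,
      (h.prepared 2 (by omega) (by omega)).2.2.2 _ _, fun y => by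
        have := h.right 2 (by omega) (by omega) y
        simpa using this⟩
  rw [after_eq_of_stays hD ht (show s₀ + k ≤ s₀ + 1 by omega) (by omega) fun u hu hu' => ?_,
    after_of_moves hD ht (by omega) hm (h.right_silent 1 (by omega)),
    show s₀ + 1 + 1 = s₀ + 2 from rfl, e2, h.data t ht 2 (by omega) _ c4, rightPair_eq,
    dataEffect_add, add_assoc]
  · rfl
  · obtain ⟨n, rfl⟩ := Nat.exists_eq_add_of_le (show s₀ ≤ u by omega)
    exact ⟨st (n + 1) (by omega) (by omega) (by omega) (by omega), h.right_silent n (by omega)⟩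

theorem elementary_left {k : ℕ} (hk : k ≤ 6) :
    D.Elementary T layer (D.after T t (s₀ + k) (.flag i j)) := by
  obtain ⟨e1, e2, e3⟩ := h.after_left hD ht
  rcases Nat.lt_or_ge k 3 with h1 | h1
  · rw [e3 k (by omega), flagEffect_add]
    exact .one ht h.mem (.inr (.inr (.inl rfl)))
  · rcases Nat.lt_or_ge k 4 with h2 | h2
    · obtain rfl : k = 3 := by omega
      rw [e2, flagEffect_add]
      exact .one ht h.mem (.inr (.inl rfl))
    · rw [e1 k h2 hk, ← add_zero (flagEffect _), show (0 : Effect) = D.dataEffect (layer t) 0 by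
        rw [dataEffect, syndrome_zero]; rfl, flagEffect_add]
      exact .one ht h.mem (.inl rfl)

theorem elementary_right {k : ℕ} (hk : k ≤ 6) :
    D.Elementary T layer (D.after T t (s₀ + k) (.flag i (j + 1))) := by
  obtain ⟨e1, e2, e3⟩ := h.after_right hD ht
  rcases Nat.lt_or_ge k 2 with h1 | h1
  · rw [e3 k (by omega), flagEffect_add]
    exact .one ht h.mem (.inr (.inr (.inr rfl)))
  · rcases Nat.lt_or_ge k 3 with h2 | h2
    · obtain rfl : k = 2 := by omega
      rw [e2, flagEffect_add]
      exact .one ht h.mem (.inr (.inl rfl))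
    · rw [e1 k h2 hk, ← add_zero (flagEffect _), show (0 : Effect) = D.dataEffect (layer t) 0 by
        rw [dataEffect, syndrome_zero]; rfl, flagEffect_add]
      exact .one ht h.mem (.inl rfl)

/-- The syndrome qubit is coupled twice to each flag qubit, the second time after the flag qubit has
acted on the data. An error is thus copied to the flags once or twice; a flag that is flipped twice
shows nothing. -/
theorem elementary_anc (hg : D.syndrome (layer t) (errorOn (plaquette D.d (i, j))) = 0) {k : ℕ}
    (hk : k ≤ 6) : D.Elementary T layer (D.after T t (s₀ + k) (.anc i j)) := by
  obtain ⟨l1, l2, l3⟩ := h.after_left hD ht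
  obtain ⟨r1, r2, r3⟩ := h.after_right hD ht
  have hlt := h.lt
  have mr : ∀ n, n = 0 ∨ n = 3 → D.after T t (s₀ + n) (.anc i j) =
      D.after T t (s₀ + (n + 1)) (.anc i j) + D.after T t (s₀ + (n + 1)) (.flag i (j + 1)) := by
    intro n hn
    refine after_of_moves hD ht (by omega) ⟨h.anc_mem, by simp,
      (h.prepared (n + 1) (by omega) (by omega)).1,
      (h.prepared (n + 1) (by omega) (by omega)).2.2.1, fun y => ?_⟩ (h.anc_silent n (by omega))
    have := h.anc (n + 1) (by omega) (by omega) y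
    rcases hn with rfl | rfl <;> simpa using this
  have ml : ∀ n, n = 1 ∨ n = 4 → D.after T t (s₀ + n) (.anc i j) =
      D.after T t (s₀ + (n + 1)) (.anc i j) + D.after T t (s₀ + (n + 1)) (.flag i j) := by
    intro n hn
    refine after_of_moves hD ht (by omega) ⟨h.anc_mem, by simp,
      (h.prepared (n + 1) (by omega) (by omega)).1,
      (h.prepared (n + 1) (by omega) (by omega)).2.1, fun y => ?_⟩ (h.anc_silent n (by omega))
    have := h.anc (n + 1) (by omega) (by omega) y
    rcases hn with rfl | rfl <;> simpa using this
  have st : ∀ n, n = 2 ∨ n = 5 →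
      D.after T t (s₀ + n) (.anc i j) = D.after T t (s₀ + (n + 1)) (.anc i j) := by
    intro n hn
    refine after_of_stays hD ht (by omega) ⟨(h.prepared (n + 1) (by omega) (by omega)).1,
      fun y hy => ?_⟩ (h.anc_silent n (by omega))
    rcases (h.anc (n + 1) (by omega) (by omega) y).1 hy with hy | hy <;> omega
  have e6 : D.after T t (s₀ + 6) (.anc i j) = 0 :=
    h.anc_forgotten.after_eq_zero hD h.lt (by simp) (h.anc_silent 6 le_rfl) ht
  have e5 : D.after T t (s₀ + 5) (.anc i j) = 0 := by rw [st 5 (by simp), e6]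
  have e4 : D.after T t (s₀ + 4) (.anc i j) = flagEffect (t, (i, j), .left) := by
    rw [ml 4 (by simp), e5, l1 5 (by omega) (by omega), zero_add]
  have e3 : D.after T t (s₀ + 3) (.anc i j) =
      flagEffect (t, (i, j), .left) + flagEffect (t, (i, j), .right) := by
    rw [mr 3 (by simp), e4, r1 4 (by omega) (by omega)]
  have e2 : D.after T t (s₀ + 2) (.anc i j) =
      flagEffect (t, (i, j), .left) + flagEffect (t, (i, j), .right) := by rw [st 2 (by simp), e3]
  -- After the first coupling to the right flag qubit, an error goes twice to the left one, which
  -- spreads it to the left corners and hides its own flag, and once to the right one, too late to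
  -- reach the data.
  have e1 : D.after T t (s₀ + 1) (.anc i j) =
      flagEffect (t, (i, j), .right) + D.dataEffect (layer t) (leftPair (i, j)) := by
    rw [ml 1 (by simp), e2, l3 2 le_rfl]
    calc _ = (flagEffect (t, (i, j), .left) + flagEffect (t, (i, j), .left)) +
          (flagEffect (t, (i, j), .right) + D.dataEffect (layer t) (leftPair (i, j))) := by abel
      _ = _ := by rw [effect_add_self, zero_add]
  -- Before all couplings both flags are flipped twice and all four corners are affected: the
  -- generator itself.
  have e0 : D.after T t (s₀ + 0) (.anc i j) =
      D.dataEffect (layer t) (errorOn (plaquette D.d (i, j))) := by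
    have hp : errorOn (plaquette D.d (i, j)) = leftPair (i, j) + rightPair (i, j) := by
      rw [← leftPair_add_plaquette h.mem, ← add_assoc, add_self, zero_add]
    rw [mr 0 (by simp), e1, r3 1 le_rfl, hp, dataEffect_add]
    calc _ = (flagEffect (t, (i, j), .right) + flagEffect (t, (i, j), .right)) +
          (D.dataEffect (layer t) (leftPair (i, j)) +
            D.dataEffect (layer t) (rightPair (i, j))) := by abel
      _ = _ := by rw [effect_add_self, zero_add]
  have hboth : D.Elementary T layer
      (flagEffect (t, (i, j), .left) + flagEffect (t, (i, j), .right)) := by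
    have : flagEffect (t, (i, j), .left) + flagEffect (t, (i, j), .right) =
        (0, 0, Pi.single (t, (i, j), .left) 1 + Pi.single (t, (i, j), .right) 1) :=
      Prod.ext (add_zero _) (Prod.ext (add_zero _) rfl)
    rw [this]
    exact .both ht h.mem
  interval_cases k
  · rw [e0, dataEffect, hg]
    exact .neutral (Submodule.subset_span ⟨_, gens_of_flagged h.mem, rfl⟩)
  · rw [e1, flagEffect_add]
    exact .one ht h.mem (.inr (.inr (.inl rfl)))
  · rwa [e2]
  · rwa [e3]
  · rw [e4, ← l1 4 le_rfl (by omega)]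
    exact h.elementary_left hD ht (by omega)
  · rw [e5]; exact elementary_zero D T layer
  · rw [e6]; exact elementary_zero D T layer

/-- The first CNOT from the syndrome qubit to the left flag qubit may leave an error on its target
only, which spreads to both left corners. -/
theorem pair_left : D.SingleEffect T (leftPair (i, j), D.syndrome (layer t) (leftPair (i, j)),
    Pi.single (t, (i, j), .left) 1) := by
  have hlt := h.lt
  have := (singleEffect_arrow ht (by omega)
    ((h.anc 2 (by omega) (by omega) (.flag i j)).2 (by simp))).2
  rwa [(h.after_left hD ht).2.2 2 le_rfl, flagEffect_add] at this

theorem pair_right : D.SingleEffect T (rightPair (i, j), D.syndrome (layer t) (rightPair (i, j)),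
    Pi.single (t, (i, j), .right) 1) := by
  have hlt := h.lt
  have := (singleEffect_arrow ht (by omega)
    ((h.anc 1 (by omega) (by omega) (.flag i (j + 1))).2 (by simp))).2
  rwa [(h.after_right hD ht).2.2 1 le_rfl, flagEffect_add] at this

/-- The source of a flag qubit's first CNOT to the data may be left with an error; only the second
corner is then affected. -/
theorem corner (σ : Side) : D.SingleEffect T (errorOn {Problem.corner (i, j) σ},
    D.syndrome (layer t) (errorOn {Problem.corner (i, j) σ}), Pi.single (t, (i, j), σ) 1) := by
  have hlt := h.lt
  cases σ
  · have := (singleEffect_arrow ht (by omega)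
      ((h.left 3 (by omega) (by omega) (.data i j)).2 (by simp))).1
    rwa [(h.after_left hD ht).2.1, flagEffect_add] at this
  · have := (singleEffect_arrow ht (by omega)
      ((h.right 2 (by omega) (by omega) (.data (i + 1) (j + 1))).2 (by simp))).1
    rwa [(h.after_right hD ht).2.1, flagEffect_add] at this

end SpreadWindow

/-- The measurement of a stabilizer of the other type on a weight-four face, in the time steps
`s₀, …, s₀ + 6`. -/
structure DetectWindow (D : Problem) (T s₀ i j : ℕ) : Prop where
  lt : s₀ + 6 < D.circuit.steps
  left_mem : .flag i j ∈ D.circuit.qubits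
  right_mem : .flag i (j + 1) ∈ D.circuit.qubits
  prepared : ∀ k, 1 ≤ k → k ≤ 6 → ¬ D.circuit.Prepared (s₀ + k) (.anc i j) ∧
    ¬ D.circuit.Prepared (s₀ + k) (.flag i j) ∧ ¬ D.circuit.Prepared (s₀ + k) (.flag i (j + 1))
  anc : ∀ k, 1 ≤ k → k ≤ 6 → ∀ y, ¬ D.circuit.Arrow D.err (s₀ + k) (.anc i j) y
  left : ∀ k, 1 ≤ k → k ≤ 6 → ∀ y, D.circuit.Arrow D.err (s₀ + k) (.flag i j) y ↔
    (k = 2 ∨ k = 5) ∧ y = .anc i j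
  right : ∀ k, 1 ≤ k → k ≤ 6 → ∀ y, D.circuit.Arrow D.err (s₀ + k) (.flag i (j + 1)) y ↔
    (k = 1 ∨ k = 4) ∧ y = .anc i j
  anc_silent : ∀ k < 6, D.Silent (s₀ + k) (.anc i j)
  left_silent : ∀ k ≤ 6, D.Silent (s₀ + k) (.flag i j)
  right_silent : ∀ k ≤ 6, D.Silent (s₀ + k) (.flag i (j + 1))
  anc_forgotten : D.Forgotten T (s₀ + 6) (.anc i j)
  left_forgotten : D.Forgotten T (s₀ + 6) (.flag i j)
  right_forgotten : D.Forgotten T (s₀ + 6) (.flag i (j + 1))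
  read : ∀ t < T, D.effectOf T (Pi.single (t * D.circuit.steps + (s₀ + 6) + 1)
    (Pi.single (.anc i j) 1)) = D.vertEffect t (i, j)

namespace DetectWindow

variable {s₀ i j : ℕ} (hD : D.Regular) (h : D.DetectWindow T s₀ i j) {t : ℕ} (ht : t < T)

include hD h ht

theorem after_anc {k : ℕ} (hk : k ≤ 6) :
    D.after T t (s₀ + k) (.anc i j) = D.vertEffect t (i, j) := by
  rw [after_read hD ht (show s₀ + k ≤ s₀ + 6 by omega) h.lt (fun v hv hv' => ?_)
    (fun v hv hv' => ?_) h.anc_forgotten, h.read t ht]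
  · obtain ⟨n, rfl⟩ := Nat.exists_eq_add_of_le (show s₀ ≤ v by omega)
    exact ⟨(h.prepared n (by omega) (by omega)).1, h.anc n (by omega) (by omega)⟩
  · obtain ⟨n, rfl⟩ := Nat.exists_eq_add_of_le (show s₀ ≤ v by omega)
    exact h.anc_silent n (by omega)

/-- A flag qubit is coupled to the syndrome qubit after the steps `m` and `m + 3`. -/
theorem after_flag {m j' : ℕ} (hm1 : m ≤ 1) (hmem : .flag i j' ∈ D.circuit.qubits)
    (hp : ∀ k, 1 ≤ k → k ≤ 6 → ¬ D.circuit.Prepared (s₀ + k) (.flag i j'))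
    (harr : ∀ k, 1 ≤ k → k ≤ 6 → ∀ y, D.circuit.Arrow D.err (s₀ + k) (.flag i j') y ↔
      (k = m + 1 ∨ k = m + 4) ∧ y = .anc i j)
    (hs : ∀ k ≤ 6, D.Silent (s₀ + k) (.flag i j')) (hf : D.Forgotten T (s₀ + 6) (.flag i j'))
    {k : ℕ} (hk : k ≤ 6) : D.after T t (s₀ + k) (.flag i j') =
      if m < k ∧ k < m + 4 then D.vertEffect t (i, j) else 0 := by
  have hlt := h.lt
  have e6 : D.after T t (s₀ + 6) (.flag i j') = 0 :=
    hf.after_eq_zero hD h.lt (by simp) (hs 6 le_rfl) ht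
  have st : ∀ n < 6, n ≠ m → n ≠ m + 3 →
      D.after T t (s₀ + n) (.flag i j') = D.after T t (s₀ + (n + 1)) (.flag i j') := by
    intro n hn h1 h2
    refine after_of_stays hD ht (by omega) ⟨hp (n + 1) (by omega) (by omega), fun y hy => ?_⟩
      (hs n (by omega))
    have := ((harr (n + 1) (by omega) (by omega) y).1 hy).1
    omega
  have mv : ∀ n < 6, n = m ∨ n = m + 3 → D.after T t (s₀ + n) (.flag i j') =
      D.after T t (s₀ + (n + 1)) (.flag i j') + D.vertEffect t (i, j) := by
    intro n hn h1
    rw [← h.after_anc hD ht (show n + 1 ≤ 6 by omega)]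
    refine after_of_moves hD ht (by omega) ⟨hmem, by simp, hp (n + 1) (by omega) (by omega),
      (h.prepared (n + 1) (by omega) (by omega)).1, fun y => ?_⟩ (hs n (by omega))
    have h2 : n + 1 = m + 1 ∨ n + 1 = m + 4 := by omega
    have := harr (n + 1) (by omega) (by omega) y
    rwa [and_iff_right h2] at this
  -- Backward induction from the end of the window. Each of the two couplings toggles the effect, so
  -- only errors between them flip the outcome.
  obtain ⟨n, hn⟩ := Nat.exists_eq_add_of_le hk
  induction n generalizing k with
  | zero =>
    obtain rfl : k = 6 := by omega
    rw [e6, if_neg (by omega)]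
  | succ n ih =>
    have := ih (k := k + 1) (by omega) (by omega)
    by_cases h1 : k = m ∨ k = m + 3
    · rw [mv k (by omega) h1, this]
      rcases h1 with rfl | rfl
      · rw [if_pos (by omega), if_neg (by omega), effect_add_self]
      · rw [if_neg (by omega), if_pos (by omega), zero_add]
    · rw [st k (by omega) (fun h => h1 (.inl h)) (fun h => h1 (.inr h)), this]
      exact if_congr (by omega) rfl rfl

theorem after_left {k : ℕ} (hk : k ≤ 6) : D.after T t (s₀ + k) (.flag i j) =
    if 1 < k ∧ k < 5 then D.vertEffect t (i, j) else 0 :=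
  h.after_flag hD ht le_rfl h.left_mem (fun k h1 h2 => (h.prepared k h1 h2).2.1) h.left
    h.left_silent h.left_forgotten hk

theorem after_right {k : ℕ} (hk : k ≤ 6) : D.after T t (s₀ + k) (.flag i (j + 1)) =
    if 0 < k ∧ k < 4 then D.vertEffect t (i, j) else 0 :=
  h.after_flag hD ht (Nat.zero_le 1) h.right_mem (fun k h1 h2 => (h.prepared k h1 h2).2.2)
    h.right h.right_silent h.right_forgotten hk

theorem elementary (layer : ℕ → ℕ) {k : ℕ} (hk : k ≤ 6) :
    D.Elementary T layer (D.after T t (s₀ + k) (.anc i j)) ∧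
    D.Elementary T layer (D.after T t (s₀ + k) (.flag i j)) ∧
    D.Elementary T layer (D.after T t (s₀ + k) (.flag i (j + 1))) := by
  rw [h.after_anc hD ht hk, h.after_left hD ht hk, h.after_right hD ht hk]
  refine ⟨.vert, ?_, ?_⟩ <;>
  · split_ifs
    · exact .vert
    · exact elementary_zero D T layer

end DetectWindow

/-- The measurement of a generator of weight two with the measurement qubit `a`. -/
theorem elementary_of_pair (hD : D.Regular) {layer : ℕ → ℕ} {s₀ s₁ s₂ m : ℕ} {a : Qubit}
    {q₁ q₂ f : ℕ × ℕ} {t : ℕ} (ht : t < T) (h01 : s₀ < s₁) (h12 : s₁ < s₂) (h2m : s₂ ≤ m)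
    (hm : m < D.circuit.steps) (ha : ∀ i j, a ≠ .data i j)
    (hm₁ : D.circuit.Moves D.err s₁ a (.data q₁.1 q₁.2))
    (hm₂ : D.circuit.Moves D.err s₂ a (.data q₂.1 q₂.2))
    (hst : ∀ s, s₀ < s → s ≤ m → s ≠ s₁ → s ≠ s₂ → D.circuit.Stays D.err s a)
    (hsil : ∀ s, s₀ ≤ s → s ≤ m → D.Silent s a) (hf : D.Forgotten T m a)
    (hg : f ∈ D.gens) (hf2 : plaquette D.d f = {q₁, q₂}) (h12' : q₁ ≠ q₂)
    (hsyn : D.syndrome (layer t) (errorOn (plaquette D.d f)) = 0) (hlay : layer t ≤ T)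
    (hdata : ∀ s, s₀ ≤ s → s ≤ m → ∀ q ∈ D.lattice,
      D.after T t s (.data q.1 q.2) = D.spaceEffect (layer t) q) {s : ℕ} (hs : s₀ ≤ s)
    (hs' : s ≤ m) : D.Elementary T layer (D.after T t s a) := by
  have hl : plaquette D.d f ⊆ D.lattice := inter_subset_right
  have c1 : q₁ ∈ D.lattice := hl (by simp [hf2])
  have c2 : q₂ ∈ D.lattice := hl (by simp [hf2])
  have e2 : ∀ s, s₂ ≤ s → s ≤ m → D.after T t s a = 0 := by
    intro s h1 h2
    rw [after_eq_of_stays hD ht h2 hm fun u hu hu' =>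
      ⟨hst _ (by omega) (by omega) (by omega) (by omega), hsil _ (by omega) (by omega)⟩]
    exact hf.after_eq_zero hD hm ha (hsil m (by omega) le_rfl) ht
  -- Between the two CNOTs only the second data qubit can still be reached.
  have e1 : ∀ s, s₁ ≤ s → s < s₂ → D.after T t s a = D.dataEffect (layer t) (errorOn {q₂}) := by
    intro s h1 h2
    obtain ⟨n, rfl⟩ := Nat.exists_eq_add_of_le' (show 1 ≤ s₂ by omega)
    rw [after_eq_of_stays hD ht (show s ≤ n by omega) (by omega) fun u hu hu' =>
        ⟨hst _ (by omega) (by omega) (by omega) (by omega), hsil _ (by omega) (by omega)⟩,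
      after_of_moves hD ht (by omega) hm₂ (hsil n (by omega) (by omega)), e2 _ le_rfl h2m,
      zero_add, hdata _ (by omega) (by omega) _ c2]
    rfl
  rcases Nat.lt_or_ge s s₂ with h1 | h1
  · rcases Nat.lt_or_ge s s₁ with h2 | h2
    · obtain ⟨n, rfl⟩ := Nat.exists_eq_add_of_le' (show 1 ≤ s₁ by omega)
      rw [after_eq_of_stays hD ht (show s ≤ n by omega) (by omega) fun u hu hu' =>
          ⟨hst _ (by omega) (by omega) (by omega) (by omega), hsil _ (by omega) (by omega)⟩,
        after_of_moves hD ht (by omega) hm₁ (hsil n (by omega) (by omega)), e1 _ le_rfl h12,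
        hdata _ (by omega) (by omega) _ c1]
      -- Before both CNOTs the error spreads to the whole generator.
      change D.Elementary T layer (D.dataEffect _ _ + D.dataEffect _ _)
      have hp : errorOn (plaquette D.d f) = errorOn {q₂} + errorOn {q₁} := by
        rw [hf2, errorOn_insert (by simpa using h12'), add_comm]
      rw [← dataEffect_add, ← hp, dataEffect, hsyn]
      exact .neutral (Submodule.subset_span ⟨_, hg, rfl⟩)
    · rw [e1 s h2 h1]
      exact .space hlay c2
  · rw [e2 s h1 hs']
    exact elementary_zero D T layer

end Problem

/-! ## The operations of the circuits -/

theorem couple_inj {b : Basis} {x y x' y' : Qubit} :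
    couple b x y = couple b x' y' ↔ x = x' ∧ y = y' := by
  cases b <;> simp [couple, and_comm]

theorem couple_ne_prep (b b' : Basis) (x y q : Qubit) : couple b x y ≠ .prep b' q := by
  cases b <;> simp [couple]

theorem couple_ne_meas (b b' : Basis) (x y q : Qubit) : couple b x y ≠ .meas b' q := by
  cases b <;> simp [couple]

theorem couple_mem_flaggedMeasurement {b : Basis} {s s' i j : ℕ} {x y : Qubit} :
    (s', couple b x y) ∈ flaggedMeasurement b s (i, j) ↔
      s' = s + 1 ∧ x = .anc i j ∧ y = .flag i (j + 1) ∨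
      s' = s + 2 ∧ x = .anc i j ∧ y = .flag i j ∨
      s' = s + 2 ∧ x = .flag i (j + 1) ∧ y = .data (i + 1) (j + 1) ∨
      s' = s + 3 ∧ x = .flag i j ∧ y = .data i j ∨
      s' = s + 3 ∧ x = .flag i (j + 1) ∧ y = .data i (j + 1) ∨
      s' = s + 4 ∧ x = .flag i j ∧ y = .data (i + 1) j ∨
      s' = s + 4 ∧ x = .anc i j ∧ y = .flag i (j + 1) ∨
      s' = s + 5 ∧ x = .anc i j ∧ y = .flag i j := by
  simp only [flaggedMeasurement, mem_insert, mem_singleton, Prod.mk.injEq, couple_inj,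
    couple_ne_prep, couple_ne_meas, and_false, false_or, or_false]

theorem couple_mem_pairMeasurement {b : Basis} {a q₁ q₂ x y : Qubit} {s₀ s₁ s₂ s₃ s : ℕ} :
    (s, couple b x y) ∈ pairMeasurement b a q₁ q₂ s₀ s₁ s₂ s₃ ↔
      s = s₁ ∧ x = a ∧ y = q₁ ∨ s = s₂ ∧ x = a ∧ y = q₂ := by
  simp only [pairMeasurement, mem_insert, mem_singleton, Prod.mk.injEq, couple_inj,
    couple_ne_prep, couple_ne_meas, and_false, false_or, or_false]

/-- In step `k` of the measurements on even faces, the first qubit (nearer to the syndrome qubit) is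
coupled to the second one. -/
def EvenCouple (d k : ℕ) : Qubit → Qubit → Prop
  | .anc i j, .flag i' j' => 1 ≤ i ∧ i + 1 ≤ d ∧ 1 ≤ j ∧ j + 1 ≤ d ∧ (i + j) % 2 = 0 ∧ i' = i ∧
      ((k = 1 ∨ k = 4) ∧ j' = j + 1 ∨ (k = 2 ∨ k = 5) ∧ j' = j)
  | .anc i j, .data i' j' => 1 ≤ j ∧ j + 1 ≤ d ∧ (i + j) % 2 = 0 ∧
      (i = 0 ∧ i' = 1 ∨ i = d ∧ i' = d) ∧ (k = 4 ∧ j' = j ∨ k = 2 ∧ j' = j + 1)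
  | .flag i j, .data i' j' => 1 ≤ i ∧ i + 1 ≤ d ∧ 1 ≤ j ∧ j ≤ d ∧ j' = j ∧
      ((i + j) % 2 = 0 ∧ j + 1 ≤ d ∧ (k = 3 ∧ i' = i ∨ k = 4 ∧ i' = i + 1) ∨
        (i + j) % 2 = 1 ∧ 2 ≤ j ∧ (k = 3 ∧ i' = i ∨ k = 2 ∧ i' = i + 1))
  | _, _ => False

/-- In step `k` of the measurements on odd faces, the first qubit (nearer to the syndrome qubit) is
coupled to the second one. -/
def OddCouple (d k : ℕ) : Qubit → Qubit → Prop
  | .anc i j, .flag i' j' => 1 ≤ i ∧ i + 1 ≤ d ∧ 1 ≤ j ∧ j + 1 ≤ d ∧ (i + j) % 2 = 1 ∧ i' = i ∧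
      ((k = 1 ∨ k = 4) ∧ j' = j + 1 ∨ (k = 2 ∨ k = 5) ∧ j' = j)
  | .flag i j, .data i' j' => 1 ≤ i ∧ i + 1 ≤ d ∧ 1 ≤ j ∧ j ≤ d ∧ j' = j ∧
      (((i + j) % 2 = 1 ∨ j = 1) ∧ (k = 3 ∧ i' = i ∨ k = 4 ∧ i' = i + 1) ∨
        (i + j) % 2 = 0 ∧ 2 ≤ j ∧ (k = 3 ∧ i' = i ∨ k = 2 ∧ i' = i + 1))
  | _, _ => False

/-- The gates become linear conditions on the indices and their parities. In this form the questions
which CNOTs act on a qubit and when are decided by linear arithmetic. -/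
theorem couple_mem_measureEven {d : ℕ} (hd : 3 ≤ d) {b : Basis} {s s' : ℕ} {x y : Qubit} :
    (s', couple b x y) ∈ measureEven d b s ↔ s ≤ s' ∧ EvenCouple d (s' - s) x y := by
  simp only [measureEven, mem_union, mem_biUnion, Prod.exists, couple_mem_flaggedMeasurement,
    couple_mem_pairMeasurement, mem_sdiff, mem_bulk_evenFaces, mem_evenFaces]
  cases x with
  | data i j => simp [EvenCouple]
  | flag i j =>
    cases y with
    | data i' j' =>
      simp only [reduceCtorEq, false_and, and_false, false_or, Qubit.flag.injEq, Qubit.data.injEq,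
        EvenCouple, or_false, exists_const]
      constructor
      · rintro ⟨a, b, h⟩
        omega
      · rintro ⟨h0, h1, h2, h3, h4, rfl, h⟩
        -- For even `i + j'` the qubit is the left flag of the face `(i, j')`, for odd `i + j'` the
        -- right flag of the face `(i, j' - 1)`.
        rcases h with h | h
        · exact ⟨i, j', by omega⟩
        · exact ⟨i, j' - 1, by omega⟩
    | flag i' j' => simp [EvenCouple]
    | anc i' j' => simp [EvenCouple]
  | anc i j =>
    cases y with
    | data i' j' =>
      simp only [reduceCtorEq, false_and, and_false, false_or, Qubit.anc.injEq, Qubit.data.injEq,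
        EvenCouple, or_false, exists_const]
      constructor
      · rintro ⟨a, b, h1, h2⟩
        split_ifs at h2 <;> omega
      · rintro ⟨h0, h⟩
        refine ⟨i, j, by omega, ?_⟩
        split_ifs <;> omega
    | flag i' j' =>
      simp only [reduceCtorEq, and_false, false_or, Qubit.anc.injEq, Qubit.flag.injEq,
        EvenCouple, or_false, exists_const]
      constructor
      · rintro ⟨a, b, h⟩
        omega
      · rintro ⟨h0, h⟩
        exact ⟨i, j, by omega⟩
    | anc i' j' => simp [EvenCouple]

set_option maxHeartbeats 800000 in
theorem couple_mem_measureOdd {d : ℕ} (hd : 3 ≤ d) (hodd : d % 2 = 1) {b : Basis} {s s' : ℕ}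
    {x y : Qubit} :
    (s', couple b x y) ∈ measureOdd d b s ↔ s ≤ s' ∧ OddCouple d (s' - s) x y := by
  simp only [measureOdd, mem_union, mem_biUnion, Prod.exists, couple_mem_flaggedMeasurement,
    couple_mem_pairMeasurement, mem_sdiff, mem_bulk_oddFaces, mem_oddFaces]
  cases x with
  | data i j => simp [OddCouple]
  | flag i j =>
    cases y with
    | data i' j' =>
      simp only [reduceCtorEq, and_false, false_or, Qubit.flag.injEq, Qubit.data.injEq,
        OddCouple, or_false]
      constructor
      · rintro (⟨a, b, h⟩ | ⟨a, b, h1, h2⟩)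
        · omega
        · split_ifs at h2 <;> omega
      · rintro ⟨h0, h1, h2, h3, h4, rfl, h⟩
        by_cases g1 : (i + j') % 2 = 1
        -- In the last column and, below, in the first one, the flag qubit may be the measurement
        -- qubit of a face of weight two on the boundary.
        · by_cases g2 : j' = d
          · refine .inr ⟨i, j', by omega, ?_⟩
            rw [if_neg (by omega)]
            omega
          · exact .inl ⟨i, j', by omega⟩
        · by_cases g2 : j' = 1
          · refine .inr ⟨i, 0, by omega, ?_⟩
            rw [if_pos rfl]
            omega
          · exact .inl ⟨i, j' - 1, by omega⟩
    | flag i' j' => simp [OddCouple]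
    | anc i' j' => simp [OddCouple]
  | anc i j =>
    cases y with
    | data i' j' => simp [OddCouple]
    | flag i' j' =>
      simp only [reduceCtorEq, and_false, false_or, Qubit.anc.injEq, Qubit.flag.injEq,
        OddCouple, or_false, exists_const]
      constructor
      · rintro ⟨a, b, h⟩
        omega
      · rintro ⟨h0, h⟩
        exact ⟨i, j, by omega⟩
    | anc i' j' => simp [OddCouple]

/-! ### Preparations and measurements -/

/-- The measurement and flag qubits for the operators on even faces. -/
def EvenUses (d : ℕ) : Qubit → Prop
  | .anc i j => i ≤ d ∧ 1 ≤ j ∧ j + 1 ≤ d ∧ (i + j) % 2 = 0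
  | .flag i j => 1 ≤ i ∧ i + 1 ≤ d ∧ 1 ≤ j ∧ j ≤ d ∧
      ((i + j) % 2 = 0 ∧ j + 1 ≤ d ∨ (i + j) % 2 = 1 ∧ 2 ≤ j)
  | .data _ _ => False

/-- The measurement and flag qubits for the operators on odd faces. -/
def OddUses (d : ℕ) : Qubit → Prop
  | .anc i j => 1 ≤ i ∧ i + 1 ≤ d ∧ 1 ≤ j ∧ j + 1 ≤ d ∧ (i + j) % 2 = 1
  | .flag i j => 1 ≤ i ∧ i + 1 ≤ d ∧ 1 ≤ j ∧ j ≤ d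
  | .data _ _ => False

/-- A preparation in either basis erases errors of both types, so the two bases are not
distinguished. -/
theorem exists_prep_mem_flaggedMeasurement {b : Basis} {s s' i j : ℕ} {q : Qubit} :
    ((s', Op.prep .X q) ∈ flaggedMeasurement b s (i, j) ∨
      (s', Op.prep .Z q) ∈ flaggedMeasurement b s (i, j)) ↔
      s' = s ∧ (q = .anc i j ∨ q = .flag i j ∨ q = .flag i (j + 1)) := by
  simp only [flaggedMeasurement, mem_insert, mem_singleton, Prod.mk.injEq,
    (couple_ne_prep _ _ _ _ _).symm, and_false, or_false, Op.prep.injEq, reduceCtorEq]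
  cases b <;> simp [Basis.other] <;> tauto

theorem meas_mem_flaggedMeasurement {b b' : Basis} {s s' i j : ℕ} {q : Qubit}
    (h : (s', Op.meas b' q) ∈ flaggedMeasurement b s (i, j)) :
      s' = s + 6 ∧ (q = .anc i j ∨ q = .flag i j ∨ q = .flag i (j + 1)) := by
  simp only [flaggedMeasurement, mem_insert, mem_singleton, Prod.mk.injEq,
    (couple_ne_meas _ _ _ _ _).symm, and_false, false_or, Op.meas.injEq, reduceCtorEq] at h
  tauto

theorem exists_prep_mem_pairMeasurement {b : Basis} {a q₁ q₂ q : Qubit} {s₀ s₁ s₂ s₃ s : ℕ} :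
    ((s, Op.prep .X q) ∈ pairMeasurement b a q₁ q₂ s₀ s₁ s₂ s₃ ∨
      (s, Op.prep .Z q) ∈ pairMeasurement b a q₁ q₂ s₀ s₁ s₂ s₃) ↔ s = s₀ ∧ q = a := by
  simp only [pairMeasurement, mem_insert, mem_singleton, Prod.mk.injEq,
    (couple_ne_prep _ _ _ _ _).symm, and_false, or_false, Op.prep.injEq, reduceCtorEq]
  cases b <;> simp

theorem meas_mem_pairMeasurement {b b' : Basis} {a q₁ q₂ q : Qubit} {s₀ s₁ s₂ s₃ s : ℕ}
    (h : (s, Op.meas b' q) ∈ pairMeasurement b a q₁ q₂ s₀ s₁ s₂ s₃) : s = s₃ ∧ q = a := by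
  simp only [pairMeasurement, mem_insert, mem_singleton, Prod.mk.injEq,
    (couple_ne_meas _ _ _ _ _).symm, and_false, false_or, Op.meas.injEq, reduceCtorEq] at h
  tauto

theorem exists_mem_biUnion_or {α β : Type*} [DecidableEq β] {S : Finset α} {f : α → Finset β}
    {x y : β} : (x ∈ S.biUnion f ∨ y ∈ S.biUnion f) ↔ ∃ a ∈ S, x ∈ f a ∨ y ∈ f a := by
  simp only [mem_biUnion, ← exists_or, ← and_or_left]

theorem prepared_measureEven {d : ℕ} {b : Basis} {s s' : ℕ} {q : Qubit} :
    ((s', Op.prep .X q) ∈ measureEven d b s ∨ (s', Op.prep .Z q) ∈ measureEven d b s) ↔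
      s' = s ∧ EvenUses d q := by
  simp only [measureEven, mem_union]
  rw [or_or_or_comm, exists_mem_biUnion_or, exists_mem_biUnion_or]
  simp only [Prod.exists, exists_prep_mem_flaggedMeasurement, exists_prep_mem_pairMeasurement,
    mem_sdiff, mem_bulk_evenFaces, mem_evenFaces]
  cases q with
  | data i j => simp [EvenUses]
  | flag i j =>
    simp only [reduceCtorEq, and_false, false_or, Qubit.flag.injEq, EvenUses, or_false,
      exists_const]
    constructor
    · rintro ⟨a, b, h⟩
      omega
    · rintro ⟨h0, h1, h2, h3, h4, h | h⟩
      · exact ⟨i, j, by omega⟩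
      · exact ⟨i, j - 1, by omega⟩
  | anc i j =>
    simp only [reduceCtorEq, Qubit.anc.injEq, EvenUses, or_false]
    constructor
    · rintro (⟨a, b, h⟩ | ⟨a, b, h⟩) <;> omega
    · rintro h
      by_cases h1 : 1 ≤ i ∧ i ≤ d - 1 ∧ 1 ≤ j ∧ j ≤ d - 1 ∧ (i + j) % 2 = 0
      · exact .inl ⟨i, j, by omega⟩
      · exact .inr ⟨i, j, by omega⟩

theorem prepared_measureOdd {d : ℕ} (hodd : d % 2 = 1) {b : Basis} {s s' : ℕ} {q : Qubit} :
    ((s', Op.prep .X q) ∈ measureOdd d b s ∨ (s', Op.prep .Z q) ∈ measureOdd d b s) ↔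
      s' = s ∧ OddUses d q := by
  simp only [measureOdd, mem_union]
  rw [or_or_or_comm, exists_mem_biUnion_or, exists_mem_biUnion_or]
  simp only [Prod.exists, exists_prep_mem_flaggedMeasurement, exists_prep_mem_pairMeasurement,
    mem_sdiff, mem_bulk_oddFaces, mem_oddFaces]
  cases q with
  | data i j => simp [OddUses]
  | flag i j =>
    simp only [reduceCtorEq, false_or, Qubit.flag.injEq, OddUses]
    constructor
    · rintro (⟨a, b, h⟩ | ⟨a, b, h1, h2⟩)
      · omega
      · split_ifs at h2 <;> omega
    · rintro ⟨h0, h1, h2, h3, h4⟩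
      by_cases g1 : (i + j) % 2 = 1
      · by_cases g2 : j = d
        · refine .inr ⟨i, j, by omega, ?_⟩
          rw [if_neg (by omega)]
          omega
        · exact .inl ⟨i, j, by omega⟩
      · by_cases g2 : j = 1
        · refine .inr ⟨i, 0, by omega, ?_⟩
          rw [if_pos rfl]
          omega
        · exact .inl ⟨i, j - 1, by omega⟩
  | anc i j =>
    simp only [reduceCtorEq, Qubit.anc.injEq, OddUses, or_false, and_false, exists_const]
    constructor
    · rintro ⟨a, b, h⟩
      omega
    · rintro h
      exact ⟨i, j, by omega⟩

theorem meas_measureEven {d : ℕ} {b b' : Basis} {s s' : ℕ} {q : Qubit}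
    (h : (s', Op.meas b' q) ∈ measureEven d b s) : s' = s + 6 ∧ EvenUses d q := by
  simp only [measureEven, mem_union, mem_biUnion, Prod.exists, mem_sdiff, mem_bulk_evenFaces,
    mem_evenFaces] at h
  rcases h with ⟨i, j, h1, h2⟩ | ⟨i, j, h1, h2⟩
  · obtain ⟨rfl, rfl | rfl | rfl⟩ := meas_mem_flaggedMeasurement h2 <;>
    · refine ⟨rfl, ?_⟩; simp only [EvenUses]; omega
  · obtain ⟨rfl, rfl⟩ := meas_mem_pairMeasurement h2
    refine ⟨rfl, ?_⟩; simp only [EvenUses]; omega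

theorem meas_measureOdd {d : ℕ} {b b' : Basis} {s s' : ℕ} {q : Qubit}
    (h : (s', Op.meas b' q) ∈ measureOdd d b s) : s' = s + 6 ∧ OddUses d q := by
  simp only [measureOdd, mem_union, mem_biUnion, Prod.exists, mem_sdiff, mem_bulk_oddFaces,
    mem_oddFaces] at h
  rcases h with ⟨i, j, h1, h2⟩ | ⟨i, j, h1, h2⟩
  · obtain ⟨rfl, rfl | rfl | rfl⟩ := meas_mem_flaggedMeasurement h2 <;>
    · refine ⟨rfl, ?_⟩; simp only [OddUses]; omega
  · obtain ⟨rfl, rfl⟩ := meas_mem_pairMeasurement h2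
    refine ⟨rfl, ?_⟩
    simp only [OddUses]
    split_ifs <;> omega

theorem idle_notMem_measureEven {d : ℕ} {b : Basis} {s s' : ℕ} {q : Qubit} :
    (s', Op.idle q) ∉ measureEven d b s := by
  cases b <;> simp [measureEven, flaggedMeasurement, pairMeasurement, couple]

theorem idle_notMem_measureOdd {d : ℕ} {b : Basis} {s s' : ℕ} {q : Qubit} :
    (s', Op.idle q) ∉ measureOdd d b s := by
  cases b <;> simp [measureOdd, flaggedMeasurement, pairMeasurement, couple]

/-! ## The checks of the two codes -/

/-- The odd face below the data qubit `(i, j)`. -/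
def faceBelow (i j : ℕ) : ℕ × ℕ := (i, if (i + j) % 2 = 1 then j else j - 1)

/-- The odd face above the data qubit `(i, j)`. -/
def faceAbove (i j : ℕ) : ℕ × ℕ := (i - 1, if (i + j) % 2 = 0 then j else j - 1)

/-- The even face to the right of the data qubit `(i, j)`. -/
def faceRight (i j : ℕ) : ℕ × ℕ := (if (i + j) % 2 = 0 then i else i - 1, j)

/-- The even face to the left of the data qubit `(i, j)`. -/
def faceLeft (i j : ℕ) : ℕ × ℕ := (if (i + j) % 2 = 1 then i else i - 1, j - 1)

/-- Of the four faces around a qubit two are odd, one above and one below it. Odd faces exist also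
on the left and right boundaries, so only the top and bottom rows lack one of the two. -/
theorem mem_oddFaces_and_mem_plaquette {d i j : ℕ} (h1 : 1 ≤ i) (h2 : i ≤ d) (h3 : 1 ≤ j)
    (h4 : j ≤ d) (v : ℕ × ℕ) : v ∈ oddFaces d ∧ (i, j) ∈ plaquette d v ↔
      i + 1 ≤ d ∧ v = faceBelow i j ∨ 2 ≤ i ∧ v = faceAbove i j := by
  obtain ⟨k, l⟩ := v
  simp only [mem_oddFaces, mem_plaquette, faceBelow, faceAbove, Prod.mk.injEq]
  split_ifs <;> omega

theorem mem_evenFaces_and_mem_plaquette {d i j : ℕ} (h1 : 1 ≤ i) (h2 : i ≤ d) (h3 : 1 ≤ j)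
    (h4 : j ≤ d) (v : ℕ × ℕ) : v ∈ evenFaces d ∧ (i, j) ∈ plaquette d v ↔
      j + 1 ≤ d ∧ v = faceRight i j ∨ 2 ≤ j ∧ v = faceLeft i j := by
  obtain ⟨k, l⟩ := v
  simp only [mem_evenFaces, mem_plaquette, faceRight, faceLeft, Prod.mk.injEq]
  split_ifs <;> omega

theorem faceBelow_ne_faceAbove {i : ℕ} (h : 1 ≤ i) (j : ℕ) : faceBelow i j ≠ faceAbove i j := by
  intro h'
  have := congrArg Prod.fst h'
  simp only [faceBelow, faceAbove] at this
  omega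

theorem faceRight_ne_faceLeft {j : ℕ} (h : 1 ≤ j) (i : ℕ) : faceRight i j ≠ faceLeft i j := by
  intro h'
  have := congrArg Prod.snd h'
  simp only [faceRight, faceLeft] at this
  omega

theorem card_eq_one_or_two {α : Type*} [DecidableEq α] {s : Finset α} {v w : α} {P Q : Prop}
    (h : ∀ x, x ∈ s ↔ P ∧ x = v ∨ Q ∧ x = w) (hPQ : P ∨ Q) : #s = 1 ∨ #s = 2 := by
  by_cases hP : P
  · by_cases hQ : Q
    · have : s = {v, w} := by ext x; simp [h, hP, hQ]
      rw [this]
      by_cases hvw : v = w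
      · subst hvw; simp
      · exact .inr (Finset.card_pair hvw)
    · exact .inl (Finset.card_eq_one.2 ⟨v, by ext x; simp [h, hP, hQ]⟩)
  · have hQ := hPQ.resolve_left hP
    exact .inl (Finset.card_eq_one.2 ⟨w, by ext x; simp [h, hP, hQ]⟩)

/-! ### From the properties of a circuit to the counting of lines -/

namespace Problem

variable {D : Problem}

theorem checkValue_errorOn (q v : ℕ × ℕ) :
    D.checkValue (errorOn {q}) v = if q ∈ plaquette D.d v then 1 else 0 := by
  simp [checkValue, errorOn, Finset.sum_ite_eq']

theorem card_space_of {q v w : ℕ × ℕ} {P Q : Prop}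
    (h : ∀ x, x ∈ D.checks ∧ q ∈ plaquette D.d x ↔ P ∧ x = v ∨ Q ∧ x = w) (hPQ : P ∨ Q) :
    #{v ∈ D.checks | D.checkValue (errorOn {q}) v ≠ 0} = 1 ∨
    #{v ∈ D.checks | D.checkValue (errorOn {q}) v ≠ 0} = 2 := by
  refine card_eq_one_or_two (v := v) (w := w) (P := P) (Q := Q) (fun x => ?_) hPQ
  rw [mem_filter, checkValue_errorOn, ← h]
  simp

theorem checkValue_leftPair_ne_zero (f v : ℕ × ℕ) : D.checkValue (leftPair f) v ≠ 0 ↔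
    (f ∈ plaquette D.d v ↔ (f.1 + 1, f.2) ∉ plaquette D.d v) := by
  rw [leftPair_eq, checkValue_add, checkValue_errorOn, checkValue_errorOn]
  split_ifs with h1 h2 h2 <;> simp [h1, h2]
  decide

theorem card_le_weight {line : ℕ × ℕ → ℕ} {s : Finset ℕ} {x : DataError}
    (h : ∀ i ∈ s, D.lineSum line i x ≠ 0) : #s ≤ D.weight x := by
  have : s ⊆ ({q ∈ D.lattice | x q ≠ 0}).image line := by
    intro i hi
    obtain ⟨q, hq, hne⟩ := Finset.exists_ne_zero_of_sum_ne_zero (h i hi)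
    rw [mem_filter] at hq
    exact mem_image.2 ⟨q, mem_filter.2 ⟨hq.1, hne⟩, hq.2⟩
  exact (card_le_card this).trans card_image_le

/-- What is used of a syndrome measurement circuit. -/
structure Simulates (D : Problem) (T : ℕ) (layer : ℕ → ℕ) : Prop where
  layer_le : ∀ t < T, layer t ≤ T
  elementary : ∀ l ∈ D.circuit.locations T, ∀ a ∈ l.2.2.errors,
    D.Elementary T layer (D.effect T (Pi.single l a))
  space : ∀ t ≤ T, ∀ q ∈ D.lattice,
    D.SingleEffect T (errorOn {q}, D.syndrome t (errorOn {q}), 0)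
  pair_left : ∀ t < T, ∀ f ∈ D.flaggedFaces, D.SingleEffect T
    (leftPair f, D.syndrome (layer t) (leftPair f), Pi.single (t, f, .left) 1)
  pair_right : ∀ t < T, ∀ f ∈ D.flaggedFaces, D.SingleEffect T
    (rightPair f, D.syndrome (layer t) (rightPair f), Pi.single (t, f, .right) 1)
  corner : ∀ t < T, ∀ f ∈ D.flaggedFaces, ∀ σ, D.SingleEffect T
    (errorOn {corner f σ}, D.syndrome (layer t) (errorOn {corner f σ}), Pi.single (t, f, σ) 1)
  idle : ∀ q ∈ D.lattice, ((0, 0, .idle (.data q.1 q.2)) : Location) ∈ D.circuit.locations T ∧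
    D.effect T (Pi.single (0, 0, .idle (.data q.1 q.2)) (Pi.single D.err 1, 0)) =
      (errorOn {q}, D.syndrome 0 (errorOn {q}), 0)

variable {T : ℕ} {layer : ℕ → ℕ}

theorem Simulates.pair (h : D.Simulates T layer) (t : ℕ) (ht : t < T) (f : ℕ × ℕ)
    (hf : f ∈ D.flaggedFaces) (σ : Side) : ∃ x, (x = leftPair f ∨ x = rightPair f) ∧
      D.SingleEffect T (x, D.syndrome (layer t) x, Pi.single (t, f, σ) 1) := by
  cases σ
  · exact ⟨_, .inl rfl, h.pair_left t ht f hf⟩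
  · exact ⟨_, .inr rfl, h.pair_right t ht f hf⟩

theorem mem_lattice {i j : ℕ} : (i, j) ∈ D.lattice ↔ (1 ≤ i ∧ i ≤ D.d) ∧ 1 ≤ j ∧ j ≤ D.d := by
  simp [lattice]

theorem lineSum_fst {i : ℕ} (h1 : 1 ≤ i) (h2 : i ≤ D.d) (x : DataError) :
    D.lineSum Prod.fst i x = ∑ c ∈ Icc 1 D.d, x (i, c) := by
  rw [lineSum, lattice, Finset.sum_filter, Finset.sum_product,
    Finset.sum_eq_single_of_mem i (by simp [h1, h2])]
  · simp
  · intro b _ hb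
    simp [hb]

theorem lineSum_snd {i : ℕ} (h1 : 1 ≤ i) (h2 : i ≤ D.d) (x : DataError) :
    D.lineSum Prod.snd i x = ∑ c ∈ Icc 1 D.d, x (c, i) := by
  rw [lineSum, lattice, Finset.sum_filter, Finset.sum_product_right,
    Finset.sum_eq_single_of_mem i (by simp [h1, h2])]
  · simp
  · intro b _ hb
    simp [hb]

theorem lineSum_plaquette (line : ℕ × ℕ → ℕ) (f : ℕ × ℕ) (i : ℕ) :
    D.lineSum line i (errorOn (plaquette D.d f)) = #{q ∈ plaquette D.d f | line q = i} := by
  rw [lineSum, Finset.natCast_card_filter, Finset.sum_filter]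
  have h1 : ∀ q ∈ D.lattice, (if line q = i then errorOn (plaquette D.d f) q else 0) =
      if q ∈ plaquette D.d f then (if line q = i then 1 else 0) else (0 : ZMod 2) := by
    intro q _
    rw [errorOn]
    split_ifs <;> rfl
  rw [Finset.sum_congr rfl h1, Finset.sum_ite_mem]
  exact Finset.sum_congr (Finset.inter_eq_right.2 inter_subset_right) fun _ _ => rfl

theorem checkValue_sum (s : Finset ℕ) (g : ℕ → DataError) (v : ℕ × ℕ) :
    D.checkValue (∑ i ∈ s, g i) v = ∑ i ∈ s, D.checkValue (g i) v :=
  map_sum (AddMonoidHom.mk' (fun x => D.checkValue x v) fun x y => D.checkValue_add x y v) g s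

/-- Errors that are detected on the odd faces. -/
theorem tractable_rows (hd : 3 ≤ D.d) (hc : D.checks = oddFaces D.d) (hg : D.gens = evenFaces D.d)
    (h : D.Simulates T layer) : D.Tractable T Prod.fst (fun i => (i, 1)) layer where
  line_eq := .inl rfl
  point_mem i hi := by
    rw [mem_Icc] at hi
    rw [mem_lattice]
    omega
  line_point _ := rfl
  layer_le := h.layer_le
  checkValue_gen := by
    rintro ⟨i, j⟩ hf ⟨k, l⟩ hv
    rw [hg] at hf
    rw [hc] at hv
    exact sum_plaquette_plaquette hf hv
  lineSum_gen := by
    rintro ⟨k, l⟩ hf i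
    rw [hg, mem_evenFaces] at hf
    rw [lineSum_plaquette]
    -- Even faces have both of their columns in the lattice, so they meet each of their rows in two
    -- points.
    by_cases hi : (i = k ∨ i = k + 1) ∧ 1 ≤ i ∧ i ≤ D.d
    · have : ({q ∈ plaquette D.d (k, l) | q.1 = i} : Finset (ℕ × ℕ)) = {(i, l), (i, l + 1)} := by
        ext ⟨a, b⟩
        simp only [mem_filter, mem_plaquette, mem_insert, mem_singleton, Prod.mk.injEq]
        omega
      rw [this, card_pair (by simp)]
      rfl
    · have : ({q ∈ plaquette D.d (k, l) | q.1 = i} : Finset (ℕ × ℕ)) = ∅ := by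
        ext ⟨a, b⟩
        simp only [mem_filter, mem_plaquette, notMem_empty, iff_false]
        omega
      rw [this]
      rfl
  checkValue_line := by
    rintro ⟨k, l⟩ hv
    rw [hc, mem_oddFaces] at hv
    simp only [checkValue_sum, checkValue_errorOn]
    rw [Finset.sum_boole]
    -- The first column meets an odd face in two points or not at all.
    by_cases hl : l ≤ 1
    · have : ({i ∈ Icc 1 D.d | (i, 1) ∈ plaquette D.d (k, l)} : Finset ℕ) = {k, k + 1} := by
        ext a
        simp only [mem_filter, mem_plaquette, mem_insert, mem_singleton, mem_Icc]
        omega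
      rw [this, card_pair (by simp)]
      rfl
    · have : ({i ∈ Icc 1 D.d | (i, 1) ∈ plaquette D.d (k, l)} : Finset ℕ) = ∅ := by
        ext a
        simp only [mem_filter, mem_plaquette, mem_Icc, notMem_empty, iff_false]
        omega
      rw [this]
      rfl
  mem_trivialErrors := by
    intro x hx0 hx i hi hs
    rw [mem_Icc] at hi
    rw [lineSum_fst hi.1 hi.2] at hs
    rw [trivialErrors, hg]
    rw [hc] at hx
    exact mem_span_evenFaces x hx0 hx hi.1 hi.2 hs
  card_space := by
    rintro ⟨i, j⟩ hq
    rw [mem_lattice] at hq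
    refine card_space_of (v := faceBelow i j) (w := faceAbove i j) (P := i + 1 ≤ D.d) (Q := 2 ≤ i)
      ?_ (by omega)
    rw [hc]
    exact mem_oddFaces_and_mem_plaquette hq.1.1 hq.1.2 hq.2.1 hq.2.2
  card_cross := by
    rintro ⟨i, j⟩ hf
    rw [flaggedFaces, hg, mem_bulk_evenFaces] at hf
    -- The check to the left of the face contains both points of the pair; what remains are the
    -- checks above and below the face. Since `d ≥ 3`, at least one of them exists.
    refine card_eq_one_or_two (v := (i - 1, j)) (w := (i + 1, j)) (P := 2 ≤ i)
      (Q := i + 2 ≤ D.d) ?_ (by omega)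
    rintro ⟨k, l⟩
    rw [mem_filter, checkValue_leftPair_ne_zero, hc]
    simp only [mem_oddFaces, mem_plaquette, Prod.mk.injEq]
    omega
  elementary := h.elementary
  space := h.space
  pair := h.pair
  corner := h.corner
  idle := h.idle

/-- Errors that are detected on the even faces. -/
theorem tractable_columns (hd : 3 ≤ D.d) (hc : D.checks = evenFaces D.d)
    (hg : D.gens = oddFaces D.d) (h : D.Simulates T layer) :
    D.Tractable T Prod.snd (fun i => (1, i)) layer where
  line_eq := .inr rfl
  point_mem i hi := by
    rw [mem_Icc] at hi
    rw [mem_lattice]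
    omega
  line_point _ := rfl
  layer_le := h.layer_le
  checkValue_gen := by
    rintro ⟨i, j⟩ hf ⟨k, l⟩ hv
    rw [hg] at hf
    rw [hc] at hv
    exact sum_plaquette_plaquette' hv hf
  lineSum_gen := by
    rintro ⟨k, l⟩ hf i
    rw [hg, mem_oddFaces] at hf
    rw [lineSum_plaquette]
    by_cases hi : (i = l ∨ i = l + 1) ∧ 1 ≤ i ∧ i ≤ D.d
    · have : ({q ∈ plaquette D.d (k, l) | q.2 = i} : Finset (ℕ × ℕ)) = {(k, i), (k + 1, i)} := by
        ext ⟨a, b⟩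
        simp only [mem_filter, mem_plaquette, mem_insert, mem_singleton, Prod.mk.injEq]
        omega
      rw [this, card_pair (by simp)]
      rfl
    · have : ({q ∈ plaquette D.d (k, l) | q.2 = i} : Finset (ℕ × ℕ)) = ∅ := by
        ext ⟨a, b⟩
        simp only [mem_filter, mem_plaquette, notMem_empty, iff_false]
        omega
      rw [this]
      rfl
  checkValue_line := by
    rintro ⟨k, l⟩ hv
    rw [hc, mem_evenFaces] at hv
    simp only [checkValue_sum, checkValue_errorOn]
    rw [Finset.sum_boole]
    by_cases hl : k ≤ 1
    · have : ({i ∈ Icc 1 D.d | (1, i) ∈ plaquette D.d (k, l)} : Finset ℕ) = {l, l + 1} := by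
        ext a
        simp only [mem_filter, mem_plaquette, mem_insert, mem_singleton, mem_Icc]
        omega
      rw [this, card_pair (by simp)]
      rfl
    · have : ({i ∈ Icc 1 D.d | (1, i) ∈ plaquette D.d (k, l)} : Finset ℕ) = ∅ := by
        ext a
        simp only [mem_filter, mem_plaquette, mem_Icc, notMem_empty, iff_false]
        omega
      rw [this]
      rfl
  mem_trivialErrors := by
    intro x hx0 hx i hi hs
    rw [mem_Icc] at hi
    rw [lineSum_snd hi.1 hi.2] at hs
    rw [trivialErrors, hg]
    rw [hc] at hx
    exact mem_span_oddFaces x hx0 hx hi.1 hi.2 hs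
  card_space := by
    rintro ⟨i, j⟩ hq
    rw [mem_lattice] at hq
    refine card_space_of (v := faceRight i j) (w := faceLeft i j) (P := j + 1 ≤ D.d) (Q := 2 ≤ j)
      ?_ (by omega)
    rw [hc]
    exact mem_evenFaces_and_mem_plaquette hq.1.1 hq.1.2 hq.2.1 hq.2.2
  card_cross := by
    rintro ⟨i, j⟩ hf
    rw [flaggedFaces, hg, mem_bulk_oddFaces] at hf
    -- Here the faces above and below exist in any case, possibly as boundary faces.
    refine card_eq_one_or_two (v := (i - 1, j)) (w := (i + 1, j)) (P := True)
      (Q := True) ?_ (.inl trivial)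
    rintro ⟨k, l⟩
    rw [mem_filter, checkValue_leftPair_ne_zero, hc]
    simp only [mem_evenFaces, mem_plaquette, Prod.mk.injEq, true_and]
    omega
  elementary := h.elementary
  space := h.space
  pair := h.pair
  corner := h.corner
  idle := h.idle

/-- The fault with the effect of the flag on the left of the face `(1, 1)` leads to an error of
weight two in the first column. -/
theorem hasParallelWeightTwoFault (hd : 3 ≤ D.d) (hc : D.checks = oddFaces D.d)
    (hg : D.gens = evenFaces D.d) (hT : 1 ≤ T) (hs : D.Simulates T layer) :
    D.HasParallelWeightTwoFault T := by
  have h := tractable_rows hd hc hg hs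
  have hf : (1, 1) ∈ D.flaggedFaces := by
    rw [flaggedFaces, hg, mem_bulk_evenFaces]
    omega
  set L : DataError := ∑ i ∈ Icc 1 D.d, errorOn {(i, 1)} with hL
  have hLv : ∀ q, L q = if q.2 = 1 ∧ 1 ≤ q.1 ∧ q.1 ≤ D.d then 1 else 0 := by
    rintro ⟨a, b⟩
    rw [hL, Finset.sum_apply]
    simp only [errorOn, mem_singleton, Prod.mk.injEq]
    by_cases hb : b = 1
    · simp [hb, Finset.sum_ite_eq]
    · simp [hb]
  -- A logical operator with even weight on some row would be trivial, so it meets all `d` rows.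
  have hw : ∀ x, D.IsLogical x → D.d ≤ D.weight x := by
    intro x hx
    have := card_le_weight (D := D) (line := Prod.fst) (s := Icc 1 D.d) (x := x) fun i hi h0 =>
      hx.2.2 (h.mem_trivialErrors x hx.1 hx.2.1 i hi h0)
    simpa using this
  refine ⟨L, ⟨?_, h.checkValue_line, ?_⟩, ?_, hw,
    (hs.pair_left 0 (by omega) _ hf).singleFault fun e he => ?_⟩
  · rintro ⟨a, b⟩ hq
    rw [mem_lattice] at hq
    rw [hLv, if_neg]
    dsimp only
    omega
  · intro hmem
    have h1 := lineSum_eq_zero_of_trivial h hmem 1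
    rw [hL, lineSum_sum_point (line := Prod.fst) (point := fun i => (i, 1)) h.point_mem
      h.line_point le_rfl, if_pos (by simp; omega)] at h1
    exact one_ne_zero h1
  · have : ({q ∈ D.lattice | L q ≠ 0} : Finset (ℕ × ℕ)) = (Icc 1 D.d).image fun i => (i, 1) := by
      ext ⟨a, b⟩
      simp only [mem_filter, hLv, mem_lattice, mem_image, mem_Icc, Prod.mk.injEq, ne_eq,
        ite_eq_right_iff, one_ne_zero, imp_false, not_not]
      constructor
      · rintro ⟨h1, h2⟩
        exact ⟨a, by omega⟩
      · rintro ⟨i, h1, rfl, rfl⟩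
        omega
    rw [weight, this, card_image_of_injective _ fun a b hab => by simpa using hab]
    simp
  · have he1 : D.dataError T e = leftPair (1, 1) := by rw [← effect_data, he]
    have hcorner := corner_mem_lattice hf
    -- The odd weight on two rows survives the addition of trivial errors and gives the lower bound
    -- `2`.
    have hline : ∀ i ∈ ({1, 2} : Finset ℕ), D.lineSum Prod.fst i (leftPair (1, 1)) ≠ 0 := by
      intro i hi
      rw [leftPair_eq, lineSum_add, lineSum_errorOn hcorner.1, lineSum_errorOn hcorner.2.2.1]
      simp only [mem_insert, mem_singleton] at hi
      rcases hi with rfl | rfl <;> simp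
    rw [he1]
    refine ⟨?_, fun x hx => ?_, fun q hq => ?_⟩
    · have : ({q ∈ D.lattice | leftPair (1, 1) q ≠ 0} : Finset (ℕ × ℕ)) = {(1, 1), (2, 1)} := by
        ext ⟨a, b⟩
        simp only [mem_filter, mem_lattice, leftPair, errorOn, mem_insert, mem_singleton,
          Prod.mk.injEq, ne_eq, ite_eq_right_iff, one_ne_zero, imp_false, not_not]
        omega
      rw [weight, this, card_pair (by simp)]
    · have := card_le_weight (D := D) (line := Prod.fst) (s := {1, 2}) (x := leftPair (1, 1) + x)
        fun i hi => by
          rw [lineSum_add, lineSum_eq_zero_of_trivial h hx i, add_zero]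
          exact hline i hi
      simpa using this
    · obtain ⟨a, b⟩ := q
      simp only [leftPair, errorOn, mem_insert, mem_singleton, Prod.mk.injEq, ne_eq,
        ite_eq_right_iff, one_ne_zero, imp_false, not_not] at hq
      rw [hLv, if_pos]
      · exact one_ne_zero
      · dsimp only
        omega

end Problem

/-! ### Criterion for a circuit in terms of single qubits -/

namespace Problem

variable {D : Problem} {T : ℕ} {layer : ℕ → ℕ}

/-- A circuit simulates the code if the effects of errors on single qubits are as they should. -/
theorem simulates_of {lo hi s₀ : ℕ} (hD : D.Regular) (hT : 1 ≤ T) (hlo : 1 ≤ lo)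
    (hhi : hi + 1 ≤ D.circuit.steps) (hlayer : ∀ t < T, layer t ≤ T)
    (hdata : ∀ q ∈ D.lattice, D.DataRule T layer lo hi q)
    (hmem : ∀ q ∈ D.lattice, .data q.1 q.2 ∈ D.circuit.qubits)
    (hidle : ∀ s, s = 0 ∨ s + 1 = D.circuit.steps → ∀ q ∈ D.lattice, ∀ o,
      (s, o) ∈ D.circuit.gates → Qubit.data q.1 q.2 ∉ o.acts)
    (hw : ∀ i j, (i, j) ∈ D.flaggedFaces → D.SpreadWindow T layer s₀ i j)
    (hq : ∀ t < T, ∀ s < D.circuit.steps, ∀ q ∈ D.circuit.qubits,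
      D.Elementary T layer (D.after T t s q))
    (ha : ∀ s o, (s, o) ∈ D.circuit.gates → o.acts ⊆ D.circuit.qubits)
    (hc : ∀ s < D.circuit.steps, ∀ x y, D.circuit.Arrow D.err s x y →
      1 ≤ s ∧ D.circuit.Moves D.err s x y ∧ D.Silent (s - 1) x) : D.Simulates T layer where
  layer_le := hlayer
  elementary _ hl a _ := elementary_effect hq ha hD hc hl a
  space t ht q hq' := by
    rcases Nat.lt_or_ge t T with h | h
    · have h1 := singleEffect_idle h (by omega)
        (idle_mem_ops (hmem q hq') (hidle 0 (.inl rfl) q hq'))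
      rwa [(hdata q hq' t h 0 (by omega)).2.1 (by omega)] at h1
    -- Layer `T` has no noisy round of its own; its space edges come from data qubits that are idle
    -- in the last step of the last round.
    · obtain rfl : t = T := by omega
      have h2 : t - 1 < t := by omega
      have h1 := singleEffect_idle h2 (s := D.circuit.steps - 1) (by omega)
        (idle_mem_ops (hmem q hq') (hidle _ (.inr (by omega)) q hq'))
      rwa [(hdata q hq' (t - 1) h2 _ (by omega)).2.2 (by omega), Nat.sub_add_cancel hT] at h1
  pair_left t ht f hf := (hw f.1 f.2 hf).pair_left hD ht
  pair_right t ht f hf := (hw f.1 f.2 hf).pair_right hD ht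
  corner t ht f hf σ := (hw f.1 f.2 hf).corner hD ht σ
  idle q hq' := by
    have hl : ((0, 0, .idle (.data q.1 q.2)) : Location) ∈ D.circuit.locations T :=
      mem_locations.2 ⟨hT, by dsimp only; omega,
        idle_mem_ops (hmem q hq') (hidle 0 (.inl rfl) q hq')⟩
    refine ⟨hl, ?_⟩
    rw [effect_idle hl, (hdata q hq' 0 hT 0 (by omega)).2.1 (by omega)]
    rfl

theorem syndrome_eq_zero_of {x : DataError} (h : ∀ v ∈ D.checks, D.checkValue x v = 0) (t : ℕ) :
    D.syndrome t x = 0 := by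
  funext v
  rw [syndrome]
  split_ifs with hv
  · exact h _ hv.2
  · rfl

/-- The qubit `flag i j` is not a flag qubit for a generator of type `err`. -/
def Unflagged (D : Problem) (i j : ℕ) : Prop :=
  ∀ φ : Flag, φ.2.1 ∈ D.flaggedFaces → Qubit.flag i j ≠ φ.qubit

/-- A flag qubit can serve only the faces on its right and on its left. -/
theorem unflagged_of {i j : ℕ} (h1 : (i, j) ∉ D.flaggedFaces)
    (h2 : 1 ≤ j → (i, j - 1) ∉ D.flaggedFaces) : D.Unflagged i j := by
  rintro ⟨t, ⟨k, l⟩, σ⟩ hf h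
  cases σ
  · simp only [Flag.qubit, Qubit.flag.injEq] at h
    obtain ⟨rfl, rfl⟩ := h
    exact h1 hf
  · simp only [Flag.qubit, Qubit.flag.injEq] at h
    obtain ⟨rfl, rfl⟩ := h
    exact h2 (by omega) hf

theorem silent_anc {s i j : ℕ} (h : ∀ v ∈ D.checks, (s, Qubit.anc i j) ∉ D.readout v) :
    D.Silent s (.anc i j) := ⟨h, fun _ _ _ => by simp [Flag.qubit]⟩

/-- Flag qubits are read by the flag measurements. -/
theorem effectOf_flag_qubit (hD : D.Regular) {t : ℕ} (ht : t < T) {f : ℕ × ℕ} {σ : Side}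
    (hf : f ∈ D.flaggedFaces)
    (hpar : ∀ i j, (i, j) ∈ D.flaggedFaces → (i, j + 1) ∉ D.flaggedFaces)
    (h1 : ∀ i j, (i, j) ∈ D.flaggedFaces → ∀ v ∈ D.checks,
      (D.flagStep, Qubit.flag i j) ∉ D.readout v ∧
      (D.flagStep, Qubit.flag i (j + 1)) ∉ D.readout v) :
    D.effectOf T (Pi.single (t * D.circuit.steps + D.flagStep + 1)
      (Pi.single (Flag.qubit (t, f, σ)) 1)) = flagEffect (t, f, σ) := by
  obtain ⟨i, j⟩ := f
  refine effectOf_flag hD (φ := (t, (i, j), σ)) ht hf (fun v hv => ?_) ?_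
  · cases σ
    · exact (h1 i j hf v hv).1
    · exact (h1 i j hf v hv).2
  · rintro ⟨t', ⟨k, l⟩, σ'⟩ hf' h
    dsimp only at hf'
    -- Neighbouring faces in a row are never both flagged, so a flag qubit does not serve two of
    -- them.
    cases σ <;> cases σ' <;> simp only [Flag.qubit, Qubit.flag.injEq] at h
    · obtain ⟨rfl, rfl⟩ := h; rfl
    · obtain ⟨rfl, rfl⟩ := h; exact absurd hf (hpar _ _ hf')
    · obtain ⟨rfl, rfl⟩ := h; exact absurd hf' (hpar _ _ hf)
    · obtain ⟨rfl, h⟩ := h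
      obtain rfl : j = l := by omega
      rfl

end Problem

/-! ## The heavy hexagon code -/

/-- In step `k`, the `Z`-type gauge measurements copy `X` errors from the first to the second
qubit. -/
def PairCouple (d k : ℕ) : Qubit → Qubit → Prop
  | .data i j, .flag i' j' => 1 ≤ i' ∧ i' + 1 ≤ d ∧ 1 ≤ j' ∧ j' ≤ d ∧ j = j' ∧
      (k = 8 ∧ i = i' ∨ k = 9 ∧ i = i' + 1)
  | _, _ => False

/-- The range of the indices of the flag qubits. -/
def FlagRange (d : ℕ) : Qubit → Prop
  | .flag i j => 1 ≤ i ∧ i + 1 ≤ d ∧ 1 ≤ j ∧ j ≤ d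
  | _ => False

/-- The qubits of the heavy hexagon code. -/
def HexRange (d : ℕ) : Qubit → Prop
  | .data i j => 1 ≤ i ∧ i ≤ d ∧ 1 ≤ j ∧ j ≤ d
  | .flag i j => 1 ≤ i ∧ i + 1 ≤ d ∧ 1 ≤ j ∧ j ≤ d
  | .anc i j => i ≤ d ∧ 1 ≤ j ∧ j + 1 ≤ d ∧ (i + j) % 2 = 0

theorem data_mem_dataQubits {d i j : ℕ} :
    .data i j ∈ dataQubits d ↔ 1 ≤ i ∧ i ≤ d ∧ 1 ≤ j ∧ j ≤ d := by
  simp [dataQubits, and_assoc]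

theorem flag_mem_flagQubits {d i j : ℕ} :
    .flag i j ∈ flagQubits d ↔ 1 ≤ i ∧ i ≤ d - 1 ∧ 1 ≤ j ∧ j ≤ d := by
  simp [flagQubits, and_assoc]

theorem anc_mem_ancQubits {F : Finset (ℕ × ℕ)} {i j : ℕ} :
    .anc i j ∈ ancQubits F ↔ (i, j) ∈ F := by
  simp [ancQubits]

section Hex

variable {d : ℕ} (hd : 3 ≤ d)

theorem hex_mem_qubits {q : Qubit} : q ∈ (heavyHexCircuit d).qubits ↔ HexRange d q := by
  simp only [heavyHexCircuit, mem_union]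
  cases q with
  | data i j =>
    rw [data_mem_dataQubits]
    simp [flagQubits, ancQubits, HexRange]
  | flag i j =>
    rw [flag_mem_flagQubits]
    simp only [dataQubits, ancQubits, mem_image, reduceCtorEq, and_false, exists_const, false_or,
      or_false, HexRange]
    omega
  | anc i j =>
    rw [anc_mem_ancQubits, mem_evenFaces]
    simp only [dataQubits, flagQubits, mem_image, reduceCtorEq, and_false, exists_const, false_or,
      HexRange]
    omega

include hd in
theorem hex_arrow {s : ℕ} {x y : Qubit} : (heavyHexCircuit d).Arrow .X s x y ↔
    EvenCouple d s x y ∨ PairCouple d s x y := by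
  have h1 : couple .X x y = couple .Z y x := rfl
  simp only [Circuit.Arrow, heavyHexCircuit, mem_union, couple_mem_measureEven hd]
  refine or_congr (by simp) ?_
  simp only [h1, mem_biUnion, couple_mem_pairMeasurement, Prod.exists, mem_product, mem_Icc]
  cases x with
  | data i j =>
    cases y with
    | flag i' j' =>
      simp only [Qubit.flag.injEq, Qubit.data.injEq, PairCouple]
      constructor
      · rintro ⟨a, b, h⟩
        omega
      · intro h
        exact ⟨i', j', by omega⟩
    | _ => simp [PairCouple]
  | _ => simp [PairCouple]

theorem hex_prepared {s : ℕ} {q : Qubit} : (heavyHexCircuit d).Prepared s q ↔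
    s = 0 ∧ EvenUses d q ∨ s = 7 ∧ FlagRange d q := by
  simp only [Circuit.Prepared, heavyHexCircuit, mem_union]
  rw [or_or_or_comm, prepared_measureEven, exists_mem_biUnion_or]
  refine or_congr Iff.rfl ?_
  simp only [exists_prep_mem_pairMeasurement, Prod.exists, mem_product, mem_Icc]
  cases q with
  | flag i j =>
    simp only [Qubit.flag.injEq, FlagRange]
    constructor
    · rintro ⟨a, b, h⟩
      omega
    · intro h
      exact ⟨i, j, by omega⟩
  | _ => simp [FlagRange]

include hd in
theorem hex_moves {s : ℕ} {x y : Qubit} (h : (heavyHexCircuit d).Arrow .X s x y) :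
    (heavyHexCircuit d).Moves .X s x y := by
  have key : HexRange d x ∧ x ≠ y ∧ ¬ (s = 0 ∧ EvenUses d x ∨ s = 7 ∧ FlagRange d x) ∧
      ¬ (s = 0 ∧ EvenUses d y ∨ s = 7 ∧ FlagRange d y) := by
    rw [hex_arrow hd] at h
    cases x <;> cases y <;>
      simp only [EvenCouple, PairCouple, or_self, or_false, false_or] at h <;>
      simp only [HexRange, EvenUses, FlagRange, ne_eq, reduceCtorEq, not_false_eq_true, and_false,
        or_self, or_false, true_and, and_true] <;> omega
  refine ⟨hex_mem_qubits.2 key.1, key.2.1, fun h' => key.2.2.1 (hex_prepared.1 h'),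
    fun h' => key.2.2.2 (hex_prepared.1 h'), fun y' => ⟨fun h' => ?_, fun h' => h' ▸ h⟩⟩
  rw [hex_arrow hd] at h h'
  cases x <;> cases y <;> cases y' <;>
    simp only [EvenCouple, PairCouple, or_self, or_false, false_or] at h h' <;>
    simp only [Qubit.data.injEq, Qubit.flag.injEq, reduceCtorEq] <;> omega

include hd in
theorem hex_stays_data {s : ℕ} {i j : ℕ}
    (h : s ≠ 8 ∧ s ≠ 9 ∨ s = 8 ∧ d ≤ i ∨ s = 9 ∧ i ≤ 1) :
    (heavyHexCircuit d).Stays .X s (.data i j) := by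
  refine ⟨?_, fun y hy => ?_⟩
  · rw [hex_prepared]; simp [EvenUses, FlagRange]
  · rw [hex_arrow hd] at hy
    cases y <;> simp only [EvenCouple, PairCouple, or_self, false_or] at hy
    omega

include hd in
theorem hex_stays_anc {s : ℕ} {i j : ℕ}
    (h : 6 ≤ s ∨ 1 ≤ s ∧ (i = 0 ∨ i = d) ∧ s ≠ 2 ∧ s ≠ 4) :
    (heavyHexCircuit d).Stays .X s (.anc i j) := by
  refine ⟨?_, fun y hy => ?_⟩
  · rw [hex_prepared]; simp only [EvenUses, FlagRange, and_false, or_false]; omega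
  · rw [hex_arrow hd] at hy
    cases y <;> simp only [EvenCouple, PairCouple, or_self, or_false] at hy <;> omega

include hd in
theorem hex_stays_flag {s : ℕ} {i j : ℕ} (h : s = 1 ∨ s = 5 ∨ s = 6 ∨ 8 ≤ s ∨
    s ≠ 7 ∧ ((i + j) % 2 = 0 ∧ j = d ∨ (i + j) % 2 = 1 ∧ j = 1)) :
    (heavyHexCircuit d).Stays .X s (.flag i j) := by
  refine ⟨?_, fun y hy => ?_⟩
  · rw [hex_prepared]; simp only [EvenUses, FlagRange]; omega
  · rw [hex_arrow hd] at hy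
    cases y <;> simp only [EvenCouple, PairCouple, or_self, or_false] at hy
    omega

include hd in
theorem hex_resets_anc {i j : ℕ} (h : HexRange d (.anc i j)) :
    (heavyHexCircuit d).Resets .X 0 (.anc i j) := by
  refine ⟨hex_prepared.2 (.inl ⟨rfl, h⟩), fun y hy => ?_⟩
  rw [hex_arrow hd] at hy
  cases y <;> simp only [EvenCouple, PairCouple, or_self, or_false] at hy <;> omega

include hd in
theorem hex_resets_flag {s i j : ℕ} (h : HexRange d (.flag i j))
    (hs : s = 7 ∨ s = 0 ∧ ¬ ((i + j) % 2 = 0 ∧ j = d ∨ (i + j) % 2 = 1 ∧ j = 1)) :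
    (heavyHexCircuit d).Resets .X s (.flag i j) := by
  refine ⟨hex_prepared.2 ?_, fun y hy => ?_⟩
  · simp only [HexRange] at h
    simp only [EvenUses, FlagRange]
    omega
  · rw [hex_arrow hd] at hy
    cases y <;> simp only [EvenCouple, PairCouple, or_self, or_false] at hy
    omega

theorem hex_regular : (heavyHexX d).Regular where
  readout_lt v _ x hx := by
    obtain ⟨j, -, rfl⟩ := mem_image.1 hx
    exact Nat.lt_succ_self 10
  flagStep_lt := by simp [heavyHexX, heavyHexCircuit]

theorem hex_mem_readout {s i j : ℕ} {v : ℕ × ℕ} : (s, Qubit.flag i j) ∈ (heavyHexX d).readout v ↔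
    s = 10 ∧ v.1 = i ∧ (j = v.2 ∨ j = v.2 + 1) ∧ 1 ≤ j ∧ j ≤ d := by
  simp only [heavyHexX, mem_image, mem_inter, mem_insert, mem_singleton, mem_Icc, Prod.mk.injEq,
    Qubit.flag.injEq]
  constructor
  · rintro ⟨k, h⟩
    omega
  · intro h
    exact ⟨j, by omega⟩

theorem hex_readout_ne_data (v : ℕ × ℕ) (x : ℕ × Qubit) (hx : x ∈ (heavyHexX d).readout v)
    (i j : ℕ) : x.2 ≠ .data i j := by
  obtain ⟨j, -, rfl⟩ := mem_image.1 hx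
  simp

theorem hex_silent_anc (s i j : ℕ) : (heavyHexX d).Silent s (.anc i j) :=
  Problem.silent_anc fun v _ h => by
    obtain ⟨j, -, h⟩ := mem_image.1 h
    simp at h

theorem hex_mem_flaggedFaces {i j : ℕ} : (i, j) ∈ (heavyHexX d).flaggedFaces ↔
    1 ≤ i ∧ i ≤ d - 1 ∧ 1 ≤ j ∧ j ≤ d - 1 ∧ (i + j) % 2 = 0 := mem_bulk_evenFaces

/-- Flag qubits are read in step `10` as gauge outcomes and in step `6` as flags. The last two
alternatives describe the qubits at the sides of the lattice that are not flags of any weight-four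
face. -/
theorem hex_silent_flag {s i j : ℕ} (h : s ≠ 10 ∧ (s ≠ 6 ∨
    ((i + j) % 2 = 0 ∧ j = d ∨ (i + j) % 2 = 1 ∧ j = 1))) :
    (heavyHexX d).Silent s (.flag i j) := by
  refine ⟨fun v _ hv => h.1 (hex_mem_readout.1 hv).1, fun hs => ?_⟩
  change s = 6 at hs
  refine Problem.unflagged_of ?_ fun hj => ?_ <;> rw [hex_mem_flaggedFaces] <;> omega

/-- A stabilizer outcome is the parity of one or two gauge outcomes, and the supports of these gauge
operators lie in a single odd face each. -/
theorem hex_readsCheck {i j : ℕ} (h : HexRange d (.flag i j)) :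
    (heavyHexX d).ReadsCheck 10 (.flag i j) (faceBelow i j) := by
  refine ⟨?_, fun hs => absurd hs (by simp [heavyHexX])⟩
  rintro ⟨k, l⟩
  simp only [HexRange] at h
  rw [hex_mem_readout, show (heavyHexX d).checks = oddFaces d from rfl, mem_oddFaces, faceBelow,
    Prod.mk.injEq]
  split_ifs <;> omega

variable {T : ℕ}

include hd in
theorem hex_forgotten_anc {s i j : ℕ} (h : HexRange d (.anc i j)) (hs : 6 ≤ s) (hs' : s < 11) :
    (heavyHexX d).Forgotten T s (.anc i j) :=
  Problem.forgotten_of_wrap hex_regular hs' (Nat.zero_lt_succ _) (by simp) (hex_resets_anc hd h)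
    fun v _ hv => ⟨hex_stays_anc hd (by omega), hex_silent_anc _ _ _⟩

include hd in
-- The next preparation takes place in step `0` of the following round if the qubit is a flag, and
-- otherwise in step `7`.
theorem hex_forgotten_flag {i j : ℕ} (h : HexRange d (.flag i j)) :
    (heavyHexX d).Forgotten T 10 (.flag i j) := by
  by_cases hu : (i + j) % 2 = 0 ∧ j = d ∨ (i + j) % 2 = 1 ∧ j = 1
  · refine Problem.forgotten_of_wrap hex_regular (Nat.lt_succ_self 10) (u := 7)
      (by simp [heavyHexX, heavyHexCircuit]) (by simp) (hex_resets_flag hd h (.inl rfl))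
      fun v hv hv' => ?_
    change v < 11 at hv
    exact ⟨hex_stays_flag hd (by omega), hex_silent_flag (by omega)⟩
  · refine Problem.forgotten_of_wrap hex_regular (Nat.lt_succ_self 10) (u := 0)
      (by simp [heavyHexX, heavyHexCircuit]) (by simp) (hex_resets_flag hd h (.inr ⟨rfl, hu⟩))
      fun v hv hv' => ?_
    change v < 11 at hv
    omega

include hd in
theorem hex_after_flag {t : ℕ} (ht : t < T) {s i j : ℕ} (h : HexRange d (.flag i j)) (hs : 7 ≤ s)
    (hs' : s < 11) : (heavyHexX d).after T t s (.flag i j) =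
      (heavyHexX d).vertEffect t (faceBelow i j) := by
  have hlt : 10 < (heavyHexX d).circuit.steps := Nat.lt_succ_self 10
  rw [Problem.after_read hex_regular ht (show s ≤ 10 by omega) hlt (fun v h1 h2 => ?_)
    (fun v h1 h2 => ?_) (hex_forgotten_flag hd h)]
  · exact Problem.effectOf_readsCheck hex_regular ht hlt (.inr (by simp)) (hex_readsCheck h)
  · exact hex_stays_flag hd (by omega)
  · exact hex_silent_flag (by omega)

include hd in
-- The preparation in step `7` separates the two roles of the qubit, as a flag and as a measurement
-- qubit.
theorem hex_forgotten_flag_six {i j : ℕ} (h : HexRange d (.flag i j)) :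
    (heavyHexX d).Forgotten T 6 (.flag i j) :=
  Problem.forgotten_of_resets hex_regular (u := 7) (by omega)
    (by simp [heavyHexX, heavyHexCircuit]) (hex_resets_flag hd h (.inl rfl)) fun v _ _ => by omega

include hd in
-- Step `8` couples a data qubit to the gauge measurement below it and step `9` to the one above it;
-- the corresponding checks are the two odd faces of the qubit. All errors before step `8` are seen
-- in the same round.
theorem hex_dataRule (q : ℕ × ℕ) (hq : q ∈ (heavyHexX d).lattice) :
    (heavyHexX d).DataRule T (fun t => t) 8 9 q := by
  obtain ⟨i, j⟩ := q
  have hq' := hq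
  rw [Problem.mem_lattice] at hq'
  change (1 ≤ i ∧ i ≤ d) ∧ 1 ≤ j ∧ j ≤ d at hq'
  have hc := mem_oddFaces_and_mem_plaquette hq'.1.1 hq'.1.2 hq'.2.1 hq'.2.2
  have m1 : i + 1 ≤ d → (heavyHexCircuit d).Moves .X 8 (.data i j) (.flag i j) := fun h =>
    hex_moves hd ((hex_arrow hd).2 (.inr (by simp [PairCouple]; omega)))
  have m2 : 2 ≤ i → (heavyHexCircuit d).Moves .X 9 (.data i j) (.flag (i - 1) j) := fun h =>
    hex_moves hd ((hex_arrow hd).2 (.inr (by simp [PairCouple]; omega)))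
  have a1 : i + 1 ≤ d → ∀ t < T, (heavyHexX d).after T t 8 (.flag i j) =
      (heavyHexX d).vertEffect t (faceBelow i j) := fun h t ht =>
    hex_after_flag hd ht (by simp only [HexRange]; omega) (by omega) (by omega)
  have a2 : 2 ≤ i → ∀ t < T, (heavyHexX d).after T t 9 (.flag (i - 1) j) =
      (heavyHexX d).vertEffect t (faceAbove i j) := fun h t ht => by
    have : faceAbove i j = faceBelow (i - 1) j := by
      rw [faceAbove, faceBelow]
      split_ifs <;> first | rfl | (exfalso; omega)
    rw [this]
    exact hex_after_flag hd ht (by simp only [HexRange]; omega) (by omega) (by omega)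
  have hlt : 9 < (heavyHexX d).circuit.steps := by simp [heavyHexX, heavyHexCircuit]
  have hr := fun v (_ : v ∈ (heavyHexX d).checks) => hex_readout_ne_data (d := d) v
  by_cases h1 : i + 1 ≤ d
  · by_cases h2 : 2 ≤ i
    · exact Problem.dataRule_two hex_regular hr hq (by omega) (show 8 < 9 by omega) hlt le_rfl
        le_rfl (faceBelow_ne_faceAbove (by omega) j) (fun v => (hc v).trans (by simp [h1, h2]))
        (fun s _ _ => hex_stays_data hd (by omega)) (m1 h1) (m2 h2) (a1 h1) (a2 h2)
    · exact Problem.dataRule_one hex_regular hr hq (s₁ := 8) (by omega) (by omega) le_rfl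
        (by omega) (fun v => (hc v).trans (by simp [h1, h2]))
        (fun s _ => hex_stays_data hd (by dsimp only; omega)) (m1 h1) (a1 h1)
  · have h2 : 2 ≤ i := by omega
    exact Problem.dataRule_one hex_regular hr hq (s₁ := 9) (by omega) hlt (by omega)
      le_rfl (fun v => (hc v).trans (by simp [h1, h2]))
      (fun s _ => hex_stays_data hd (by dsimp only; omega)) (m2 h2) (a2 h2)

include hd in
-- The gauge measurements that detect `X` errors follow in the same round, so errors spread in round
-- `t` are detected in layer `t`.
theorem hex_spreadWindow {i j : ℕ} (h : (i, j) ∈ (heavyHexX d).flaggedFaces) :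
    (heavyHexX d).SpreadWindow T (fun t => t) 0 i j := by
  have h' := hex_mem_flaggedFaces.1 h
  have hl : HexRange d (.flag i j) := by simp only [HexRange]; omega
  have hr : HexRange d (.flag i (j + 1)) := by simp only [HexRange]; omega
  have ha : HexRange d (.anc i j) := by simp only [HexRange]; omega
  refine ⟨by simp [heavyHexX, heavyHexCircuit], h, hex_mem_qubits.2 ha, hex_mem_qubits.2 hl,
    hex_mem_qubits.2 hr, fun k h1 h2 => ?_, fun k h1 h2 y => (hex_arrow hd).trans ?_,
    fun k h1 h2 y => (hex_arrow hd).trans ?_, fun k h1 h2 y => (hex_arrow hd).trans ?_,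
    fun k _ => hex_silent_anc _ _ _, fun k _ => hex_silent_flag (by omega),
    fun k _ => hex_silent_flag (by omega), hex_forgotten_anc hd ha (by omega) (by omega),
    hex_forgotten_flag_six hd hl, hex_forgotten_flag_six hd hr, fun t ht σ => ?_,
    fun t ht k hk q hq => ?_⟩
  · change ¬ (heavyHexCircuit d).Prepared (0 + k) _ ∧ ¬ (heavyHexCircuit d).Prepared (0 + k) _ ∧
      ¬ (heavyHexCircuit d).Prepared (0 + k) _ ∧
      ∀ i' j', ¬ (heavyHexCircuit d).Prepared (0 + k) (.data i' j')
    simp only [hex_prepared, EvenUses, FlagRange, and_false, or_false, not_false_eq_true,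
      implies_true, and_true]
    omega
  · cases y <;> simp only [EvenCouple, PairCouple, Qubit.flag.injEq, reduceCtorEq, and_false,
      iff_false, or_false] <;> omega
  · cases y <;> simp only [EvenCouple, PairCouple, Qubit.data.injEq, reduceCtorEq, and_false,
      or_false] <;> omega
  · cases y <;> simp only [EvenCouple, PairCouple, Qubit.data.injEq, reduceCtorEq, and_false,
      or_false] <;> omega
  · refine Problem.effectOf_flag_qubit hex_regular ht h (fun i j h1 h2 => ?_) fun i j h1 v hv => ?_
    · rw [hex_mem_flaggedFaces] at h1 h2
      omega
    · rw [hex_mem_readout, hex_mem_readout]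
      simp [heavyHexX]
  · exact (hex_dataRule hd q hq t ht (0 + k) (by simp [heavyHexX, heavyHexCircuit]; omega)).2.1
      (by omega)

include hd in
theorem hex_elementary {t s : ℕ} (ht : t < T) (hs : s < (heavyHexX d).circuit.steps) {q : Qubit}
    (hq : q ∈ (heavyHexX d).circuit.qubits) :
    (heavyHexX d).Elementary T (fun t => t) ((heavyHexX d).after T t s q) := by
  change s < 11 at hs
  replace hq : HexRange d q := hex_mem_qubits.1 hq
  cases q with
  | data i j =>
    simp only [HexRange] at hq
    exact (hex_dataRule hd (i, j) (by rw [Problem.mem_lattice]; exact ⟨⟨hq.1, hq.2.1⟩, hq.2.2⟩)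
      t ht s hs).1
  | flag i j =>
    rcases Nat.lt_or_ge s 7 with h1 | h1
    · by_cases hu : (i + j) % 2 = 0 ∧ j = d ∨ (i + j) % 2 = 1 ∧ j = 1
      -- This qubit takes no part in the `X`-type measurements and waits for its preparation in step
      -- `7`.
      · have : (heavyHexX d).Forgotten T s (.flag i j) :=
          Problem.forgotten_of_resets hex_regular (u := 7) h1
            (by simp [heavyHexX, heavyHexCircuit]) (hex_resets_flag hd hq (.inl rfl))
            fun v _ _ => ⟨hex_stays_flag hd (by omega), hex_silent_flag (by omega)⟩
        rw [this.after_eq_zero hex_regular hs (by simp) (hex_silent_flag (by omega)) ht]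
        exact Problem.elementary_zero _ _ _
      · simp only [HexRange] at hq
        by_cases hp : (i + j) % 2 = 0
        · have hw := hex_spreadWindow (T := T) hd (i := i) (j := j)
            (hex_mem_flaggedFaces.2 (by omega))
          exact Nat.zero_add s ▸ hw.elementary_left hex_regular ht (k := s) (by omega)
        · obtain ⟨n, rfl⟩ := Nat.exists_eq_add_of_le' hq.2.2.1
          have hw := hex_spreadWindow (T := T) hd (i := i) (j := n)
            (hex_mem_flaggedFaces.2 (by omega))
          exact Nat.zero_add s ▸ hw.elementary_right hex_regular ht (k := s) (by omega)
    · rw [hex_after_flag hd ht hq h1 hs]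
      exact .vert
  | anc i j =>
    rcases Nat.lt_or_ge 6 s with h1 | h1
    · rw [(hex_forgotten_anc hd hq h1.le hs).after_eq_zero hex_regular hs (by simp)
        (hex_silent_anc _ _ _) ht]
      exact Problem.elementary_zero _ _ _
    · have hq' := hq
      simp only [HexRange] at hq
      have hg : (i, j) ∈ (heavyHexX d).gens := mem_evenFaces.2 (by omega)
      have hsyn : (heavyHexX d).syndrome t
          (errorOn (plaquette (heavyHexX d).d (i, j))) = 0 :=
        Problem.syndrome_eq_zero_of (by
          rintro ⟨k, l⟩ hv
          exact sum_plaquette_plaquette hg hv) t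
      -- Faces on the top and bottom boundaries have weight two and are measured without flags.
      by_cases hb : i = 0 ∨ i = d
      · have hdata : ∀ s, 0 ≤ s → s ≤ 6 → ∀ q ∈ (heavyHexX d).lattice,
            (heavyHexX d).after T t s (.data q.1 q.2) = (heavyHexX d).spaceEffect t q :=
          fun s _ h2 q hq => (hex_dataRule hd q hq t ht s (show s < 11 by omega)).2.1 (by omega)
        have hm : ∀ k j', k = 4 ∧ j' = j ∨ k = 2 ∧ j' = j + 1 → (heavyHexCircuit d).Moves .X k
            (.anc i j) (.data (if i = 0 then 1 else d) j') := by
          intro k j' hk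
          refine hex_moves hd ((hex_arrow hd).2 (.inl ?_))
          simp only [EvenCouple]
          split_ifs <;> omega
        refine Problem.elementary_of_pair hex_regular (layer := fun t => t) (s₀ := 0) (s₁ := 2)
          (s₂ := 4) (m := 6) (q₁ := (if i = 0 then 1 else d, j + 1))
          (q₂ := (if i = 0 then 1 else d, j)) (f := (i, j)) ht (by omega) (by omega) (by omega)
          (by simp [heavyHexX, heavyHexCircuit]) (by simp) (hm 2 _ (by omega)) (hm 4 _ (by omega))
          (fun s h2 h3 h4 h5 => hex_stays_anc hd (by omega)) (fun s _ _ => hex_silent_anc _ _ _)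
          (hex_forgotten_anc hd hq' le_rfl (by omega)) hg ?_ (by simp) hsyn ht.le hdata
          (Nat.zero_le s) h1
        ext ⟨a, b⟩
        rw [mem_plaquette]
        simp only [mem_insert, mem_singleton, Prod.mk.injEq]
        change (a = i ∨ a = i + 1) ∧ (b = j ∨ b = j + 1) ∧ 1 ≤ a ∧ a ≤ d ∧ 1 ≤ b ∧ b ≤ d ↔ _
        split_ifs <;> omega
      · have hw := hex_spreadWindow (T := T) hd (i := i) (j := j)
            (hex_mem_flaggedFaces.2 (by omega))
        exact Nat.zero_add s ▸ hw.elementary_anc hex_regular ht hsyn (k := s) h1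

include hd in
theorem hex_gate {s : ℕ} {o : Op} (h : (s, o) ∈ (heavyHexCircuit d).gates) :
    (∃ x y, o.acts = {x, y} ∧ (heavyHexCircuit d).Arrow .X s x y) ∨
      ∃ q, o.acts = {q} ∧ (EvenUses d q ∨ FlagRange d q) := by
  cases o with
  | cnot c t => exact .inl ⟨c, t, rfl, h⟩
  | prep b q =>
    have hp : (heavyHexCircuit d).Prepared s q := by
      cases b
      · exact .inl h
      · exact .inr h
    exact .inr ⟨q, rfl, (hex_prepared.1 hp).imp And.right And.right⟩
  | meas b q =>
    refine .inr ⟨q, rfl, ?_⟩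
    rcases mem_union.1 h with h | h
    · exact .inl (meas_measureEven h).2
    · simp only [mem_biUnion, Prod.exists, mem_product, mem_Icc] at h
      obtain ⟨i, j, h1, h2⟩ := h
      obtain ⟨-, rfl⟩ := meas_mem_pairMeasurement h2
      simp only [FlagRange]
      omega
  | idle q =>
    rcases mem_union.1 h with h | h
    · exact absurd h idle_notMem_measureEven
    · simp [pairMeasurement, couple] at h

include hd in
theorem hex_arrow_range {s : ℕ} {x y : Qubit} (h : (heavyHexCircuit d).Arrow .X s x y) :
    HexRange d x ∧ HexRange d y ∧ 1 ≤ s ∧ s ≤ 9 ∧ ∀ i j, x = .flag i j → s ≤ 4 := by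
  rw [hex_arrow hd] at h
  cases x <;> cases y <;>
    simp only [EvenCouple, PairCouple, or_self, or_false, false_or] at h <;>
    simp only [HexRange, reduceCtorEq, false_imp_iff, implies_true, and_true, Qubit.flag.injEq] <;>
    first
    | omega
    | exact ⟨by omega, by omega, by omega, by omega, fun _ _ _ => by omega⟩

include hd in
theorem hex_simulates (hT : 1 ≤ T) : (heavyHexX d).Simulates T fun t => t := by
  refine Problem.simulates_of hex_regular hT (by omega)
    (by simp [heavyHexX, heavyHexCircuit]) (fun t ht => ht.le) (hex_dataRule hd) ?_ ?_
    (fun i j => hex_spreadWindow hd) (fun t ht s hs q hq => hex_elementary hd ht hs hq) ?_ ?_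
  · rintro ⟨i, j⟩ hq
    rw [Problem.mem_lattice] at hq
    exact hex_mem_qubits.2 ⟨hq.1.1, hq.1.2, hq.2⟩
  · rintro s hs ⟨i, j⟩ hq o ho hmem
    change s = 0 ∨ s + 1 = 11 at hs
    rcases hex_gate hd ho with ⟨x, y, h1, h2⟩ | ⟨q, h1, h2⟩
    · have := hex_arrow_range hd h2
      omega
    · rw [h1, mem_singleton] at hmem
      subst hmem
      simp [EvenUses, FlagRange] at h2
  · intro s o ho q hq
    refine hex_mem_qubits.2 ?_
    rcases hex_gate hd ho with ⟨x, y, h1, h2⟩ | ⟨q', h1, h2⟩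
    · have := hex_arrow_range hd h2
      rw [h1, mem_insert, mem_singleton] at hq
      rcases hq with rfl | rfl
      exacts [this.1, this.2.1]
    · rw [h1, mem_singleton] at hq
      subst hq
      cases q <;> simp only [EvenUses, FlagRange, or_self, or_false] at h2 <;>
        simp only [HexRange] <;> omega
  · intro s _ x y h
    have hr := hex_arrow_range hd h
    refine ⟨hr.2.2.1, hex_moves hd h, ?_⟩
    cases x with
    | data i j =>
      exact Problem.silent_data (fun v _ => hex_readout_ne_data v) _ _ _
    | flag i j =>
      have := hr.2.2.2.2 i j rfl
      exact hex_silent_flag (by omega)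
    | anc i j => exact hex_silent_anc _ _ _

end Hex

/-! ## The heavy square code -/

/-- The qubits of the heavy square code. -/
def SquareRange (d : ℕ) : Qubit → Prop
  | .data i j => 1 ≤ i ∧ i ≤ d ∧ 1 ≤ j ∧ j ≤ d
  | .flag i j => 1 ≤ i ∧ i + 1 ≤ d ∧ 1 ≤ j ∧ j ≤ d
  | .anc i j => i ≤ d ∧ 1 ≤ j ∧ j + 1 ≤ d ∧ ((i + j) % 2 = 0 ∨ (i + j) % 2 = 1 ∧ 1 ≤ i ∧ i + 1 ≤ d)

section Square

variable {d : ℕ} (hd : 3 ≤ d) (hodd : d % 2 = 1)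

theorem square_mem_qubits {q : Qubit} : q ∈ (heavySquareCircuit d).qubits ↔ SquareRange d q := by
  simp only [heavySquareCircuit, mem_union]
  cases q with
  | data i j =>
    rw [data_mem_dataQubits]
    simp [flagQubits, ancQubits, SquareRange]
  | flag i j =>
    rw [flag_mem_flagQubits]
    simp only [dataQubits, ancQubits, mem_image, reduceCtorEq, and_false, exists_const, false_or,
      or_false, SquareRange]
    omega
  | anc i j =>
    rw [anc_mem_ancQubits, mem_union, mem_evenFaces, mem_bulk_oddFaces]
    simp only [dataQubits, flagQubits, mem_image, reduceCtorEq, and_false, exists_const, false_or,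
      SquareRange]
    omega

include hd hodd in
-- `X` errors run along the CNOTs of the `X`-type measurements from the syndrome qubit to the data,
-- and along those of the `Z`-type measurements in the opposite direction. For `Z` errors both
-- directions are reversed.
theorem square_arrow {s : ℕ} {x y : Qubit} : (heavySquareCircuit d).Arrow .X s x y ↔
    OddCouple d s x y ∨ 7 ≤ s ∧ EvenCouple d (s - 7) y x := by
  have h1 : couple .X x y = couple .Z y x := rfl
  simp only [Circuit.Arrow, heavySquareCircuit, mem_union, couple_mem_measureOdd hd hodd]
  rw [h1, couple_mem_measureEven hd]
  simp

include hd hodd in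
theorem square_arrow' {s : ℕ} {x y : Qubit} : (heavySquareCircuit d).Arrow .Z s x y ↔
    OddCouple d s y x ∨ 7 ≤ s ∧ EvenCouple d (s - 7) x y :=
  square_arrow hd hodd (x := y) (y := x)

include hodd in
theorem square_prepared {s : ℕ} {q : Qubit} : (heavySquareCircuit d).Prepared s q ↔
    s = 0 ∧ OddUses d q ∨ s = 7 ∧ EvenUses d q := by
  simp only [Circuit.Prepared, heavySquareCircuit, mem_union]
  rw [or_or_or_comm, prepared_measureEven, prepared_measureOdd hodd]

include hodd in
theorem square_gate {s : ℕ} {o : Op} (h : (s, o) ∈ (heavySquareCircuit d).gates) :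
    (∃ x y, o.acts = {x, y} ∧ (heavySquareCircuit d).Arrow .X s x y) ∨
      ∃ q, o.acts = {q} ∧ (OddUses d q ∨ EvenUses d q) := by
  cases o with
  | cnot c t => exact .inl ⟨c, t, rfl, h⟩
  | prep b q =>
    have hp : (heavySquareCircuit d).Prepared s q := by
      cases b
      · exact .inl h
      · exact .inr h
    exact .inr ⟨q, rfl, ((square_prepared hodd).1 hp).imp And.right And.right⟩
  | meas b q =>
    refine .inr ⟨q, rfl, ?_⟩
    rcases mem_union.1 h with h | h
    · exact .inl (meas_measureOdd h).2
    · exact .inr (meas_measureEven h).2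
  | idle q =>
    rcases mem_union.1 h with h | h
    · exact absurd h idle_notMem_measureOdd
    · exact absurd h idle_notMem_measureEven

include hd hodd in
theorem square_arrow_range {s : ℕ} {x y : Qubit} (h : (heavySquareCircuit d).Arrow .X s x y) :
    SquareRange d x ∧ SquareRange d y ∧ x ≠ y ∧ 1 ≤ s ∧ s ≠ 7 ∧ s ≤ 12 ∧
      (∀ i j, x = .flag i j → s ≠ 6 ∧ s ≠ 7) ∧
      ∀ i j, y = .flag i j → s ≠ 6 ∧ s ≠ 7 := by
  rw [square_arrow hd hodd] at h
  cases x <;> cases y <;>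
    simp only [EvenCouple, OddCouple, and_false, or_self, or_false, false_or] at h <;>
    simp only [SquareRange, ne_eq, reduceCtorEq, not_false_eq_true, true_and] <;>
    exact ⟨by omega, by omega, by omega, by omega, by omega, fun _ _ _ => by omega,
      fun _ _ _ => by omega⟩

include hd hodd in
theorem square_not_prepared {s : ℕ} {x y : Qubit} (h : (heavySquareCircuit d).Arrow .X s x y)
    (q : Qubit) : ¬ (heavySquareCircuit d).Prepared s q := by
  have := square_arrow_range hd hodd h
  rw [square_prepared hodd]
  omega

set_option maxHeartbeats 800000 in
include hd hodd in
theorem square_moves {s : ℕ} {x y : Qubit} (h : (heavySquareCircuit d).Arrow .X s x y) :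
    (heavySquareCircuit d).Moves .X s x y := by
  have hr := square_arrow_range hd hodd h
  have hp := square_not_prepared hd hodd h
  refine ⟨square_mem_qubits.2 hr.1, hr.2.2.1, hp _, hp _,
    fun y' => ⟨fun h' => ?_, fun h' => h' ▸ h⟩⟩
  rw [square_arrow hd hodd] at h h'
  cases x <;> cases y <;> cases y' <;>
    simp only [EvenCouple, OddCouple, and_false, or_self, or_false, false_or] at h h' <;>
    simp only [Qubit.data.injEq, Qubit.flag.injEq, Qubit.anc.injEq, reduceCtorEq] <;> omega

set_option maxHeartbeats 800000 in
include hd hodd in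
theorem square_moves' {s : ℕ} {x y : Qubit} (h : (heavySquareCircuit d).Arrow .Z s x y) :
    (heavySquareCircuit d).Moves .Z s x y := by
  have hr := square_arrow_range hd hodd (x := y) (y := x) h
  have hp := square_not_prepared hd hodd (x := y) (y := x) h
  refine ⟨square_mem_qubits.2 hr.2.1, hr.2.2.1.symm, hp _, hp _,
    fun y' => ⟨fun h' => ?_, fun h' => h' ▸ h⟩⟩
  rw [square_arrow' hd hodd] at h h'
  cases x <;> cases y <;> cases y' <;>
    simp only [EvenCouple, OddCouple, and_false, or_self, or_false, false_or] at h h' <;>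
    simp only [Qubit.data.injEq, Qubit.flag.injEq, Qubit.anc.injEq, reduceCtorEq] <;> omega

include hodd in
theorem square_not_prepared_data (s i j : ℕ) :
    ¬ (heavySquareCircuit d).Prepared s (.data i j) := by
  rw [square_prepared hodd]
  simp [EvenUses, OddUses]

include hodd in
theorem square_not_prepared_of {s : ℕ} (h : s ≠ 0) (h' : s ≠ 7) (q : Qubit) :
    ¬ (heavySquareCircuit d).Prepared s q := by
  rw [square_prepared hodd]
  omega

/-- The flag qubit is not used in the measurements on even faces. -/
def EvenIdle (d i j : ℕ) : Prop := (i + j) % 2 = 0 ∧ j = d ∨ (i + j) % 2 = 1 ∧ j = 1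

include hd hodd in
-- These steps contain only preparations and measurements, or lie after the end of the round.
theorem square_arrow_zero {s : ℕ} (hs : s = 0 ∨ s = 6 ∨ s = 7 ∨ 13 ≤ s) (x y : Qubit) :
    ¬ (heavySquareCircuit d).Arrow .X s x y := by
  intro h
  rw [square_arrow hd hodd] at h
  cases x <;> cases y <;>
    simp only [EvenCouple, OddCouple, and_false, or_self, or_false, false_or] at h <;> omega

include hd hodd in
theorem square_resets_of_prepared {s : ℕ} {q : Qubit} (b : Basis)
    (h : (heavySquareCircuit d).Prepared s q) : (heavySquareCircuit d).Resets b s q := by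
  refine ⟨h, fun y hy => ?_⟩
  have hs : s = 0 ∨ s = 6 ∨ s = 7 ∨ 13 ≤ s := by
    rw [square_prepared hodd] at h
    omega
  cases b
  · exact square_arrow_zero hd hodd hs _ _ hy
  · exact square_arrow_zero hd hodd hs y q hy

include hd hodd in
theorem square_resets_flag {i j : ℕ} (b : Basis) (h : SquareRange d (.flag i j)) :
    (heavySquareCircuit d).Resets b 0 (.flag i j) :=
  square_resets_of_prepared hd hodd b ((square_prepared hodd).2 (.inl ⟨rfl, h⟩))

include hd hodd in
theorem square_resets_flag_seven {i j : ℕ} (b : Basis) (h : SquareRange d (.flag i j))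
    (h' : ¬ EvenIdle d i j) : (heavySquareCircuit d).Resets b 7 (.flag i j) := by
  refine square_resets_of_prepared hd hodd b ((square_prepared hodd).2 (.inr ⟨rfl, ?_⟩))
  simp only [SquareRange, EvenIdle, EvenUses] at h h' ⊢
  omega

include hd hodd in
theorem square_resets_anc {i j : ℕ} (b : Basis) (h : SquareRange d (.anc i j)) :
    (heavySquareCircuit d).Resets b (if (i + j) % 2 = 0 then 7 else 0) (.anc i j) := by
  refine square_resets_of_prepared hd hodd b ((square_prepared hodd).2 ?_)
  simp only [SquareRange, EvenUses, OddUses] at h ⊢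
  split_ifs <;> omega

include hd hodd in
theorem square_stays_anc {s i j : ℕ} (b : Basis)
    (h : (i + j) % 2 = 0 ∧ s < 7 ∨ (i + j) % 2 = 1 ∧ 6 ≤ s) :
    (heavySquareCircuit d).Stays b s (.anc i j) := by
  refine ⟨?_, fun y hy => ?_⟩
  · rw [square_prepared hodd]
    simp only [EvenUses, OddUses]
    omega
  · cases b
    · rw [square_arrow hd hodd] at hy
      cases y <;> simp only [EvenCouple, OddCouple, and_false, or_self, or_false] at hy
      omega
    · rw [square_arrow' hd hodd] at hy
      cases y <;> simp only [EvenCouple, OddCouple, and_false, or_self, false_or] at hy <;> omega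

include hd hodd in
/-- Flag qubits between their uses. -/
theorem square_stays_flag {s i j : ℕ} (b : Basis) (h : s = 6 ∨ s = 13 ∨ 7 ≤ s ∧ EvenIdle d i j) :
    (heavySquareCircuit d).Stays b s (.flag i j) := by
  simp only [EvenIdle] at h
  refine ⟨?_, fun y hy => ?_⟩
  · rw [square_prepared hodd]
    simp only [EvenUses, OddUses]
    omega
  · cases b
    · rw [square_arrow hd hodd] at hy
      cases y <;> simp only [EvenCouple, OddCouple, and_false, or_self, or_false, false_or] at hy <;>
        omega
    · rw [square_arrow' hd hodd] at hy
      cases y <;> simp only [EvenCouple, OddCouple, and_false, or_self, or_false, false_or] at hy <;>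
        omega

include hd hodd in
theorem square_acts {s : ℕ} {o : Op} (ho : (s, o) ∈ (heavySquareCircuit d).gates) :
    o.acts ⊆ (heavySquareCircuit d).qubits := by
  intro q hq
  refine square_mem_qubits.2 ?_
  rcases square_gate hodd ho with ⟨x, y, h1, h2⟩ | ⟨q', h1, h2⟩
  · have := square_arrow_range hd hodd h2
    rw [h1, mem_insert, mem_singleton] at hq
    rcases hq with rfl | rfl
    exacts [this.1, this.2.1]
  · rw [h1, mem_singleton] at hq
    subst hq
    cases q <;> simp only [EvenUses, OddUses, or_self] at h2 <;>
      simp only [SquareRange] <;> omega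

include hd hodd in
theorem square_idle_data {s : ℕ} (hs : s = 0 ∨ s + 1 = (heavySquareCircuit d).steps) {o : Op}
    (ho : (s, o) ∈ (heavySquareCircuit d).gates) (i j : ℕ) : Qubit.data i j ∉ o.acts := by
  intro hmem
  change s = 0 ∨ s + 1 = 14 at hs
  rcases square_gate hodd ho with ⟨x, y, h1, h2⟩ | ⟨q, h1, h2⟩
  · have := square_arrow_range hd hodd h2
    omega
  · rw [h1, mem_singleton] at hmem
    subst hmem
    simp [EvenUses, OddUses] at h2

end Square

/-! ### `X` errors of the heavy square code -/

section SquareX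

variable {d : ℕ} (hd : 3 ≤ d) (hodd : d % 2 = 1) {T : ℕ}

theorem squareX_regular : (heavySquareX d).Regular where
  readout_lt v _ x hx := by
    obtain rfl := mem_singleton.1 hx
    exact Nat.lt_succ_self 13
  flagStep_lt := by simp [heavySquareX, heavySquareCircuit]

theorem squareX_readout_ne_data (v : ℕ × ℕ) (x : ℕ × Qubit)
    (hx : x ∈ (heavySquareX d).readout v) (i j : ℕ) : x.2 ≠ .data i j := by
  obtain rfl := mem_singleton.1 hx
  simp

theorem squareX_mem_flaggedFaces {i j : ℕ} : (i, j) ∈ (heavySquareX d).flaggedFaces ↔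
    1 ≤ i ∧ i ≤ d - 1 ∧ 1 ≤ j ∧ j ≤ d - 1 ∧ (i + j) % 2 = 1 := mem_bulk_oddFaces

theorem squareX_silent_anc {s i j : ℕ} (h : s ≠ 13 ∨ (i + j) % 2 = 1) :
    (heavySquareX d).Silent s (.anc i j) :=
  Problem.silent_anc fun v hv hmem => by
    obtain ⟨k, l⟩ := v
    have h1 := mem_evenFaces.1 hv
    have h2 := mem_singleton.1 hmem
    simp only [Prod.mk.injEq, Qubit.anc.injEq] at h2
    omega

theorem squareX_silent_flag {s i j : ℕ} (h : s ≠ 6 ∨ (i + j) % 2 = 1 ∧ j = d ∨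
    (i + j) % 2 = 0 ∧ j = 1) : (heavySquareX d).Silent s (.flag i j) := by
  refine ⟨fun v _ hv => ?_, fun hs => ?_⟩
  · have := mem_singleton.1 hv
    simp at this
  · change s = 6 at hs
    refine Problem.unflagged_of ?_ fun hj => ?_ <;> rw [squareX_mem_flaggedFaces] <;> omega

theorem squareX_readsCheck {i j : ℕ} (h : (i, j) ∈ evenFaces d) :
    (heavySquareX d).ReadsCheck 13 (.anc i j) (i, j) := by
  refine ⟨?_, fun hs => absurd hs (by simp [heavySquareX])⟩
  rintro ⟨k, l⟩
  simp only [heavySquareX, mem_singleton, Prod.mk.injEq, Qubit.anc.injEq, true_and]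
  constructor
  · rintro ⟨-, h1, h2⟩
    exact ⟨h1.symm, h2.symm⟩
  · rintro ⟨rfl, rfl⟩
    exact ⟨h, rfl, rfl⟩

theorem squareX_read_anc {t i j : ℕ} (ht : t < T) (h : (i, j) ∈ evenFaces d) :
    (heavySquareX d).effectOf T (Pi.single (t * (heavySquareX d).circuit.steps + 13 + 1)
      (Pi.single (.anc i j) 1)) = (heavySquareX d).vertEffect t (i, j) :=
  Problem.effectOf_readsCheck squareX_regular ht (Nat.lt_succ_self 13) (.inr (by simp))
    (squareX_readsCheck h)

include hd hodd

theorem squareX_stays_data {s i j : ℕ} (h1 : s = 9 → j ≤ 1 ∨ (i + j) % 2 = 1 ∧ i + 1 ≤ d)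
    (h2 : s = 10 → i = d ∨ (i + j) % 2 = 0 ∧ j = d ∨ (i + j) % 2 = 1 ∧ j ≤ 1)
    (h3 : s = 11 → j = d ∨ (i + j) % 2 = 0 ∧ i + 1 ≤ d) :
    (heavySquareCircuit d).Stays .X s (.data i j) := by
  refine ⟨square_not_prepared_data hodd _ _ _, fun y hy => ?_⟩
  rw [square_arrow hd hodd] at hy
  cases y <;> simp only [EvenCouple, OddCouple, and_false, or_self, false_or] at hy <;> omega

theorem squareX_forgotten_anc_odd {s i j : ℕ} (h : SquareRange d (.anc i j))
    (hp : (i + j) % 2 = 1) (hs : 6 ≤ s) (hs' : s < 14) :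
    (heavySquareX d).Forgotten T s (.anc i j) := by
  have hr := square_resets_anc hd hodd .X h
  rw [if_neg (by omega)] at hr
  exact Problem.forgotten_of_wrap squareX_regular hs' (Nat.zero_lt_succ _) (by simp) hr
    fun v _ hv => ⟨square_stays_anc hd hodd _ (by omega), squareX_silent_anc (.inr hp)⟩

theorem squareX_forgotten_anc_even {i j : ℕ} (h : SquareRange d (.anc i j))
    (hp : (i + j) % 2 = 0) : (heavySquareX d).Forgotten T 13 (.anc i j) := by
  have hr := square_resets_anc hd hodd .X h
  rw [if_pos hp] at hr
  refine Problem.forgotten_of_wrap squareX_regular (Nat.lt_succ_self 13) (u := 7)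
    (by simp [heavySquareX, heavySquareCircuit]) (by simp) hr fun v hv hv' => ?_
  change v < 14 at hv
  exact ⟨square_stays_anc hd hodd _ (by omega), squareX_silent_anc (by omega)⟩

theorem squareX_after_anc_even {t s i j : ℕ} (ht : t < T) (h : SquareRange d (.anc i j))
    (hp : (i + j) % 2 = 0) (hs : s < 7) : (heavySquareX d).after T t s (.anc i j) = 0 := by
  have hr := square_resets_anc hd hodd .X h
  rw [if_pos hp] at hr
  have : (heavySquareX d).Forgotten T s (.anc i j) :=
    Problem.forgotten_of_resets squareX_regular hs (by simp [heavySquareX, heavySquareCircuit]) hr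
      fun v _ _ => ⟨square_stays_anc hd hodd _ (by omega), squareX_silent_anc (by omega)⟩
  exact this.after_eq_zero squareX_regular (show s < 14 by omega) (by simp)
    (squareX_silent_anc (by omega)) ht

theorem squareX_forgotten_flag {i j : ℕ} (h : SquareRange d (.flag i j)) :
    (heavySquareX d).Forgotten T 13 (.flag i j) :=
  Problem.forgotten_of_wrap squareX_regular (Nat.lt_succ_self 13) (u := 0)
    (by simp [heavySquareX, heavySquareCircuit]) (by simp) (square_resets_flag hd hodd _ h)
    fun v hv hv' => by change v < 14 at hv; omega

theorem squareX_forgotten_flag_of_evenIdle {s i j : ℕ} (h : SquareRange d (.flag i j))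
    (h' : EvenIdle d i j) (hs : 6 ≤ s) (hs' : s < 14) :
    (heavySquareX d).Forgotten T s (.flag i j) :=
  Problem.forgotten_of_wrap squareX_regular hs' (u := 0)
    (by simp [heavySquareX, heavySquareCircuit]) (by simp) (square_resets_flag hd hodd _ h)
    fun v _ _ => ⟨square_stays_flag hd hodd _ (.inr (.inr ⟨by omega, h'⟩)),
      squareX_silent_flag (by omega)⟩

/-- After its use for an odd face the qubit is prepared again in step `7`, or it is not needed for
the even faces and idles until the next round. -/
theorem squareX_forgotten_flag_six {i j : ℕ} (h : SquareRange d (.flag i j)) :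
    (heavySquareX d).Forgotten T 6 (.flag i j) := by
  by_cases h' : EvenIdle d i j
  · exact squareX_forgotten_flag_of_evenIdle hd hodd h h' le_rfl (by omega)
  · exact Problem.forgotten_of_resets squareX_regular (u := 7) (by omega)
      (by simp [heavySquareX, heavySquareCircuit]) (square_resets_flag_seven hd hodd _ h h')
      fun v _ _ => by omega

theorem squareX_detectWindow {i j : ℕ} (h : (i, j) ∈ bulk d (evenFaces d)) :
    (heavySquareX d).DetectWindow T 7 i j := by
  have h' := mem_bulk_evenFaces.1 h
  have hl : SquareRange d (.flag i j) := by simp only [SquareRange]; omega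
  have hr : SquareRange d (.flag i (j + 1)) := by simp only [SquareRange]; omega
  have ha : SquareRange d (.anc i j) := by simp only [SquareRange]; omega
  refine ⟨by simp [heavySquareX, heavySquareCircuit], square_mem_qubits.2 hl,
    square_mem_qubits.2 hr, fun k h1 h2 => ⟨?_, ?_, ?_⟩,
    fun k h1 h2 y hy => ?_,
    fun k h1 h2 y => (square_arrow hd hodd).trans ?_,
    fun k h1 h2 y => (square_arrow hd hodd).trans ?_,
    fun k _ => squareX_silent_anc (by omega), fun k _ => squareX_silent_flag (by omega),
    fun k _ => squareX_silent_flag (by omega), squareX_forgotten_anc_even hd hodd ha (by omega),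
    squareX_forgotten_flag hd hodd hl, squareX_forgotten_flag hd hodd hr,
    fun t ht => squareX_read_anc ht (mem_filter.1 h).1⟩
  · exact square_not_prepared_of hodd (by omega) (by omega) _
  · exact square_not_prepared_of hodd (by omega) (by omega) _
  · exact square_not_prepared_of hodd (by omega) (by omega) _
  · replace hy := (square_arrow hd hodd).1 hy
    cases y <;> simp only [EvenCouple, OddCouple, and_false, or_self, or_false] at hy
    omega
  · cases y <;> simp only [EvenCouple, OddCouple, Qubit.anc.injEq, reduceCtorEq, and_false,
      or_false, false_or, iff_false] <;> omega
  · cases y <;> simp only [EvenCouple, OddCouple, Qubit.anc.injEq, reduceCtorEq, and_false,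
      or_false, false_or, iff_false] <;> omega

theorem squareX_after_anc {t s i j : ℕ} (ht : t < T) (h : (i, j) ∈ evenFaces d)
    (hs : 7 ≤ s) (hs' : s < 14) : (heavySquareX d).after T t s (.anc i j) =
      (heavySquareX d).vertEffect t (i, j) := by
  have hlt : 13 < (heavySquareX d).circuit.steps := Nat.lt_succ_self 13
  have h1 := mem_evenFaces.1 h
  have ha : SquareRange d (.anc i j) := by simp only [SquareRange]; omega
  rw [Problem.after_read squareX_regular ht (show s ≤ 13 by omega) hlt (fun v h2 h3 => ?_)
    (fun v h2 h3 => squareX_silent_anc (by omega))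
    (squareX_forgotten_anc_even hd hodd ha (by omega)), squareX_read_anc ht h]
  refine ⟨square_not_prepared_of hodd (by omega) (by omega) _, fun y hy => ?_⟩
  replace hy := (square_arrow hd hodd).1 hy
  cases y <;> simp only [EvenCouple, OddCouple, and_false, or_self, or_false] at hy
  omega

/-- The left check of a data qubit always comes before the right one. Even faces are measured after
the odd ones, so errors from the first half of a round are still seen in the same round. -/
theorem squareX_dataRule (q : ℕ × ℕ) (hq : q ∈ (heavySquareX d).lattice) :
    (heavySquareX d).DataRule T (fun t => t) 9 11 q := by
  obtain ⟨i, j⟩ := q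
  have hq' := hq
  rw [Problem.mem_lattice] at hq'
  change (1 ≤ i ∧ i ≤ d) ∧ 1 ≤ j ∧ j ≤ d at hq'
  have hc := mem_evenFaces_and_mem_plaquette hq'.1.1 hq'.1.2 hq'.2.1 hq'.2.2
  have mv : ∀ s y, 7 ≤ s ∧ EvenCouple d (s - 7) y (.data i j) →
      (heavySquareCircuit d).Moves .X s (.data i j) y := fun s y h =>
    square_moves hd hodd ((square_arrow hd hodd).2 (.inr h))
  -- With respect to the even face on its left the qubit is the lower right corner (step `9`), the
  -- upper right corner (step `10`), or the right qubit of a face on the top or bottom boundary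
  -- (step `9`).
  have hL : 2 ≤ j → ∃ y, (heavySquareCircuit d).Moves .X
      (if (i + j) % 2 = 0 ∨ i = d then 9 else 10) (.data i j) y ∧ ∀ t < T,
      (heavySquareX d).after T t (if (i + j) % 2 = 0 ∨ i = d then 9 else 10) y =
        (heavySquareX d).vertEffect t (faceLeft i j) := by
    intro h2
    by_cases hp : (i + j) % 2 = 0
    · rw [if_pos (.inl hp), show faceLeft i j = (i - 1, j - 1) by simp [faceLeft, hp]]
      by_cases h1 : i = 1
      · subst h1
        refine ⟨.anc 0 (j - 1), mv _ _ (by simp [EvenCouple]; omega), fun t ht =>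
          squareX_after_anc hd hodd ht (mem_evenFaces.2 (by omega)) (by omega)
            (by omega)⟩
      · refine ⟨.flag (i - 1) j, mv _ _ (by simp [EvenCouple]; omega), fun t ht => ?_⟩
        have hw := squareX_detectWindow (T := T) hd hodd (i := i - 1) (j := j - 1)
          (mem_bulk_evenFaces.2 (by omega))
        have := hw.after_right squareX_regular ht (k := 2) (by omega)
        rwa [Nat.sub_add_cancel (by omega)] at this
    · by_cases h1 : i = d
      · subst h1
        rw [if_pos (.inr rfl), show faceLeft i j = (i, j - 1) by
          simp [faceLeft, show (i + j) % 2 = 1 by omega]]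
        exact ⟨.anc i (j - 1), mv _ _ (by simp [EvenCouple]; omega), fun t ht =>
          squareX_after_anc hd hodd ht (mem_evenFaces.2 (by omega)) (by omega)
            (by omega)⟩
      · rw [if_neg (by omega), show faceLeft i j = (i, j - 1) by
          simp [faceLeft, show (i + j) % 2 = 1 by omega]]
        refine ⟨.flag i j, mv _ _ (by simp [EvenCouple]; omega), fun t ht => ?_⟩
        have hw := squareX_detectWindow (T := T) hd hodd (i := i) (j := j - 1)
          (mem_bulk_evenFaces.2 (by omega))
        have := hw.after_right squareX_regular ht (k := 3) (by omega)
        rwa [Nat.sub_add_cancel (by omega)] at this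
  -- With respect to the even face on its right the qubit is the lower left corner (step `11`), the
  -- upper left corner (step `10`), or the left qubit of a boundary face (step `11`).
  have hR : j + 1 ≤ d → ∃ y, (heavySquareCircuit d).Moves .X
      (if (i + j) % 2 = 1 ∨ i = d then 11 else 10) (.data i j) y ∧ ∀ t < T,
      (heavySquareX d).after T t (if (i + j) % 2 = 1 ∨ i = d then 11 else 10) y =
        (heavySquareX d).vertEffect t (faceRight i j) := by
    intro h2
    by_cases hp : (i + j) % 2 = 1
    · rw [if_pos (.inl hp), show faceRight i j = (i - 1, j) by simp [faceRight, hp]]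
      by_cases h1 : i = 1
      · subst h1
        refine ⟨.anc 0 j, mv _ _ (by simp [EvenCouple]; omega), fun t ht =>
          squareX_after_anc hd hodd ht (mem_evenFaces.2 (by omega)) (by omega)
            (by omega)⟩
      · refine ⟨.flag (i - 1) j, mv _ _ (by simp [EvenCouple]; omega), fun t ht => ?_⟩
        have hw := squareX_detectWindow (T := T) hd hodd (i := i - 1) (j := j)
          (mem_bulk_evenFaces.2 (by omega))
        exact hw.after_left squareX_regular ht (k := 4) (by omega)
    · by_cases h1 : i = d
      · subst h1
        rw [if_pos (.inr rfl), show faceRight i j = (i, j) by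
          simp [faceRight, show (i + j) % 2 = 0 by omega]]
        exact ⟨.anc i j, mv _ _ (by simp [EvenCouple]; omega), fun t ht =>
          squareX_after_anc hd hodd ht (mem_evenFaces.2 (by omega)) (by omega)
            (by omega)⟩
      · rw [if_neg (by omega), show faceRight i j = (i, j) by
          simp [faceRight, show (i + j) % 2 = 0 by omega]]
        refine ⟨.flag i j, mv _ _ (by simp [EvenCouple]; omega), fun t ht => ?_⟩
        have hw := squareX_detectWindow (T := T) hd hodd (i := i) (j := j)
          (mem_bulk_evenFaces.2 (by omega))
        exact hw.after_left squareX_regular ht (k := 3) (by omega)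
  set sL := if (i + j) % 2 = 0 ∨ i = d then 9 else 10 with hsL
  set sR := if (i + j) % 2 = 1 ∨ i = d then 11 else 10 with hsR
  have hsL' : ((i + j) % 2 = 0 ∨ i = d) ∧ sL = 9 ∨ ((i + j) % 2 = 1 ∧ i ≠ d) ∧ sL = 10 := by
    rw [hsL]; split_ifs <;> omega
  have hsR' : ((i + j) % 2 = 1 ∨ i = d) ∧ sR = 11 ∨ ((i + j) % 2 = 0 ∧ i ≠ d) ∧ sR = 10 := by
    rw [hsR]; split_ifs <;> omega
  clear_value sL sR
  have hlt : sR < (heavySquareX d).circuit.steps := show sR < 14 by omega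
  have hr := fun v (_ : v ∈ (heavySquareX d).checks) => squareX_readout_ne_data (d := d) v
  by_cases h1 : j + 1 ≤ d
  · obtain ⟨yR, mR, aR⟩ := hR h1
    by_cases h2 : 2 ≤ j
    · obtain ⟨yL, mL, aL⟩ := hL h2
      exact Problem.dataRule_two squareX_regular hr hq (by omega) (show sL < sR by omega) hlt
        (by omega) (by omega) (faceRight_ne_faceLeft (by omega) i).symm
        (fun v => (hc v).trans (by simp [h1, h2, or_comm]))
        (fun s h3 h4 => squareX_stays_data hd hodd (by omega) (by omega) (by omega)) mL mR aL aR
    · exact Problem.dataRule_one squareX_regular hr hq (by omega) hlt (by omega)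
        (by omega) (fun v => (hc v).trans (by simp [h1, h2]))
        (fun s h3 => squareX_stays_data hd hodd (by dsimp only; omega) (by dsimp only; omega)
          (by dsimp only; omega)) mR aR
  · have h2 : 2 ≤ j := by omega
    obtain ⟨yL, mL, aL⟩ := hL h2
    exact Problem.dataRule_one squareX_regular hr hq (by omega) (show sL < 14 by omega) (by omega)
      (by omega) (fun v => (hc v).trans (by simp [h1, h2]))
      (fun s h3 => squareX_stays_data hd hodd (by dsimp only; omega) (by dsimp only; omega)
        (by dsimp only; omega)) mL aL

theorem squareX_spreadWindow {i j : ℕ} (h : (i, j) ∈ (heavySquareX d).flaggedFaces) :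
    (heavySquareX d).SpreadWindow T (fun t => t) 0 i j := by
  have h' := squareX_mem_flaggedFaces.1 h
  have hl : SquareRange d (.flag i j) := by simp only [SquareRange]; omega
  have hr : SquareRange d (.flag i (j + 1)) := by simp only [SquareRange]; omega
  have ha : SquareRange d (.anc i j) := by simp only [SquareRange]; omega
  refine ⟨by simp [heavySquareX, heavySquareCircuit], h, square_mem_qubits.2 ha,
    square_mem_qubits.2 hl, square_mem_qubits.2 hr, fun k h1 h2 => ?_,
    fun k h1 h2 y => (square_arrow hd hodd).trans ?_,
    fun k h1 h2 y => (square_arrow hd hodd).trans ?_,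
    fun k h1 h2 y => (square_arrow hd hodd).trans ?_,
    fun k _ => squareX_silent_anc (by omega), fun k _ => squareX_silent_flag (by omega),
    fun k _ => squareX_silent_flag (by omega),
    squareX_forgotten_anc_odd hd hodd ha (by omega) (by omega) (by omega),
    squareX_forgotten_flag_six hd hodd hl, squareX_forgotten_flag_six hd hodd hr,
    fun t ht σ => ?_, fun t ht k hk q hq => ?_⟩
  · have hp := square_not_prepared_of hodd (show 0 + k ≠ 0 by omega) (show 0 + k ≠ 7 by omega)
    exact ⟨hp _, hp _, hp _, fun _ _ => hp _⟩
  · cases y <;> simp only [EvenCouple, OddCouple, Qubit.flag.injEq, reduceCtorEq, and_false,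
      or_false]
    omega
  · cases y <;> simp only [EvenCouple, OddCouple, Qubit.data.injEq, reduceCtorEq, and_false,
      or_false, false_or, iff_false] <;> omega
  · cases y <;> simp only [EvenCouple, OddCouple, Qubit.data.injEq, reduceCtorEq, and_false,
      or_false, false_or, iff_false] <;> omega
  · refine Problem.effectOf_flag_qubit squareX_regular ht h (fun i j h1 h2 => ?_)
      fun i j h1 v hv => ?_
    · rw [squareX_mem_flaggedFaces] at h1 h2
      omega
    · simp [heavySquareX]
  · exact (squareX_dataRule hd hodd q hq t ht (0 + k) (show 0 + k < 14 by omega)).2.1 (by omega)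

/-- On the left and right boundaries the flag qubit is itself the measurement qubit of a weight-two
generator. -/
theorem squareX_elementary_pair {t s i j l : ℕ} (ht : t < T) (hs : s ≤ 6) (hi : 1 ≤ i)
    (hi' : i + 1 ≤ d) (h : l = 0 ∧ j = 1 ∧ i % 2 = 1 ∨ l = d ∧ j = d ∧ i % 2 = 0) :
    (heavySquareX d).Elementary T (fun t => t) ((heavySquareX d).after T t s (.flag i j)) := by
  have hg : (i, l) ∈ (heavySquareX d).gens := mem_oddFaces.2 (by omega)
  have hr : SquareRange d (.flag i j) := by simp only [SquareRange]; omega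
  have hm : ∀ k i', k = 3 ∧ i' = i ∨ k = 4 ∧ i' = i + 1 → (heavySquareCircuit d).Moves .X k
      (.flag i j) (.data i' j) := fun k i' hk =>
    square_moves hd hodd ((square_arrow hd hodd).2 (.inl (by simp [OddCouple]; omega)))
  refine Problem.elementary_of_pair squareX_regular (layer := fun t => t) (s₀ := 0) (s₁ := 3)
    (s₂ := 4) (m := 6) (q₁ := (i, j)) (q₂ := (i + 1, j)) (f := (i, l)) ht (by omega) (by omega)
    (by omega) (by simp [heavySquareX, heavySquareCircuit]) (by simp) (hm 3 _ (by omega))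
    (hm 4 _ (by omega)) (fun s h2 h3 h4 h5 => ?_) (fun s _ _ => squareX_silent_flag (by omega))
    (squareX_forgotten_flag_six hd hodd hr) hg ?_ (by simp) ?_ ht.le
    (fun s _ h2 q hq => (squareX_dataRule hd hodd q hq t ht s (show s < 14 by omega)).2.1
      (by omega)) (Nat.zero_le s) hs
  · refine ⟨square_not_prepared_of hodd (by omega) (by omega) _, fun y hy => ?_⟩
    replace hy := (square_arrow hd hodd).1 hy
    cases y <;> simp only [EvenCouple, OddCouple, and_false, or_false, false_or] at hy <;> omega
  · ext ⟨a, b⟩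
    rw [mem_plaquette]
    simp only [mem_insert, mem_singleton, Prod.mk.injEq]
    change (a = i ∨ a = i + 1) ∧ (b = l ∨ b = l + 1) ∧ 1 ≤ a ∧ a ≤ d ∧ 1 ≤ b ∧ b ≤ d ↔ _
    omega
  · refine Problem.syndrome_eq_zero_of ?_ t
    rintro ⟨k, l⟩ hv
    exact sum_plaquette_plaquette' hv hg

theorem squareX_elementary {t s : ℕ} (ht : t < T) (hs : s < (heavySquareX d).circuit.steps)
    {q : Qubit} (hq : q ∈ (heavySquareX d).circuit.qubits) :
    (heavySquareX d).Elementary T (fun t => t) ((heavySquareX d).after T t s q) := by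
  change s < 14 at hs
  replace hq : SquareRange d q := square_mem_qubits.1 hq
  cases q with
  | data i j =>
    simp only [SquareRange] at hq
    exact (squareX_dataRule hd hodd (i, j)
      (by rw [Problem.mem_lattice]; exact ⟨⟨hq.1, hq.2.1⟩, hq.2.2⟩) t ht s hs).1
  | flag i j =>
    have hq' := hq
    simp only [SquareRange] at hq'
    rcases Nat.lt_or_ge 6 s with h1 | h1
    · by_cases hu : EvenIdle d i j
      · rw [(squareX_forgotten_flag_of_evenIdle hd hodd hq hu h1.le hs).after_eq_zero
          squareX_regular hs (by simp) (squareX_silent_flag (by omega)) ht]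
        exact Problem.elementary_zero _ _ _
      · simp only [EvenIdle] at hu
        obtain ⟨k, rfl⟩ := Nat.exists_eq_add_of_le (show 7 ≤ s by omega)
        by_cases hp : (i + j) % 2 = 0
        · have hw := squareX_detectWindow (T := T) hd hodd (i := i) (j := j)
            (mem_bulk_evenFaces.2 (by omega))
          exact (hw.elementary squareX_regular ht (fun t => t) (k := k) (by omega)).2.1
        · obtain ⟨n, rfl⟩ := Nat.exists_eq_add_of_le' hq'.2.2.1
          have hw := squareX_detectWindow (T := T) hd hodd (i := i) (j := n)
            (mem_bulk_evenFaces.2 (by omega))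
          exact (hw.elementary squareX_regular ht (fun t => t) (k := k) (by omega)).2.2
    · by_cases hp : (i + j) % 2 = 1
      · by_cases hj : j = d
        · exact squareX_elementary_pair hd hodd ht h1 hq'.1 hq'.2.1 (l := d) (by omega)
        · have hw := squareX_spreadWindow (T := T) hd hodd (i := i) (j := j)
            (squareX_mem_flaggedFaces.2 (by omega))
          exact Nat.zero_add s ▸ hw.elementary_left squareX_regular ht (k := s) h1
      · by_cases hj : j = 1
        · exact squareX_elementary_pair hd hodd ht h1 hq'.1 hq'.2.1 (l := 0) (by omega)
        · obtain ⟨n, rfl⟩ := Nat.exists_eq_add_of_le' hq'.2.2.1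
          have hw := squareX_spreadWindow (T := T) hd hodd (i := i) (j := n)
            (squareX_mem_flaggedFaces.2 (by omega))
          exact Nat.zero_add s ▸ hw.elementary_right squareX_regular ht (k := s) h1
  | anc i j =>
    have hq' := hq
    simp only [SquareRange] at hq'
    by_cases hp : (i + j) % 2 = 0
    · rcases Nat.lt_or_ge s 7 with h1 | h1
      · rw [squareX_after_anc_even hd hodd ht hq hp h1]
        exact Problem.elementary_zero _ _ _
      · rw [squareX_after_anc hd hodd ht (mem_evenFaces.2 (by omega)) h1 hs]
        exact .vert
    · rcases Nat.lt_or_ge 6 s with h1 | h1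
      · rw [(squareX_forgotten_anc_odd hd hodd hq (by omega) h1.le hs).after_eq_zero
          squareX_regular hs (by simp) (squareX_silent_anc (by omega)) ht]
        exact Problem.elementary_zero _ _ _
      · have hg : (i, j) ∈ (heavySquareX d).gens := mem_oddFaces.2 (by omega)
        have hsyn : (heavySquareX d).syndrome t
            (errorOn (plaquette (heavySquareX d).d (i, j))) = 0 :=
          Problem.syndrome_eq_zero_of (by
            rintro ⟨k, l⟩ hv
            exact sum_plaquette_plaquette' hv hg) t
        have hw := squareX_spreadWindow (T := T) hd hodd (i := i) (j := j)
            (squareX_mem_flaggedFaces.2 (by omega))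
        exact Nat.zero_add s ▸ hw.elementary_anc squareX_regular ht hsyn (k := s) h1

theorem squareX_simulates (hT : 1 ≤ T) : (heavySquareX d).Simulates T fun t => t := by
  refine Problem.simulates_of squareX_regular hT (by omega)
    (by simp [heavySquareX, heavySquareCircuit]) (fun t ht => ht.le) (squareX_dataRule hd hodd)
    ?_ ?_ (fun i j => squareX_spreadWindow hd hodd)
    (fun t ht s hs q hq => squareX_elementary hd hodd ht hs hq)
    (fun s o => square_acts hd hodd) ?_
  · rintro ⟨i, j⟩ hq
    rw [Problem.mem_lattice] at hq
    exact square_mem_qubits.2 ⟨hq.1.1, hq.1.2, hq.2⟩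
  · exact fun s hs q _ o ho => square_idle_data hd hodd hs ho q.1 q.2
  · intro s _ x y h
    have hr := square_arrow_range hd hodd h
    refine ⟨hr.2.2.2.1, square_moves hd hodd h, ?_⟩
    cases x with
    | data i j => exact Problem.silent_data (fun v _ => squareX_readout_ne_data v) _ _ _
    | flag i j =>
      have := hr.2.2.2.2.2.2.1 i j rfl
      exact squareX_silent_flag (by omega)
    | anc i j => exact squareX_silent_anc (by omega)

end SquareX

/-! ### `Z` errors of the heavy square code -/

section SquareZ

variable {d : ℕ} (hd : 3 ≤ d) (hodd : d % 2 = 1) {T : ℕ}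

/-- The measurement qubit of an odd face. -/
def oddReader (d : ℕ) (v : ℕ × ℕ) : Qubit :=
  if v.2 = 0 then .flag v.1 1 else if v.2 = d then .flag v.1 d else .anc v.1 v.2

theorem squareZ_regular : (heavySquareZ d).Regular where
  readout_lt v _ x hx := by
    obtain rfl := mem_singleton.1 hx
    simp [heavySquareZ, heavySquareCircuit]
  flagStep_lt := Nat.lt_succ_self 13

theorem squareZ_mem_readout {s : ℕ} {q : Qubit} {v : ℕ × ℕ} :
    (s, q) ∈ (heavySquareZ d).readout v ↔ s = 6 ∧ q = oddReader d v := by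
  simp [heavySquareZ, oddReader]

theorem squareZ_readout_ne_data (v : ℕ × ℕ) (x : ℕ × Qubit)
    (hx : x ∈ (heavySquareZ d).readout v) (i j : ℕ) : x.2 ≠ .data i j := by
  rw [(squareZ_mem_readout.1 hx).2, oddReader]
  split_ifs <;> simp

theorem squareZ_mem_flaggedFaces {i j : ℕ} : (i, j) ∈ (heavySquareZ d).flaggedFaces ↔
    1 ≤ i ∧ i ≤ d - 1 ∧ 1 ≤ j ∧ j ≤ d - 1 ∧ (i + j) % 2 = 0 := mem_bulk_evenFaces

theorem squareZ_silent_anc {s i j : ℕ} (h : s ≠ 6 ∨ (i + j) % 2 = 0) :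
    (heavySquareZ d).Silent s (.anc i j) :=
  Problem.silent_anc fun v hv hmem => by
    obtain ⟨k, l⟩ := v
    have h1 := mem_oddFaces.1 hv
    obtain ⟨h2, h3⟩ := squareZ_mem_readout.1 hmem
    rw [oddReader] at h3
    split_ifs at h3
    rw [Qubit.anc.injEq] at h3
    omega

/-- The flag qubit is the measurement qubit of a face on the left or right boundary. -/
def ReadsBoundary (d i j : ℕ) : Prop := (i + j) % 2 = 1 ∧ j = d ∨ (i + j) % 2 = 0 ∧ j = 1

/-- For `Z` errors a flag qubit is read in step `6` only if it measures a boundary stabilizer, and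
in step `13` only if it is a flag for an even face. -/
theorem squareZ_silent_flag {s i j : ℕ} (h : s ≠ 6 ∨ ¬ ReadsBoundary d i j)
    (h' : s ≠ 13 ∨ EvenIdle d i j) : (heavySquareZ d).Silent s (.flag i j) := by
  simp only [ReadsBoundary, EvenIdle] at h h'
  refine ⟨fun v hv hmem => ?_, fun hs => ?_⟩
  · obtain ⟨k, l⟩ := v
    have h1 := mem_oddFaces.1 hv
    obtain ⟨h2, h3⟩ := squareZ_mem_readout.1 hmem
    rw [oddReader] at h3
    split_ifs at h3 <;> rw [Qubit.flag.injEq] at h3 <;> omega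
  · change s = 13 at hs
    refine Problem.unflagged_of ?_ fun hj => ?_ <;> rw [squareZ_mem_flaggedFaces] <;> omega

theorem squareZ_readsCheck {v : ℕ × ℕ} (h : v ∈ oddFaces d) :
    (heavySquareZ d).ReadsCheck 6 (oddReader d v) v := by
  refine ⟨fun v' => ?_, fun hs => absurd hs (by simp [heavySquareZ])⟩
  rw [squareZ_mem_readout]
  constructor
  · rintro ⟨h1, -, h2⟩
    obtain ⟨i, j⟩ := v
    obtain ⟨k, l⟩ := v'
    rw [mem_oddFaces] at h
    replace h1 := mem_oddFaces.1 h1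
    rw [oddReader, oddReader] at h2
    rw [Prod.mk.injEq]
    split_ifs at h2 <;> simp only [Qubit.flag.injEq, Qubit.anc.injEq] at h2 <;> omega
  · rintro rfl
    exact ⟨h, rfl, rfl⟩

theorem squareZ_read {t : ℕ} {v : ℕ × ℕ} (ht : t < T) (h : v ∈ oddFaces d) :
    (heavySquareZ d).effectOf T (Pi.single (t * (heavySquareZ d).circuit.steps + 6 + 1)
      (Pi.single (oddReader d v) 1)) = (heavySquareZ d).vertEffect t v :=
  Problem.effectOf_readsCheck squareZ_regular ht (by simp [heavySquareZ, heavySquareCircuit])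
    (.inr fun i j => by rw [oddReader]; split_ifs <;> simp) (squareZ_readsCheck h)

include hd hodd

theorem squareZ_stays_data {s i j : ℕ}
    (h1 : s = 2 → i ≤ 1 ∨ j ≤ 1 ∨ (i + j) % 2 = 0) (h2 : s = 3 → d ≤ i)
    (h3 : s = 4 → i ≤ 1 ∨ (i + j) % 2 = 1 ∧ 2 ≤ j) :
    (heavySquareCircuit d).Stays .Z s (.data i j) := by
  refine ⟨square_not_prepared_data hodd _ _ _, fun y hy => ?_⟩
  rw [square_arrow' hd hodd] at hy
  cases y <;> simp only [EvenCouple, OddCouple, and_false, or_self, or_false] at hy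
  omega

theorem squareZ_forgotten_anc_odd {s i j : ℕ} (h : SquareRange d (.anc i j))
    (hp : (i + j) % 2 = 1) (hs : 6 ≤ s) (hs' : s < 14) :
    (heavySquareZ d).Forgotten T s (.anc i j) := by
  have hr := square_resets_anc hd hodd .Z h
  rw [if_neg (by omega)] at hr
  exact Problem.forgotten_of_wrap squareZ_regular hs' (Nat.zero_lt_succ _) (by simp) hr
    fun v _ hv => ⟨square_stays_anc hd hodd _ (by omega), squareZ_silent_anc (by omega)⟩

theorem squareZ_forgotten_anc_even {i j : ℕ} (h : SquareRange d (.anc i j))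
    (hp : (i + j) % 2 = 0) : (heavySquareZ d).Forgotten T 13 (.anc i j) := by
  have hr := square_resets_anc hd hodd .Z h
  rw [if_pos hp] at hr
  refine Problem.forgotten_of_wrap squareZ_regular (Nat.lt_succ_self 13) (u := 7)
    (by simp [heavySquareZ, heavySquareCircuit]) (by simp) hr fun v hv hv' => ?_
  change v < 14 at hv
  exact ⟨square_stays_anc hd hodd _ (by omega), squareZ_silent_anc (by omega)⟩

theorem squareZ_after_anc_even {t s i j : ℕ} (ht : t < T) (h : SquareRange d (.anc i j))
    (hp : (i + j) % 2 = 0) (hs : s < 7) : (heavySquareZ d).after T t s (.anc i j) = 0 := by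
  have hr := square_resets_anc hd hodd .Z h
  rw [if_pos hp] at hr
  have : (heavySquareZ d).Forgotten T s (.anc i j) :=
    Problem.forgotten_of_resets squareZ_regular hs (by simp [heavySquareZ, heavySquareCircuit]) hr
      fun v _ _ => ⟨square_stays_anc hd hodd _ (by omega), squareZ_silent_anc (by omega)⟩
  exact this.after_eq_zero squareZ_regular (show s < 14 by omega) (by simp)
    (squareZ_silent_anc (by omega)) ht

theorem squareZ_forgotten_flag {i j : ℕ} (h : SquareRange d (.flag i j)) :
    (heavySquareZ d).Forgotten T 13 (.flag i j) :=
  Problem.forgotten_of_wrap squareZ_regular (Nat.lt_succ_self 13) (u := 0)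
    (by simp [heavySquareZ, heavySquareCircuit]) (by simp) (square_resets_flag hd hodd _ h)
    fun v hv hv' => by change v < 14 at hv; omega

theorem squareZ_forgotten_flag_of_evenIdle {s i j : ℕ} (h : SquareRange d (.flag i j))
    (h' : EvenIdle d i j) (hs : 6 ≤ s) (hs' : s < 14) :
    (heavySquareZ d).Forgotten T s (.flag i j) :=
  Problem.forgotten_of_wrap squareZ_regular hs' (u := 0)
    (by simp [heavySquareZ, heavySquareCircuit]) (by simp) (square_resets_flag hd hodd _ h)
    fun v _ _ => ⟨square_stays_flag hd hodd _ (.inr (.inr ⟨by omega, h'⟩)),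
      squareZ_silent_flag (by omega) (.inr h')⟩

theorem squareZ_forgotten_flag_six {i j : ℕ} (h : SquareRange d (.flag i j)) :
    (heavySquareZ d).Forgotten T 6 (.flag i j) := by
  by_cases h' : EvenIdle d i j
  · exact squareZ_forgotten_flag_of_evenIdle hd hodd h h' le_rfl (by omega)
  · exact Problem.forgotten_of_resets squareZ_regular (u := 7) (by omega)
      (by simp [heavySquareZ, heavySquareCircuit]) (square_resets_flag_seven hd hodd _ h h')
      fun v _ _ => by omega

theorem squareZ_detectWindow {i j : ℕ} (h : (i, j) ∈ bulk d (oddFaces d)) :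
    (heavySquareZ d).DetectWindow T 0 i j := by
  have h' := mem_bulk_oddFaces.1 h
  have hl : SquareRange d (.flag i j) := by simp only [SquareRange]; omega
  have hr : SquareRange d (.flag i (j + 1)) := by simp only [SquareRange]; omega
  have ha : SquareRange d (.anc i j) := by simp only [SquareRange]; omega
  have bl : ¬ ReadsBoundary d i j := by simp only [ReadsBoundary]; omega
  have br : ¬ ReadsBoundary d i (j + 1) := by simp only [ReadsBoundary]; omega
  refine ⟨by simp [heavySquareZ, heavySquareCircuit], square_mem_qubits.2 hl,
    square_mem_qubits.2 hr, fun k h1 h2 => ⟨?_, ?_, ?_⟩,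
    fun k h1 h2 y hy => ?_,
    fun k h1 h2 y => (square_arrow' hd hodd).trans ?_,
    fun k h1 h2 y => (square_arrow' hd hodd).trans ?_,
    fun k _ => squareZ_silent_anc (by omega),
    fun k _ => squareZ_silent_flag (.inr bl) (by omega),
    fun k _ => squareZ_silent_flag (.inr br) (by omega),
    squareZ_forgotten_anc_odd hd hodd ha (by omega) (by omega) (by omega),
    squareZ_forgotten_flag_six hd hodd hl, squareZ_forgotten_flag_six hd hodd hr,
    fun t ht => ?_⟩
  · exact square_not_prepared_of hodd (by omega) (by omega) _
  · exact square_not_prepared_of hodd (by omega) (by omega) _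
  · exact square_not_prepared_of hodd (by omega) (by omega) _
  · replace hy := (square_arrow' hd hodd).1 hy
    cases y <;> simp only [EvenCouple, OddCouple, and_false, or_self, false_or] at hy <;> omega
  · cases y <;> simp only [EvenCouple, OddCouple, Qubit.anc.injEq, reduceCtorEq, and_false,
      or_false, false_or, iff_false] <;> omega
  · cases y <;> simp only [EvenCouple, OddCouple, Qubit.anc.injEq, reduceCtorEq, and_false,
      or_false, false_or, iff_false] <;> omega
  · have := squareZ_read ht (mem_filter.1 h).1
    rwa [show oddReader d (i, j) = .anc i j by
      rw [oddReader, if_neg (by dsimp only; omega), if_neg (by dsimp only; omega)]] at this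

/-- Such a qubit is the target of both CNOTs, so `Z` errors stay on it until its measurement and
flip the outcome of the boundary stabilizer. -/
theorem squareZ_after_boundary {t s i j l : ℕ} (ht : t < T) (hi : 1 ≤ i) (hi' : i + 1 ≤ d)
    (h : l = 0 ∧ j = 1 ∧ i % 2 = 1 ∨ l = d ∧ j = d ∧ i % 2 = 0) (hs : s ≤ 6) :
    (heavySquareZ d).after T t s (.flag i j) = (heavySquareZ d).vertEffect t (i, l) := by
  have hlt : 6 < (heavySquareZ d).circuit.steps := by simp [heavySquareZ, heavySquareCircuit]
  have hr : SquareRange d (.flag i j) := by simp only [SquareRange]; omega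
  rw [Problem.after_read squareZ_regular ht hs hlt (fun v h2 h3 => ?_)
    (fun v h2 h3 => squareZ_silent_flag (by omega) (by omega))
    (squareZ_forgotten_flag_six hd hodd hr)]
  · have hv : (i, l) ∈ oddFaces d := mem_oddFaces.2 (by omega)
    have := squareZ_read ht hv
    rwa [show oddReader d (i, l) = .flag i j by
      rw [oddReader]
      rcases h with ⟨rfl, rfl, -⟩ | ⟨rfl, rfl, -⟩
      · rw [if_pos rfl]
      · rw [if_neg (by dsimp only; omega), if_pos rfl]] at this
  · refine ⟨square_not_prepared_of hodd (by omega) (by omega) _, fun y hy => ?_⟩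
    replace hy := (square_arrow' hd hodd).1 hy
    cases y <;> simp only [EvenCouple, OddCouple, and_false, or_false, false_or] at hy <;> omega

/-- The check below a data qubit is coupled to it in step `3`, the one above in step `2` if the
qubit is its lower right corner and in step `4` if it is its lower left corner or belongs to a
boundary face. So either check may come first. -/
theorem squareZ_dataRule (q : ℕ × ℕ) (hq : q ∈ (heavySquareZ d).lattice) :
    (heavySquareZ d).DataRule T (fun t => t + 1) 2 4 q := by
  obtain ⟨i, j⟩ := q
  have hq' := hq
  rw [Problem.mem_lattice] at hq'
  change (1 ≤ i ∧ i ≤ d) ∧ 1 ≤ j ∧ j ≤ d at hq'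
  have hc := mem_oddFaces_and_mem_plaquette hq'.1.1 hq'.1.2 hq'.2.1 hq'.2.2
  have mv : ∀ s y, OddCouple d s y (.data i j) →
      (heavySquareCircuit d).Moves .Z s (.data i j) y := fun s y h =>
    square_moves' hd hodd ((square_arrow' hd hodd).2 (.inl h))
  have mB : i + 1 ≤ d → (heavySquareCircuit d).Moves .Z 3 (.data i j) (.flag i j) := fun h =>
    mv _ _ (by simp [OddCouple]; omega)
  have aB : i + 1 ≤ d → ∀ t < T, (heavySquareZ d).after T t 3 (.flag i j) =
      (heavySquareZ d).vertEffect t (faceBelow i j) := by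
    intro h t ht
    by_cases hp : (i + j) % 2 = 1
    · rw [show faceBelow i j = (i, j) by simp [faceBelow, hp]]
      by_cases hj : j = d
      · exact squareZ_after_boundary hd hodd ht (by omega) h (by omega) (by omega)
      · have hw := squareZ_detectWindow (T := T) hd hodd (i := i) (j := j)
          (mem_bulk_oddFaces.2 (by omega))
        exact hw.after_left squareZ_regular ht (k := 3) (by omega)
    · rw [show faceBelow i j = (i, j - 1) by simp [faceBelow, show (i + j) % 2 = 0 by omega]]
      by_cases hj : j = 1
      · exact squareZ_after_boundary hd hodd ht (by omega) h (by omega) (by omega)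
      · have hw := squareZ_detectWindow (T := T) hd hodd (i := i) (j := j - 1)
          (mem_bulk_oddFaces.2 (by omega))
        have := hw.after_right squareZ_regular ht (k := 3) (by omega)
        rwa [Nat.sub_add_cancel (by omega)] at this
  have mA : 2 ≤ i → (heavySquareCircuit d).Moves .Z
      (if (i + j) % 2 = 1 ∧ 2 ≤ j then 2 else 4) (.data i j) (.flag (i - 1) j) := fun h =>
    mv _ _ (by split_ifs <;> simp [OddCouple] <;> omega)
  have aA : 2 ≤ i → ∀ t < T, (heavySquareZ d).after T t
      (if (i + j) % 2 = 1 ∧ 2 ≤ j then 2 else 4) (.flag (i - 1) j) =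
        (heavySquareZ d).vertEffect t (faceAbove i j) := by
    intro h t ht
    by_cases hp : (i + j) % 2 = 0
    · rw [if_neg (by omega), show faceAbove i j = (i - 1, j) by simp [faceAbove, hp]]
      by_cases hj : j = d
      · exact squareZ_after_boundary hd hodd ht (by omega) (by omega) (by omega) (by omega)
      · have hw := squareZ_detectWindow (T := T) hd hodd (i := i - 1) (j := j)
          (mem_bulk_oddFaces.2 (by omega))
        exact hw.after_left squareZ_regular ht (k := 4) (by omega)
    · rw [show faceAbove i j = (i - 1, j - 1) by
        simp [faceAbove, show (i + j) % 2 = 1 by omega]]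
      by_cases hj : j = 1
      · rw [if_neg (by omega)]
        exact squareZ_after_boundary hd hodd ht (by omega) (by omega) (by omega) (by omega)
      · rw [if_pos (by omega)]
        have hw := squareZ_detectWindow (T := T) hd hodd (i := i - 1) (j := j - 1)
          (mem_bulk_oddFaces.2 (by omega))
        have := hw.after_right squareZ_regular ht (k := 2) (by omega)
        rwa [Nat.sub_add_cancel (by omega)] at this
  set sA := if (i + j) % 2 = 1 ∧ 2 ≤ j then 2 else 4 with hsA
  have hsA' : ((i + j) % 2 = 1 ∧ 2 ≤ j) ∧ sA = 2 ∨ ¬ ((i + j) % 2 = 1 ∧ 2 ≤ j) ∧ sA = 4 := by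
    rw [hsA]; split_ifs <;> omega
  clear_value sA
  have hlt : ∀ s < 14, s < (heavySquareZ d).circuit.steps := fun s h => h
  have hr := fun v (_ : v ∈ (heavySquareZ d).checks) => squareZ_readout_ne_data (d := d) v
  have hne := faceBelow_ne_faceAbove hq'.1.1 j
  by_cases h1 : i + 1 ≤ d
  · by_cases h2 : 2 ≤ i
    · rcases hsA' with ⟨h3, rfl⟩ | ⟨h3, rfl⟩
      · exact Problem.dataRule_two squareZ_regular hr hq (by omega) (show 2 < 3 by omega)
          (hlt 3 (by omega)) (by omega) (by omega) hne.symm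
          (fun v => (hc v).trans (by simp [h1, h2, or_comm]))
          (fun s _ _ => squareZ_stays_data hd hodd (by omega) (by omega) (by omega)) (mA h2)
          (mB h1) (aA h2) (aB h1)
      · exact Problem.dataRule_two squareZ_regular hr hq (by omega) (show 3 < 4 by omega)
          (hlt 4 (by omega)) (by omega) (by omega) hne
          (fun v => (hc v).trans (by simp [h1, h2]))
          (fun s _ _ => squareZ_stays_data hd hodd (by dsimp only; omega) (by omega) (by omega))
          (mB h1) (mA h2) (aB h1) (aA h2)
    · exact Problem.dataRule_one squareZ_regular hr hq (s₁ := 3) (by omega) (hlt 3 (by omega))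
        (by omega) (by omega) (fun v => (hc v).trans (by simp [h1, h2]))
        (fun s _ => squareZ_stays_data hd hodd (by dsimp only; omega) (by omega)
          (by dsimp only; omega)) (mB h1) (aB h1)
  · have h2 : 2 ≤ i := by omega
    exact Problem.dataRule_one squareZ_regular hr hq (s₁ := sA) (by omega) (hlt sA (by omega))
      (by omega) (by omega) (fun v => (hc v).trans (by simp [h1, h2]))
      (fun s _ => squareZ_stays_data hd hodd (by dsimp only; omega) (by dsimp only; omega)
        (by dsimp only; omega)) (mA h2) (aA h2)

theorem squareZ_after_data {t s : ℕ} (ht : t < T) (h : 4 ≤ s) (h' : s < 14) (q : ℕ × ℕ)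
    (hq : q ∈ (heavySquareZ d).lattice) : (heavySquareZ d).after T t s (.data q.1 q.2) =
      (heavySquareZ d).spaceEffect (t + 1) q :=
  (squareZ_dataRule hd hodd q hq t ht s h').2.2 h

/-- The `Z`-type operators are measured after the stabilizers that detect `Z` errors. What they
spread in round `t` is detected one round later, in layer `t + 1`. -/
theorem squareZ_spreadWindow {i j : ℕ} (h : (i, j) ∈ (heavySquareZ d).flaggedFaces) :
    (heavySquareZ d).SpreadWindow T (fun t => t + 1) 7 i j := by
  have h' := squareZ_mem_flaggedFaces.1 h
  have hl : SquareRange d (.flag i j) := by simp only [SquareRange]; omega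
  have hr : SquareRange d (.flag i (j + 1)) := by simp only [SquareRange]; omega
  have ha : SquareRange d (.anc i j) := by simp only [SquareRange]; omega
  refine ⟨by simp [heavySquareZ, heavySquareCircuit], h, square_mem_qubits.2 ha,
    square_mem_qubits.2 hl, square_mem_qubits.2 hr, fun k h1 h2 => ?_,
    fun k h1 h2 y => (square_arrow' hd hodd).trans ?_,
    fun k h1 h2 y => (square_arrow' hd hodd).trans ?_,
    fun k h1 h2 y => (square_arrow' hd hodd).trans ?_,
    fun k _ => squareZ_silent_anc (by omega),
    fun k _ => squareZ_silent_flag (by omega) (by omega),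
    fun k _ => squareZ_silent_flag (by omega) (by omega),
    squareZ_forgotten_anc_even hd hodd ha (by omega),
    squareZ_forgotten_flag hd hodd hl, squareZ_forgotten_flag hd hodd hr,
    fun t ht σ => ?_, fun t ht k hk q hq => squareZ_after_data hd hodd ht (by omega) (by omega) q hq⟩
  · have hp := square_not_prepared_of hodd (show 7 + k ≠ 0 by omega) (show 7 + k ≠ 7 by omega)
    exact ⟨hp _, hp _, hp _, fun _ _ => hp _⟩
  · cases y <;> simp only [EvenCouple, OddCouple, Qubit.flag.injEq, reduceCtorEq, and_false,
      or_false, false_or, iff_false] <;> omega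
  · cases y <;> simp only [EvenCouple, OddCouple, Qubit.data.injEq, reduceCtorEq, and_false,
      or_false, false_or, iff_false] <;> omega
  · cases y <;> simp only [EvenCouple, OddCouple, Qubit.data.injEq, reduceCtorEq, and_false,
      or_false, false_or, iff_false] <;> omega
  · refine Problem.effectOf_flag_qubit squareZ_regular ht h (fun i j h1 h2 => ?_)
      fun i j h1 v hv => ?_
    · rw [squareZ_mem_flaggedFaces] at h1 h2
      omega
    · rw [squareZ_mem_readout, squareZ_mem_readout]
      simp [heavySquareZ]

theorem squareZ_elementary_pair {t s i j : ℕ} (ht : t < T) (hs : 7 ≤ s) (hs' : s ≤ 13)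
    (hi : i = 0 ∨ i = d) (hj : 1 ≤ j) (hj' : j + 1 ≤ d) (hp : (i + j) % 2 = 0) :
    (heavySquareZ d).Elementary T (fun t => t + 1)
      ((heavySquareZ d).after T t s (.anc i j)) := by
  have hg : (i, j) ∈ (heavySquareZ d).gens := mem_evenFaces.2 (by omega)
  have hr : SquareRange d (.anc i j) := by simp only [SquareRange]; omega
  have hm : ∀ k j', k = 11 ∧ j' = j ∨ k = 9 ∧ j' = j + 1 → (heavySquareCircuit d).Moves .Z k
      (.anc i j) (.data (if i = 0 then 1 else d) j') := by
    intro k j' hk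
    refine square_moves' hd hodd ((square_arrow' hd hodd).2 (.inr ?_))
    simp only [EvenCouple]
    split_ifs <;> omega
  refine Problem.elementary_of_pair squareZ_regular (layer := fun t => t + 1) (s₀ := 7) (s₁ := 9)
    (s₂ := 11) (m := 13) (q₁ := (if i = 0 then 1 else d, j + 1))
    (q₂ := (if i = 0 then 1 else d, j)) (f := (i, j)) ht (by omega) (by omega) (by omega)
    (Nat.lt_succ_self 13) (by simp) (hm 9 _ (by omega)) (hm 11 _ (by omega))
    (fun s h2 h3 h4 h5 => ?_) (fun s _ _ => squareZ_silent_anc (by omega))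
    (squareZ_forgotten_anc_even hd hodd hr hp) hg ?_ (by simp) ?_ ht
    (fun s h1 h2 => squareZ_after_data hd hodd ht (by omega) (by omega)) hs hs'
  · refine ⟨square_not_prepared_of hodd (by omega) (by omega) _, fun y hy => ?_⟩
    replace hy := (square_arrow' hd hodd).1 hy
    cases y <;> simp only [EvenCouple, OddCouple, and_false, or_self, false_or] at hy <;> omega
  · ext ⟨a, b⟩
    rw [mem_plaquette]
    simp only [mem_insert, mem_singleton, Prod.mk.injEq]
    change (a = i ∨ a = i + 1) ∧ (b = j ∨ b = j + 1) ∧ 1 ≤ a ∧ a ≤ d ∧ 1 ≤ b ∧ b ≤ d ↔ _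
    split_ifs <;> omega
  · refine Problem.syndrome_eq_zero_of ?_ (t + 1)
    rintro ⟨k, l⟩ hv
    exact sum_plaquette_plaquette hg hv

theorem squareZ_elementary {t s : ℕ} (ht : t < T) (hs : s < (heavySquareZ d).circuit.steps)
    {q : Qubit} (hq : q ∈ (heavySquareZ d).circuit.qubits) :
    (heavySquareZ d).Elementary T (fun t => t + 1) ((heavySquareZ d).after T t s q) := by
  change s < 14 at hs
  replace hq : SquareRange d q := square_mem_qubits.1 hq
  cases q with
  | data i j =>
    simp only [SquareRange] at hq
    exact (squareZ_dataRule hd hodd (i, j)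
      (by rw [Problem.mem_lattice]; exact ⟨⟨hq.1, hq.2.1⟩, hq.2.2⟩) t ht s hs).1
  | flag i j =>
    have hq' := hq
    simp only [SquareRange] at hq'
    rcases Nat.lt_or_ge 6 s with h1 | h1
    · by_cases hu : EvenIdle d i j
      · rw [(squareZ_forgotten_flag_of_evenIdle hd hodd hq hu h1.le hs).after_eq_zero
          squareZ_regular hs (by simp) (squareZ_silent_flag (by omega) (.inr hu)) ht]
        exact Problem.elementary_zero _ _ _
      · simp only [EvenIdle] at hu
        obtain ⟨k, rfl⟩ := Nat.exists_eq_add_of_le (show 7 ≤ s by omega)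
        by_cases hp : (i + j) % 2 = 0
        · have hw := squareZ_spreadWindow (T := T) hd hodd (i := i) (j := j)
            (squareZ_mem_flaggedFaces.2 (by omega))
          exact hw.elementary_left squareZ_regular ht (by omega)
        · obtain ⟨n, rfl⟩ := Nat.exists_eq_add_of_le' hq'.2.2.1
          have hw := squareZ_spreadWindow (T := T) hd hodd (i := i) (j := n)
            (squareZ_mem_flaggedFaces.2 (by omega))
          exact hw.elementary_right squareZ_regular ht (by omega)
    · by_cases hp : (i + j) % 2 = 1
      · by_cases hj : j = d
        · rw [squareZ_after_boundary hd hodd ht hq'.1 hq'.2.1 (l := d) (by omega) h1]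
          exact .vert
        · have hw := squareZ_detectWindow (T := T) hd hodd (i := i) (j := j)
            (mem_bulk_oddFaces.2 (by omega))
          exact Nat.zero_add s ▸ (hw.elementary squareZ_regular ht _ (k := s) h1).2.1
      · by_cases hj : j = 1
        · rw [squareZ_after_boundary hd hodd ht hq'.1 hq'.2.1 (l := 0) (by omega) h1]
          exact .vert
        · obtain ⟨n, rfl⟩ := Nat.exists_eq_add_of_le' hq'.2.2.1
          have hw := squareZ_detectWindow (T := T) hd hodd (i := i) (j := n)
            (mem_bulk_oddFaces.2 (by omega))
          exact Nat.zero_add s ▸ (hw.elementary squareZ_regular ht _ (k := s) h1).2.2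
  | anc i j =>
    have hq' := hq
    simp only [SquareRange] at hq'
    by_cases hp : (i + j) % 2 = 0
    · rcases Nat.lt_or_ge s 7 with h1 | h1
      · rw [squareZ_after_anc_even hd hodd ht hq hp h1]
        exact Problem.elementary_zero _ _ _
      · by_cases hb : i = 0 ∨ i = d
        · exact squareZ_elementary_pair hd hodd ht h1 (by omega) hb (by omega) (by omega) hp
        · have hg : (i, j) ∈ (heavySquareZ d).gens := mem_evenFaces.2 (by omega)
          have hsyn : (heavySquareZ d).syndrome (t + 1)
              (errorOn (plaquette (heavySquareZ d).d (i, j))) = 0 :=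
            Problem.syndrome_eq_zero_of (by
              rintro ⟨k, l⟩ hv
              exact sum_plaquette_plaquette hg hv) (t + 1)
          obtain ⟨k, rfl⟩ := Nat.exists_eq_add_of_le h1
          have hw := squareZ_spreadWindow (T := T) hd hodd (i := i) (j := j)
            (squareZ_mem_flaggedFaces.2 (by omega))
          exact hw.elementary_anc squareZ_regular ht hsyn (by omega)
    · rcases Nat.lt_or_ge 6 s with h1 | h1
      · rw [(squareZ_forgotten_anc_odd hd hodd hq (by omega) h1.le hs).after_eq_zero
          squareZ_regular hs (by simp) (squareZ_silent_anc (by omega)) ht]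
        exact Problem.elementary_zero _ _ _
      · have hw := squareZ_detectWindow (T := T) hd hodd (i := i) (j := j)
            (mem_bulk_oddFaces.2 (by omega))
        exact Nat.zero_add s ▸ (hw.elementary squareZ_regular ht _ (k := s) h1).1

theorem squareZ_simulates (hT : 1 ≤ T) : (heavySquareZ d).Simulates T fun t => t + 1 := by
  refine Problem.simulates_of squareZ_regular hT (by omega)
    (by simp [heavySquareZ, heavySquareCircuit]) (fun t ht => ht) (squareZ_dataRule hd hodd)
    ?_ ?_ (fun i j => squareZ_spreadWindow hd hodd)
    (fun t ht s hs q hq => squareZ_elementary hd hodd ht hs hq)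
    (fun s o => square_acts hd hodd) ?_
  · rintro ⟨i, j⟩ hq
    rw [Problem.mem_lattice] at hq
    exact square_mem_qubits.2 ⟨hq.1.1, hq.1.2, hq.2⟩
  · exact fun s hs q _ o ho => square_idle_data hd hodd hs ho q.1 q.2
  · intro s _ x y h
    have hr := square_arrow_range hd hodd (x := y) (y := x) h
    refine ⟨hr.2.2.2.1, square_moves' hd hodd h, ?_⟩
    cases x with
    | data i j => exact Problem.silent_data (fun v _ => squareZ_readout_ne_data v) _ _ _
    | flag i j =>
      have := hr.2.2.2.2.2.2.2 i j rfl
      exact squareZ_silent_flag (by omega) (by omega)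
    | anc i j => exact squareZ_silent_anc (by omega)

end SquareZ

end FlagCode

/-! ### The three cases together -/

theorem mainTheorem2 (d : ℕ) (hd : 3 ≤ d) (hodd : Odd d) (T : ℕ) (hT : 1 ≤ T) :
    (∃ p₀ : ℝ, 0 < p₀ ∧ ∀ p : ℝ, 0 < p → p < p₀ →
      ∀ D ∈ [FlagCode.heavyHexX d, FlagCode.heavySquareX d, FlagCode.heavySquareZ d],
        D.CorrectsFaults p T ((d - 1) / 2) ∧ D.HasEffectiveDistance p T d) ∧
    (FlagCode.heavyHexX d).HasParallelWeightTwoFault T ∧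
    (FlagCode.heavySquareZ d).HasParallelWeightTwoFault T := by
  have hodd' : d % 2 = 1 := Nat.odd_iff.1 hodd
  have h1 := FlagCode.hex_simulates hd hT
  have h2 := FlagCode.squareX_simulates hd hodd' hT
  have h3 := FlagCode.squareZ_simulates hd hodd' hT
  obtain ⟨p₁, hp₁, m₁⟩ := (FlagCode.Problem.tractable_rows hd rfl rfl h1).main hodd
  obtain ⟨p₂, hp₂, m₂⟩ := (FlagCode.Problem.tractable_columns hd rfl rfl h2).main hodd
  obtain ⟨p₃, hp₃, m₃⟩ := (FlagCode.Problem.tractable_rows hd rfl rfl h3).main hodd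
  refine ⟨⟨min p₁ (min p₂ p₃), lt_min hp₁ (lt_min hp₂ hp₃), fun p hp hlt D hD => ?_⟩,
    FlagCode.Problem.hasParallelWeightTwoFault hd rfl rfl hT h1,
    FlagCode.Problem.hasParallelWeightTwoFault hd rfl rfl hT h3⟩
  rw [lt_min_iff, lt_min_iff] at hlt
  simp only [List.mem_cons, List.not_mem_nil, or_false] at hD
  rcases hD with rfl | rfl | rfl
  · exact m₁ p hp hlt.1
  · exact m₂ p hp hlt.2.1
  · exact m₃ p hp hlt.2.2
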